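/- **Setting.** Let $d\ge 2$; functions on $\mathbb R^{1+d}$ take values in finite-dimensional complex vector spaces, $\|u\|_{L^qL^r}=\big\|\,\|u(t,\cdot)\|_{L^r_x}\big\|_{L^q_t}$, and $(x)_-=\min\{x,0\}$. Let $\chi\ge 0$ be a smooth bump function supported in $[2^{-2},2^2]$ with $\sum_{k\in\mathbb Z}\chi(r/2^k)=1$ for $r>0$. For $k,j\in\mathbb Z$ and $s\in\{+,-\}$ let $P_k$ and $Q_j^s$ be the Fourier multipliers with symbols $\chi(|\xi|/2^k)$ and $\chi\big(\big|s\tau-|\xi|\big|/2^j\big)$, let $Q_{<j}^s=\sum_{i<j}Q_i^s$, and write $f_k=P_kf$. *Boxes.* For $k\in\mathbb Z$ and $\ell\le 0$ fix a family of rectangular boxes $\mathcal C=\mathcal C_k(\ell)$ of dimensions $2^k\times(2^{k+\ell})^{d-1}$, the side of length $2^k$ being aligned with the radial direction at the center, with finite overlap, together with smooth cutoffs $m_{\mathcal C}$ that are supported in a fixed dilate of $\mathcal C$, are adapted to $\mathcal C$ (all derivatives bounded in the unit scale of $\mathcal C$) and sum to $1$ on $\{|\xi|\ge 2^{k-2}\}$;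 $P_{\mathcal C}$ is the spatial Fourier multiplier with symbol $m_{\mathcal C}$. The overlap, dilation and derivative bounds do not depend on $k,\ell$. *Operators with bounded mass.* $\mathcal L(f,g)(x)=\int K(x-y_1,x-y_2)\,f(y_1)\,g(y_2)\,dy_1dy_2$, where $K$ is a measure on $\mathbb R^d\times\mathbb R^d$ with values in bilinear maps and with finite total mass $\|K\|$. *Null forms.* The bilinear operator on $\mathbb R^d$ with symbol $m$ is $(2\pi)^{-2d}\int e^{ix\cdot(\xi+\eta)}m(\xi,\eta)\hat f(\xi)\hat g(\eta)\,d\xi d\eta$. It is an abstract null form (of order $1$) if $m$ is smooth on $\{\xi\neq0,\eta\ne0\}$ and there, for all orders and multi-indices, $$|(\xi\cdot\partial_\xi)^{n_1}(\eta\cdot\partial_\eta)^{n_2}m(\xi,\eta)|\le A_{n_1,n_2}|\angle(\xi,\eta)|,\qquad |\partial_\xi^{\alpha_1}\partial_\eta^{\alpha_2}m(\xi,\eta)|\le A_{\alpha_1,\alpha_2}|\xi|^{-|\alpha_1|}|\eta|^{-|\alpha_2|}.$$ $\mathcal N_+$ denotes an abstract null form; $\mathcal N_-$ denotes a bilinear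 operator such that $(f,g)\mapsto\mathcal N_-(f,\bar g)$ is an abstract null form, i.e. its symbol is $m(\xi,-\eta)$ with $m$ as above. A dual abstract null form $\mathcal N^*_s$ of type $s$ is a bilinear operator such that $\int h\,\mathcal N_s^*(f,g)\,dx=\int f\,\mathcal N_{-s}(h,g)\,dx$ for all Schwartz $f,g,h$ and some abstract null form $\mathcal N_{-s}$ of type $-s$. Bilinear operators on $\mathbb R^d$ act on functions on $\mathbb R^{1+d}$ at each fixed time. **Statement.** Let $C_0\in\mathbb R$, let $k_0,k_1,k_2,j\in\mathbb Z$, and let $k_{\min}\le k_{\rm med}\le k_{\max}$ be the increasing rearrangement of $k_0,k_1,k_2$. Suppose $|k_{\max}-k_{\rm med}|\le5$ and $j\le k_{\min}+C_0$, and put $\ell=\frac12(j-k_{\min})_-$. Write $\|u\|_{\rm box}=\big(\sum_{\mathcal C=\mathcal C_{k_{\min}}(\ell)}\|P_{\mathcal C}u\|_{L^2L^\infty}^2\big)^{1/2}$. Then for all signs $s_0,s_1,s_2\in\{+,-\}$ and all Schwartz functions $f,g$ on $\mathbb R^{1+d}$ the following hold. 1. For every $\mathcal L$ with bounded mass, $$\|P_{k_0}Q_j^{s_0}\mathcal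 L(Q_{<j}^{s_1}f_{k_1},Q_{<j}^{s_2}g_{k_2})\|_{L^2L^2}\lesssim\|K\|\,\|f_{k_1}\|_{L^\infty L^2}\,\|Q_{<j}^{s_2}g_{k_2}\|_{\rm box},$$ $$\|P_{k_0}Q_{<j}^{s_0}\mathcal L(Q_j^{s_1}f_{k_1},Q_{<j}^{s_2}g_{k_2})\|_{L^1L^2}\lesssim\|K\|\,\|Q_j^{s_1}f_{k_1}\|_{L^2L^2}\,\|Q_{<j}^{s_2}g_{k_2}\|_{\rm box}.$$ 2. For every abstract null form $\mathcal N_{s_1s_2}$ of type $s_1s_2$, $$\|P_{k_0}Q_j^{s_0}\mathcal N_{s_1s_2}(Q_{<j}^{s_1}f_{k_1},Q_{<j}^{s_2}g_{k_2})\|_{L^2L^2}\lesssim 2^{\ell}2^{k_{\min}-\min\{k_1,k_2\}}\|f_{k_1}\|_{L^\infty L^2}\|Q_{<j}^{s_2}g_{k_2}\|_{\rm box},$$ $$\|P_{k_0}Q_{<j}^{s_0}\mathcal N_{s_1s_2}(Q_j^{s_1}f_{k_1},Q_{<j}^{s_2}g_{k_2})\|_{L^1L^2}\lesssim 2^{\ell}2^{k_{\min}-\min\{k_1,k_2\}}\|Q_j^{s_1}f_{k_1}\|_{L^2L^2}\|Q_{<j}^{s_2}g_{k_2}\|_{\rm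 box}.$$ 3. For every dual abstract null form $\mathcal N^*_{s_0s_2}$ of type $s_0s_2$, $$\|P_{k_0}Q_j^{s_0}\mathcal N^*_{s_0s_2}(Q_{<j}^{s_1}f_{k_1},Q_{<j}^{s_2}g_{k_2})\|_{L^2L^2}\lesssim 2^{\ell}2^{k_{\min}-\min\{k_0,k_2\}}\|f_{k_1}\|_{L^\infty L^2}\|Q_{<j}^{s_2}g_{k_2}\|_{\rm box},$$ $$\|P_{k_0}Q_{<j}^{s_0}\mathcal N^*_{s_0s_2}(Q_j^{s_1}f_{k_1},Q_{<j}^{s_2}g_{k_2})\|_{L^1L^2}\lesssim 2^{\ell}2^{k_{\min}-\min\{k_0,k_2\}}\|Q_j^{s_1}f_{k_1}\|_{L^2L^2}\|Q_{<j}^{s_2}g_{k_2}\|_{\rm box},$$ $$\|P_{k_0}Q_{<j}^{s_0}\mathcal N^*_{s_0s_2}(Q_{<j}^{s_1}f_{k_1},Q_j^{s_2}g_{k_2})\|_{L^1L^2}\lesssim 2^{\ell}2^{k_{\min}-\min\{k_0,k_2\}}\|Q_{<j}^{s_1}f_{k_1}\|_{\rm box}\|Q_j^{s_2}g_{k_2}\|_{L^2L^2}.$$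 The implicit constants depend only on $d$, the value spaces, $\chi$, $C_0$, the overlap, dilation and derivative bounds of the box families and, in 2 and 3, on the constants $A$ of the null form; they do not depend on $k_0,k_1,k_2,j,s_0,s_1,s_2,f,g$ or on the individual operators and boxes. -/

import Mathlib

set_option maxSynthPendingDepth 3

open MeasureTheory Set
open scoped ENNReal NNReal SchwartzMap ContDiff

noncomputable section

namespace MDNull

/-! ### Space, values, mixed norms -/

/-- Physical (or frequency) space `ℝ^d`. -/
abbrev Sp (d : ℕ) := EuclideanSpace ℝ (Fin d)

/-- Bilinear maps `E₁ × E₂ → E₀` between the spaces in which the functions take their values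
(`E₁ = E₂ = E₀ = ℂ` is the scalar case). -/
abbrev Bil (E₁ E₂ E₀ : Type*) [NormedAddCommGroup E₁] [NormedSpace ℂ E₁]
    [NormedAddCommGroup E₂] [NormedSpace ℂ E₂] [NormedAddCommGroup E₀] [NormedSpace ℂ E₀] :=
  E₁ →L[ℂ] E₂ →L[ℂ] E₀

variable {d : ℕ} {E E₁ E₂ E₀ : Type*} [NormedAddCommGroup E] [NormedSpace ℂ E]
  [NormedAddCommGroup E₁] [NormedSpace ℂ E₁] [NormedAddCommGroup E₂] [NormedSpace ℂ E₂]
  [NormedAddCommGroup E₀] [NormedSpace ℂ E₀]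

/-- The norm of `L^q_t L^r_x` on `ℝ^{1+d}`, with values in `[0, ∞]`. -/
def mixedNorm (q r : ℝ≥0∞) (u : ℝ × Sp d → E) : ℝ≥0∞ :=
  eLpNorm (fun t : ℝ => eLpNorm (fun x : Sp d => u (t, x)) r volume) q volume

/-! ### Fourier multipliers (convention `f̂(ξ) = ∫ e^{-i x·ξ} f(x) dx`) -/

/-- The spatial Fourier transform of a vector-valued function. -/
def fourierX (f : Sp d → E) (ξ : Sp d) : E :=
  ∫ x : Sp d, Complex.exp (-Complex.I * ((inner ℝ x ξ : ℝ) : ℂ)) • f x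

/-- The convolution kernel of the spatial multiplier with symbol `a`. -/
def kernelX (a : Sp d → ℝ) (x : Sp d) : ℂ :=
  ((2 * Real.pi : ℝ) : ℂ)⁻¹ ^ d *
    ∫ ξ : Sp d, Complex.exp (Complex.I * ((inner ℝ x ξ : ℝ) : ℂ)) * (a ξ : ℂ)

/-- The spatial Fourier multiplier with (smooth, compactly supported) symbol `a`, acting on
space-time functions at each fixed time.  It is written as the convolution with the inverse
Fourier transform of `a`, so that it also makes sense on non-integrable functions. -/
def multX (a : Sp d → ℝ) (u : ℝ × Sp d → E) (p : ℝ × Sp d) : E :=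
  ∫ y : Sp d, kernelX a (p.2 - y) • u (p.1, y)

/-- The convolution kernel of the space-time multiplier with symbol `a (τ, ξ)`. -/
def kernelTX (a : ℝ × Sp d → ℝ) (p : ℝ × Sp d) : ℂ :=
  ((2 * Real.pi : ℝ) : ℂ)⁻¹ ^ (d + 1) *
    ∫ X : ℝ × Sp d,
      Complex.exp (Complex.I * ((p.1 * X.1 + inner ℝ p.2 X.2 : ℝ) : ℂ)) * (a X : ℂ)

/-- The space-time Fourier multiplier with (smooth, compactly supported) symbol `a (τ, ξ)`,
written as a convolution on `ℝ^{1+d}`. -/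
def multTX (a : ℝ × Sp d → ℝ) (u : ℝ × Sp d → E) (p : ℝ × Sp d) : E :=
  ∫ q : ℝ × Sp d, kernelTX a (p - q) • u q

/-! ### Littlewood-Paley and modulation projections -/

/-- A smooth non-negative bump function supported on `[2⁻², 2²]` whose dyadic dilates sum to one
on `(0, ∞)`. -/
structure IsDyadicBump (χ : ℝ → ℝ) : Prop where
  smooth : ContDiff ℝ ∞ χ
  nonneg : ∀ r, 0 ≤ χ r
  supp : Function.support χ ⊆ Icc (2 ^ (-2 : ℤ)) (2 ^ (2 : ℤ))
  sum_one : ∀ r : ℝ, 0 < r → HasSum (fun k : ℤ => χ (r / 2 ^ k)) 1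

/-- The profile `∑_{i < 0} χ(r / 2^i)`, written as `1 - ∑_{i ≥ 0} χ(r / 2^i)`; the two agree
for `r > 0`, and the latter takes the limiting value `1` at `r = 0`. -/
def lowBump (χ : ℝ → ℝ) (r : ℝ) : ℝ := 1 - ∑' i : ℕ, χ (r / 2 ^ i)

/-- The sign `s ∈ {+, -}` as a real number. -/
def sgnR (s : ℤˣ) : ℝ := ((s : ℤ) : ℝ)

/-- `P_k`. -/
def projP (χ : ℝ → ℝ) (k : ℤ) (u : ℝ × Sp d → E) : ℝ × Sp d → E :=
  multX (fun ξ => χ (‖ξ‖ / 2 ^ k)) u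

/-- `P_k Q_j^s`, the multiplier with symbol `χ(|ξ| / 2^k) χ(|s τ - |ξ|| / 2^j)`. -/
def projPQ (χ : ℝ → ℝ) (k j : ℤ) (s : ℤˣ) (u : ℝ × Sp d → E) :
    ℝ × Sp d → E :=
  multTX (fun X => χ (‖X.2‖ / 2 ^ k) * χ (|sgnR s * X.1 - ‖X.2‖| / 2 ^ j)) u

/-- `P_k Q_{<j}^s`, where `Q_{<j}^s = ∑_{i < j} Q_i^s`. -/
def projPQlt (χ : ℝ → ℝ) (k j : ℤ) (s : ℤˣ) (u : ℝ × Sp d → E) :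
    ℝ × Sp d → E :=
  multTX (fun X => χ (‖X.2‖ / 2 ^ k) * lowBump χ (|sgnR s * X.1 - ‖X.2‖| / 2 ^ j)) u

/-! ### Rectangular boxes -/

/-- A rectangular box (given by its center and an orthonormal frame of sides) together with a
cutoff function. -/
structure FreqBox (d : ℕ) where
  center : Sp d
  frame : OrthonormalBasis (Fin d) ℝ (Sp d)
  cutoff : Sp d → ℝ

/-- Side lengths of `𝒞_k(ℓ)`: `2^k` in the direction of the first frame vector, `2^{k+ℓ}` in
the others. -/
def boxSide (k : ℤ) (l : ℝ) (i : Fin d) : ℝ :=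
  if (i : ℕ) = 0 then (2 : ℝ) ^ (k : ℝ) else (2 : ℝ) ^ ((k : ℝ) + l)

/-- The affine map that takes the unit cube `[-1/2, 1/2]^d` to the box. -/
def FreqBox.chart (b : FreqBox d) (k : ℤ) (l : ℝ) (y : Sp d) : Sp d :=
  b.center + ∑ i, (boxSide k l i * y i) • b.frame i

/-- The box dilated about its center by the factor `lam`. -/
def FreqBox.dilate (b : FreqBox d) (k : ℤ) (l lam : ℝ) : Set (Sp d) :=
  b.chart k l '' {y | ∀ i, |y i| ≤ lam / 2}

/-- A family of boxes of the form `𝒞_k(ℓ)` (longest side radial at the center) with overlap at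
most `M`, and associated smooth cutoffs which are supported in the `lam`-dilated boxes, are
adapted to the boxes (bounds `D` on the derivatives in the unit scale of the box), and sum to one
on `{|ξ| ≥ 2^{k-2}}`, which contains the supports of all `P_{k'}` with `k' ≥ k`. -/
structure IsBoxFamily {ι : Type} (k : ℤ) (l lam : ℝ) (M : ℕ) (D : ℕ → ℝ)
    (box : ι → FreqBox d) : Prop where
  center_ne : ∀ a, (box a).center ≠ 0
  radial : ∀ a, ∀ i : Fin d, (i : ℕ) = 0 →
    (box a).center = ‖(box a).center‖ • (box a).frame i
  overlap : ∀ ξ, {a | ξ ∈ (box a).dilate k l 1}.encard ≤ M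
  smooth : ∀ a, ContDiff ℝ ∞ (box a).cutoff
  supp : ∀ a, Function.support (box a).cutoff ⊆ (box a).dilate k l lam
  adapted : ∀ a n y,
    ‖iteratedFDeriv ℝ n (fun z => (box a).cutoff ((box a).chart k l z)) y‖ ≤ D n
  sum_one : ∀ ξ : Sp d, (2 : ℝ) ^ (k - 2) ≤ ‖ξ‖ → HasSum (fun a => (box a).cutoff ξ) 1

/-- `(∑_𝒞 ‖P_𝒞 u‖²_{L² L^∞})^{1/2}`. -/
def boxNorm {ι : Type} (box : ι → FreqBox d) (u : ℝ × Sp d → E) : ℝ≥0∞ :=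
  (∑' a, mixedNorm 2 ∞ (multX (box a).cutoff u) ^ 2) ^ (1 / 2 : ℝ)

/-! ### Bilinear operators -/

/-- A bilinear operator on functions of `x ∈ ℝ^d`, applied to space-time functions at each fixed
time. -/
def atEachTime (T : (Sp d → E₁) → (Sp d → E₂) → Sp d → E₀)
    (F : ℝ × Sp d → E₁) (G : ℝ × Sp d → E₂) (p : ℝ × Sp d) : E₀ :=
  T (fun x => F (p.1, x)) (fun x => G (p.1, x)) p.2

/-- The translation-invariant bilinear operator whose kernel is the measure `K μ`, where `K` is
a `μ`-integrable density with values in bilinear maps.  By polar decomposition every kernel measure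
of finite mass is of this form. -/
def kernelOp (μ : Measure (Sp d × Sp d)) (K : Sp d × Sp d → Bil E₁ E₂ E₀)
    (f : Sp d → E₁) (g : Sp d → E₂) (x : Sp d) : E₀ :=
  ∫ y, K y (f (x - y.1)) (g (x - y.2)) ∂μ

/-- The translation-invariant bilinear operator with symbol `m (ξ, η)`. -/
def symbolOp (m : Sp d → Sp d → Bil E₁ E₂ E₀)
    (f : Sp d → E₁) (g : Sp d → E₂) (x : Sp d) : E₀ :=
  (((2 * Real.pi : ℝ) : ℂ)⁻¹ ^ (2 * d)) •
    ∫ ζ : Sp d × Sp d, Complex.exp (Complex.I * ((inner ℝ x (ζ.1 + ζ.2) : ℝ) : ℂ)) •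
      m ζ.1 ζ.2 (fourierX f ζ.1) (fourierX g ζ.2)

/-- `S_ξ = ξ · ∂_ξ`. -/
def radialDerivFst (m : Sp d → Sp d → Bil E₁ E₂ E₀) (ξ η : Sp d) :
    Bil E₁ E₂ E₀ :=
  fderiv ℝ (fun ξ' => m ξ' η) ξ ξ

/-- `S_η = η · ∂_η`. -/
def radialDerivSnd (m : Sp d → Sp d → Bil E₁ E₂ E₀) (ξ η : Sp d) :
    Bil E₁ E₂ E₀ :=
  fderiv ℝ (fun η' => m ξ η') η η

/-- `m` is the symbol of an abstract null form of order `1`, with constants `A` in the angular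
bounds and `B` in the derivative bounds. -/
structure IsNullSymbol (A B : ℕ → ℕ → ℝ) (m : Sp d → Sp d → Bil E₁ E₂ E₀) :
    Prop where
  smooth : ContDiffOn ℝ ∞ (fun p : Sp d × Sp d => m p.1 p.2) {p | p.1 ≠ 0 ∧ p.2 ≠ 0}
  angle_bound : ∀ i₁ i₂ : ℕ, ∀ ξ η : Sp d, ξ ≠ 0 → η ≠ 0 →
    ‖(radialDerivFst^[i₁] (radialDerivSnd^[i₂] m)) ξ η‖ ≤
      A i₁ i₂ * InnerProductGeometry.angle ξ η
  deriv_bound : ∀ i₁ i₂ : ℕ, ∀ ξ η : Sp d, ξ ≠ 0 → η ≠ 0 →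
    ‖iteratedFDeriv ℝ i₁ (fun ξ' => iteratedFDeriv ℝ i₂ (fun η' => m ξ' η') η) ξ‖ ≤
      B i₁ i₂ * (‖ξ‖ ^ i₁)⁻¹ * (‖η‖ ^ i₂)⁻¹

/-- `m` is the symbol of an abstract null form `𝒩_s` of type `s`.  For `s = -1`: the symbol
`m (ξ, -η)` of `(f, g) ↦ 𝒩_-(f, ḡ)` is that of an abstract null form. -/
def IsNullSymbolOfType (s : ℤˣ) (A B : ℕ → ℕ → ℝ)
    (m : Sp d → Sp d → Bil E₁ E₂ E₀) : Prop :=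
  IsNullSymbol A B (fun ξ η => m ξ (sgnR s • η))

/-- `T` is a dual abstract null form `𝒩*_s` of type `s`:
`∫ h · T(f, g) dx = ∫ f · 𝒩_{-s}(h, g) dx` for some abstract null form `𝒩_{-s}` of type `-s`
and all Schwartz functions, where `·` is the bilinear pairing between a vector space and its dual
(row vectors times column vectors).  The function `T(f, g)` lies
in `L²`, is determined almost everywhere by this identity, and is represented by its continuous
representative. -/
def IsDualNullForm (s : ℤˣ) (A B : ℕ → ℕ → ℝ)
    (T : (Sp d → E₁) → (Sp d → E₂) → Sp d → E₀) : Prop :=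
  ∃ m : Sp d → Sp d → Bil (StrongDual ℂ E₀) E₂ (StrongDual ℂ E₁), IsNullSymbolOfType (-s) A B m ∧
    ∀ (f : 𝓢(Sp d, E₁)) (g : 𝓢(Sp d, E₂)),
      Continuous (T f g) ∧ MemLp (T f g) 2 volume ∧
      ∀ h : 𝓢(Sp d, StrongDual ℂ E₀),
        ∫ x, h x (T f g x) = ∫ x, symbolOp m h g x (f x)

/-! ### Frequency parameters -/

/-- The minimum of three integers. -/
def kMin (k₀ k₁ k₂ : ℤ) : ℤ := min k₀ (min k₁ k₂)

/-- The maximum of three integers. -/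
def kMax (k₀ k₁ k₂ : ℤ) : ℤ := max k₀ (max k₁ k₂)

/-- The median of three integers. -/
def kMed (k₀ k₁ k₂ : ℤ) : ℤ := k₀ + k₁ + k₂ - kMin k₀ k₁ k₂ - kMax k₀ k₁ k₂

/-- `ℓ = ½ (j - k_min)_-`, where `(x)_- = min(x, 0)`. -/
def ell (k₀ k₁ k₂ j : ℤ) : ℝ := min ((j : ℝ) - (kMin k₀ k₁ k₂ : ℝ)) 0 / 2

/-- The angular gain `2^ℓ 2^{k_min - min(a, b)}`. -/
def gain (k₀ k₁ k₂ j a b : ℤ) : ℝ≥0∞ :=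
  ENNReal.ofReal ((2 : ℝ) ^ ell k₀ k₁ k₂ j * (2 : ℝ) ^ (kMin k₀ k₁ k₂ - min a b))

end MDNull

end

open MDNull

/-!
The estimates express that a resonant interaction of three waves forces their frequencies to be
nearly parallel, up to sign.

On the Fourier side and at a fixed time, a bilinear operator multiplies frequencies `ξ`, `η` of the
inputs by a symbol and produces the output frequency `ξ + η`. The projections `Q_j`, `Q_{<j}` are
convolutions in time whose kernels have mass independent of `j` (`norm_kap_le`, `lintegral_wt`), and
the output projection annihilates every pair `(ξ, η)` with
`|s₀|ξ + η| - s₁|ξ| - s₂|η|| ≥ 2^{j+4}` or with frequencies outside the dyadic shells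
(`integral_kap_smul_eq_zero`). The symbol may therefore be replaced by any other symbol that agrees
with it on the remaining pairs, the predicate `Compat`. After this everything happens at a fixed
time: an `L² × L^∞ → L²` bound for the new symbol gives the mixed norm estimates by Hölder's and
Young's inequalities in time (`exists_estimate_of_boxDecomp`).

For compatible frequencies the identity
`|ξ + η|² - (s₁|ξ| + s₂|η|)² = -s₁ s₂ |ξ| |η| |s₁ ξ/|ξ| - s₂ η/|η||²` bounds the signed directions
of `ξ` and `η` to within `O(2^ℓ 2^{k_min - min(k₁, k₂)})` of each other
(`Compat.norm_dir_sub_le`). The condition is symmetric in the three frequencies, so the same holds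
for the other pairs. If `ξ`, or else `ξ + η`, whichever is larger, is held fixed, then `η` is
confined to a region comparable to a single box, and comparing volumes shows that it meets boundedly
many boxes (`exists_card_le_of_compat`). The pieces `η ∈ 𝒞` are then summed by Cauchy-Schwarz when
`ξ` is fixed and by almost orthogonality of the outputs when `ξ + η` is fixed
(`BoxDecomp.eLpNorm_bilF_le`). Both give the square sum over boxes.

It remains to bound the symbol on one box. A symbol that depends only on `ξ`, or only on `ξ + η`, is
a pointwise product composed with a Fourier multiplier on `L²`, and a modulation in `η` is a
translation of the second factor. Hence `L² × L^∞ → L²` bounds (`SliceBound`) hold for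
superpositions of modulations with such coefficients. The symbol of an operator with bounded mass
is of this form (`kernelOp_eq_symbolOp`, `exists_sliceBound_kernelSymbol`), and so is, by Fourier
inversion, any symbol that is smooth in `η` in the scale of the box
(`exists_sliceBound_of_smooth`).

A null symbol has this smoothness with a gain of the angle (`exists_iteratedFDeriv_aligned_le`).
Radial derivatives gain it by hypothesis. A direction of the box deviates from the radial one by so
little that the general derivative bounds suffice for the remainder. This yields the factor
`2^ℓ 2^{k_min - min}` (`exists_sliceBound_aligned`). A dual null form is the operator whose symbol is
the transpose of the null symbol at `(-(ξ + η), η)` (`eq_symbolOp_of_dual`), so that the relevant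
angle is the one between the output and an input. When that input is not the one localized to boxes,
it equals `(ξ + η)` minus the localized one, and alignment still holds because the angle between the
two inputs is controlled as well (`IsBoxFamily.aligned_fst`).
-/

noncomputable section

namespace MDNull

open scoped FourierTransform

/-! ### Phases and the Fourier transform on `L¹ ∩ L²` -/

/-- The phase `e^{ix}`. -/
def ph (x : ℝ) : ℂ := Complex.exp (Complex.I * (x : ℂ))

@[simp] lemma norm_ph (x : ℝ) : ‖ph x‖ = 1 := by
  rw [ph, mul_comm, Complex.norm_exp_ofReal_mul_I]

lemma ph_add (x y : ℝ) : ph (x + y) = ph x * ph y := by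
  simp [ph, ← Complex.exp_add, mul_add]

@[fun_prop] lemma continuous_ph : Continuous ph := by unfold ph; fun_prop

lemma ph_two_pi (x : ℝ) : ph (2 * Real.pi * x) = (Real.fourierChar x : ℂ) := by
  rw [Real.fourierChar_apply, ph]; congr 1; push_cast; ring

section FT

variable {d : ℕ} {E : Type*} [NormedAddCommGroup E] [NormedSpace ℂ E]

lemma fourierX_eq_ph (f : Sp d → E) (ξ : Sp d) :
    fourierX f ξ = ∫ x : Sp d, ph (-inner ℝ x ξ) • f x := by
  unfold fourierX ph
  congr 1; ext x; congr 2; push_cast; ring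

lemma fourierX_eq_fourier (f : Sp d → E) (ξ : Sp d) :
    fourierX f ξ = 𝓕 f ((2 * Real.pi)⁻¹ • ξ) := by
  rw [fourierX_eq_ph, Real.fourier_eq]
  congr 1; ext x
  rw [Circle.smul_def, ← ph_two_pi, inner_smul_right]
  congr 2
  have := Real.pi_pos
  field_simp

/-- The unnormalized inverse Fourier transform `x ↦ ∫ e^{i x·ξ} φ(ξ) dξ`. -/
def invX (φ : Sp d → E) (x : Sp d) : E := ∫ ξ : Sp d, ph (inner ℝ x ξ) • φ ξ

lemma invX_eq_fourierX (φ : Sp d → E) (x : Sp d) : invX φ x = fourierX φ (-x) := by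
  rw [fourierX_eq_ph, invX]
  congr 1; ext y; rw [inner_neg_right, neg_neg, real_inner_comm]

lemma invX_eq_fourierInv (φ : Sp d → E) (x : Sp d) :
    invX φ x = 𝓕⁻ φ ((2 * Real.pi)⁻¹ • x) := by
  rw [invX_eq_fourierX, fourierX_eq_fourier, Real.fourierInv_eq_fourier_neg, smul_neg]

lemma norm_fourierX_le (f : Sp d → E) (ξ : Sp d) : ‖fourierX f ξ‖ ≤ ∫ x, ‖f x‖ := by
  rw [fourierX_eq_ph]
  refine (norm_integral_le_integral_norm _).trans (le_of_eq ?_)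
  simp [norm_smul]

lemma integrable_ph_smul {X : Type*} [TopologicalSpace X] [MeasurableSpace X] [BorelSpace X]
    {μ : Measure X}
    {f : X → E} {p : X → ℝ} (hf : Integrable f μ) (hp : Continuous p) :
    Integrable (fun x => ph (p x) • f x) μ := by
  refine hf.bdd_smul 1 ?_ (Filter.Eventually.of_forall fun x => by simp)
  have : Measurable (fun x => ph (p x)) := (continuous_ph.comp hp).measurable
  exact this.aestronglyMeasurable

lemma continuous_invX {φ : Sp d → E} (hφ : Integrable φ) : Continuous (invX φ) := by
  unfold invX
  refine continuous_of_dominated (bound := fun ξ => ‖φ ξ‖) ?_ ?_ hφ.norm ?_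
  · intro x
    exact (integrable_ph_smul hφ (by fun_prop)).aestronglyMeasurable
  · intro x; filter_upwards with ξ; simp [norm_smul]
  · filter_upwards with ξ; fun_prop

lemma continuous_fourierX {φ : Sp d → E} (hφ : Integrable φ) : Continuous (fourierX φ) := by
  have : fourierX φ = fun x => invX φ (-x) := by
    ext x; rw [invX_eq_fourierX, neg_neg]
  rw [this]
  exact (continuous_invX hφ).comp continuous_neg

lemma two_pi_inv_pos : 0 < (2 * Real.pi)⁻¹ := by positivity

lemma invX_fourierX [CompleteSpace E] {f : Sp d → E} (hc : Continuous f) (hf : Integrable f)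
    (hf' : Integrable (fourierX f)) (x : Sp d) :
    invX (fourierX f) x = ((2 * Real.pi : ℝ) ^ d : ℝ) • f x := by
  have e : fourierX f = fun ξ => 𝓕 f ((2 * Real.pi)⁻¹ • ξ) := funext (fourierX_eq_fourier f)
  have h1 : Integrable (𝓕 f) := by
    rw [e] at hf'
    exact (integrable_comp_smul_iff volume (𝓕 f) two_pi_inv_pos.ne').1 hf'
  have h2 := congrFun (hc.fourierInv_fourier_eq hf h1) x
  rw [invX, e]
  have h3 := Measure.integral_comp_smul volume
    (fun v : Sp d => ph (2 * Real.pi * inner ℝ x v) • 𝓕 f v) ((2 * Real.pi)⁻¹)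
  have h4 : ∀ ξ : Sp d, ph (inner ℝ x ξ) • 𝓕 f ((2 * Real.pi)⁻¹ • ξ) =
      ph (2 * Real.pi * inner ℝ x ((2 * Real.pi)⁻¹ • ξ)) • 𝓕 f ((2 * Real.pi)⁻¹ • ξ) := by
    intro ξ
    congr 2
    rw [inner_smul_right]
    have := Real.pi_pos
    field_simp
  simp_rw [h4]
  rw [h3, ← h2]
  congr 1
  · simp only [finrank_euclideanSpace, Fintype.card_fin]
    rw [inv_pow, inv_inv, abs_of_nonneg (by positivity)]
  · rw [Real.fourierInv_eq]
    congr 1; ext v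
    rw [Circle.smul_def, ← ph_two_pi, real_inner_comm]

lemma fourierX_invX [CompleteSpace E] {φ : Sp d → E} (hc : Continuous φ) (hf : Integrable φ)
    (hf' : Integrable (invX φ)) (ξ : Sp d) :
    fourierX (invX φ) ξ = ((2 * Real.pi : ℝ) ^ d : ℝ) • φ ξ := by
  have e : invX φ = fun x => fourierX φ (-x) := funext (invX_eq_fourierX φ)
  have h0 : Integrable (fourierX φ) := by
    rw [e] at hf'
    have := hf'.comp_neg
    simpa using this
  rw [← invX_fourierX hc hf h0 ξ, fourierX_eq_ph, invX, e]
  rw [← integral_neg_eq_self]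
  congr 1; ext x
  simp only [inner_neg_left, neg_neg]
  rw [real_inner_comm]

lemma eLpNorm_fourier_of_inner {H : Type*}
    [NormedAddCommGroup H] [InnerProductSpace ℂ H] [CompleteSpace H]
    {φ : Sp d → H} (h1 : Integrable φ volume) (h2 : MemLp φ 2 volume) :
    eLpNorm (𝓕 φ) 2 volume = eLpNorm φ 2 volume := by
  set L : Lp H 2 (volume : Measure (Sp d)) := h2.toLp φ with hL
  have key : ∀ᵐ x ∂(volume : Measure (Sp d)), (𝓕 L : Lp H 2 (volume : Measure (Sp d))) x = 𝓕 φ x := by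
    apply ae_eq_of_integral_contDiff_smul_eq
    · exact (Lp.memLp (𝓕 L : Lp H 2 (volume : Measure (Sp d)))).locallyIntegrable (by norm_num)
    · exact (VectorFourier.fourierIntegral_continuous Real.continuous_fourierChar
        (L := innerₗ (Sp d)) (by exact continuous_inner) h1).locallyIntegrable
    · intro g hg hgc
      let gS : 𝓢(Sp d, ℂ) := (hgc.comp_left (g := (Complex.ofReal : ℝ → ℂ)) rfl).toSchwartzMap
          (Complex.ofRealCLM.contDiff.comp hg)
      have hgS : ∀ x, gS x = (g x : ℂ) := fun x => rfl
      have e1 := congrArg (fun T => T gS) (Lp.fourier_toTemperedDistribution_eq L)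
      simp only [TemperedDistribution.fourier_apply, Lp.toTemperedDistribution_apply] at e1
      have e2 : ∫ x, (𝓕 gS) x • L x ∂volume = ∫ x, (𝓕 (gS : Sp d → ℂ)) x • φ x ∂volume := by
        apply integral_congr_ae
        filter_upwards [h2.coeFn_toLp] with x hx
        rw [hL, hx, SchwartzMap.fourier_coe]
      have e3 := VectorFourier.integral_fourierIntegral_smul_eq_flip
        (L := innerₗ (Sp d)) (μ := volume) (ν := volume) Real.continuous_fourierChar
        (by exact continuous_inner) gS.integrable h1
      rw [flip_innerₗ] at e3
      calc ∫ x, g x • (𝓕 L : Lp H 2 (volume : Measure (Sp d))) x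
          = ∫ x, gS x • (𝓕 L : Lp H 2 (volume : Measure (Sp d))) x := by
            congr 1
        _ = ∫ x, gS x • 𝓕 φ x := by rw [← e1, e2]; exact e3
        _ = _ := by
            congr 1
  rw [← eLpNorm_congr_ae key]
  have := Lp.norm_fourier_eq L
  rw [Lp.norm_def, Lp.norm_def] at this
  rw [ENNReal.toReal_eq_toReal_iff' (Lp.eLpNorm_ne_top _) (Lp.eLpNorm_ne_top _)] at this
  rw [this]
  exact eLpNorm_congr_ae h2.coeFn_toLp

end FT

lemma eLpNorm_comp_neg {d : ℕ} {E : Type*} [NormedAddCommGroup E] (f : Sp d → E) (p : ℝ≥0∞) :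
    eLpNorm (fun y => f (-y)) p volume = eLpNorm f p volume := by
  have he : MeasurableEmbedding (fun y : Sp d => -y) :=
    (MeasurableEquiv.neg (Sp d)).measurableEmbedding
  have := he.eLpNorm_map_measure (g := f) (p := p) (μ := volume)
  rw [(Measure.measurePreserving_neg (volume : Measure (Sp d))).map_eq] at this
  exact this.symm

/-- Plancherel for `L¹ ∩ L²` functions with values in a finite-dimensional space. -/
lemma exists_eLpNorm_invX_le (d : ℕ) (E : Type*) [NormedAddCommGroup E] [NormedSpace ℂ E]
    [FiniteDimensional ℂ E] :
    ∃ C : ℝ≥0, ∀ φ : Sp d → E, Integrable φ →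
      eLpNorm (invX φ) 2 volume ≤ C * eLpNorm φ 2 volume := by
  let H := EuclideanSpace ℂ (Fin (Module.finrank ℂ E))
  let L : E ≃L[ℂ] H := ContinuousLinearEquiv.ofFinrankEq (by simp [H])
  set c : ℝ≥0∞ := ENNReal.ofReal |(((2 * Real.pi)⁻¹ : ℝ) ^ Module.finrank ℝ (Sp d))⁻¹| with hc
  have hmap := Measure.map_addHaar_smul (volume : Measure (Sp d)) two_pi_inv_pos.ne'
  have hscale : ∀ f : Sp d → E, eLpNorm (fun x => f ((2 * Real.pi)⁻¹ • x)) 2 volume =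
      c ^ (1 / 2 : ℝ) * eLpNorm f 2 volume := by
    intro f
    have he : MeasurableEmbedding (fun x : Sp d => (2 * Real.pi)⁻¹ • x) :=
      (Homeomorph.smulOfNeZero _ two_pi_inv_pos.ne').measurableEmbedding
    have := he.eLpNorm_map_measure (g := f) (p := 2) (μ := volume)
    rw [hmap, eLpNorm_smul_measure_of_ne_top (by norm_num)] at this
    rw [smul_eq_mul] at this
    rw [hc]
    simp only [one_div]
    simpa [Function.comp_def] using this.symm
  refine ⟨(c ^ (1 / 2 : ℝ)).toNNReal * (‖(L.symm : H →L[ℂ] E)‖₊ * ‖(L : E →L[ℂ] H)‖₊ + 1), ?_⟩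
  intro φ h1
  have hcpos : c ^ (1 / 2 : ℝ) ≠ 0 := by
    have : c ≠ 0 := by
      rw [hc]; simp [Real.pi_ne_zero]
    simp [this]
  have hctop : c ^ (1 / 2 : ℝ) ≠ ⊤ :=
    ENNReal.rpow_ne_top_of_nonneg (by norm_num) (by rw [hc]; exact ENNReal.ofReal_ne_top)
  rw [ENNReal.coe_mul, ENNReal.coe_toNNReal hctop]
  by_cases h2 : eLpNorm φ 2 volume = ⊤
  · rw [h2, ENNReal.mul_top]
    · exact le_top
    · simp only [ne_eq, mul_eq_zero, not_or]; exact ⟨hcpos, by simp⟩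
  have h2' : MemLp φ 2 volume := ⟨h1.aestronglyMeasurable, lt_top_iff_ne_top.2 h2⟩
  have e1 : invX φ = fun x => (fun y => 𝓕 φ (-y)) ((2 * Real.pi)⁻¹ • x) := by
    ext x; rw [invX_eq_fourierX, fourierX_eq_fourier, smul_neg]
  rw [e1, hscale (fun y => 𝓕 φ (-y)), mul_assoc]
  gcongr
  have e2 : eLpNorm (fun y => 𝓕 φ (-y)) 2 volume = eLpNorm (𝓕 φ) 2 volume :=
    eLpNorm_comp_neg _ _
  rw [e2]
  have e3 : ∀ x, L (𝓕 φ x) = 𝓕 (fun y => L (φ y)) x := by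
    intro x
    rw [Real.fourier_eq, Real.fourier_eq, ← ContinuousLinearEquiv.integral_comp_comm]
    congr 1; ext v; simp [Circle.smul_def]
  have e4 : eLpNorm (fun x => L (𝓕 φ x)) 2 volume = eLpNorm (fun x => L (φ x)) 2 volume := by
    rw [show (fun x => L (𝓕 φ x)) = 𝓕 (fun y => L (φ y)) from funext e3]
    refine eLpNorm_fourier_of_inner ?_ ?_
    · exact (L : E →L[ℂ] H).integrable_comp h1
    · exact (L : E →L[ℂ] H).comp_memLp' h2'
  calc eLpNorm (𝓕 φ) 2 volume
      ≤ ‖(L.symm : H →L[ℂ] E)‖₊ • eLpNorm (fun x => L (𝓕 φ x)) 2 volume := by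
        apply eLpNorm_le_nnreal_smul_eLpNorm_of_ae_le_mul
        filter_upwards with x
        have := (L.symm : H →L[ℂ] E).le_opNNNorm (L (𝓕 φ x))
        simpa using this
    _ = ‖(L.symm : H →L[ℂ] E)‖₊ • eLpNorm (fun x => L (φ x)) 2 volume := by rw [e4]
    _ ≤ ‖(L.symm : H →L[ℂ] E)‖₊ • (‖(L : E →L[ℂ] H)‖₊ • eLpNorm φ 2 volume) := by
        gcongr
        apply eLpNorm_le_nnreal_smul_eLpNorm_of_ae_le_mul
        filter_upwards with x
        exact (L : E →L[ℂ] H).le_opNNNorm (φ x)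
    _ = (‖(L.symm : H →L[ℂ] E)‖₊ * ‖(L : E →L[ℂ] H)‖₊ : ℝ≥0) * eLpNorm φ 2 volume := by
        rw [ENNReal.smul_def, ENNReal.smul_def, smul_eq_mul, smul_eq_mul, ENNReal.coe_mul, mul_assoc]
    _ ≤ _ := by
        gcongr
        exact_mod_cast le_self_add

lemma eLpNorm_fourierX_eq_invX {d : ℕ} {E : Type*} [NormedAddCommGroup E] [NormedSpace ℂ E]
    (φ : Sp d → E) (p : ℝ≥0∞) :
    eLpNorm (fourierX φ) p volume = eLpNorm (invX φ) p volume := by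
  rw [show invX φ = fun x => fourierX φ (-x) from funext (invX_eq_fourierX φ)]
  exact (eLpNorm_comp_neg _ _).symm

/-- Convolution with `γ̂` on the Fourier side is multiplication by `γ` in space, hence bounded on
`L²` by the supremum of `|γ|`. -/
lemma exists_eLpNorm_conv_fourierX_le (d : ℕ) (E : Type*) [NormedAddCommGroup E] [NormedSpace ℂ E]
    [FiniteDimensional ℂ E] :
    ∃ C : ℝ≥0, ∀ (φ : Sp d → E) (γ : 𝓢(Sp d, ℂ)), Integrable φ →
      eLpNorm (fun ζ => ∫ ξ, fourierX γ (ζ - ξ) • φ ξ) 2 volume ≤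
        C * (eLpNorm φ 2 volume * eLpNorm γ ∞ volume) := by
  obtain ⟨C, hC⟩ := exists_eLpNorm_invX_le d E
  refine ⟨C * C, fun φ γ hφ => ?_⟩
  have e1 : (fun ζ => ∫ ξ, fourierX γ (ζ - ξ) • φ ξ) = fourierX (fun x => γ x • invX φ x) := by
    ext ζ
    rw [fourierX_eq_ph]
    have : ∀ ξ, fourierX γ (ζ - ξ) • φ ξ =
        ∫ x, (ph (-inner ℝ x ζ) * γ x) • (ph (inner ℝ x ξ) • φ ξ) := by
      intro ξ
      rw [fourierX_eq_ph, ← integral_smul_const]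
      congr 1; ext x
      rw [inner_sub_right, neg_sub, sub_eq_add_neg, ph_add, smul_smul]
      congr 1; simp only [smul_eq_mul]; ring
    simp_rw [this]
    rw [integral_integral_swap]
    · congr 1; ext x
      rw [integral_smul, mul_smul]; rfl
    · have h1 : Integrable (fun p : Sp d × Sp d => γ p.2 • φ p.1) (volume.prod volume) :=
        (γ.integrable.smul_prod hφ).swap
      refine (integrable_ph_smul h1 (p := fun p => -inner ℝ p.2 ζ + inner ℝ p.2 p.1)
        (by fun_prop)).congr ?_
      filter_upwards with p
      simp only [Function.uncurry, ph_add, smul_smul]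
      congr 1; ring
  have hcont := continuous_invX hφ
  have hprod : Integrable (fun x => γ x • invX φ x) := by
    refine γ.integrable.smul_bdd (∫ x, ‖φ x‖) hcont.aestronglyMeasurable ?_
    filter_upwards with x
    rw [invX_eq_fourierX]; exact norm_fourierX_le _ _
  rw [e1, eLpNorm_fourierX_eq_invX]
  calc _ ≤ C * eLpNorm (fun x => γ x • invX φ x) 2 volume := hC _ hprod
    _ ≤ C * (eLpNorm γ ∞ volume * eLpNorm (invX φ) 2 volume) := by
        gcongr
        exact eLpNorm_smul_le_eLpNorm_top_mul_eLpNorm 2 hcont.aestronglyMeasurable _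
    _ ≤ C * (eLpNorm γ ∞ volume * (C * eLpNorm φ 2 volume)) := by
        gcongr
        exact hC _ hφ
    _ = _ := by rw [ENNReal.coe_mul]; ring

/-- Minkowski's integral inequality in `L²`. -/
lemma eLpNorm_lintegral_le {X Y : Type*} [MeasurableSpace X] [MeasurableSpace Y]
    (μ : Measure X) (ν : Measure Y) [SFinite μ] [SFinite ν] {h : Y → X → ℝ≥0∞}
    (hh : Measurable (Function.uncurry h)) :
    eLpNorm (fun x => ∫⁻ y, h y x ∂ν) 2 μ ≤ ∫⁻ y, eLpNorm (h y) 2 μ ∂ν := by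
  have key : ∀ f : X → ℝ≥0∞, eLpNorm f 2 μ = (∫⁻ x, f x ^ 2 ∂μ) ^ (1 / 2 : ℝ) := by
    intro f
    rw [eLpNorm_eq_lintegral_rpow_enorm_toReal (by norm_num) (by norm_num)]
    simp
  have hsq : ∀ a : ℝ≥0∞, (a ^ (1 / 2 : ℝ)) ^ 2 = a := by
    intro a
    rw [← ENNReal.rpow_natCast, ← ENNReal.rpow_mul]; norm_num
  have hroot : ∀ a b : ℝ≥0∞, a ≤ b ^ 2 → a ^ (1 / 2 : ℝ) ≤ b := by
    intro a b hab
    calc a ^ (1 / 2 : ℝ) ≤ (b ^ 2) ^ (1 / 2 : ℝ) := by gcongr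
      _ = b := by rw [← ENNReal.rpow_natCast, ← ENNReal.rpow_mul]; norm_num
  have hm1 : ∀ y, Measurable (h y) := fun y => hh.comp measurable_prodMk_left
  have hm2 : ∀ x, Measurable (fun y => h y x) := fun x => hh.comp measurable_prodMk_right
  rw [key]
  apply hroot
  have hn : Measurable (fun y => eLpNorm (h y) 2 μ) := by
    simp_rw [key]
    exact ((Measurable.lintegral_prod_right' (hh.pow_const 2)).pow_const _)
  calc ∫⁻ x, (∫⁻ y, h y x ∂ν) ^ 2 ∂μ
      = ∫⁻ x, ∫⁻ y, ∫⁻ y', h y x * h y' x ∂ν ∂ν ∂μ := by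
        congr 1; ext x
        rw [sq, ← lintegral_mul_const _ (hm2 x)]
        congr 1; ext y
        rw [lintegral_const_mul _ (hm2 x)]
    _ = ∫⁻ y, ∫⁻ x, ∫⁻ y', h y x * h y' x ∂ν ∂μ ∂ν := by
        rw [lintegral_lintegral_swap]
        refine Measurable.aemeasurable ?_
        have : Measurable (fun q : (X × Y) × Y => h q.1.2 q.1.1 * h q.2 q.1.1) :=
          (hh.comp (by fun_prop : Measurable (fun q : (X × Y) × Y => (q.1.2, q.1.1)))).mul
            (hh.comp (by fun_prop : Measurable (fun q : (X × Y) × Y => (q.2, q.1.1))))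
        exact Measurable.lintegral_prod_right' this
    _ = ∫⁻ y, ∫⁻ y', ∫⁻ x, h y x * h y' x ∂μ ∂ν ∂ν := by
        congr 1; ext y
        rw [lintegral_lintegral_swap]
        exact (((hm1 y).comp measurable_fst).mul
          (hh.comp (by fun_prop : Measurable (fun q : X × Y => (q.2, q.1))))).aemeasurable
    _ ≤ ∫⁻ y, ∫⁻ y', eLpNorm (h y) 2 μ * eLpNorm (h y') 2 μ ∂ν ∂ν := by
        gcongr with y y'
        rw [key, key]
        have := ENNReal.lintegral_mul_le_Lp_mul_Lq μ (p := 2) (q := 2)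
          (by constructor <;> norm_num) (hm1 y).aemeasurable (hm1 y').aemeasurable
        simpa using this
    _ = (∫⁻ y, eLpNorm (h y) 2 μ ∂ν) ^ 2 := by
        rw [sq, ← lintegral_mul_const _ hn]
        congr 1; ext y
        rw [lintegral_const_mul _ hn]

end MDNull

end

noncomputable section

namespace MDNull

open scoped FourierTransform

/-! ### Profiles and symbols of the frequency projections -/

/-- A modulation profile: a function `b` on `[0, ∞)` whose even extension is smooth and which is
supported in `[0, 4]`. Both `χ` and `∑_{i<0} χ(·/2^i)` are profiles. -/
structure IsProfile (b : ℝ → ℝ) : Prop where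
  smooth : ContDiff ℝ ∞ (fun σ => b |σ|)
  supp : ∀ r, 4 < r → b r = 0

lemma IsDyadicBump.eq_zero_of_lt {χ : ℝ → ℝ} (hχ : IsDyadicBump χ) {r : ℝ} (hr : r < 1 / 4) :
    χ r = 0 := by
  by_contra h
  have := (hχ.supp (Function.mem_support.2 h)).1
  norm_num at this; linarith

lemma IsDyadicBump.eq_zero_of_gt {χ : ℝ → ℝ} (hχ : IsDyadicBump χ) {r : ℝ} (hr : 4 < r) :
    χ r = 0 := by
  by_contra h
  have := (hχ.supp (Function.mem_support.2 h)).2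
  norm_num at this; linarith

lemma IsDyadicBump.le_one {χ : ℝ → ℝ} (hχ : IsDyadicBump χ) (r : ℝ) : χ r ≤ 1 := by
  by_cases hr : 0 < r
  · have := le_hasSum (hχ.sum_one r hr) 0 (fun i _ => hχ.nonneg _)
    simpa using this
  · rw [hχ.eq_zero_of_lt (by linarith)]; norm_num

lemma IsDyadicBump.isProfile {χ : ℝ → ℝ} (hχ : IsDyadicBump χ) : IsProfile χ where
  smooth := by
    rw [contDiff_iff_contDiffAt]
    intro x
    by_cases hx : x = 0
    · have : (fun σ => χ |σ|) =ᶠ[nhds x] fun _ => (0 : ℝ) := by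
        have h := (continuous_abs (G := ℝ)).continuousAt (x := x)
        have h2 : ∀ᶠ y in nhds x, |y| < 1 / 4 := h.eventually (gt_mem_nhds (by simp [hx]))
        filter_upwards [h2] with y hy using hχ.eq_zero_of_lt hy
      exact contDiffAt_const.congr_of_eventuallyEq this
    · exact hχ.smooth.contDiffAt.comp x (contDiffAt_abs hx)
  supp := fun r hr => hχ.eq_zero_of_gt hr

lemma IsDyadicBump.isProfile_lowBump {χ : ℝ → ℝ} (hχ : IsDyadicBump χ) :
    IsProfile (lowBump χ) where
  smooth := by
    rw [contDiff_iff_contDiffAt]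
    intro x
    obtain ⟨n, hn⟩ := pow_unbounded_of_one_lt (4 * (|x| + 1)) (one_lt_two (α := ℝ))
    have : (fun σ => lowBump χ |σ|) =ᶠ[nhds x]
        fun σ => 1 - ∑ i ∈ Finset.range n, χ |σ / 2 ^ i| := by
      have h := (continuous_abs (G := ℝ)).continuousAt (x := x)
      have h2 : ∀ᶠ y in nhds x, |y| < |x| + 1 := h.eventually (gt_mem_nhds (by simp))
      filter_upwards [h2] with y hy
      unfold lowBump
      rw [tsum_eq_sum (s := Finset.range n)]
      · congr 1
        refine Finset.sum_congr rfl fun i _ => ?_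
        rw [abs_div, abs_of_pos (by positivity : (0 : ℝ) < 2 ^ i)]
      · intro i hi
        apply hχ.eq_zero_of_lt
        rw [div_lt_iff₀ (by positivity)]
        have : (2 : ℝ) ^ n ≤ 2 ^ i := pow_le_pow_right₀ (by norm_num) (by simpa using hi)
        linarith
    refine ContDiffAt.congr_of_eventuallyEq ?_ this
    refine contDiffAt_const.sub (ContDiffAt.sum fun i _ => ?_)
    exact (hχ.isProfile.smooth.comp (contDiff_id.div_const (2 ^ i))).contDiffAt
  supp := by
    intro r hr
    unfold lowBump
    have h1 := hχ.sum_one r (by linarith)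
    have h2 : HasSum (fun i : ℕ => χ (r / 2 ^ (i : ℤ))) 1 := by
      refine (Function.Injective.hasSum_iff (Nat.cast_injective (R := ℤ)) ?_).2 h1
      intro i hi
      have hi' : i < 0 := by
        by_contra h
        exact hi ⟨i.toNat, by simp; omega⟩
      apply hχ.eq_zero_of_gt
      have : (2 : ℝ) ^ i ≤ 1 := by
        have := zpow_le_zpow_right₀ (one_le_two (α := ℝ)) hi'.le
        simpa using this
      rw [lt_div_iff₀ (by positivity)]
      nlinarith
    have h3 : HasSum (fun i : ℕ => χ (r / 2 ^ i)) 1 := by simpa using h2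
    rw [h3.tsum_eq]; ring

/-- The symbol `χ(|ξ|/2^k) b(|sτ-|ξ||/2^j)`. -/
def symA {d : ℕ} (χ b : ℝ → ℝ) (k j : ℤ) (s : ℤˣ) (X : ℝ × Sp d) : ℝ :=
  χ (‖X.2‖ / 2 ^ k) * b (|sgnR s * X.1 - ‖X.2‖| / 2 ^ j)

lemma abs_sgnR (s : ℤˣ) : |sgnR s| = 1 := by
  rcases Int.units_eq_one_or s with rfl | rfl <;> simp [sgnR]

lemma sgnR_sq (s : ℤˣ) : sgnR s * sgnR s = 1 := by
  rcases Int.units_eq_one_or s with rfl | rfl <;> simp [sgnR]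

lemma sgnR_mul (s s' : ℤˣ) : sgnR (s * s') = sgnR s * sgnR s' := by
  simp [sgnR]

lemma sgnR_neg (s : ℤˣ) : sgnR (-s) = -sgnR s := by
  simp [sgnR]

lemma abs_sgnR_mul_sub (s : ℤˣ) (x y : ℝ) : |sgnR s * x - y| = |x - sgnR s * y| := by
  have : sgnR s * x - y = sgnR s * (x - sgnR s * y) := by
    rw [mul_sub, ← mul_assoc, sgnR_sq, one_mul]
  rw [this, abs_mul, abs_sgnR, one_mul]

section sym

variable {d : ℕ} {χ b : ℝ → ℝ}

lemma contDiff_chi_norm (hχ : IsDyadicBump χ) (k : ℤ) :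
    ContDiff ℝ ∞ (fun ξ : Sp d => χ (‖ξ‖ / 2 ^ k)) := by
  rw [contDiff_iff_contDiffAt]
  intro x
  by_cases hx : x = 0
  · have : (fun ξ : Sp d => χ (‖ξ‖ / 2 ^ k)) =ᶠ[nhds x] fun _ => (0 : ℝ) := by
      have h := (continuous_norm (E := Sp d)).continuousAt (x := x)
      have h2 : ∀ᶠ y in nhds x, ‖y‖ < 2 ^ k / 4 := h.eventually (gt_mem_nhds (by
        simp only [hx, norm_zero]; positivity))
      filter_upwards [h2] with y hy
      apply hχ.eq_zero_of_lt
      rw [div_lt_iff₀ (by positivity)]; linarith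
    exact contDiffAt_const.congr_of_eventuallyEq this
  · exact hχ.smooth.contDiffAt.comp x ((contDiffAt_norm ℝ hx).div_const _)

lemma contDiff_symA (hχ : IsDyadicBump χ) (hb : IsProfile b) (k j : ℤ) (s : ℤˣ) :
    ContDiff ℝ ∞ (symA (d := d) χ b k j s) := by
  rw [contDiff_iff_contDiffAt]
  intro x
  by_cases hx : x.2 = 0
  · have : symA (d := d) χ b k j s =ᶠ[nhds x] fun _ => (0 : ℝ) := by
      have h : ContinuousAt (fun y : ℝ × Sp d => ‖y.2‖) x := by fun_prop
      have h2 : ∀ᶠ y in nhds x, ‖(y : ℝ × Sp d).2‖ < 2 ^ k / 4 := h.eventually (gt_mem_nhds (by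
        simp only [hx, norm_zero]; positivity))
      filter_upwards [h2] with y hy
      unfold symA
      rw [hχ.eq_zero_of_lt, zero_mul]
      rw [div_lt_iff₀ (by positivity)]; linarith
    exact contDiffAt_const.congr_of_eventuallyEq this
  · unfold symA
    have h1 : ContDiffAt ℝ ∞ (fun X : ℝ × Sp d => χ (‖X.2‖ / 2 ^ k)) x :=
      ((contDiff_chi_norm hχ k).comp contDiff_snd).contDiffAt
    refine h1.mul ?_
    have h2 : ContDiffAt ℝ ∞ (fun X : ℝ × Sp d => (sgnR s * X.1 - ‖X.2‖) / 2 ^ j) x := by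
      refine ContDiffAt.div_const ?_ _
      exact (contDiffAt_const.mul contDiffAt_fst).sub ((contDiffAt_norm ℝ hx).comp x contDiffAt_snd)
    have h3 := hb.smooth.contDiffAt.comp x h2
    refine h3.congr_of_eventuallyEq (Filter.Eventually.of_forall fun y => ?_)
    simp only [Function.comp, abs_div]
    rw [abs_of_pos (by positivity : (0 : ℝ) < 2 ^ j)]

lemma symA_ne_zero (hχ : IsDyadicBump χ) (hb : IsProfile b) {k j : ℤ} {s : ℤˣ} {X : ℝ × Sp d}
    (h : symA χ b k j s X ≠ 0) :
    (2 : ℝ) ^ (k - 2) ≤ ‖X.2‖ ∧ ‖X.2‖ ≤ 2 ^ (k + 2) ∧ |X.1 - sgnR s * ‖X.2‖| ≤ 2 ^ (j + 2) := by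
  unfold symA at h
  have hk : (0 : ℝ) < 2 ^ k := by positivity
  have hj : (0 : ℝ) < 2 ^ j := by positivity
  rw [zpow_sub₀ (by norm_num), zpow_add₀ (by norm_num), zpow_add₀ (by norm_num)]
  norm_num
  refine ⟨?_, ?_, ?_⟩
  · by_contra h1
    refine h ?_
    rw [hχ.eq_zero_of_lt, zero_mul]
    rw [div_lt_iff₀ hk]; linarith
  · by_contra h1
    refine h ?_
    rw [hχ.eq_zero_of_gt, zero_mul]
    rw [lt_div_iff₀ hk]; linarith
  · by_contra h1
    refine h ?_
    rw [hb.supp, mul_zero]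
    rw [abs_sgnR_mul_sub, lt_div_iff₀ hj]; linarith

lemma hasCompactSupport_symA (hχ : IsDyadicBump χ) (hb : IsProfile b) (k j : ℤ) (s : ℤˣ) :
    HasCompactSupport (symA (d := d) χ b k j s) := by
  refine HasCompactSupport.of_support_subset_isCompact
    (isCompact_closedBall (0 : ℝ × Sp d) (2 ^ (j + 2) + 2 ^ (k + 2))) ?_
  intro X hX
  obtain ⟨_, h2, h3⟩ := symA_ne_zero hχ hb (Function.mem_support.1 hX)
  rw [mem_closedBall_zero_iff, Prod.norm_def, max_le_iff]
  have hj : (0 : ℝ) < 2 ^ (j + 2) := by positivity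
  refine ⟨?_, by linarith⟩
  have h4 : |sgnR s * ‖X.2‖| = ‖X.2‖ := by rw [abs_mul, abs_sgnR, one_mul, abs_norm]
  have h5 := abs_sub_abs_le_abs_sub X.1 (sgnR s * ‖X.2‖)
  rw [Real.norm_eq_abs]; linarith

end sym

/-! ### Schwartz functions on space-time -/

section transport

variable (d : ℕ)

/-- `ℝ^{1+d}` with its Euclidean structure. -/
abbrev STE := WithLp 2 (ℝ × Sp d)

/-- The identification of Euclidean space-time with the product `ℝ × ℝ^d`. -/
def stE : STE d ≃L[ℝ] ℝ × Sp d := WithLp.prodContinuousLinearEquiv 2 ℝ ℝ (Sp d)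

lemma measurePreserving_stE : MeasurePreserving (stE d) volume volume :=
  WithLp.volume_preserving_ofLp _ _

lemma integral_stE {E : Type*} [NormedAddCommGroup E] [NormedSpace ℝ E] (f : ℝ × Sp d → E) :
    ∫ v : STE d, f (stE d v) = ∫ p, f p :=
  (measurePreserving_stE d).integral_comp
    (stE d).toHomeomorph.measurableEmbedding f

lemma inner_stE (v w : STE d) :
    inner ℝ v w = (stE d v).1 * (stE d w).1 + inner ℝ (stE d v).2 (stE d w).2 := by
  rw [WithLp.prod_inner_apply]
  simp [stE, mul_comm]

variable {d}

/-- Every space-time multiplier with smooth compactly supported symbol has a Schwartz kernel. -/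
lemma exists_schwartz_kernelTX {a : ℝ × Sp d → ℝ} (ha : ContDiff ℝ ∞ a)
    (hac : HasCompactSupport a) : ∃ K : 𝓢(ℝ × Sp d, ℂ), ∀ p, K p = kernelTX a p := by
  let aS : 𝓢(STE d, ℂ) := HasCompactSupport.toSchwartzMap (f := fun v => (a (stE d v) : ℂ))
    ((hac.comp_homeomorph (stE d).toHomeomorph).comp_left
      (g := (Complex.ofReal : ℝ → ℂ)) Complex.ofReal_zero)
    (Complex.ofRealCLM.contDiff.comp (ha.comp (stE d).contDiff))
  let sc : STE d ≃L[ℝ] STE d := ContinuousLinearEquiv.smulLeft (Units.mk0 _ two_pi_inv_pos.ne')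
  refine ⟨((2 * Real.pi : ℝ) : ℂ)⁻¹ ^ (d + 1) •
    SchwartzMap.compCLMOfContinuousLinearEquiv ℂ ((stE d).symm.trans sc) (𝓕⁻ aS), fun p => ?_⟩
  rw [smul_apply, kernelTX, smul_eq_mul]
  congr 1
  rw [SchwartzMap.compCLMOfContinuousLinearEquiv_apply, Function.comp_apply,
    SchwartzMap.fourierInv_coe, Real.fourierInv_eq, ← integral_stE]
  congr 1; ext v
  rw [Circle.smul_def, ← ph_two_pi, smul_eq_mul]
  congr 1
  change ph _ = ph _
  congr 1
  have e1 : ((stE d).symm.trans sc) p = (2 * Real.pi)⁻¹ • (stE d).symm p := rfl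
  rw [e1, inner_smul_right, inner_stE, ContinuousLinearEquiv.apply_symm_apply]
  have := Real.pi_pos
  field_simp
  rw [real_inner_comm]

variable {E : Type*} [NormedAddCommGroup E] [NormedSpace ℂ E]

/-- Convolution preserves Schwartz functions on space-time. -/
lemma exists_schwartz_conv [CompleteSpace E] (K : 𝓢(ℝ × Sp d, ℂ)) (f : 𝓢(ℝ × Sp d, E)) :
    ∃ F : 𝓢(ℝ × Sp d, E), ∀ p, F p = ∫ q, K (p - q) • f q := by
  let KV := SchwartzMap.compCLMOfContinuousLinearEquiv ℂ (stE d) K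
  let fV := SchwartzMap.compCLMOfContinuousLinearEquiv ℂ (stE d) f
  refine ⟨SchwartzMap.compCLMOfContinuousLinearEquiv ℂ (stE d).symm
    (SchwartzMap.convolution (ContinuousLinearMap.lsmul ℂ ℂ).flip fV KV), fun p => ?_⟩
  rw [SchwartzMap.compCLMOfContinuousLinearEquiv_apply, Function.comp_apply,
    SchwartzMap.convolution_apply, convolution, ← integral_stE]
  congr 1

lemma exists_schwartz_multTX [CompleteSpace E] {a : ℝ × Sp d → ℝ} (ha : ContDiff ℝ ∞ a)
    (hac : HasCompactSupport a) (f : 𝓢(ℝ × Sp d, E)) :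
    ∃ F : 𝓢(ℝ × Sp d, E), ⇑F = multTX a f := by
  obtain ⟨K, hK⟩ := exists_schwartz_kernelTX ha hac
  obtain ⟨F, hF⟩ := exists_schwartz_conv K f
  exact ⟨F, funext fun p => by rw [hF, multTX]; simp_rw [hK]⟩

/-- The restriction of a Schwartz function on space-time to a time slice. -/
def sliceS (t : ℝ) (f : 𝓢(ℝ × Sp d, E)) : 𝓢(Sp d, E) :=
  SchwartzMap.compCLMOfAntilipschitz ℂ (K := 1) (g := fun x : Sp d => ((t, x) : ℝ × Sp d))
    (by
      have h1 : (fun x : Sp d => ((t, x) : ℝ × Sp d)) =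
          (fun x => ((t, 0) : ℝ × Sp d) + ContinuousLinearMap.inr ℝ ℝ (Sp d) x) := by
        ext x <;> simp
      rw [h1]
      exact (Function.HasTemperateGrowth.const _).add
        (ContinuousLinearMap.inr ℝ ℝ (Sp d)).hasTemperateGrowth)
    (by
      apply AntilipschitzWith.of_le_mul_dist
      intro x y
      simp [Prod.dist_eq]) f

@[simp] lemma sliceS_apply (t : ℝ) (f : 𝓢(ℝ × Sp d, E)) (x : Sp d) : sliceS t f x = f (t, x) :=
  rfl

lemma exists_decay (f : 𝓢(ℝ × Sp d, E)) : ∃ C : ℝ, 0 ≤ C ∧ ∀ t x,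
    ‖f (t, x)‖ ≤ C * (1 + ‖t‖) ^ (-2 : ℝ) * (1 + ‖x‖) ^ (-((d : ℝ) + 1)) := by
  have h := SchwartzMap.one_add_le_sup_seminorm_apply (𝕜 := ℂ) (m := (d + 3, 0)) (k := d + 3)
    (n := 0) le_rfl le_rfl f
  set C := 2 ^ (d + 3) * (Finset.Iic (d + 3, 0)).sup (fun m => SchwartzMap.seminorm ℂ m.1 m.2) f
  refine ⟨C, ?_, fun t x => ?_⟩
  · exact (by positivity : (0 : ℝ) ≤ _).trans (h 0)
  have h1 := h (t, x)
  rw [norm_iteratedFDeriv_zero] at h1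
  have ht : ‖t‖ ≤ ‖(t, x)‖ := norm_fst_le (t, x)
  have hx : ‖x‖ ≤ ‖(t, x)‖ := norm_snd_le (t, x)
  rw [Real.rpow_neg (by positivity), Real.rpow_neg (by positivity)]
  have e1 : (1 + ‖t‖) ^ (2 : ℝ) = (1 + ‖t‖) ^ 2 := by norm_cast
  have e2 : (1 + ‖x‖) ^ ((d : ℝ) + 1) = (1 + ‖x‖) ^ (d + 1) := by norm_cast
  rw [e1, e2, mul_assoc, ← mul_inv, ← div_eq_mul_inv, le_div_iff₀ (by positivity)]
  calc ‖f (t, x)‖ * ((1 + ‖t‖) ^ 2 * (1 + ‖x‖) ^ (d + 1))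
      ≤ ‖f (t, x)‖ * ((1 + ‖(t, x)‖) ^ 2 * (1 + ‖(t, x)‖) ^ (d + 1)) := by gcongr
    _ = (1 + ‖(t, x)‖) ^ (d + 3) * ‖f (t, x)‖ := by ring
    _ ≤ C := h1

lemma integrable_japanese_time : Integrable (fun t : ℝ => (1 + ‖t‖) ^ (-2 : ℝ)) :=
  integrable_one_add_norm (by simp)

lemma integrable_japanese_space : Integrable (fun x : Sp d => (1 + ‖x‖) ^ (-((d : ℝ) + 1))) :=
  integrable_one_add_norm (by simp)

/-- The spatial Fourier transform of a space-time function at a fixed time. -/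
def hatX (u : ℝ × Sp d → E) (t : ℝ) (ξ : Sp d) : E := fourierX (fun x => u (t, x)) ξ

lemma continuous_hatX (f : 𝓢(ℝ × Sp d, E)) : Continuous (fun p : ℝ × Sp d => hatX f p.1 p.2) := by
  obtain ⟨C, hC, hf⟩ := exists_decay f
  simp only [hatX, fourierX_eq_ph]
  refine continuous_of_dominated
    (bound := fun x : Sp d => C * (1 + ‖x‖) ^ (-((d : ℝ) + 1))) ?_ ?_ ?_ ?_
  · intro p
    exact (integrable_ph_smul (sliceS p.1 f).integrable (by fun_prop)).aestronglyMeasurable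
  · intro p; filter_upwards with x
    rw [norm_smul, norm_ph, one_mul]
    refine (hf p.1 x).trans ?_
    gcongr
    refine mul_le_of_le_one_right hC ?_
    exact Real.rpow_le_one_of_one_le_of_nonpos (by simp) (by norm_num)
  · exact integrable_japanese_space.const_mul C
  · filter_upwards with x
    exact (continuous_ph.comp (by fun_prop)).smul (f.continuous.comp (by fun_prop))

lemma exists_norm_hatX_le (f : 𝓢(ℝ × Sp d, E)) : ∃ C : ℝ, 0 ≤ C ∧ ∀ t ξ,
    ‖hatX f t ξ‖ ≤ C * (1 + ‖t‖) ^ (-2 : ℝ) := by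
  obtain ⟨C, hC, hf⟩ := exists_decay f
  refine ⟨C * ∫ x : Sp d, (1 + ‖x‖) ^ (-((d : ℝ) + 1)), ?_, fun t ξ => ?_⟩
  · exact mul_nonneg hC (integral_nonneg fun x => by positivity)
  · refine (norm_fourierX_le _ _).trans ?_
    calc ∫ x, ‖f (t, x)‖ ≤ ∫ x, C * (1 + ‖t‖) ^ (-2 : ℝ) * (1 + ‖x‖) ^ (-((d : ℝ) + 1)) := by
          refine integral_mono (sliceS t f).integrable.norm
            (integrable_japanese_space.const_mul _) (fun x => hf t x)
      _ = _ := by rw [integral_const_mul]; ring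

lemma integrable_hatX (f : 𝓢(ℝ × Sp d, E)) (ξ : Sp d) : Integrable (fun t => hatX f t ξ) := by
  obtain ⟨C, hC, hf⟩ := exists_norm_hatX_le f
  refine (integrable_japanese_time.const_mul C).mono' ?_ ?_
  · exact ((continuous_hatX f).comp (by fun_prop : Continuous fun t : ℝ => (t, ξ))).aestronglyMeasurable
  · filter_upwards with t using hf t ξ

end transport

end MDNull

end

noncomputable section

namespace MDNull

open scoped FourierTransform

/-! ### Spatial Fourier transform of the projections -/

section kap

variable {d : ℕ} {χ b : ℝ → ℝ}

/-- The spatial Fourier transform `(t, ξ) ↦ (2π)⁻¹ ∫ e^{itτ} a(τ, ξ) dτ` of the kernel of the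
multiplier with symbol `a = χ(|ξ|/2^k) b(|sτ-|ξ||/2^j)`. -/
def kap (χ b : ℝ → ℝ) (k j : ℤ) (s : ℤˣ) (t : ℝ) (ξ : Sp d) : ℂ :=
  ((2 * Real.pi : ℝ) : ℂ)⁻¹ * ∫ τ : ℝ, ph (t * τ) * (symA χ b k j s (τ, ξ) : ℂ)

/-- The time kernel `(2π)⁻¹ ∫ e^{itσ} b(|σ|) dσ` of the modulation projection at unit scale. -/
def profKer (b : ℝ → ℝ) (t : ℝ) : ℂ :=
  ((2 * Real.pi : ℝ) : ℂ)⁻¹ * ∫ σ : ℝ, ph (t * σ) * (b |σ| : ℂ)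

/-- The majorant `2^j |β(2^j t)|` of `kap`, where `β = profKer b`. -/
def wt (b : ℝ → ℝ) (j : ℤ) (t : ℝ) : ℝ := 2 ^ j * ‖profKer b (2 ^ j * t)‖

lemma wt_nonneg (b : ℝ → ℝ) (j : ℤ) (t : ℝ) : 0 ≤ wt b j t := by unfold wt; positivity

lemma exists_schwartz_profKer (hb : IsProfile b) : ∃ β : 𝓢(ℝ, ℂ), ∀ t, β t = profKer b t := by
  have hc : HasCompactSupport (fun σ => b |σ|) := by
    refine HasCompactSupport.of_support_subset_isCompact (isCompact_closedBall (0 : ℝ) 4) ?_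
    intro σ hσ
    rw [mem_closedBall_zero_iff, Real.norm_eq_abs]
    by_contra h
    exact hσ (hb.supp _ (not_le.1 h))
  let bS : 𝓢(ℝ, ℂ) := HasCompactSupport.toSchwartzMap (f := fun σ => (b |σ| : ℂ))
    (hc.comp_left (g := (Complex.ofReal : ℝ → ℂ)) Complex.ofReal_zero)
    (Complex.ofRealCLM.contDiff.comp hb.smooth)
  let sc : ℝ ≃L[ℝ] ℝ := ContinuousLinearEquiv.smulLeft (Units.mk0 _ two_pi_inv_pos.ne')
  refine ⟨((2 * Real.pi : ℝ) : ℂ)⁻¹ •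
    SchwartzMap.compCLMOfContinuousLinearEquiv ℂ sc (𝓕⁻ bS), fun t => ?_⟩
  rw [smul_apply, profKer, smul_eq_mul]
  congr 1
  rw [SchwartzMap.compCLMOfContinuousLinearEquiv_apply, Function.comp_apply,
    SchwartzMap.fourierInv_coe, Real.fourierInv_eq]
  congr 1; ext v
  rw [Circle.smul_def, ← ph_two_pi, smul_eq_mul]
  congr 1
  have e1 : sc t = (2 * Real.pi)⁻¹ * t := rfl
  have e2 : inner ℝ v (sc t) = (2 * Real.pi)⁻¹ * t * v := by
    rw [e1]; rfl
  rw [e2]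
  congr 1
  have := Real.pi_pos
  field_simp

lemma continuous_wt (hb : IsProfile b) (j : ℤ) : Continuous (wt b j) := by
  obtain ⟨β, hβ⟩ := exists_schwartz_profKer hb
  unfold wt
  simp_rw [← hβ]
  have := β.continuous
  fun_prop

lemma integrable_wt (hb : IsProfile b) (j : ℤ) : Integrable (wt b j) := by
  obtain ⟨β, hβ⟩ := exists_schwartz_profKer hb
  unfold wt
  simp_rw [← hβ]
  refine Integrable.const_mul ?_ _
  exact β.integrable.norm.comp_mul_left' (by positivity)

/-- The mass of the time kernels does not depend on the modulation scale. -/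
lemma lintegral_wt (b : ℝ → ℝ) (hb : IsProfile b) (j : ℤ) :
    ∫⁻ t, ENNReal.ofReal (wt b j t) = ∫⁻ t, ENNReal.ofReal (wt b 0 t) := by
  rw [← ofReal_integral_eq_lintegral_ofReal (integrable_wt hb j)
      (Filter.Eventually.of_forall (wt_nonneg b j)),
    ← ofReal_integral_eq_lintegral_ofReal (integrable_wt hb 0)
      (Filter.Eventually.of_forall (wt_nonneg b 0))]
  congr 1
  unfold wt
  simp only [zpow_zero, one_mul]
  rw [integral_const_mul, Measure.integral_comp_mul_left (fun t => ‖profKer b t‖)]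
  rw [abs_inv, abs_of_pos (by positivity : (0 : ℝ) < 2 ^ j), smul_eq_mul, ← mul_assoc,
    mul_inv_cancel₀ (by positivity), one_mul]

/-- The time kernels are dominated by the functions `wt`, whose mass does not depend on `j`. -/
lemma norm_kap_le (hχ : IsDyadicBump χ) (k j : ℤ) (s : ℤˣ) (t : ℝ) (ξ : Sp d) :
    ‖kap χ b k j s t ξ‖ ≤ χ (‖ξ‖ / 2 ^ k) * wt b j t := by
  have hj : (0 : ℝ) < 2 ^ j := by positivity
  have e : kap χ b k j s t ξ =
      (χ (‖ξ‖ / 2 ^ k) : ℂ) * (ph (t * (sgnR s * ‖ξ‖)) * (2 ^ j * profKer b (2 ^ j * t))) := by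
    unfold kap profKer
    have h1 : ∀ τ : ℝ, ph (t * τ) * (symA χ b k j s (τ, ξ) : ℂ) =
        ((χ (‖ξ‖ / 2 ^ k) : ℂ) * ph (t * (sgnR s * ‖ξ‖))) *
        (fun σ : ℝ => ph (2 ^ j * t * σ) * (b |σ| : ℂ))
          ((2 ^ j)⁻¹ * (τ - sgnR s * ‖ξ‖)) := by
      intro τ
      have e1 : ph (t * τ) = ph (t * (sgnR s * ‖ξ‖)) *
          ph (2 ^ j * t * ((2 ^ j)⁻¹ * (τ - sgnR s * ‖ξ‖))) := by
        rw [← ph_add]; congr 1; field_simp; ring_nf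
      simp only [symA]
      rw [e1, abs_sgnR_mul_sub, abs_mul, abs_of_pos (inv_pos.2 hj), div_eq_inv_mul]
      push_cast; ring_nf
    simp_rw [h1]
    rw [integral_const_mul, integral_sub_right_eq_self
        (fun τ => (fun σ : ℝ => ph (2 ^ j * t * σ) * (b |σ| : ℂ)) ((2 ^ j)⁻¹ * τ)),
      Measure.integral_comp_mul_left (fun σ : ℝ => ph (2 ^ j * t * σ) * (b |σ| : ℂ)),
      inv_inv, abs_of_pos hj, Complex.real_smul]
    push_cast; ring
  rw [e, norm_mul, norm_mul, norm_mul, norm_ph, one_mul, wt]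
  rw [Complex.norm_real, Real.norm_of_nonneg (hχ.nonneg _)]
  simp

variable (hχ : IsDyadicBump χ) (hb : IsProfile b) (k j : ℤ) (s : ℤˣ)
include hχ hb

lemma continuous_kap : Continuous (fun p : ℝ × Sp d => kap χ b k j s p.1 p.2) := by
  have hc := (contDiff_symA (d := d) hχ hb k j s).continuous
  obtain ⟨x₀, hx₀⟩ := hc.norm.exists_forall_ge_of_hasCompactSupport
    (hasCompactSupport_symA (d := d) hχ hb k j s).norm
  obtain ⟨R, hR⟩ := (hasCompactSupport_symA (d := d) hχ hb k j s).isCompact.isBounded.subset_closedBall 0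
  unfold kap
  refine continuous_const.mul ?_
  refine continuous_of_dominated
    (bound := (Metric.closedBall (0 : ℝ) R).indicator fun _ => ‖symA χ b k j s x₀‖) ?_ ?_ ?_ ?_
  · intro p
    refine Continuous.aestronglyMeasurable ?_
    exact (continuous_ph.comp (by fun_prop)).mul
      (Complex.continuous_ofReal.comp (hc.comp (by fun_prop)))
  · intro p; filter_upwards with τ
    rw [norm_mul, norm_ph, one_mul, Complex.norm_real]
    by_cases hτ : τ ∈ Metric.closedBall (0 : ℝ) R
    · rw [indicator_of_mem hτ]; exact hx₀ _
    · rw [indicator_of_notMem hτ]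
      by_contra h
      have h1 : symA χ b k j s (τ, p.2) ≠ 0 := fun h2 => h (by simp [h2])
      have := hR (subset_tsupport _ (Function.mem_support.2 h1))
      rw [mem_closedBall_zero_iff] at this hτ
      exact hτ ((norm_fst_le (τ, p.2)).trans this)
  · refine (integrable_indicator_iff measurableSet_closedBall).2 ?_
    exact integrableOn_const (isCompact_closedBall _ _).measure_lt_top.ne
  · filter_upwards with τ
    exact (continuous_ph.comp (by fun_prop)).mul
      (Complex.continuous_ofReal.comp (hc.comp (by fun_prop)))

omit hb in
lemma kap_ne_zero {t : ℝ} {ξ : Sp d} (h : kap χ b k j s t ξ ≠ 0) :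
    (2 : ℝ) ^ (k - 2) ≤ ‖ξ‖ ∧ ‖ξ‖ ≤ 2 ^ (k + 2) := by
  have h1 : χ (‖ξ‖ / 2 ^ k) ≠ 0 := by
    intro h0
    have := norm_kap_le (b := b) hχ k j s t ξ
    rw [h0, zero_mul] at this
    exact h (norm_le_zero_iff.1 this)
  have hk : (0 : ℝ) < 2 ^ k := by positivity
  rw [zpow_sub₀ (by norm_num), zpow_add₀ (by norm_num)]
  norm_num
  constructor
  · by_contra h2
    exact h1 (hχ.eq_zero_of_lt (by rw [div_lt_iff₀ hk]; linarith))
  · by_contra h2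
    exact h1 (hχ.eq_zero_of_gt (by rw [lt_div_iff₀ hk]; linarith))

lemma integrable_kap_time (ξ : Sp d) : Integrable (fun t => kap χ b k j s t ξ) := by
  refine ((integrable_wt hb j).const_mul (χ (‖ξ‖ / 2 ^ k))).mono' ?_ ?_
  · exact ((continuous_kap hχ hb k j s).comp
      (by fun_prop : Continuous fun t : ℝ => (t, ξ))).aestronglyMeasurable
  · filter_upwards with t using norm_kap_le hχ k j s t ξ

omit hb in
lemma hasCompactSupport_kap (t : ℝ) : HasCompactSupport (kap (d := d) χ b k j s t) := by
  refine HasCompactSupport.of_support_subset_isCompact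
    (isCompact_closedBall (0 : Sp d) (2 ^ (k + 2))) ?_
  intro ξ hξ
  rw [mem_closedBall_zero_iff]
  exact (kap_ne_zero hχ k j s (Function.mem_support.1 hξ)).2

lemma kernelTX_symA (t : ℝ) (x : Sp d) :
    kernelTX (symA χ b k j s) (t, x) =
      ((2 * Real.pi : ℝ) : ℂ)⁻¹ ^ d * invX (kap χ b k j s t) x := by
  have hc := (contDiff_symA (d := d) hχ hb k j s).continuous
  have hi : Integrable (fun X : ℝ × Sp d =>
      ph (t * X.1 + inner ℝ x X.2) * (symA χ b k j s X : ℂ)) (volume.prod volume) := by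
    refine Continuous.integrable_of_hasCompactSupport ?_ ?_
    · exact (continuous_ph.comp (by fun_prop)).mul (Complex.continuous_ofReal.comp hc)
    · exact ((hasCompactSupport_symA (d := d) hχ hb k j s).comp_left
        (g := (Complex.ofReal : ℝ → ℂ)) Complex.ofReal_zero).mul_left
  have e : kernelTX (symA χ b k j s) (t, x) = ((2 * Real.pi : ℝ) : ℂ)⁻¹ ^ (d + 1) *
      ∫ X : ℝ × Sp d, ph (t * X.1 + inner ℝ x X.2) * (symA χ b k j s X : ℂ) := rfl
  rw [e, Measure.volume_eq_prod, integral_prod_symm _ hi, invX, pow_succ, mul_assoc]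
  congr 1
  rw [← integral_const_mul]
  congr 1; ext ξ
  simp only [kap, smul_eq_mul]
  rw [mul_left_comm]
  congr 1
  rw [← integral_const_mul]
  congr 1; ext τ
  rw [ph_add]; ring

lemma hatX_kernelTX (t : ℝ) (ξ : Sp d) :
    hatX (kernelTX (symA χ b k j s)) t ξ = kap χ b k j s t ξ := by
  obtain ⟨K, hK⟩ := exists_schwartz_kernelTX (contDiff_symA (d := d) hχ hb k j s)
    (hasCompactSupport_symA hχ hb k j s)
  have hpi : (((2 * Real.pi : ℝ) : ℂ)⁻¹ ^ d) ≠ 0 := by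
    have := Real.pi_pos
    simp [Real.pi_ne_zero]
  have hcont : Continuous (kap (d := d) χ b k j s t) :=
    (continuous_kap hχ hb k j s).comp (by fun_prop : Continuous fun ξ : Sp d => (t, ξ))
  have hint : Integrable (invX (kap (d := d) χ b k j s t)) := by
    have h1 := (sliceS t K).integrable (μ := volume)
    have h2 : ⇑(sliceS t K) =
        fun x => ((2 * Real.pi : ℝ) : ℂ)⁻¹ ^ d * invX (kap χ b k j s t) x := by
      ext x; rw [sliceS_apply, hK, kernelTX_symA hχ hb]
    rw [h2] at h1
    exact (integrable_const_mul_iff (IsUnit.mk0 _ hpi) _).1 h1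
  have h3 := fourierX_invX hcont
    (hcont.integrable_of_hasCompactSupport (hasCompactSupport_kap hχ k j s t)) hint ξ
  unfold hatX
  simp_rw [kernelTX_symA hχ hb]
  rw [fourierX_eq_ph] at h3 ⊢
  simp only [smul_eq_mul] at h3 ⊢
  simp_rw [mul_left_comm _ (((2 * Real.pi : ℝ) : ℂ)⁻¹ ^ d)]
  rw [integral_const_mul, h3, Complex.real_smul]
  push_cast
  rw [← mul_assoc, ← mul_pow, inv_mul_cancel₀, one_pow, one_mul]
  simp [Real.pi_ne_zero]

end kap

section conv

variable {d : ℕ} {χ b : ℝ → ℝ} {E : Type*} [NormedAddCommGroup E] [NormedSpace ℂ E]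

/-- The frequency support of a function of the form `P_k Q_j^s f` or `P_k Q_{<j}^s f`: its spatial
Fourier transform lives in the annulus `|ξ| ~ 2^k`, and at each `ξ` is a superposition of
oscillations `e^{itτ}` with `|τ - s|ξ|| ≤ 2^{j+2}`. -/
structure FreqLoc (k j : ℤ) (s : ℤˣ) (F : ℝ × Sp d → E) : Prop where
  annulus : ∀ t ξ, hatX F t ξ ≠ 0 → (2 : ℝ) ^ (k - 2) ≤ ‖ξ‖ ∧ ‖ξ‖ ≤ 2 ^ (k + 2)
  modulation : ∀ ξ, ∃ p : ℝ → E, Integrable p ∧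
    (∀ τ, p τ ≠ 0 → |τ - sgnR s * ‖ξ‖| ≤ 2 ^ (j + 2)) ∧
    ∀ t, hatX F t ξ = ∫ τ, ph (t * τ) • p τ

instance : (volume : Measure (ℝ × Sp d)).IsAddHaarMeasure :=
  inferInstanceAs (((volume : Measure ℝ).prod (volume : Measure (Sp d))).IsAddHaarMeasure)

lemma integrable_conv_slice [CompleteSpace E] (K : 𝓢(ℝ × Sp d, ℂ)) (f : 𝓢(ℝ × Sp d, E)) (t : ℝ) :
    Integrable (fun z : Sp d × (ℝ × Sp d) => K (t - z.2.1, z.1 - z.2.2) • f z.2)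
      (volume.prod volume) := by
  obtain ⟨C, hC, hK⟩ := exists_decay K
  have hm : AEStronglyMeasurable
      (fun z : Sp d × (ℝ × Sp d) => K (t - z.2.1, z.1 - z.2.2) • f z.2)
      (volume.prod volume) := by
    refine Continuous.aestronglyMeasurable ?_
    exact (K.continuous.comp (by fun_prop)).smul (f.continuous.comp (by fun_prop))
  have hJ := integrable_japanese_space (d := d)
  rw [integrable_prod_iff' hm]
  have hKs : ∀ (t' : ℝ) (x : Sp d), ‖K (t', x)‖ ≤ C * (1 + ‖x‖) ^ (-((d : ℝ) + 1)) := by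
    intro t' x
    refine (hK t' x).trans ?_
    gcongr
    refine mul_le_of_le_one_right hC ?_
    exact Real.rpow_le_one_of_one_le_of_nonpos (by simp) (by norm_num)
  constructor
  · filter_upwards with q
    refine Integrable.smul_const ?_ _
    exact (sliceS (t - q.1) K).integrable.comp_sub_right q.2
  · refine ((f.integrable (μ := volume)).norm.const_mul
      (∫ x : Sp d, C * (1 + ‖x‖) ^ (-((d : ℝ) + 1)))).mono' ?_ ?_
    · exact hm.norm.prod_swap.integral_prod_right'
    · filter_upwards with q
      rw [Real.norm_of_nonneg (integral_nonneg fun _ => norm_nonneg _)]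
      simp only [norm_smul]
      rw [integral_mul_const]
      refine mul_le_mul_of_nonneg_right ?_ (norm_nonneg _)
      rw [← integral_sub_right_eq_self
        (fun x : Sp d => C * (1 + ‖x‖) ^ (-((d : ℝ) + 1))) q.2]
      refine integral_mono ((sliceS (t - q.1) K).integrable.comp_sub_right q.2).norm
        ((hJ.const_mul C).comp_sub_right q.2) (fun x => hKs _ _)

lemma hatX_conv [CompleteSpace E] (K : 𝓢(ℝ × Sp d, ℂ)) (f : 𝓢(ℝ × Sp d, E)) (t : ℝ) (ξ : Sp d) :
    hatX (fun p => ∫ q, K (p - q) • f q) t ξ = ∫ t', hatX K (t - t') ξ • hatX f t' ξ := by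
  have hI := integrable_conv_slice K f t
  have e1 : hatX (fun p => ∫ q, K (p - q) • f q) t ξ =
      ∫ x, ∫ q : ℝ × Sp d, ph (-inner ℝ x ξ) • (K (t - q.1, x - q.2) • f q) := by
    rw [hatX, fourierX_eq_ph]
    congr 1; ext x
    rw [← integral_smul]; rfl
  have hI2 := integrable_ph_smul hI (p := fun z => -inner ℝ z.1 ξ) (by fun_prop)
  rw [e1, integral_integral_swap hI2]
  have e2 : ∀ q : ℝ × Sp d, ∫ x, ph (-inner ℝ x ξ) • (K (t - q.1, x - q.2) • f q) =
      hatX K (t - q.1) ξ • (ph (-inner ℝ q.2 ξ) • f q) := by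
    intro q
    have h1 : ∀ x : Sp d, ph (-inner ℝ x ξ) • (K (t - q.1, x - q.2) • f q) =
        (fun y => (ph (-inner ℝ y ξ) • K (t - q.1, y)) • (ph (-inner ℝ q.2 ξ) • f q))
          (x - q.2) := by
      intro x
      simp only [smul_smul, smul_eq_mul]
      congr 1
      rw [show -inner ℝ x ξ = -inner ℝ (x - q.2) ξ + -inner ℝ q.2 ξ by
        rw [inner_sub_left]; ring, ph_add]
      ring_nf
    simp_rw [h1]
    rw [integral_sub_right_eq_self
      (fun y => (ph (-inner ℝ y ξ) • K (t - q.1, y)) • (ph (-inner ℝ q.2 ξ) • f q)) q.2,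
      integral_smul_const, hatX, fourierX_eq_ph]
  have hI3 := hI2.integral_prod_right
  simp only [e2] at hI3 ⊢
  rw [Measure.volume_eq_prod] at hI3 ⊢
  rw [integral_prod _ hI3]
  congr 1; ext t'
  simp only
  rw [integral_smul, hatX, hatX, fourierX_eq_ph (fun x => f (t', x))]

lemma hatX_multTX [CompleteSpace E] (hχ : IsDyadicBump χ) (hb : IsProfile b) (k j : ℤ) (s : ℤˣ)
    (f : 𝓢(ℝ × Sp d, E)) (t : ℝ) (ξ : Sp d) :
    hatX (multTX (symA χ b k j s) f) t ξ = ∫ t', kap χ b k j s (t - t') ξ • hatX f t' ξ := by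
  obtain ⟨K, hK⟩ := exists_schwartz_kernelTX (contDiff_symA (d := d) hχ hb k j s)
    (hasCompactSupport_symA hχ hb k j s)
  have h := hatX_conv K f t ξ
  rw [show ⇑K = kernelTX (symA χ b k j s) from funext hK] at h
  simp_rw [hatX_kernelTX hχ hb] at h
  exact h

lemma exists_schwartz_proj [CompleteSpace E] (hχ : IsDyadicBump χ) (hb : IsProfile b) (k j : ℤ)
    (s : ℤˣ) (f : 𝓢(ℝ × Sp d, E)) :
    ∃ F : 𝓢(ℝ × Sp d, E), ⇑F = multTX (symA χ b k j s) f :=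
  exists_schwartz_multTX (contDiff_symA hχ hb k j s) (hasCompactSupport_symA hχ hb k j s) f

/-- Space-time projections of Schwartz functions are frequency localized. -/
lemma freqLoc_multTX [CompleteSpace E] (hχ : IsDyadicBump χ) (hb : IsProfile b) (k j : ℤ) (s : ℤˣ)
    (f : 𝓢(ℝ × Sp d, E)) : FreqLoc k j s (multTX (symA χ b k j s) f) where
  annulus := by
    intro t ξ h
    rw [hatX_multTX hχ hb] at h
    by_contra h2
    apply h
    have : ∀ t', kap χ b k j s (t - t') ξ = 0 := by
      intro t'
      by_contra h3
      exact h2 (kap_ne_zero hχ k j s h3)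
    simp [this]
  modulation := by
    intro ξ
    have hcs := (contDiff_symA (d := d) hχ hb k j s).continuous
    have hcc : Continuous (fun τ : ℝ => (symA χ b k j s (τ, ξ) : ℂ)) :=
      Complex.continuous_ofReal.comp (hcs.comp (by fun_prop))
    have hc1 : HasCompactSupport (fun τ : ℝ => (symA χ b k j s (τ, ξ) : ℂ)) := by
      refine HasCompactSupport.of_support_subset_isCompact
        (isCompact_closedBall (sgnR s * ‖ξ‖) (2 ^ (j + 2))) ?_
      intro τ hτ
      rw [Metric.mem_closedBall, Real.dist_eq]
      have : symA χ b k j s (τ, ξ) ≠ 0 := fun h => hτ (by simp [h])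
      exact (symA_ne_zero hχ hb this).2.2
    have hci := hcc.integrable_of_hasCompactSupport (μ := volume) hc1
    have hfi := integrable_hatX f ξ
    refine ⟨fun τ => (((2 * Real.pi : ℝ) : ℂ)⁻¹ * (symA χ b k j s (τ, ξ) : ℂ)) •
      ∫ t', ph (-t' * τ) • hatX f t' ξ, ?_, ?_, ?_⟩
    · refine (hci.const_mul _).smul_bdd (∫ t', ‖hatX f t' ξ‖) ?_ ?_
      · refine Continuous.aestronglyMeasurable ?_
        refine continuous_of_dominated (bound := fun t' => ‖hatX f t' ξ‖) ?_ ?_ hfi.norm ?_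
        · intro τ
          exact (integrable_ph_smul hfi (by fun_prop)).aestronglyMeasurable
        · intro τ; filter_upwards with t'; simp [norm_smul]
        · filter_upwards with t'; fun_prop
      · filter_upwards with τ
        refine (norm_integral_le_integral_norm _).trans (le_of_eq ?_)
        simp [norm_smul]
    · intro τ hτ
      have : symA χ b k j s (τ, ξ) ≠ 0 := fun h => hτ (by simp [h])
      exact (symA_ne_zero hχ hb this).2.2
    · intro t
      rw [hatX_multTX hχ hb]
      have e1 : ∀ t', kap χ b k j s (t - t') ξ • hatX f t' ξ =
          ∫ τ, ph ((t - t') * τ) •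
            ((((2 * Real.pi : ℝ) : ℂ)⁻¹ * (symA χ b k j s (τ, ξ) : ℂ)) • hatX f t' ξ) := by
        intro t'
        rw [kap, ← integral_const_mul, ← integral_smul_const]
        congr 1; ext τ
        rw [smul_smul]; congr 1; ring
      simp_rw [e1]
      rw [integral_integral_swap]
      · congr 1; ext τ
        rw [← integral_smul, ← integral_smul]
        congr 1; ext t'
        rw [sub_mul, sub_eq_add_neg, ph_add, ← neg_mul, smul_smul, smul_smul, smul_smul]
        congr 1; ring
      · have h0 := ((hci.const_mul ((2 * Real.pi : ℝ) : ℂ)⁻¹).smul_prod hfi).swap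
        have h1 : Integrable (fun z : ℝ × ℝ =>
            (((2 * Real.pi : ℝ) : ℂ)⁻¹ * (symA χ b k j s (z.2, ξ) : ℂ)) • hatX f z.1 ξ)
            (volume.prod volume) := h0
        have hp : Continuous (fun z : ℝ × ℝ => (t - z.1) * z.2) := by fun_prop
        have h2 := integrable_ph_smul h1 hp
        exact h2

/-- Every spatial multiplier with smooth compactly supported symbol has a Schwartz kernel. -/
lemma exists_schwartz_kernelX {a : Sp d → ℝ} (ha : ContDiff ℝ ∞ a) (hac : HasCompactSupport a) :
    ∃ K : 𝓢(Sp d, ℂ), (∀ x, K x = kernelX a x) ∧ ∀ ξ, fourierX K ξ = a ξ := by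
  let aS : 𝓢(Sp d, ℂ) := HasCompactSupport.toSchwartzMap (f := fun v => (a v : ℂ))
    (hac.comp_left (g := (Complex.ofReal : ℝ → ℂ)) Complex.ofReal_zero)
    (Complex.ofRealCLM.contDiff.comp ha)
  let sc : Sp d ≃L[ℝ] Sp d := ContinuousLinearEquiv.smulLeft (Units.mk0 _ two_pi_inv_pos.ne')
  let K : 𝓢(Sp d, ℂ) := ((2 * Real.pi : ℝ) : ℂ)⁻¹ ^ d •
    SchwartzMap.compCLMOfContinuousLinearEquiv ℂ sc (𝓕⁻ aS)
  have hK : ∀ x, K x = ((2 * Real.pi : ℝ) : ℂ)⁻¹ ^ d * invX (fun ξ => (a ξ : ℂ)) x := by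
    intro x
    simp only [K]
    rw [smul_apply, smul_eq_mul, invX_eq_fourierInv,
      SchwartzMap.compCLMOfContinuousLinearEquiv_apply, Function.comp_apply,
      SchwartzMap.fourierInv_coe]
    rfl
  have hK' : ∀ x, K x = kernelX a x := by
    intro x; rw [hK]; rfl
  have hpi : (((2 * Real.pi : ℝ) : ℂ)⁻¹ ^ d) ≠ 0 := by simp [Real.pi_ne_zero]
  have hac' : Integrable (fun ξ => (a ξ : ℂ)) := aS.integrable
  have hinv : Integrable (invX (fun ξ => (a ξ : ℂ))) := by
    have h1 := K.integrable (μ := volume)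
    rw [show ⇑K = fun x => ((2 * Real.pi : ℝ) : ℂ)⁻¹ ^ d * invX (fun ξ => (a ξ : ℂ)) x from
      funext hK] at h1
    exact (integrable_const_mul_iff (IsUnit.mk0 _ hpi) _).1 h1
  have hKhat : ∀ ξ, fourierX K ξ = a ξ := by
    intro ξ
    have h3 := fourierX_invX (Complex.continuous_ofReal.comp ha.continuous) hac' hinv ξ
    rw [show ⇑K = fun x => ((2 * Real.pi : ℝ) : ℂ)⁻¹ ^ d * invX (fun ξ => (a ξ : ℂ)) x from
      funext hK]
    rw [fourierX_eq_ph] at h3 ⊢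
    simp only [smul_eq_mul] at h3 ⊢
    simp_rw [mul_left_comm _ (((2 * Real.pi : ℝ) : ℂ)⁻¹ ^ d)]
    rw [integral_const_mul]
    erw [h3]
    rw [Complex.real_smul]
    push_cast
    rw [← mul_assoc, ← mul_pow, inv_mul_cancel₀, one_pow, one_mul]
    · rfl
    · simp [Real.pi_ne_zero]
  exact ⟨K, hK', hKhat⟩

/-- Compactly supported spatial multipliers preserve Schwartz functions and act on the Fourier
transform by multiplication. -/
lemma exists_schwartz_multX [CompleteSpace E] {a : Sp d → ℝ} (ha : ContDiff ℝ ∞ a)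
    (hac : HasCompactSupport a) (f : 𝓢(Sp d, E)) :
    ∃ g : 𝓢(Sp d, E), (∀ x, g x = ∫ y, kernelX a (x - y) • f y) ∧
      ∀ ξ, fourierX g ξ = a ξ • fourierX f ξ := by
  obtain ⟨K, hK', hKhat⟩ := exists_schwartz_kernelX ha hac
  refine ⟨SchwartzMap.convolution (ContinuousLinearMap.lsmul ℂ ℂ).flip f K, fun x => ?_, fun ξ => ?_⟩
  · rw [SchwartzMap.convolution_apply, convolution]
    simp_rw [← hK']
    rfl
  · rw [fourierX_eq_fourier, ← SchwartzMap.fourier_coe, SchwartzMap.fourier_convolution,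
      SchwartzMap.pairing_apply_apply, SchwartzMap.fourier_coe, SchwartzMap.fourier_coe,
      ← fourierX_eq_fourier, ← fourierX_eq_fourier, hKhat]
    simp

end conv

end MDNull

end

noncomputable section

namespace MDNull

open scoped FourierTransform

/-! ### Resonance: which frequency interactions survive the modulation cutoffs -/

/-- The frequencies `ξ` and `η` can interact in `P_{k₀} Q^{s₀} B(P_{k₁} Q^{s₁} f, P_{k₂} Q^{s₂} g)`
when all modulations are at most `2^{j+2}`. The inequalities are strict, so that the set of such
pairs is open. -/
structure Compat {d : ℕ} (k₀ k₁ k₂ j : ℤ) (s₀ s₁ s₂ : ℤˣ) (ξ η : Sp d) : Prop where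
  lb₁ : (2 : ℝ) ^ (k₁ - 3) < ‖ξ‖
  ub₁ : ‖ξ‖ < 2 ^ (k₁ + 3)
  lb₂ : (2 : ℝ) ^ (k₂ - 3) < ‖η‖
  ub₂ : ‖η‖ < 2 ^ (k₂ + 3)
  lb₀ : (2 : ℝ) ^ (k₀ - 3) < ‖ξ + η‖
  ub₀ : ‖ξ + η‖ < 2 ^ (k₀ + 3)
  modulation : |sgnR s₀ * ‖ξ + η‖ - sgnR s₁ * ‖ξ‖ - sgnR s₂ * ‖η‖| < 2 ^ (j + 4)

section resonance

variable {d : ℕ} {χ b : ℝ → ℝ} {E E₁ E₂ E₀ : Type*} [NormedAddCommGroup E] [NormedSpace ℂ E]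
  [NormedAddCommGroup E₁] [NormedSpace ℂ E₁] [NormedAddCommGroup E₂] [NormedSpace ℂ E₂]
  [NormedAddCommGroup E₀] [NormedSpace ℂ E₀]

/-- Convolving an oscillation `e^{itσ}` with the time kernel multiplies it by the space-time symbol
at `(σ, ζ)`. -/
lemma integral_kap_mul_ph (hχ : IsDyadicBump χ) (hb : IsProfile b) (k j : ℤ) (s : ℤˣ) (ζ : Sp d)
    (t σ : ℝ) :
    ∫ t', kap χ b k j s (t - t') ζ * ph (t' * σ) = ph (t * σ) * (symA χ b k j s (σ, ζ) : ℂ) := by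
  set A : ℝ → ℂ := fun τ => (symA χ b k j s (τ, ζ) : ℂ) with hA
  have hcs := (contDiff_symA (d := d) hχ hb k j s).continuous
  have hcc : Continuous A := Complex.continuous_ofReal.comp (hcs.comp (by fun_prop))
  have hc1 : HasCompactSupport A := by
    refine HasCompactSupport.of_support_subset_isCompact
      (isCompact_closedBall (sgnR s * ‖ζ‖) (2 ^ (j + 2))) ?_
    intro τ hτ
    rw [Metric.mem_closedBall, Real.dist_eq]
    have : symA χ b k j s (τ, ζ) ≠ 0 := fun h => hτ (by simp [A, h])
    exact (symA_ne_zero hχ hb this).2.2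
  have hci : Integrable A := hcc.integrable_of_hasCompactSupport hc1
  have hpi := Real.pi_pos
  have e1 : ∀ u, kap χ b k j s u ζ = ((2 * Real.pi : ℝ) : ℂ)⁻¹ * 𝓕⁻ A ((2 * Real.pi)⁻¹ * u) := by
    intro u
    rw [kap, Real.fourierInv_eq]
    congr 2; ext τ
    rw [Circle.smul_def, ← ph_two_pi, smul_eq_mul]
    congr 2
    change u * τ = 2 * Real.pi * ((2 * Real.pi)⁻¹ * u * τ)
    field_simp
  have hki := integrable_kap_time hχ hb k j s ζ
  have hinv : Integrable (𝓕⁻ A) := by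
    simp_rw [e1] at hki
    have h2 := (integrable_const_mul_iff (IsUnit.mk0 _ (by simp [Real.pi_ne_zero])) _).1 hki
    exact (integrable_comp_mul_left_iff (𝓕⁻ A) two_pi_inv_pos.ne').1 h2
  have h4 := integral_sub_left_eq_self (fun u => kap χ b k j s u ζ * ph ((t - u) * σ)) volume t
  simp only [sub_sub_cancel] at h4
  rw [h4]
  have e2 : ∀ u, kap χ b k j s u ζ * ph ((t - u) * σ) =
      ph (t * σ) * (((2 * Real.pi : ℝ) : ℂ)⁻¹ *
        (fun v => ph (2 * Real.pi * (-(v * σ))) * 𝓕⁻ A v) ((2 * Real.pi)⁻¹ * u)) := by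
    intro u
    rw [e1, sub_mul, sub_eq_add_neg, ph_add]
    have : ph (2 * Real.pi * (-((2 * Real.pi)⁻¹ * u * σ))) = ph (-(u * σ)) := by
      congr 1; field_simp
    simp only [this]
    ring
  simp_rw [e2]
  rw [integral_const_mul, integral_const_mul,
    Measure.integral_comp_mul_left (fun v => ph (2 * Real.pi * (-(v * σ))) * 𝓕⁻ A v)]
  congr 1
  have hinv' : Integrable (𝓕 A) := by
    refine hinv.comp_neg.congr (Filter.Eventually.of_forall fun u => ?_)
    simp [Real.fourierInv_eq_fourier_neg]
  have h3 := congrFun (hcc.fourier_fourierInv_eq hci hinv') σ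
  rw [Real.fourier_eq] at h3
  have hAσ : (symA χ b k j s (σ, ζ) : ℂ) = A σ := rfl
  rw [hAσ, ← h3, inv_inv, abs_of_pos (by positivity), Complex.real_smul, ← mul_assoc,
    inv_mul_cancel₀ (by simp [Real.pi_ne_zero]), one_mul]
  congr 1; ext v
  rw [Circle.smul_def, ← ph_two_pi, smul_eq_mul]
  congr 2
  congr 1
  rw [mul_comm v σ]; rfl

lemma bil_integral_integral {X Y : Type*} [MeasurableSpace X] [MeasurableSpace Y] {μ : Measure X}
    {ν : Measure Y} [SFinite μ] [SFinite ν] [CompleteSpace E₁] [CompleteSpace E₂] [CompleteSpace E₀]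
    (B : Bil E₁ E₂ E₀) {f : X → E₁} {g : Y → E₂} (hf : Integrable f μ) (hg : Integrable g ν) :
    B (∫ x, f x ∂μ) (∫ y, g y ∂ν) = ∫ z, B (f z.1) (g z.2) ∂(μ.prod ν) := by
  have hi : Integrable (fun z : X × Y => B (f z.1) (g z.2)) (μ.prod ν) := by
    refine ((hf.norm.mul_prod hg.norm).const_mul ‖B‖).mono' ?_ ?_
    · exact B.aestronglyMeasurable_comp₂ hf.aestronglyMeasurable.comp_fst
        hg.aestronglyMeasurable.comp_snd
    · filter_upwards with z
      rw [← mul_assoc]; exact B.le_opNorm₂ _ _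
  rw [integral_prod _ hi]
  have h1 : ∀ x, ∫ y, B (f x) (g y) ∂ν = B (f x) (∫ y, g y ∂ν) := fun x =>
    (B (f x)).integral_comp_comm hg
  simp_rw [h1]
  exact ((B.flip (∫ y, g y ∂ν)).integral_comp_comm hf).symm

lemma integrable_bil_prod {X Y : Type*} [MeasurableSpace X] [MeasurableSpace Y] {μ : Measure X}
    {ν : Measure Y} [SFinite μ] [SFinite ν]
    (B : Bil E₁ E₂ E₀) {f : X → E₁} {g : Y → E₂} (hf : Integrable f μ) (hg : Integrable g ν) :
    Integrable (fun z : X × Y => B (f z.1) (g z.2)) (μ.prod ν) := by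
  refine ((hf.norm.mul_prod hg.norm).const_mul ‖B‖).mono' ?_ ?_
  · exact B.aestronglyMeasurable_comp₂ hf.aestronglyMeasurable.comp_fst
      hg.aestronglyMeasurable.comp_snd
  · filter_upwards with z
    rw [← mul_assoc]; exact B.le_opNorm₂ _ _

/-- The output modulation cutoff annihilates the interaction of incompatible frequencies. -/
lemma integral_kap_smul_eq_zero [CompleteSpace E₁] [CompleteSpace E₂] [CompleteSpace E₀]
    (hχ : IsDyadicBump χ) (hb : IsProfile b) {k₀ k₁ k₂ j : ℤ} {s₀ s₁ s₂ : ℤˣ}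
    {F : ℝ × Sp d → E₁} {G : ℝ × Sp d → E₂} (hF : FreqLoc k₁ j s₁ F) (hG : FreqLoc k₂ j s₂ G)
    (B : Bil E₁ E₂ E₀) {ξ η : Sp d} (h : ¬ Compat k₀ k₁ k₂ j s₀ s₁ s₂ ξ η) (t : ℝ) :
    ∫ t', kap χ b k₀ j s₀ (t - t') (ξ + η) • B (hatX F t' ξ) (hatX G t' η) = 0 := by
  have hlt : ∀ k : ℤ, (2 : ℝ) ^ (k - 3) < 2 ^ (k - 2) := fun k =>
    zpow_lt_zpow_right₀ (by norm_num) (by omega)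
  have hlt' : ∀ k : ℤ, (2 : ℝ) ^ (k + 2) < 2 ^ (k + 3) := fun k =>
    zpow_lt_zpow_right₀ (by norm_num) (by omega)
  by_cases h1 : (2 : ℝ) ^ (k₁ - 3) < ‖ξ‖ ∧ ‖ξ‖ < 2 ^ (k₁ + 3)
  swap
  · have : ∀ t', hatX F t' ξ = 0 := by
      intro t'
      by_contra h2
      obtain ⟨h3, h4⟩ := hF.annulus t' ξ h2
      exact h1 ⟨(hlt _).trans_le h3, h4.trans_lt (hlt' _)⟩
    simp [this]
  by_cases h2 : (2 : ℝ) ^ (k₂ - 3) < ‖η‖ ∧ ‖η‖ < 2 ^ (k₂ + 3)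
  swap
  · have : ∀ t', hatX G t' η = 0 := by
      intro t'
      by_contra h2'
      obtain ⟨h3, h4⟩ := hG.annulus t' η h2'
      exact h2 ⟨(hlt _).trans_le h3, h4.trans_lt (hlt' _)⟩
    simp [this]
  by_cases h0 : (2 : ℝ) ^ (k₀ - 3) < ‖ξ + η‖ ∧ ‖ξ + η‖ < 2 ^ (k₀ + 3)
  swap
  · have : ∀ t', kap χ b k₀ j s₀ (t - t') (ξ + η) = 0 := by
      intro t'
      by_contra h2'
      obtain ⟨h3, h4⟩ := kap_ne_zero hχ k₀ j s₀ h2'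
      exact h0 ⟨(hlt _).trans_le h3, h4.trans_lt (hlt' _)⟩
    simp [this]
  have h3 : (2 : ℝ) ^ (j + 4) ≤ |sgnR s₀ * ‖ξ + η‖ - sgnR s₁ * ‖ξ‖ - sgnR s₂ * ‖η‖| := by
    by_contra h4
    exact h ⟨h1.1, h1.2, h2.1, h2.2, h0.1, h0.2, not_le.1 h4⟩
  obtain ⟨p, hp, hps, hpF⟩ := hF.modulation ξ
  obtain ⟨q, hq, hqs, hqG⟩ := hG.modulation η
  have e1 : ∀ t', kap χ b k₀ j s₀ (t - t') (ξ + η) • B (hatX F t' ξ) (hatX G t' η) =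
      ∫ z : ℝ × ℝ, (kap χ b k₀ j s₀ (t - t') (ξ + η) * ph (t' * (z.1 + z.2))) •
        B (p z.1) (q z.2) := by
    intro t'
    rw [hpF, hqG, bil_integral_integral B (integrable_ph_smul hp (by fun_prop))
      (integrable_ph_smul hq (by fun_prop)), ← integral_smul]
    congr 1; ext z
    rw [map_smul, map_smul, smul_apply, smul_smul, mul_add, ph_add, smul_smul]
    congr 1; ring
  simp_rw [e1]
  have hk := integrable_kap_time hχ hb k₀ j s₀ (ξ + η)
  rw [integral_integral_swap]
  · have e2 : ∀ z : ℝ × ℝ, ∫ t', (kap χ b k₀ j s₀ (t - t') (ξ + η) * ph (t' * (z.1 + z.2))) •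
        B (p z.1) (q z.2) = 0 := by
      intro z
      rw [integral_smul_const, integral_kap_mul_ph hχ hb]
      by_cases hz1 : p z.1 = 0
      · simp [hz1]
      by_cases hz2 : q z.2 = 0
      · simp [hz2]
      have hz3 : symA χ b k₀ j s₀ (z.1 + z.2, ξ + η) = 0 := by
        by_contra h5
        have b0 := (symA_ne_zero hχ hb h5).2.2
        have b1 := hps _ hz1
        have b2 := hqs _ hz2
        have hj : (0 : ℝ) < 2 ^ j := by positivity
        rw [zpow_add₀ (by norm_num)] at h3 b0 b1 b2
        norm_num at h3 b0 b1 b2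
        have : sgnR s₀ * ‖ξ + η‖ - sgnR s₁ * ‖ξ‖ - sgnR s₂ * ‖η‖ =
            -(z.1 + z.2 - sgnR s₀ * ‖ξ + η‖) + (z.1 - sgnR s₁ * ‖ξ‖) +
              (z.2 - sgnR s₂ * ‖η‖) := by ring
        rw [this] at h3
        have := abs_add_three (-(z.1 + z.2 - sgnR s₀ * ‖ξ + η‖)) (z.1 - sgnR s₁ * ‖ξ‖)
          (z.2 - sgnR s₂ * ‖η‖)
        rw [abs_neg] at this
        linarith
      simp [hz3]
    simp_rw [e2]
    simp
  · have h1 : Integrable (fun z : ℝ × (ℝ × ℝ) =>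
        kap χ b k₀ j s₀ (t - z.1) (ξ + η) • B (p z.2.1) (q z.2.2)) (volume.prod volume) :=
      (hk.comp_sub_left t).smul_prod (integrable_bil_prod B hp hq)
    have hpc : Continuous (fun z : ℝ × (ℝ × ℝ) => z.1 * (z.2.1 + z.2.2)) := by fun_prop
    refine (integrable_ph_smul h1 hpc).congr (Filter.Eventually.of_forall fun z => ?_)
    simp only [Function.uncurry, smul_smul]
    congr 1; ring

end resonance

end MDNull

end

noncomputable section

namespace MDNull

open scoped FourierTransform

/-! ### Bilinear operators on the Fourier side -/

section bilinear

variable {d : ℕ} {χ b : ℝ → ℝ} {E E₁ E₂ E₀ : Type*} [NormedAddCommGroup E] [NormedSpace ℂ E]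
  [NormedAddCommGroup E₁] [NormedSpace ℂ E₁] [NormedAddCommGroup E₂] [NormedSpace ℂ E₂]
  [NormedAddCommGroup E₀] [NormedSpace ℂ E₀]

/-- The Fourier transform, up to a power of `2π`, of the bilinear operator with symbol `M`,
as an operator on the Fourier transforms of the two factors. -/
def bilF (M : Sp d → Sp d → Bil E₁ E₂ E₀) (φ : Sp d → E₁) (ψ : Sp d → E₂) (ζ : Sp d) : E₀ :=
  ∫ ξ, M ξ (ζ - ξ) (φ ξ) (ψ (ζ - ξ))

lemma exists_hat_majorant {k j : ℤ} {s : ℤˣ} (F : 𝓢(ℝ × Sp d, E)) (hF : FreqLoc k j s F) :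
    ∃ (C : ℝ) (g : Sp d → ℝ), Integrable g ∧ (∀ ξ, 0 ≤ g ξ) ∧ (∀ ξ, g ξ ≤ C) ∧
      ∀ t ξ, ‖hatX F t ξ‖ ≤ g ξ := by
  obtain ⟨C, hC, hF'⟩ := exists_norm_hatX_le F
  refine ⟨C, (Metric.closedBall 0 (2 ^ (k + 2))).indicator (fun _ => C), ?_, ?_, ?_, ?_⟩
  · exact (integrable_indicator_iff measurableSet_closedBall).2
      (integrableOn_const (measure_closedBall_lt_top.ne))
  · exact fun ξ => indicator_nonneg (fun _ _ => hC) ξ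
  · exact fun ξ => indicator_le_self' (fun _ _ => hC) ξ
  · intro t ξ
    by_cases h : hatX F t ξ = 0
    · rw [h, norm_zero]; exact indicator_nonneg (fun _ _ => hC) ξ
    · rw [indicator_of_mem (mem_closedBall_zero_iff.2 (hF.annulus t ξ h).2)]
      refine (hF' t ξ).trans (mul_le_of_le_one_right hC ?_)
      exact Real.rpow_le_one_of_one_le_of_nonpos (by simp) (by norm_num)

/-- A uniformly bounded, strongly measurable symbol. -/
structure BddSymbol (m : Sp d → Sp d → Bil E₁ E₂ E₀) : Prop where
  meas : StronglyMeasurable (fun p : Sp d × Sp d => m p.1 p.2)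
  bdd : ∃ B : ℝ, ∀ ξ η, ‖m ξ η‖ ≤ B

lemma stronglyMeasurable_bil {X : Type*} [MeasurableSpace X] {M : X → Bil E₁ E₂ E₀} {f : X → E₁}
    {g : X → E₂} (hM : StronglyMeasurable M) (hf : StronglyMeasurable f)
    (hg : StronglyMeasurable g) : StronglyMeasurable (fun x => M x (f x) (g x)) := by
  have h1 : Continuous (fun p : (Bil E₁ E₂ E₀) × E₁ × E₂ => p.1 p.2.1 p.2.2) := by fun_prop
  exact h1.comp_stronglyMeasurable (hM.prodMk (hf.prodMk hg))

/-- The integrability behind every exchange of the time convolution with the frequency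
interaction. -/
lemma integrable_interaction {W V : Type*} [MeasurableSpace W] [MeasurableSpace V]
    {ν : Measure W} {ρ : Measure V} [SFinite ν] [SFinite ρ] {k : W → ℂ} (hk : Integrable k ν)
    {τ : W → ℝ} (hτ : Measurable τ) {m : Sp d → Sp d → Bil E₁ E₂ E₀} (hm : BddSymbol m)
    (F : 𝓢(ℝ × Sp d, E₁)) (G : 𝓢(ℝ × Sp d, E₂)) {a a' : V → Sp d} (ha : Measurable a)
    (ha' : Measurable a') {c : V → ℝ} (hc : Integrable c ρ)
    (hcb : ∀ t v, ‖hatX F t (a v)‖ * ‖hatX G t (a' v)‖ ≤ c v) :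
    Integrable (fun z : W × V => k z.1 • m (a z.2) (a' z.2) (hatX F (τ z.1) (a z.2))
      (hatX G (τ z.1) (a' z.2))) (ν.prod ρ) := by
  obtain ⟨B, hB⟩ := hm.bdd
  have hB0 : 0 ≤ B := (norm_nonneg _).trans (hB 0 0)
  refine ((hk.norm.mul_prod hc).const_mul B).mono' ?_ ?_
  · refine hk.aestronglyMeasurable.comp_fst.smul (StronglyMeasurable.aestronglyMeasurable ?_)
    refine stronglyMeasurable_bil ?_ ?_ ?_
    · exact hm.meas.comp_measurable (g := fun z : W × V => (a z.2, a' z.2)) (by fun_prop)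
    · exact (continuous_hatX F).stronglyMeasurable.comp_measurable
        (g := fun z : W × V => (τ z.1, a z.2)) (by fun_prop)
    · exact (continuous_hatX G).stronglyMeasurable.comp_measurable
        (g := fun z : W × V => (τ z.1, a' z.2)) (by fun_prop)
  · filter_upwards with z
    rw [norm_smul]
    calc ‖k z.1‖ * ‖m (a z.2) (a' z.2) (hatX F (τ z.1) (a z.2)) (hatX G (τ z.1) (a' z.2))‖
        ≤ ‖k z.1‖ * (B * ‖hatX F (τ z.1) (a z.2)‖ * ‖hatX G (τ z.1) (a' z.2)‖) := by
          gcongr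
          refine ((m _ _).le_opNorm₂ _ _).trans ?_
          gcongr
          exact hB _ _
      _ = B * (‖k z.1‖ * (‖hatX F (τ z.1) (a z.2)‖ * ‖hatX G (τ z.1) (a' z.2)‖)) := by ring
      _ ≤ B * (‖k z.1‖ * c z.2) := by gcongr; exact hcb _ _

/-- The change of variables `(ζ, ξ) ↦ (ξ, ζ - ξ)`. -/
def shearE (d : ℕ) : Sp d × Sp d ≃ᵐ Sp d × Sp d :=
  MeasurableEquiv.prodComm.trans (MeasurableEquiv.shearAddRight (Sp d)).symm

lemma shearE_apply (ζ ξ : Sp d) : shearE d (ζ, ξ) = (ξ, ζ - ξ) := by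
  change (ξ, -ξ + ζ) = _
  rw [neg_add_eq_sub]

lemma measurePreserving_shearE :
    MeasurePreserving (shearE d) (volume.prod volume) (volume.prod volume) :=
  (measurePreserving_prod_neg_add (G := Sp d) volume volume).comp Measure.measurePreserving_swap

lemma integral_kernelTX_mul_ph (hχ : IsDyadicBump χ) (hb : IsProfile b) (k j : ℤ) (s : ℤˣ)
    (u : ℝ) (x ζ : Sp d) :
    ∫ x', kernelTX (symA χ b k j s) (u, x - x') * ph (inner ℝ x' ζ) =
      ph (inner ℝ x ζ) * kap χ b k j s u ζ := by
  rw [← hatX_kernelTX hχ hb, hatX, fourierX_eq_ph]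
  have h4 := integral_sub_left_eq_self
    (fun y => kernelTX (symA χ b k j s) (u, y) * ph (inner ℝ (x - y) ζ)) volume x
  simp only [sub_sub_cancel] at h4
  rw [h4, ← integral_const_mul]
  congr 1; ext y
  rw [inner_sub_left, sub_eq_add_neg, ph_add, smul_eq_mul]
  ring

/-- The output of a projected bilinear operator as an inverse Fourier transform. -/
lemma multTX_symbolOp_eq_invX [CompleteSpace E₀] (hχ : IsDyadicBump χ) (hb : IsProfile b)
    {k₀ k₁ k₂ j : ℤ} {s₀ s₁ s₂ : ℤˣ} (F : 𝓢(ℝ × Sp d, E₁)) (G : 𝓢(ℝ × Sp d, E₂))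
    (hF : FreqLoc k₁ j s₁ F) (hG : FreqLoc k₂ j s₂ G) {m : Sp d → Sp d → Bil E₁ E₂ E₀}
    (hm : BddSymbol m) (t : ℝ) (x : Sp d) :
    multTX (symA χ b k₀ j s₀) (atEachTime (symbolOp m) F G) (t, x) =
      (((2 * Real.pi : ℝ) : ℂ)⁻¹ ^ (2 * d)) • invX (fun ζ => ∫ ξ, ∫ t',
        kap χ b k₀ j s₀ (t - t') ζ • m ξ (ζ - ξ) (hatX F t' ξ) (hatX G t' (ζ - ξ))) x := by
  obtain ⟨K, hK⟩ := exists_schwartz_kernelTX (contDiff_symA (d := d) hχ hb k₀ j s₀)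
    (hasCompactSupport_symA hχ hb k₀ j s₀)
  obtain ⟨CF, gF, hgF, hgF0, hgFC, hFg⟩ := exists_hat_majorant F hF
  obtain ⟨CG, gG, hgG, hgG0, hgGC, hGg⟩ := exists_hat_majorant G hG
  have hKi : Integrable (fun q : ℝ × Sp d => K ((t, x) - q)) := K.integrable.comp_sub_left _
  have hI := integrable_interaction (W := ℝ × Sp d) (V := Sp d × Sp d) (ν := volume)
    (ρ := volume) hKi (τ := Prod.fst) measurable_fst hm F G measurable_fst measurable_snd
    (c := fun z => gF z.1 * gG z.2) (hgF.mul_prod hgG)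
    (fun t v => mul_le_mul (hFg _ _) (hGg _ _) (norm_nonneg _) (hgF0 _))
  have hI' : Integrable (fun z : (ℝ × Sp d) × (Sp d × Sp d) =>
      ph (inner ℝ z.1.2 (z.2.1 + z.2.2)) • K ((t, x) - z.1) • m z.2.1 z.2.2 (hatX F z.1.1 z.2.1)
      (hatX G z.1.1 z.2.2)) (volume.prod volume) := integrable_ph_smul hI (by fun_prop)
  have e1 : multTX (symA χ b k₀ j s₀) (atEachTime (symbolOp m) F G) (t, x) =
      (((2 * Real.pi : ℝ) : ℂ)⁻¹ ^ (2 * d)) • ∫ q : ℝ × Sp d, ∫ z : Sp d × Sp d,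
        ph (inner ℝ q.2 (z.1 + z.2)) • K ((t, x) - q) • m z.1 z.2 (hatX F q.1 z.1)
      (hatX G q.1 z.2) := by
    rw [multTX, ← integral_smul]
    congr 1; ext q
    rw [atEachTime, symbolOp, smul_comm, ← hK]
    congr 1
    rw [← integral_smul]
    congr 1; ext z
    rw [smul_comm]; rfl
  rw [e1]
  congr 1
  rw [integral_integral_swap hI']
  have e2 : ∀ᵐ z : Sp d × Sp d, ∫ q : ℝ × Sp d, ph (inner ℝ q.2 (z.1 + z.2)) • K ((t, x) - q) •
      m z.1 z.2 (hatX F q.1 z.1) (hatX G q.1 z.2) = ph (inner ℝ x (z.1 + z.2)) •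
      ∫ t', kap χ b k₀ j s₀ (t - t') (z.1 + z.2) • m z.1 z.2 (hatX F t' z.1) (hatX G t' z.2) := by
    filter_upwards [hI'.prod_left_ae] with z hz
    have hz' : Integrable (fun q : ℝ × Sp d => ph (inner ℝ q.2 (z.1 + z.2)) • K ((t, x) - q) •
      m z.1 z.2 (hatX F q.1 z.1) (hatX G q.1 z.2)) (volume.prod volume) := hz
    rw [show (volume : Measure (ℝ × Sp d)) = volume.prod volume from rfl, integral_prod _ hz',
      ← integral_smul]
    congr 1; ext t'
    have : ∀ x' : Sp d, ph (inner ℝ x' (z.1 + z.2)) • K ((t, x) - (t', x')) •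
      m z.1 z.2 (hatX F t' z.1) (hatX G t' z.2) =
        (kernelTX (symA χ b k₀ j s₀) (t - t', x - x') * ph (inner ℝ x' (z.1 + z.2))) •
        m z.1 z.2 (hatX F t' z.1) (hatX G t' z.2) := by
      intro x'
      rw [smul_smul, mul_comm, hK]; rfl
    simp_rw [this]
    rw [integral_smul_const, integral_kernelTX_mul_ph hχ hb, mul_smul]
  rw [integral_congr_ae e2]
  have hJ : Integrable (fun z : Sp d × Sp d => ph (inner ℝ x (z.1 + z.2)) •
      ∫ t', kap χ b k₀ j s₀ (t - t') (z.1 + z.2) • m z.1 z.2 (hatX F t' z.1) (hatX G t' z.2))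
      (volume.prod volume) := hI'.integral_prod_right.congr e2
  have hemb := (shearE d).measurableEmbedding
  have h5 := measurePreserving_shearE.integral_comp hemb (fun z : Sp d × Sp d =>
    ph (inner ℝ x (z.1 + z.2)) •
      ∫ t', kap χ b k₀ j s₀ (t - t') (z.1 + z.2) • m z.1 z.2 (hatX F t' z.1) (hatX G t' z.2))
  have h6 := (measurePreserving_shearE.integrable_comp_emb hemb).2 hJ
  refine h5.symm.trans ?_
  refine (integral_prod _ h6).trans ?_
  rw [invX]
  congr 1; ext ζ
  rw [← integral_smul]
  congr 1; ext ξ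
  simp only [Function.comp_apply, shearE_apply, add_sub_cancel]

lemma stronglyMeasurable_bilF_prod {m : Sp d → Sp d → Bil E₁ E₂ E₀}
    (hm : BddSymbol m) (F : 𝓢(ℝ × Sp d, E₁)) (G : 𝓢(ℝ × Sp d, E₂)) :
    StronglyMeasurable (fun p : ℝ × Sp d => bilF m (hatX F p.1) (hatX G p.1) p.2) := by
  unfold bilF
  have : StronglyMeasurable (fun p : (ℝ × Sp d) × Sp d =>
      m p.2 (p.1.2 - p.2) (hatX F p.1.1 p.2) (hatX G p.1.1 (p.1.2 - p.2))) := by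
    refine stronglyMeasurable_bil ?_ ?_ ?_
    · exact hm.meas.comp_measurable (g := fun z : (ℝ × Sp d) × Sp d => (z.2, z.1.2 - z.2))
        (by fun_prop)
    · exact (continuous_hatX F).stronglyMeasurable.comp_measurable
        (g := fun z : (ℝ × Sp d) × Sp d => (z.1.1, z.2)) (by fun_prop)
    · exact (continuous_hatX G).stronglyMeasurable.comp_measurable
        (g := fun z : (ℝ × Sp d) × Sp d => (z.1.1, z.1.2 - z.2)) (by fun_prop)
  exact this.integral_prod_right

/-- Only the interactions of compatible frequencies contribute to a projected bilinear operator: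
its time slices are controlled by those of any bilinear operator whose symbol agrees with the
given one there. -/
lemma exists_eLpNorm_proj_bilinear_le (d : ℕ) (E₀ : Type*) [NormedAddCommGroup E₀]
    [NormedSpace ℂ E₀] [FiniteDimensional ℂ E₀] :
    ∃ C : ℝ≥0, ∀ {χ b : ℝ → ℝ} {E₁ E₂ : Type _} [NormedAddCommGroup E₁] [NormedSpace ℂ E₁]
      [NormedAddCommGroup E₂] [NormedSpace ℂ E₂] [FiniteDimensional ℂ E₁] [FiniteDimensional ℂ E₂],
      IsDyadicBump χ → IsProfile b →
      ∀ {k₀ k₁ k₂ j : ℤ} {s₀ s₁ s₂ : ℤˣ} (F : 𝓢(ℝ × Sp d, E₁)) (G : 𝓢(ℝ × Sp d, E₂)),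
      FreqLoc k₁ j s₁ F → FreqLoc k₂ j s₂ G → ∀ {m m' : Sp d → Sp d → Bil E₁ E₂ E₀},
      BddSymbol m → BddSymbol m' →
      (∀ ξ η, Compat k₀ k₁ k₂ j s₀ s₁ s₂ ξ η → (2 : ℝ) ^ (k₂ - 2) ≤ ‖η‖ → ‖η‖ ≤ 2 ^ (k₂ + 2) →
        m ξ η = m' ξ η) → ∀ t : ℝ,
      eLpNorm (fun x => multTX (symA χ b k₀ j s₀) (atEachTime (symbolOp m) F G) (t, x)) 2 volume ≤
        C * ∫⁻ t', ENNReal.ofReal (wt b j (t - t')) *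
          eLpNorm (bilF m' (hatX F t') (hatX G t')) 2 volume := by
  obtain ⟨C, hC⟩ := exists_eLpNorm_invX_le d E₀
  refine ⟨‖((2 * Real.pi : ℝ) : ℂ)⁻¹ ^ (2 * d)‖₊ * C, ?_⟩
  intro χ b E₁ E₂ _ _ _ _ _ _ hχ hb k₀ k₁ k₂ j s₀ s₁ s₂ F G hF hG m m' hm hm' hmm t
  have := FiniteDimensional.complete ℂ E₁
  have := FiniteDimensional.complete ℂ E₂
  have := FiniteDimensional.complete ℂ E₀
  obtain ⟨CF, gF, hgF, hgF0, hgFC, hFg⟩ := exists_hat_majorant F hF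
  obtain ⟨CG, gG, hgG, hgG0, hgGC, hGg⟩ := exists_hat_majorant G hG
  set Y : Sp d → E₀ := fun ζ => ∫ t', kap χ b k₀ j s₀ (t - t') ζ •
    bilF m' (hatX F t') (hatX G t') ζ with hY
  have eY : ∀ ζ, (∫ ξ, ∫ t',
        kap χ b k₀ j s₀ (t - t') ζ • m ξ (ζ - ξ) (hatX F t' ξ) (hatX G t' (ζ - ξ))) = Y ζ := by
    intro ζ
    have h1 : ∀ ξ, ∫ t', kap χ b k₀ j s₀ (t - t') ζ • m ξ (ζ - ξ) (hatX F t' ξ) (hatX G t' (ζ - ξ))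
        = ∫ t', kap χ b k₀ j s₀ (t - t') ζ •
          m' ξ (ζ - ξ) (hatX F t' ξ) (hatX G t' (ζ - ξ)) := by
      intro ξ
      by_cases h : Compat k₀ k₁ k₂ j s₀ s₁ s₂ ξ (ζ - ξ)
      · congr 1; ext t'
        by_cases h0 : hatX G t' (ζ - ξ) = 0
        · simp [h0]
        · obtain ⟨h1, h2⟩ := hG.annulus _ _ h0
          rw [hmm _ _ h h1 h2]
      · have h2 := integral_kap_smul_eq_zero hχ hb hF hG (m ξ (ζ - ξ)) h t
        have h3 := integral_kap_smul_eq_zero hχ hb hF hG (m' ξ (ζ - ξ)) h t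
        rw [add_sub_cancel] at h2 h3
        rw [h2, h3]
    simp_rw [h1]
    have hk := (integrable_kap_time hχ hb k₀ j s₀ ζ).comp_sub_left t
    have hI := integrable_interaction (W := ℝ) (V := Sp d) (ν := volume)
      (ρ := volume) hk (τ := id) measurable_id hm' F G (a := id) (a' := fun ξ => ζ - ξ)
      measurable_id (by fun_prop)
      (c := fun ξ => gF ξ * CG) (hgF.mul_const _)
      (fun t v => mul_le_mul (hFg _ _) ((hGg _ _).trans (hgGC _)) (norm_nonneg _) (hgF0 _))
    rw [← integral_integral_swap hI]
    simp only [hY, bilF]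
    congr 1; ext t'
    exact integral_smul _ _
  have eU : (fun x => multTX (symA χ b k₀ j s₀) (atEachTime (symbolOp m) F G) (t, x)) =
      (((2 * Real.pi : ℝ) : ℂ)⁻¹ ^ (2 * d)) • invX Y := by
    ext x
    rw [multTX_symbolOp_eq_invX hχ hb F G hF hG hm]
    simp_rw [eY]; rfl
  have hmeas := stronglyMeasurable_bilF_prod hm' F G
  have hkm : Measurable (fun p : ℝ × Sp d => ENNReal.ofReal (wt b j (t - p.1)) *
      ‖bilF m' (hatX F p.1) (hatX G p.1) p.2‖ₑ) := by
    have := (continuous_wt hb j).measurable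
    exact (by fun_prop : Measurable fun p : ℝ × Sp d => ENNReal.ofReal (wt b j (t - p.1))).mul
      hmeas.enorm
  have hYb : ∀ ζ, ‖Y ζ‖ₑ ≤ ∫⁻ t', ENNReal.ofReal (wt b j (t - t')) *
      ‖bilF m' (hatX F t') (hatX G t') ζ‖ₑ := by
    intro ζ
    refine (enorm_integral_le_lintegral_enorm _).trans (lintegral_mono fun t' => ?_)
    rw [enorm_smul]
    gcongr
    rw [← ofReal_norm]
    refine ENNReal.ofReal_le_ofReal ((norm_kap_le hχ k₀ j s₀ _ ζ).trans ?_)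
    exact mul_le_of_le_one_left (wt_nonneg _ _ _) (hχ.le_one _)
  have hYi : Integrable Y := by
    obtain ⟨B, hB⟩ := hm'.bdd
    have hB0 : 0 ≤ B := (norm_nonneg _).trans (hB 0 0)
    have hbil : ∀ t' ζ, ‖bilF m' (hatX F t') (hatX G t') ζ‖ ≤ ∫ ξ, B * (gF ξ * CG) := by
      intro t' ζ
      refine norm_integral_le_of_norm_le ((hgF.mul_const _).const_mul _) ?_
      filter_upwards with ξ
      refine ((m' _ _).le_opNorm₂ _ _).trans ?_
      rw [mul_assoc]
      exact mul_le_mul (hB _ _) (mul_le_mul (hFg _ _) ((hGg _ _).trans (hgGC _)) (norm_nonneg _)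
        (hgF0 _)) (by positivity) hB0
    have hχi : Integrable (fun ζ : Sp d => χ (‖ζ‖ / 2 ^ k₀)) := by
      refine (contDiff_chi_norm hχ k₀).continuous.integrable_of_hasCompactSupport ?_
      refine HasCompactSupport.of_support_subset_isCompact
        (isCompact_closedBall (0 : Sp d) (4 * 2 ^ k₀)) fun ζ hζ => ?_
      rw [mem_closedBall_zero_iff]
      by_contra h
      refine hζ (hχ.eq_zero_of_gt ?_)
      rw [lt_div_iff₀ (by positivity)]
      exact not_le.1 h
    refine (hχi.mul_const (∫ t', wt b j (t - t') * ∫ ξ, B * (gF ξ * CG))).mono' ?_ ?_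
    · refine StronglyMeasurable.aestronglyMeasurable ?_
      refine StronglyMeasurable.integral_prod_right (f := fun ζ t' => kap χ b k₀ j s₀ (t - t') ζ •
        bilF m' (hatX F t') (hatX G t') ζ) ?_
      refine StronglyMeasurable.smul ?_ ?_
      · exact ((continuous_kap hχ hb k₀ j s₀).comp
          (by fun_prop : Continuous fun p : Sp d × ℝ => (t - p.2, p.1))).stronglyMeasurable
      · exact hmeas.comp_measurable measurable_swap
    · filter_upwards with ζ
      rw [← integral_const_mul]
      refine norm_integral_le_of_norm_le
        ((((integrable_wt hb j).comp_sub_left t).mul_const _).const_mul _) ?_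
      filter_upwards with t'
      rw [norm_smul, ← mul_assoc]
      exact mul_le_mul (norm_kap_le hχ k₀ j s₀ _ ζ) (hbil _ _) (norm_nonneg _)
        (mul_nonneg (hχ.nonneg _) (wt_nonneg _ _ _))
  rw [eU, eLpNorm_const_smul, ENNReal.coe_mul, mul_assoc]
  gcongr
  · rw [enorm_eq_nnnorm]
  refine (hC Y hYi).trans ?_
  gcongr
  calc eLpNorm Y 2 volume ≤ eLpNorm (fun ζ => ∫⁻ t', ENNReal.ofReal (wt b j (t - t')) *
      ‖bilF m' (hatX F t') (hatX G t') ζ‖ₑ) 2 volume := eLpNorm_mono_enorm (by simpa using hYb)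
    _ ≤ ∫⁻ t', eLpNorm (fun ζ => ENNReal.ofReal (wt b j (t - t')) *
      ‖bilF m' (hatX F t') (hatX G t') ζ‖ₑ) 2 volume :=
        eLpNorm_lintegral_le volume volume
          (h := fun t' ζ => ENNReal.ofReal (wt b j (t - t')) *
            ‖bilF m' (hatX F t') (hatX G t') ζ‖ₑ) hkm
    _ = _ := by
        congr 1; ext t'
        have h1 := eLpNorm_const_smul (wt b j (t - t') : ℂ)
          (bilF m' (hatX F t') (hatX G t')) 2 volume
        have h2 : ‖(wt b j (t - t') : ℂ)‖ₑ = ENNReal.ofReal (wt b j (t - t')) := by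
          rw [← ofReal_norm, Complex.norm_real, Real.norm_of_nonneg (wt_nonneg _ _ _)]
        rw [h2] at h1
        rw [← h1]
        refine eLpNorm_congr_enorm_ae (Filter.Eventually.of_forall fun ζ => ?_)
        rw [Pi.smul_apply, enorm_smul, h2]
        simp

end bilinear

end MDNull

end

noncomputable section

namespace MDNull

open scoped FourierTransform

/-! ### `L² × L^∞ → L²` bounds at a fixed time -/

section slice

variable {d : ℕ} {E₁ E₂ E₀ : Type*}
  [NormedAddCommGroup E₁] [NormedSpace ℂ E₁] [NormedAddCommGroup E₂] [NormedSpace ℂ E₂]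
  [NormedAddCommGroup E₀] [NormedSpace ℂ E₀]

/-- The bilinear operator with symbol `M` maps `L² × L^∞` to `L²` with norm at most `A`. The first
factor enters through its Fourier transform `φ`, which need not be smooth. -/
def SliceBound (M : Sp d → Sp d → Bil E₁ E₂ E₀) (A : ℝ≥0∞) : Prop :=
  ∀ φ : Sp d → E₁, StronglyMeasurable φ → Integrable φ → ∀ γ : 𝓢(Sp d, E₂),
    eLpNorm (bilF M φ (fourierX γ)) 2 volume ≤ A * (eLpNorm φ 2 volume * eLpNorm γ ∞ volume)

lemma SliceBound.mono {M : Sp d → Sp d → Bil E₁ E₂ E₀} {A A' : ℝ≥0∞} (h : SliceBound M A)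
    (hA : A ≤ A') : SliceBound M A' := fun φ h1 h2 γ =>
  (h φ h1 h2 γ).trans (by gcongr)

lemma continuous_fourierX_schwartz (γ : 𝓢(Sp d, E₂)) : Continuous (fourierX γ) :=
  continuous_fourierX γ.integrable

lemma fourierX_translate (γ : 𝓢(Sp d, E₂)) (p η : Sp d) :
    fourierX (fun x => γ (x - p)) η = ph (-inner ℝ p η) • fourierX γ η := by
  have h := integral_sub_right_eq_self (fun x => ph (-inner ℝ (x + p) η) • γ x) p (μ := volume)
  simp only [sub_add_cancel] at h
  rw [fourierX_eq_ph, fourierX_eq_ph, h, ← integral_smul]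
  congr 1; ext x
  rw [inner_add_left, neg_add, add_comm, ph_add, mul_smul]

/-- Modulating the symbol translates the second factor. -/
lemma SliceBound.modulate {M : Sp d → Sp d → Bil E₁ E₂ E₀} {A : ℝ≥0∞} (h : SliceBound M A)
    (p : Sp d) : SliceBound (fun ξ η => ph (-inner ℝ p η) • M ξ η) A := by
  intro φ h1 h2 γ
  have h3 := h φ h1 h2 (SchwartzMap.compSubConstCLM ℂ p γ)
  have e1 : eLpNorm (SchwartzMap.compSubConstCLM ℂ p γ) ∞ volume = eLpNorm γ ∞ volume :=
    eLpNorm_comp_measurePreserving (f := fun x => x - p) γ.continuous.aestronglyMeasurable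
      (measurePreserving_sub_right volume p)
  rw [e1] at h3
  refine le_trans (le_of_eq ?_) h3
  congr 1
  ext ζ
  unfold bilF
  congr 1; ext ξ
  have : fourierX (SchwartzMap.compSubConstCLM ℂ p γ) (ζ - ξ) = _ :=
    fourierX_translate γ p (ζ - ξ)
  rw [this, map_smul, smul_apply, smul_apply]

lemma stronglyMeasurable_bilF {M : Sp d → Sp d → Bil E₁ E₂ E₀}
    (hM : StronglyMeasurable fun p : Sp d × Sp d => M p.1 p.2) {φ : Sp d → E₁}
    (hφ : StronglyMeasurable φ) {ψ : Sp d → E₂} (hψ : StronglyMeasurable ψ) :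
    StronglyMeasurable (bilF M φ ψ) := by
  unfold bilF
  refine StronglyMeasurable.integral_prod_right (f := fun ζ ξ => M ξ (ζ - ξ) (φ ξ) (ψ (ζ - ξ))) ?_
  refine stronglyMeasurable_bil ?_ ?_ ?_
  · exact hM.comp_measurable (g := fun z : Sp d × Sp d => (z.2, z.1 - z.2)) (by fun_prop)
  · exact hφ.comp_measurable measurable_snd
  · exact hψ.comp_measurable (g := fun z : Sp d × Sp d => z.1 - z.2) (by fun_prop)

/-- Superpositions of bounded symbols are bounded, by Minkowski's inequality. -/
lemma SliceBound.integral {Y : Type*} [MeasurableSpace Y] {ν : Measure Y} [SFinite ν]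
    [CompleteSpace E₁] [CompleteSpace E₂] [CompleteSpace E₀]
    {N : Y → Sp d → Sp d → Bil E₁ E₂ E₀}
    (hN : StronglyMeasurable fun p : Y × Sp d × Sp d => N p.1 p.2.1 p.2.2) {κ : Y → ℝ}
    (hκ : Integrable κ ν) (hb : ∀ y ξ η, ‖N y ξ η‖ ≤ κ y) {A : Y → ℝ≥0∞} (hA : AEMeasurable A ν)
    (h : ∀ y, SliceBound (N y) (A y)) :
    SliceBound (fun ξ η => ∫ y, N y ξ η ∂ν) (∫⁻ y, A y ∂ν) := by
  intro φ h1 h2 γ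
  have hNi : ∀ ξ η, Integrable (fun y => N y ξ η) ν := fun ξ η =>
    hκ.mono' (hN.comp_measurable (g := fun y => (y, ξ, η)) (by fun_prop)).aestronglyMeasurable
      (Filter.Eventually.of_forall fun y => hb y ξ η)
  have hψ := (continuous_fourierX_schwartz γ).stronglyMeasurable
  have key : ∀ ζ, ‖bilF (fun ξ η => ∫ y, N y ξ η ∂ν) φ (fourierX γ) ζ‖ₑ ≤
      ∫⁻ y, ‖bilF (N y) φ (fourierX γ) ζ‖ₑ ∂ν := by
    intro ζ
    have e : bilF (fun ξ η => ∫ y, N y ξ η ∂ν) φ (fourierX γ) ζ =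
        ∫ y, bilF (N y) φ (fourierX γ) ζ ∂ν := by
      unfold bilF
      rw [integral_integral_swap]
      · congr 1; ext ξ
        rw [ContinuousLinearMap.integral_apply (hNi _ _),
          ContinuousLinearMap.integral_apply ((hNi _ _).apply_continuousLinearMap _)]
      · refine (((hκ.mul_prod h2.norm).mul_const (∫ x, ‖γ x‖))).mono' ?_ ?_
        · refine StronglyMeasurable.aestronglyMeasurable ?_
          refine stronglyMeasurable_bil ?_ ?_ ?_
          · exact hN.comp_measurable (g := fun z : Y × Sp d => (z.1, z.2, ζ - z.2)) (by fun_prop)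
          · exact h1.comp_measurable measurable_snd
          · exact hψ.comp_measurable (g := fun z : Y × Sp d => ζ - z.2) (by fun_prop)
        · filter_upwards with z
          refine ((N _ _ _).le_opNorm₂ _ _).trans ?_
          have h0 := (norm_nonneg _).trans (hb z.1 0 0)
          gcongr
          · exact hb _ _ _
          · exact norm_fourierX_le _ _
    rw [e]
    exact enorm_integral_le_lintegral_enorm _
  have hm : Measurable (fun p : Y × Sp d => ‖bilF (N p.1) φ (fourierX γ) p.2‖ₑ) := by
    refine StronglyMeasurable.enorm ?_
    unfold bilF
    refine StronglyMeasurable.integral_prod_right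
      (f := fun (p : Y × Sp d) ξ => N p.1 ξ (p.2 - ξ) (φ ξ) (fourierX γ (p.2 - ξ))) ?_
    refine stronglyMeasurable_bil ?_ ?_ ?_
    · exact hN.comp_measurable (g := fun z : (Y × Sp d) × Sp d => (z.1.1, z.2, z.1.2 - z.2))
        (by fun_prop)
    · exact h1.comp_measurable measurable_snd
    · exact hψ.comp_measurable (g := fun z : (Y × Sp d) × Sp d => z.1.2 - z.2) (by fun_prop)
  calc _ ≤ eLpNorm (fun ζ => ∫⁻ y, ‖bilF (N y) φ (fourierX γ) ζ‖ₑ ∂ν) 2 volume :=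
        eLpNorm_mono_enorm (by simpa using key)
    _ ≤ ∫⁻ y, eLpNorm (fun ζ => ‖bilF (N y) φ (fourierX γ) ζ‖ₑ) 2 volume ∂ν :=
        eLpNorm_lintegral_le volume ν (h := fun y ζ => ‖bilF (N y) φ (fourierX γ) ζ‖ₑ) hm
    _ ≤ ∫⁻ y, A y * (eLpNorm φ 2 volume * eLpNorm γ ∞ volume) ∂ν := by
        refine lintegral_mono fun y => ?_
        rw [eLpNorm_enorm]
        exact h y φ h1 h2 γ
    _ = _ := lintegral_mul_const'' _ hA

lemma SliceBound.sum {ι : Type*} (s : Finset ι) {N : ι → Sp d → Sp d → Bil E₁ E₂ E₀}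
    [CompleteSpace E₀]
    (hN : ∀ i, BddSymbol (N i)) {A : ι → ℝ≥0∞} (h : ∀ i, SliceBound (N i) (A i)) :
    SliceBound (fun ξ η => ∑ i ∈ s, N i ξ η) (∑ i ∈ s, A i) := by
  intro φ h1 h2 γ
  have hψ := (continuous_fourierX_schwartz γ).stronglyMeasurable
  have hi : ∀ i ζ, Integrable (fun ξ => N i ξ (ζ - ξ) (φ ξ) (fourierX γ (ζ - ξ))) := by
    intro i ζ
    obtain ⟨B, hB⟩ := (hN i).bdd
    have hB0 : 0 ≤ B := (norm_nonneg _).trans (hB 0 0)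
    refine ((h2.norm.const_mul B).mul_const (∫ x, ‖γ x‖)).mono' ?_ ?_
    · refine (stronglyMeasurable_bil ?_ h1 ?_).aestronglyMeasurable
      · exact (hN i).meas.comp_measurable (g := fun ξ => (ξ, ζ - ξ)) (by fun_prop)
      · exact hψ.comp_measurable (g := fun ξ => ζ - ξ) (by fun_prop)
    · filter_upwards with ξ
      refine ((N i _ _).le_opNorm₂ _ _).trans ?_
      gcongr
      · exact hB _ _
      · exact norm_fourierX_le _ _
  have e : bilF (fun ξ η => ∑ i ∈ s, N i ξ η) φ (fourierX γ) =
      ∑ i ∈ s, bilF (N i) φ (fourierX γ) := by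
    ext ζ
    simp only [bilF, sum_apply, Finset.sum_apply]
    exact integral_finsetSum _ fun i _ => hi i ζ
  rw [e, Finset.sum_mul]
  refine (eLpNorm_sum_le (fun i _ => ?_) (by norm_num)).trans
    (Finset.sum_le_sum fun i _ => h i φ h1 h2 γ)
  exact (stronglyMeasurable_bilF (hN i).meas h1 hψ).aestronglyMeasurable

lemma integrable_conv_fourierX (γ : 𝓢(Sp d, ℂ)) (ζ : Sp d) {φ : Sp d → E₁} (hφ : Integrable φ) :
    Integrable (fun ξ => fourierX γ (ζ - ξ) • φ ξ) := by
  refine hφ.bdd_smul (∫ x, ‖γ x‖) ?_ (Filter.Eventually.of_forall fun ξ => norm_fourierX_le _ _)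
  exact ((continuous_fourierX_schwartz γ).comp (by fun_prop)).aestronglyMeasurable

lemma stronglyMeasurable_conv_fourierX (γ : 𝓢(Sp d, ℂ)) {φ : Sp d → E₁}
    (hφ : StronglyMeasurable φ) :
    StronglyMeasurable (fun ζ => ∫ ξ, fourierX γ (ζ - ξ) • φ ξ) := by
  refine StronglyMeasurable.integral_prod_right (f := fun ζ ξ => fourierX γ (ζ - ξ) • φ ξ) ?_
  refine StronglyMeasurable.smul ?_ (hφ.comp_measurable measurable_snd)
  exact ((continuous_fourierX_schwartz γ).comp
    (by fun_prop : Continuous fun p : Sp d × Sp d => p.1 - p.2)).stronglyMeasurable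

/-- Symbols depending on `ξ` or on `ξ + η` only are bounded by their supremum. -/
lemma exists_sliceBound_one (d : ℕ) (E₁ E₂ E₀ : Type*)
    [NormedAddCommGroup E₁] [NormedSpace ℂ E₁] [NormedAddCommGroup E₂] [NormedSpace ℂ E₂]
    [NormedAddCommGroup E₀] [NormedSpace ℂ E₀] [FiniteDimensional ℂ E₁] [FiniteDimensional ℂ E₂]
    [FiniteDimensional ℂ E₀] :
    ∃ C : ℝ≥0, ∀ (k : Sp d → Bil E₁ E₂ E₀) (κ : ℝ≥0), StronglyMeasurable k → (∀ ξ, ‖k ξ‖₊ ≤ κ) →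
      SliceBound (fun ξ _ => k ξ) (C * κ) ∧ SliceBound (fun ξ η => k (ξ + η)) (C * κ) := by
  obtain ⟨C₀, hC₀⟩ := exists_eLpNorm_conv_fourierX_le d E₀
  obtain ⟨C₁, hC₁⟩ := exists_eLpNorm_conv_fourierX_le d E₁
  have := FiniteDimensional.complete ℂ E₁
  have := FiniteDimensional.complete ℂ E₂
  have := FiniteDimensional.complete ℂ E₀
  let e := Module.finBasis ℂ E₂
  let c : ∀ i, E₂ →L[ℂ] ℂ := fun i => LinearMap.toContinuousLinearMap (e.coord i)
  have hc : ∀ v, v = ∑ i, c i v • e i := fun v => (e.sum_repr v).symm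
  let S : ℝ≥0 := ∑ i, ‖e i‖₊ * ‖c i‖₊
  have hγ : ∀ (γ : 𝓢(Sp d, E₂)) i, eLpNorm (γ.postcompCLM (c i)) ∞ volume ≤
      ‖c i‖₊ * eLpNorm γ ∞ volume := by
    intro γ i
    refine eLpNorm_le_nnreal_smul_eLpNorm_of_ae_le_mul ?_ _
    filter_upwards with x
    exact (c i).le_opNNNorm _
  have hγ' : ∀ (γ : 𝓢(Sp d, E₂)) i η, fourierX (γ.postcompCLM (c i)) η = c i (fourierX γ η) := by
    intro γ i η
    rw [fourierX_eq_ph, fourierX_eq_ph,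
      ← (c i).integral_comp_comm (integrable_ph_smul γ.integrable (by fun_prop))]
    simp
  refine ⟨(C₀ + C₁) * S, fun k κ hk hκ => ⟨?_, ?_⟩⟩
  · intro φ h1 h2 γ
    have hφi : ∀ i, StronglyMeasurable (fun ξ => k ξ (φ ξ) (e i)) := fun i =>
      stronglyMeasurable_bil hk h1 stronglyMeasurable_const
    have hφn : ∀ i ξ, ‖k ξ (φ ξ) (e i)‖₊ ≤ κ * ‖e i‖₊ * ‖φ ξ‖₊ := by
      intro i ξ
      refine ((k ξ).le_opNorm₂ (φ ξ) (e i)).trans ?_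
      rw [mul_right_comm]
      exact mul_le_mul_of_nonneg_right (mul_le_mul_of_nonneg_right (hκ ξ) (norm_nonneg _))
        (norm_nonneg _)
    have hφint : ∀ i, Integrable (fun ξ => k ξ (φ ξ) (e i)) := fun i =>
      (h2.norm.const_mul (κ * ‖e i‖₊ : ℝ)).mono' (hφi i).aestronglyMeasurable
        (Filter.Eventually.of_forall (hφn i))
    have e1 : bilF (fun ξ _ => k ξ) φ (fourierX γ) =
        ∑ i, fun ζ => ∫ ξ, fourierX (γ.postcompCLM (c i)) (ζ - ξ) • k ξ (φ ξ) (e i) := by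
      ext ζ
      rw [Finset.sum_apply, ← integral_finsetSum _ fun i _ => integrable_conv_fourierX _ _ (hφint i)]
      unfold bilF
      congr 1; ext ξ
      conv_lhs => rw [hc (fourierX γ (ζ - ξ))]
      rw [map_sum]
      refine Finset.sum_congr rfl fun i _ => ?_
      rw [map_smul, hγ']
    rw [e1]
    refine (eLpNorm_sum_le (fun i _ => (stronglyMeasurable_conv_fourierX _ (hφi i)).aestronglyMeasurable)
      (by norm_num)).trans ?_
    calc _ ≤ ∑ i, C₀ * ((κ * ‖e i‖₊ : ℝ≥0) * eLpNorm φ 2 volume *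
            (‖c i‖₊ * eLpNorm γ ∞ volume)) := by
          refine Finset.sum_le_sum fun i _ => (hC₀ _ _ (hφint i)).trans ?_
          gcongr
          · refine eLpNorm_le_nnreal_smul_eLpNorm_of_ae_le_mul ?_ _
            filter_upwards with ξ using hφn i ξ
          · exact hγ γ i
      _ = C₀ * S * κ * (eLpNorm φ 2 volume * eLpNorm γ ∞ volume) := by
          simp only [S]
          push_cast
          rw [Finset.mul_sum, Finset.sum_mul, Finset.sum_mul]
          refine Finset.sum_congr rfl fun i _ => ?_
          ring
      _ ≤ _ := by
          push_cast
          gcongr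
          exact le_self_add
  · intro φ h1 h2 γ
    set cv : ∀ i, Sp d → E₁ := fun i ζ => ∫ ξ, fourierX (γ.postcompCLM (c i)) (ζ - ξ) • φ ξ
    have e1 : bilF (fun ξ η => k (ξ + η)) φ (fourierX γ) =
        ∑ i, fun ζ => k ζ (cv i ζ) (e i) := by
      ext ζ
      unfold bilF
      simp only [add_sub_cancel]
      have e2 : ∀ ξ, k ζ (φ ξ) (fourierX γ (ζ - ξ)) = ∑ i, ((k ζ).flip (e i))
          (fourierX (γ.postcompCLM (c i)) (ζ - ξ) • φ ξ) := by
        intro ξ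
        conv_lhs => rw [hc (fourierX γ (ζ - ξ))]
        rw [map_sum]
        refine Finset.sum_congr rfl fun i _ => ?_
        rw [map_smul, hγ', map_smul]; rfl
      simp_rw [e2]
      rw [integral_finsetSum _ fun i _ =>
        ((k ζ).flip (e i)).integrable_comp (integrable_conv_fourierX _ _ h2), Finset.sum_apply]
      refine Finset.sum_congr rfl fun i _ => ?_
      rw [((k ζ).flip (e i)).integral_comp_comm (integrable_conv_fourierX _ _ h2)]; rfl
    rw [e1]
    refine (eLpNorm_sum_le (fun i _ => (stronglyMeasurable_bil hk (stronglyMeasurable_conv_fourierX _ h1)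
      stronglyMeasurable_const).aestronglyMeasurable) (by norm_num)).trans ?_
    calc _ ≤ ∑ i, (κ * ‖e i‖₊ : ℝ≥0) * (C₁ * (eLpNorm φ 2 volume *
            (‖c i‖₊ * eLpNorm γ ∞ volume))) := by
          refine Finset.sum_le_sum fun i _ => ?_
          refine (eLpNorm_le_nnreal_smul_eLpNorm_of_ae_le_mul (g := cv i) (c := κ * ‖e i‖₊)
            ?_ _).trans ?_
          · filter_upwards with ζ
            refine ((k ζ).le_opNorm₂ (cv i ζ) (e i)).trans ?_
            rw [mul_right_comm]
            exact mul_le_mul_of_nonneg_right (mul_le_mul_of_nonneg_right (hκ ζ) (norm_nonneg _))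
              (norm_nonneg _)
          · rw [ENNReal.smul_def, smul_eq_mul]
            gcongr
            refine (hC₁ _ _ h2).trans ?_
            gcongr
            exact hγ γ i
      _ = C₁ * S * κ * (eLpNorm φ 2 volume * eLpNorm γ ∞ volume) := by
          simp only [S]
          push_cast
          rw [Finset.mul_sum, Finset.sum_mul, Finset.sum_mul]
          refine Finset.sum_congr rfl fun i _ => ?_
          ring
      _ ≤ _ := by
          push_cast
          gcongr
          exact le_add_self

end slice

end MDNull

end

noncomputable section

namespace MDNull

open scoped FourierTransform

/-! ### Summation over the boxes -/

section boxes

lemma eLpNorm_two_sq {X ε : Type*} [MeasurableSpace X] [ENorm ε] (μ : Measure X) (f : X → ε) :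
    eLpNorm f 2 μ ^ 2 = ∫⁻ x, ‖f x‖ₑ ^ 2 ∂μ := by
  rw [eLpNorm_eq_lintegral_rpow_enorm_toReal (by norm_num) (by norm_num), ← ENNReal.rpow_natCast,
    ← ENNReal.rpow_mul]
  norm_num

lemma ENNReal_sq_rpow_half (a : ℝ≥0∞) : (a ^ (1 / 2 : ℝ)) ^ 2 = a := by
  rw [← ENNReal.rpow_natCast, ← ENNReal.rpow_mul]; norm_num

lemma ENNReal_sum_mul_sq_le {ι : Type*} (s : Finset ι) (f g : ι → ℝ≥0∞) :
    (∑ i ∈ s, f i * g i) ^ 2 ≤ (∑ i ∈ s, f i ^ 2) * ∑ i ∈ s, g i ^ 2 := by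
  have h := ENNReal.inner_le_Lp_mul_Lq s f g (p := 2) (q := 2) (by constructor <;> norm_num)
  calc _ ≤ _ := pow_le_pow_left' h 2
    _ = _ := by
      rw [mul_pow, ENNReal_sq_rpow_half, ENNReal_sq_rpow_half]
      simp

lemma ENNReal_pow_two_le_iff {a b : ℝ≥0∞} : a ^ 2 ≤ b ^ 2 ↔ a ≤ b :=
  ENNReal.pow_le_pow_left_iff (by norm_num)

variable {d : ℕ} {E₁ E₂ E₀ : Type*}
  [NormedAddCommGroup E₁] [NormedSpace ℂ E₁] [NormedAddCommGroup E₂] [NormedSpace ℂ E₂]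
  [NormedAddCommGroup E₀] [NormedSpace ℂ E₀]

/-- The input frequencies `ξ` that interact with a frequency in the support of the cutoff `a`. -/
def inSet (k₀ k₁ k₂ j : ℤ) (s₀ s₁ s₂ : ℤˣ) (a : Sp d → ℝ) : Set (Sp d) :=
  {ξ | ∃ η, a η ≠ 0 ∧ Compat k₀ k₁ k₂ j s₀ s₁ s₂ ξ η}

/-- The output frequencies `ξ + η` of the interactions with a frequency `η` in the support of the
cutoff `a`. -/
def outSet (k₀ k₁ k₂ j : ℤ) (s₀ s₁ s₂ : ℤˣ) (a : Sp d → ℝ) : Set (Sp d) :=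
  {ζ | ∃ η, a η ≠ 0 ∧ Compat k₀ k₁ k₂ j s₀ s₁ s₂ (ζ - η) η}

lemma isOpen_compat (k₀ k₁ k₂ j : ℤ) (s₀ s₁ s₂ : ℤˣ) (η : Sp d) :
    IsOpen {ξ | Compat k₀ k₁ k₂ j s₀ s₁ s₂ ξ η} := by
  have h : {ξ | Compat k₀ k₁ k₂ j s₀ s₁ s₂ ξ η} = {ξ | (2 : ℝ) ^ (k₁ - 3) < ‖ξ‖} ∩
      ({ξ | ‖ξ‖ < 2 ^ (k₁ + 3)} ∩ ({_ξ | (2 : ℝ) ^ (k₂ - 3) < ‖η‖} ∩ ({_ξ | ‖η‖ < 2 ^ (k₂ + 3)} ∩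
      ({ξ | (2 : ℝ) ^ (k₀ - 3) < ‖ξ + η‖} ∩ ({ξ | ‖ξ + η‖ < 2 ^ (k₀ + 3)} ∩
      {ξ | |sgnR s₀ * ‖ξ + η‖ - sgnR s₁ * ‖ξ‖ - sgnR s₂ * ‖η‖| < 2 ^ (j + 4)}))))) := by
    ext ξ
    exact ⟨fun h => ⟨h.1, h.2, h.3, h.4, h.5, h.6, h.7⟩,
      fun ⟨h1, h2, h3, h4, h5, h6, h7⟩ => ⟨h1, h2, h3, h4, h5, h6, h7⟩⟩
  rw [h]
  refine (isOpen_lt (by fun_prop) (by fun_prop)).inter ((isOpen_lt (by fun_prop) (by fun_prop)).inter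
    (isOpen_const.inter (isOpen_const.inter ((isOpen_lt (by fun_prop) (by fun_prop)).inter
    ((isOpen_lt (by fun_prop) (by fun_prop)).inter (isOpen_lt (by fun_prop) (by fun_prop)))))))

lemma isOpen_inSet (k₀ k₁ k₂ j : ℤ) (s₀ s₁ s₂ : ℤˣ) (a : Sp d → ℝ) :
    IsOpen (inSet k₀ k₁ k₂ j s₀ s₁ s₂ a) := by
  have : inSet k₀ k₁ k₂ j s₀ s₁ s₂ a =
      ⋃ η ∈ {η | a η ≠ 0}, {ξ | Compat k₀ k₁ k₂ j s₀ s₁ s₂ ξ η} := by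
    ext ξ; simp [inSet]
  rw [this]
  exact isOpen_biUnion fun η _ => isOpen_compat _ _ _ _ _ _ _ η

lemma isOpen_outSet (k₀ k₁ k₂ j : ℤ) (s₀ s₁ s₂ : ℤˣ) (a : Sp d → ℝ) :
    IsOpen (outSet k₀ k₁ k₂ j s₀ s₁ s₂ a) := by
  have : outSet k₀ k₁ k₂ j s₀ s₁ s₂ a =
      ⋃ η ∈ {η | a η ≠ 0}, (fun ζ => ζ - η) ⁻¹' {ξ | Compat k₀ k₁ k₂ j s₀ s₁ s₂ ξ η} := by
    ext ζ; simp [outSet]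
  rw [this]
  exact isOpen_biUnion fun η _ => (isOpen_compat _ _ _ _ _ _ _ η).preimage (by fun_prop)

/-- A decomposition of the symbol `m` on the set of compatible frequencies, subordinate to a finite
family of cutoffs in the second frequency. Either each input frequency `ξ` or each output frequency
`ξ + η` meets at most `N` of the cutoffs. -/
structure BoxDecomp {ι : Type} (N : ℕ) (A : ℝ≥0∞) (k₀ k₁ k₂ j : ℤ) (s₀ s₁ s₂ : ℤˣ)
    (m : Sp d → Sp d → Bil E₁ E₂ E₀) (fin : Finset ι) (cut : ι → Sp d → ℝ)
    (Ma : ι → Sp d → Sp d → Bil E₁ E₂ E₀) : Prop where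
  smooth : ∀ a, ContDiff ℝ ∞ (cut a)
  compact : ∀ a, HasCompactSupport (cut a)
  sum_one : ∀ η : Sp d, (2 : ℝ) ^ (k₂ - 2) ≤ ‖η‖ → ‖η‖ ≤ 2 ^ (k₂ + 2) →
    ∑ a ∈ fin, cut a η = 1
  bdd : ∀ a, BddSymbol (Ma a)
  slice : ∀ a, SliceBound (Ma a) A
  agree : ∀ a, ∀ ξ η, cut a η ≠ 0 → Compat k₀ k₁ k₂ j s₀ s₁ s₂ ξ η → m ξ η = Ma a ξ η
  count : (∀ ξ, {a | a ∈ fin ∧ ξ ∈ inSet k₀ k₁ k₂ j s₀ s₁ s₂ (cut a)}.ncard ≤ N) ∨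
    (∀ ζ, {a | a ∈ fin ∧ ζ ∈ outSet k₀ k₁ k₂ j s₀ s₁ s₂ (cut a)}.ncard ≤ N)

/-- The localized symbol assembled from the pieces of a box decomposition. -/
def assembled {ι : Type} (k₀ k₁ k₂ j : ℤ) (s₀ s₁ s₂ : ℤˣ) (fin : Finset ι) (cut : ι → Sp d → ℝ)
    (Ma : ι → Sp d → Sp d → Bil E₁ E₂ E₀) (ξ η : Sp d) : Bil E₁ E₂ E₀ :=
  ∑ a ∈ fin, (outSet k₀ k₁ k₂ j s₀ s₁ s₂ (cut a)).indicator (fun _ =>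
    (inSet k₀ k₁ k₂ j s₀ s₁ s₂ (cut a)).indicator (fun _ => cut a η • Ma a ξ η) ξ) (ξ + η)

variable {ι : Type} {N : ℕ} {A : ℝ≥0∞} {k₀ k₁ k₂ j : ℤ} {s₀ s₁ s₂ : ℤˣ}
  {m : Sp d → Sp d → Bil E₁ E₂ E₀} {fin : Finset ι} {cut : ι → Sp d → ℝ}
  {Ma : ι → Sp d → Sp d → Bil E₁ E₂ E₀}

lemma BoxDecomp.bddSymbol_assembled (h : BoxDecomp N A k₀ k₁ k₂ j s₀ s₁ s₂ m fin cut Ma) :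
    BddSymbol (assembled k₀ k₁ k₂ j s₀ s₁ s₂ fin cut Ma) := by
  constructor
  · unfold assembled
    refine Finset.stronglyMeasurable_fun_sum _ fun a _ => ?_
    have h0 : StronglyMeasurable (fun p : Sp d × Sp d => cut a p.2 • Ma a p.1 p.2) :=
      ((h.smooth a).continuous.comp continuous_snd).stronglyMeasurable.smul (h.bdd a).meas
    have h1 := h0.indicator
      ((isOpen_inSet k₀ k₁ k₂ j s₀ s₁ s₂ (cut a)).preimage continuous_fst).measurableSet
    exact h1.indicator ((isOpen_outSet k₀ k₁ k₂ j s₀ s₁ s₂ (cut a)).preimage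
      (continuous_fst.add continuous_snd)).measurableSet
  · choose B hB using fun a => (h.bdd a).bdd
    have : ∀ a, ∃ c, ∀ η, ‖cut a η‖ ≤ c := fun a => by
      obtain ⟨x₀, hx⟩ := (h.smooth a).continuous.norm.exists_forall_ge_of_hasCompactSupport
        (h.compact a).norm
      exact ⟨_, hx⟩
    choose c hc using this
    refine ⟨∑ a ∈ fin, c a * B a, fun ξ η => ?_⟩
    refine (norm_sum_le _ _).trans (Finset.sum_le_sum fun a _ => ?_)
    refine (norm_indicator_le_norm_self _ _).trans ((norm_indicator_le_norm_self _ _).trans ?_)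
    rw [norm_smul]
    exact mul_le_mul (hc a η) (hB a ξ η) (norm_nonneg _) ((norm_nonneg _).trans (hc a η))

lemma BoxDecomp.eq_assembled (h : BoxDecomp N A k₀ k₁ k₂ j s₀ s₁ s₂ m fin cut Ma) {ξ η : Sp d}
    (hc : Compat k₀ k₁ k₂ j s₀ s₁ s₂ ξ η) (h1 : (2 : ℝ) ^ (k₂ - 2) ≤ ‖η‖)
    (h2 : ‖η‖ ≤ 2 ^ (k₂ + 2)) : m ξ η = assembled k₀ k₁ k₂ j s₀ s₁ s₂ fin cut Ma ξ η := by
  have e : ∀ a ∈ fin, (outSet k₀ k₁ k₂ j s₀ s₁ s₂ (cut a)).indicator (fun _ =>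
      (inSet k₀ k₁ k₂ j s₀ s₁ s₂ (cut a)).indicator (fun _ => cut a η • Ma a ξ η) ξ) (ξ + η) =
      cut a η • m ξ η := by
    intro a _
    by_cases h3 : cut a η = 0
    · simp [h3]
    · have hout : ξ + η ∈ outSet k₀ k₁ k₂ j s₀ s₁ s₂ (cut a) :=
        ⟨η, h3, by rwa [add_sub_cancel_right]⟩
      have hin : ξ ∈ inSet k₀ k₁ k₂ j s₀ s₁ s₂ (cut a) := ⟨η, h3, hc⟩
      rw [indicator_of_mem hout, indicator_of_mem hin, h.agree a ξ η h3 hc]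
  rw [assembled, Finset.sum_congr rfl e, ← Finset.sum_smul, h.sum_one η h1 h2, one_smul]

lemma sum_indicator_enorm_sq_le {V : Type*} [NormedAddCommGroup V] {s : Finset ι}
    {S : ι → Set (Sp d)} {x : Sp d} (hN : {a | a ∈ s ∧ x ∈ S a}.ncard ≤ N) (v : V) :
    ∑ a ∈ s, ‖(S a).indicator (fun _ => v) x‖ₑ ^ 2 ≤ N * ‖v‖ₑ ^ 2 := by
  classical
  have h1 : ∀ a ∈ s, ‖(S a).indicator (fun _ => v) x‖ₑ ^ 2 =
      if x ∈ S a then ‖v‖ₑ ^ 2 else 0 := by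
    intro a _
    by_cases h : x ∈ S a <;> simp [h]
  rw [Finset.sum_congr rfl h1, ← Finset.sum_filter, Finset.sum_const, nsmul_eq_mul]
  gcongr
  have : {a | a ∈ s ∧ x ∈ S a} = ((s.filter fun a => x ∈ S a : Finset ι) : Set ι) := by
    ext a; simp
  rwa [this, ncard_coe_finset] at hN

lemma enorm_sum_indicator_sq_le {V : Type*} [NormedAddCommGroup V] {s : Finset ι}
    {S : ι → Set (Sp d)} {x : Sp d} (hN : {a | a ∈ s ∧ x ∈ S a}.ncard ≤ N) (v : ι → V) :
    ‖∑ a ∈ s, (S a).indicator (fun _ => v a) x‖ₑ ^ 2 ≤ N * ∑ a ∈ s, ‖v a‖ₑ ^ 2 := by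
  classical
  have h1 : ∀ a ∈ s, ‖(S a).indicator (fun _ => v a) x‖ₑ =
      ‖(S a).indicator (fun _ => (1 : ℝ)) x‖ₑ * ‖v a‖ₑ := by
    intro a _
    by_cases h : x ∈ S a <;> simp [h]
  calc _ ≤ (∑ a ∈ s, ‖(S a).indicator (fun _ => (1 : ℝ)) x‖ₑ * ‖v a‖ₑ) ^ 2 := by
        rw [← Finset.sum_congr rfl h1]
        gcongr
        exact enorm_sum_le _ _
    _ ≤ _ := ENNReal_sum_mul_sq_le _ _ _
    _ ≤ _ := by
        gcongr
        simpa using sum_indicator_enorm_sq_le hN (1 : ℝ)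

/-- The bound of the assembled operator at a fixed time: Cauchy-Schwarz over the boxes if the
input frequencies determine the box up to `N` choices, and almost orthogonality if the output
frequencies do. -/
lemma BoxDecomp.eLpNorm_bilF_le [CompleteSpace E₂]
    (h : BoxDecomp N A k₀ k₁ k₂ j s₀ s₁ s₂ m fin cut Ma) {φ : Sp d → E₁}
    (h1 : StronglyMeasurable φ) (h2 : Integrable φ) (γ : 𝓢(Sp d, E₂)) :
    eLpNorm (bilF (assembled k₀ k₁ k₂ j s₀ s₁ s₂ fin cut Ma) φ (fourierX γ)) 2 volume ≤
      N * A * (eLpNorm φ 2 volume *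
        (∑ a ∈ fin, eLpNorm (fun x => ∫ y, kernelX (cut a) (x - y) • γ y) ∞ volume ^ 2) ^
          (1 / 2 : ℝ)) := by
  choose γ' hγ' hγf using fun a => exists_schwartz_multX (h.smooth a) (h.compact a) γ
  have eγ : ∀ a, (fun x => ∫ y, kernelX (cut a) (x - y) • γ y) = γ' a := fun a =>
    (funext (hγ' a)).symm
  simp_rw [eγ]
  set S₀ := fun a => outSet k₀ k₁ k₂ j s₀ s₁ s₂ (cut a) with hS₀
  set S₁ := fun a => inSet k₀ k₁ k₂ j s₀ s₁ s₂ (cut a) with hS₁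
  have mS₀ : ∀ a, MeasurableSet (S₀ a) := fun a => (isOpen_outSet _ _ _ _ _ _ _ _).measurableSet
  have mS₁ : ∀ a, MeasurableSet (S₁ a) := fun a => (isOpen_inSet _ _ _ _ _ _ _ _).measurableSet
  set H := fun a => bilF (Ma a) ((S₁ a).indicator φ) (fourierX (γ' a)) with hH
  have hHm : ∀ a, StronglyMeasurable (H a) := fun a =>
    stronglyMeasurable_bilF (h.bdd a).meas (h1.indicator (mS₁ a))
      (continuous_fourierX_schwartz _).stronglyMeasurable
  have hHb : ∀ a, eLpNorm (H a) 2 volume ≤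
      A * (eLpNorm ((S₁ a).indicator φ) 2 volume * eLpNorm (γ' a) ∞ volume) := fun a =>
    h.slice a _ (h1.indicator (mS₁ a)) (h2.indicator (mS₁ a)) _
  have e : ∀ ζ, bilF (assembled k₀ k₁ k₂ j s₀ s₁ s₂ fin cut Ma) φ (fourierX γ) ζ =
      ∑ a ∈ fin, (S₀ a).indicator (fun _ => H a ζ) ζ := by
    intro ζ
    have e1 : ∀ a ξ, (S₀ a).indicator (fun _ => (S₁ a).indicator
        (fun _ => cut a (ζ - ξ) • Ma a ξ (ζ - ξ)) ξ) ζ (φ ξ) (fourierX γ (ζ - ξ)) =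
        (S₀ a).indicator (fun _ => Ma a ξ (ζ - ξ) ((S₁ a).indicator φ ξ)
          (fourierX (γ' a) (ζ - ξ))) ζ := by
      intro a ξ
      by_cases ha0 : ζ ∈ S₀ a
      · by_cases ha1 : ξ ∈ S₁ a
        · simp only [ha0, ha1, indicator_of_mem, smul_apply, hγf]
          rw [ContinuousLinearMap.map_smul_of_tower]
        · simp [ha0, ha1]
      · simp [ha0]
    have hi : ∀ a, Integrable (fun ξ => (S₀ a).indicator (fun _ => Ma a ξ (ζ - ξ)
        ((S₁ a).indicator φ ξ) (fourierX (γ' a) (ζ - ξ))) ζ) := by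
      intro a
      by_cases ha0 : ζ ∈ S₀ a
      · simp only [ha0, indicator_of_mem]
        obtain ⟨B, hB⟩ := (h.bdd a).bdd
        have hB0 : 0 ≤ B := (norm_nonneg _).trans (hB 0 0)
        refine ((h2.norm.const_mul B).mul_const (∫ x, ‖γ' a x‖)).mono' ?_ ?_
        · refine (stronglyMeasurable_bil ?_ (h1.indicator (mS₁ a)) ?_).aestronglyMeasurable
          · exact (h.bdd a).meas.comp_measurable (g := fun ξ => (ξ, ζ - ξ)) (by fun_prop)
          · exact (continuous_fourierX_schwartz _).stronglyMeasurable.comp_measurable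
              (g := fun ξ => ζ - ξ) (by fun_prop)
        · filter_upwards with ξ
          refine ((Ma a _ _).le_opNorm₂ _ _).trans ?_
          gcongr
          · exact hB _ _
          · exact norm_indicator_le_norm_self _ _
          · exact norm_fourierX_le _ _
      · simp [ha0]
    unfold bilF assembled
    simp only [sum_apply, add_sub_cancel]
    have e2 : ∀ ξ, ∑ a ∈ fin, (S₀ a).indicator (fun _ => (S₁ a).indicator
        (fun _ => cut a (ζ - ξ) • Ma a ξ (ζ - ξ)) ξ) ζ (φ ξ) (fourierX γ (ζ - ξ)) =
        ∑ a ∈ fin, (S₀ a).indicator (fun _ => Ma a ξ (ζ - ξ) ((S₁ a).indicator φ ξ)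
          (fourierX (γ' a) (ζ - ξ))) ζ := fun ξ => Finset.sum_congr rfl fun a _ => e1 a ξ
    refine (integral_congr_ae (Filter.Eventually.of_forall e2)).trans ?_
    rw [integral_finsetSum _ fun a _ => hi a]
    refine Finset.sum_congr rfl fun a _ => ?_
    by_cases ha0 : ζ ∈ S₀ a
    · simp only [ha0, indicator_of_mem]; rfl
    · simp [ha0]
  have hN2 : (N : ℝ≥0∞) ≤ N ^ 2 := by
    exact_mod_cast Nat.le_self_pow (by norm_num) N
  rw [← ENNReal_pow_two_le_iff, mul_pow, mul_pow, mul_pow, ENNReal_sq_rpow_half]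
  rcases h.count with hc | hc
  -- Each `ξ` lies in at most `N` of the sets `S₁ a`: the triangle inequality, then
  -- Cauchy-Schwarz in `a`.
  · calc _ ≤ (∑ a ∈ fin, eLpNorm (H a) 2 volume) ^ 2 := by
          gcongr
          have e' : bilF (assembled k₀ k₁ k₂ j s₀ s₁ s₂ fin cut Ma) φ (fourierX γ) =
              ∑ a ∈ fin, (S₀ a).indicator (H a) := by
            ext ζ
            rw [e, Finset.sum_apply]
            rfl
          rw [e']
          exact (eLpNorm_sum_le (fun a _ => ((hHm a).indicator (mS₀ a)).aestronglyMeasurable)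
            (by norm_num)).trans (Finset.sum_le_sum fun a _ => eLpNorm_indicator_le (H a))
      _ ≤ (∑ a ∈ fin, eLpNorm ((S₁ a).indicator φ) 2 volume * (A * eLpNorm (γ' a) ∞ volume)) ^ 2 := by
          gcongr with a ha
          refine (hHb a).trans (le_of_eq (by ring))
      _ ≤ _ := ENNReal_sum_mul_sq_le _ _ _
      _ ≤ (N * eLpNorm φ 2 volume ^ 2) * (A ^ 2 * ∑ a ∈ fin, eLpNorm (γ' a) ∞ volume ^ 2) := by
          gcongr
          · simp_rw [eLpNorm_two_sq]
            rw [← lintegral_finsetSum _ fun a _ => ?_, ← lintegral_const_mul _ ?_]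
            · refine lintegral_mono fun ξ => ?_
              exact sum_indicator_enorm_sq_le (hc ξ) (φ ξ)
            · exact h1.enorm.pow_const 2
            · exact (h1.indicator (mS₁ a)).enorm.pow_const 2
          · rw [Finset.mul_sum]
            simp_rw [mul_pow]; rfl
      _ ≤ (N ^ 2 * eLpNorm φ 2 volume ^ 2) *
            (A ^ 2 * ∑ a ∈ fin, eLpNorm (γ' a) ∞ volume ^ 2) := by gcongr
      _ = _ := by ring
  -- Each `ζ` lies in at most `N` of the sets `S₀ a`: the outputs of the pieces are almost
  -- orthogonal.
  · calc _ = ∫⁻ ζ, ‖∑ a ∈ fin, (S₀ a).indicator (fun _ => H a ζ) ζ‖ₑ ^ 2 := by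
          rw [eLpNorm_two_sq]; simp_rw [e]
      _ ≤ ∫⁻ ζ, N * ∑ a ∈ fin, ‖H a ζ‖ₑ ^ 2 := lintegral_mono fun ζ =>
          enorm_sum_indicator_sq_le (hc ζ) _
      _ = N * ∑ a ∈ fin, eLpNorm (H a) 2 volume ^ 2 := by
          rw [lintegral_const_mul _ (Finset.measurable_sum _ fun a _ => (hHm a).enorm.pow_const 2),
            lintegral_finsetSum _ fun a _ => (hHm a).enorm.pow_const 2]
          simp_rw [eLpNorm_two_sq]
      _ ≤ N ^ 2 * ∑ a ∈ fin, A ^ 2 * (eLpNorm φ 2 volume ^ 2 * eLpNorm (γ' a) ∞ volume ^ 2) := by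
          gcongr with a ha
          rw [← mul_pow, ← mul_pow]
          gcongr
          refine (hHb a).trans ?_
          gcongr
          exact eLpNorm_indicator_le φ
      _ = _ := by
          rw [← Finset.mul_sum, ← Finset.mul_sum]; ring

end boxes

end MDNull

end

noncomputable section

namespace MDNull

open scoped FourierTransform

/-! ### Integration in time -/

section time

variable {d : ℕ} {χ b b₀ b₁ : ℝ → ℝ} {E E₁ E₂ E₀ : Type*} [NormedAddCommGroup E] [NormedSpace ℂ E]
  [NormedAddCommGroup E₁] [NormedSpace ℂ E₁] [NormedAddCommGroup E₂] [NormedSpace ℂ E₂]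
  [NormedAddCommGroup E₀] [NormedSpace ℂ E₀]

lemma eLpNorm_top_eq_iSup_denseSeq {E : Type*} [NormedAddCommGroup E] {f : Sp d → E} (hf : Continuous f) :
    eLpNorm f ∞ volume = ⨆ n, ‖f (TopologicalSpace.denseSeq (Sp d) n)‖ₑ := by
  rw [eLpNorm_exponent_top]
  apply le_antisymm
  · refine eLpNormEssSup_le_of_ae_enorm_bound (Filter.Eventually.of_forall fun x => ?_)
    have hcl : IsClosed {x | ‖f x‖ₑ ≤ ⨆ n, ‖f (TopologicalSpace.denseSeq (Sp d) n)‖ₑ} :=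
      isClosed_le hf.enorm continuous_const
    have hd := (TopologicalSpace.denseRange_denseSeq (Sp d)).closure_range
    have : closure (range (TopologicalSpace.denseSeq (Sp d))) ⊆
        {x | ‖f x‖ₑ ≤ ⨆ n, ‖f (TopologicalSpace.denseSeq (Sp d) n)‖ₑ} :=
      closure_minimal (by
        rintro _ ⟨n, rfl⟩
        exact le_iSup (fun n => ‖f (TopologicalSpace.denseSeq (Sp d) n)‖ₑ) n) hcl
    exact this (hd ▸ mem_univ x)
  · refine iSup_le fun n => ?_
    have hcl : IsClosed {x | ‖f x‖ₑ ≤ eLpNormEssSup f volume} :=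
      isClosed_le hf.enorm continuous_const
    have hd : Dense {x | ‖f x‖ₑ ≤ eLpNormEssSup f volume} :=
      Measure.dense_of_ae (μ := volume) (enorm_ae_le_eLpNormEssSup f volume)
    have : {x | ‖f x‖ₑ ≤ eLpNormEssSup f volume} = univ := by
      rw [← hcl.closure_eq, hd.closure_eq]
    exact this.symm.subset (mem_univ (TopologicalSpace.denseSeq (Sp d) n))

lemma measurable_eLpNorm_top_slice {E : Type*} [NormedAddCommGroup E] {H : ℝ × Sp d → E} (hH : Continuous H) :
    Measurable (fun t => eLpNorm (fun x => H (t, x)) ∞ volume) := by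
  have : ∀ t, eLpNorm (fun x => H (t, x)) ∞ volume =
      ⨆ n, ‖H (t, TopologicalSpace.denseSeq (Sp d) n)‖ₑ := fun t =>
    eLpNorm_top_eq_iSup_denseSeq (f := fun x => H (t, x)) (by fun_prop)
  simp_rw [this]
  refine Measurable.iSup fun n => ?_
  exact (hH.comp (by fun_prop : Continuous fun t : ℝ =>
    (t, TopologicalSpace.denseSeq (Sp d) n))).enorm.measurable

lemma measurable_eLpNorm_two_slice {E : Type*} [NormedAddCommGroup E] {H : ℝ × Sp d → E} (hH : Continuous H) :
    Measurable (fun t => eLpNorm (fun x => H (t, x)) 2 volume) := by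
  have : ∀ t, eLpNorm (fun x => H (t, x)) 2 volume = (∫⁻ x, ‖H (t, x)‖ₑ ^ 2) ^ (1 / 2 : ℝ) := by
    intro t
    rw [← eLpNorm_two_sq, ← ENNReal.rpow_natCast, ← ENNReal.rpow_mul]
    norm_num
  simp_rw [this]
  exact (Measurable.lintegral_prod_right' (hH.enorm.measurable.pow_const 2)).pow_const _

lemma continuous_multX [CompleteSpace E] {a : Sp d → ℝ} (ha : ContDiff ℝ ∞ a)
    (hac : HasCompactSupport a) (G : 𝓢(ℝ × Sp d, E)) : Continuous (multX a G) := by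
  have hK : Integrable (kernelX a) := by
    obtain ⟨K, hK, -⟩ := exists_schwartz_kernelX ha hac
    rw [← funext hK]
    exact K.integrable
  have e : ∀ p : ℝ × Sp d, multX a G p = ∫ y, kernelX a y • G (p.1, p.2 - y) := by
    intro p
    have h := integral_sub_left_eq_self (fun y => kernelX a y • G (p.1, p.2 - y)) volume p.2
    simp only [sub_sub_cancel] at h
    rw [multX, h]
  obtain ⟨C, hC⟩ : ∃ C, ∀ p, ‖G p‖ ≤ C := ⟨_, fun p => G.norm_le_seminorm ℝ p⟩
  rw [funext e]
  refine continuous_of_dominated (bound := fun y => ‖kernelX a y‖ * C) ?_ ?_ (hK.norm.mul_const C) ?_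
  · intro p
    exact hK.aestronglyMeasurable.smul (G.continuous.comp (by fun_prop)).aestronglyMeasurable
  · intro p; filter_upwards with y
    rw [norm_smul]
    gcongr
    exact hC _
  · filter_upwards with y
    exact (G.continuous.comp (by fun_prop)).const_smul _

/-- Young's inequality for the majorant `wt`, in `L²` and in `L¹`. -/
lemma eLpNorm_conv_wt_le (hb : IsProfile b) (j : ℤ) {Φ : ℝ → ℝ≥0∞} (hΦ : Measurable Φ) :
    eLpNorm (fun t => ∫⁻ t', ENNReal.ofReal (wt b j (t - t')) * Φ t') 2 volume ≤
        (∫⁻ t, ENNReal.ofReal (wt b 0 t)) * eLpNorm Φ 2 volume ∧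
      eLpNorm (fun t => ∫⁻ t', ENNReal.ofReal (wt b j (t - t')) * Φ t') 1 volume ≤
        (∫⁻ t, ENNReal.ofReal (wt b 0 t)) * eLpNorm Φ 1 volume := by
  have hw := (continuous_wt hb j).measurable
  constructor
  · have e : ∀ t, ∫⁻ t', ENNReal.ofReal (wt b j (t - t')) * Φ t' =
        ∫⁻ u, ENNReal.ofReal (wt b j u) * Φ (t - u) := by
      intro t
      have := lintegral_sub_left_eq_self (fun u => ENNReal.ofReal (wt b j u) * Φ (t - u)) t
        (μ := volume)
      simpa using this
    simp_rw [e]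
    refine (eLpNorm_lintegral_le volume volume
      (h := fun u t => ENNReal.ofReal (wt b j u) * Φ (t - u)) (by fun_prop)).trans ?_
    rw [← lintegral_wt b hb j, ← lintegral_mul_const _ (by fun_prop)]
    refine lintegral_mono fun u => ?_
    rw [← ENNReal_pow_two_le_iff, eLpNorm_two_sq, mul_pow, eLpNorm_two_sq,
      ← lintegral_const_mul _ (by fun_prop),
      ← lintegral_sub_right_eq_self (fun t => ENNReal.ofReal (wt b j u) ^ 2 * ‖Φ t‖ₑ ^ 2) u]
    simp [mul_pow]
  · rw [eLpNorm_one_eq_lintegral_enorm, eLpNorm_one_eq_lintegral_enorm]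
    simp only [enorm_eq_self]
    rw [lintegral_lintegral_swap (by fun_prop)]
    have e : ∀ t', ∫⁻ t, ENNReal.ofReal (wt b j (t - t')) * Φ t' =
        (∫⁻ t, ENNReal.ofReal (wt b 0 t)) * Φ t' := by
      intro t'
      rw [lintegral_mul_const _ (by fun_prop), ← lintegral_wt b hb j,
        lintegral_sub_right_eq_self (fun t => ENNReal.ofReal (wt b j t)) t']
    simp_rw [e]
    rw [lintegral_const_mul _ hΦ]

lemma exists_eLpNorm_hatX_le (d : ℕ) (E : Type*) [NormedAddCommGroup E] [NormedSpace ℂ E]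
    [FiniteDimensional ℂ E] : ∃ C : ℝ≥0, ∀ f : 𝓢(Sp d, E),
      eLpNorm (fourierX f) 2 volume ≤ C * eLpNorm f 2 volume := by
  obtain ⟨C, hC⟩ := exists_eLpNorm_invX_le d E
  exact ⟨C, fun f => (eLpNorm_fourierX_eq_invX _ _).trans_le (hC f f.integrable)⟩

/-- Modulation projections are bounded on `L^∞ L²` functions localized in frequency. -/
lemma exists_eLpNorm_hatX_proj_le (d : ℕ) (E : Type*) [NormedAddCommGroup E] [NormedSpace ℂ E]
    [FiniteDimensional ℂ E] : ∃ C : ℝ≥0, ∀ {χ b : ℝ → ℝ}, IsDyadicBump χ → IsProfile b →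
      ∀ (k j : ℤ) (s : ℤˣ) (f : 𝓢(ℝ × Sp d, E)) (t : ℝ),
      eLpNorm (hatX (multTX (symA χ b k j s) f) t) 2 volume ≤
        C * (∫⁻ t, ENNReal.ofReal (wt b 0 t)) * mixedNorm ∞ 2 (projP χ k f) := by
  obtain ⟨C, hC⟩ := exists_eLpNorm_hatX_le d E
  have := FiniteDimensional.complete ℂ E
  refine ⟨C, fun {χ b} hχ hb k j s f t => ?_⟩
  have hw := (continuous_wt hb j).measurable
  have hχc : ContDiff ℝ ∞ (fun ξ : Sp d => χ (‖ξ‖ / 2 ^ k)) := contDiff_chi_norm hχ k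
  have hχs : HasCompactSupport (fun ξ : Sp d => χ (‖ξ‖ / 2 ^ k)) := by
    refine HasCompactSupport.of_support_subset_isCompact
      (isCompact_closedBall (0 : Sp d) (4 * 2 ^ k)) fun ζ hζ => ?_
    rw [mem_closedBall_zero_iff]
    by_contra h
    refine hζ (hχ.eq_zero_of_gt ?_)
    rw [lt_div_iff₀ (by positivity)]
    exact not_le.1 h
  have hmeas : Measurable (fun p : ℝ × Sp d => ENNReal.ofReal (wt b j (t - p.1)) *
      ‖χ (‖p.2‖ / 2 ^ k) • hatX f p.1 p.2‖ₑ) := by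
    refine Measurable.mul (f := fun p : ℝ × Sp d => ENNReal.ofReal (wt b j (t - p.1)))
      (by fun_prop) ?_
    exact ((hχc.continuous.comp continuous_snd).smul (continuous_hatX f)).enorm.measurable
  calc eLpNorm (hatX (multTX (symA χ b k j s) f) t) 2 volume
      ≤ eLpNorm (fun ξ => ∫⁻ t', ENNReal.ofReal (wt b j (t - t')) *
          ‖χ (‖ξ‖ / 2 ^ k) • hatX f t' ξ‖ₑ) 2 volume := by
        refine eLpNorm_mono_enorm fun ξ => ?_
        rw [hatX_multTX hχ hb, enorm_eq_self]
        refine (enorm_integral_le_lintegral_enorm _).trans (lintegral_mono fun t' => ?_)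
        rw [enorm_smul, enorm_smul, ← mul_assoc]
        gcongr
        rw [← ofReal_norm, ← ofReal_norm, ← ENNReal.ofReal_mul (wt_nonneg _ _ _),
          Real.norm_of_nonneg (hχ.nonneg _), mul_comm]
        exact ENNReal.ofReal_le_ofReal (norm_kap_le hχ k j s _ ξ)
    _ ≤ ∫⁻ t', eLpNorm (fun ξ => ENNReal.ofReal (wt b j (t - t')) *
          ‖χ (‖ξ‖ / 2 ^ k) • hatX f t' ξ‖ₑ) 2 volume :=
        eLpNorm_lintegral_le volume volume (h := fun t' ξ => ENNReal.ofReal (wt b j (t - t')) *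
          ‖χ (‖ξ‖ / 2 ^ k) • hatX f t' ξ‖ₑ) hmeas
    _ ≤ ∫⁻ t', ENNReal.ofReal (wt b j (t - t')) * (C * mixedNorm ∞ 2 (projP χ k f)) := by
        have hae := enorm_ae_le_eLpNormEssSup
          (fun t : ℝ => eLpNorm (fun x : Sp d => projP χ k f (t, x)) 2 volume) volume
        refine lintegral_mono_ae ?_
        filter_upwards [hae] with t' ht'
        obtain ⟨g, hg, hgf⟩ := exists_schwartz_multX hχc hχs (sliceS t' f)
        have e1 : eLpNorm (fun ξ => ENNReal.ofReal (wt b j (t - t')) *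
            ‖χ (‖ξ‖ / 2 ^ k) • hatX f t' ξ‖ₑ) 2 volume ≤
            ENNReal.ofReal (wt b j (t - t')) * eLpNorm (fourierX g) 2 volume := by
          rw [← ENNReal_pow_two_le_iff, eLpNorm_two_sq, mul_pow, eLpNorm_two_sq,
            ← lintegral_const_mul _ ((continuous_fourierX_schwartz g).enorm.measurable.pow_const 2)]
          refine lintegral_mono fun ξ => le_of_eq ?_
          rw [hgf, enorm_eq_self, mul_pow]; rfl
        refine e1.trans ?_
        gcongr
        refine (hC g).trans ?_
        gcongr
        have e2 : ⇑g = fun x => projP χ k f (t', x) := funext hg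
        rw [e2]
        exact ht'
    _ = _ := by
        rw [lintegral_mul_const _ (by fun_prop), ← lintegral_wt b hb j,
          lintegral_sub_left_eq_self (fun t => ENNReal.ofReal (wt b j t)) t]
        ring

/-- The estimates for a bilinear operator whose symbol has a box decomposition. -/
lemma exists_estimate_of_boxDecomp (d : ℕ) (E₁ E₂ E₀ : Type*)
    [NormedAddCommGroup E₁] [NormedSpace ℂ E₁] [NormedAddCommGroup E₂] [NormedSpace ℂ E₂]
    [NormedAddCommGroup E₀] [NormedSpace ℂ E₀] [FiniteDimensional ℂ E₁] [FiniteDimensional ℂ E₂]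
    [FiniteDimensional ℂ E₀] {χ : ℝ → ℝ} (hχ : IsDyadicBump χ) :
    ∃ C : ℝ≥0, ∀ {b₀ b₁ b₂ : ℝ → ℝ}, (b₀ = χ ∨ b₀ = lowBump χ) → (b₁ = χ ∨ b₁ = lowBump χ) →
      (b₂ = χ ∨ b₂ = lowBump χ) → ∀ {k₀ k₁ k₂ j : ℤ} {s₀ s₁ s₂ : ℤˣ} (f : 𝓢(ℝ × Sp d, E₁))
      (g : 𝓢(ℝ × Sp d, E₂)) {ι : Type} {N : ℕ} {A : ℝ≥0∞} {m : Sp d → Sp d → Bil E₁ E₂ E₀}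
      {fin : Finset ι} {cut : ι → Sp d → ℝ} {Ma : ι → Sp d → Sp d → Bil E₁ E₂ E₀},
      BddSymbol m → BoxDecomp N A k₀ k₁ k₂ j s₀ s₁ s₂ m fin cut Ma →
      mixedNorm 2 2 (multTX (symA χ b₀ k₀ j s₀) (atEachTime (symbolOp m)
          (multTX (symA χ b₁ k₁ j s₁) f) (multTX (symA χ b₂ k₂ j s₂) g))) ≤
        C * (N * A) * mixedNorm ∞ 2 (projP χ k₁ f) * (∑ a ∈ fin, mixedNorm 2 ∞
          (multX (cut a) (multTX (symA χ b₂ k₂ j s₂) g)) ^ 2) ^ (1 / 2 : ℝ) ∧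
      mixedNorm 1 2 (multTX (symA χ b₀ k₀ j s₀) (atEachTime (symbolOp m)
          (multTX (symA χ b₁ k₁ j s₁) f) (multTX (symA χ b₂ k₂ j s₂) g))) ≤
        C * (N * A) * mixedNorm 2 2 (multTX (symA χ b₁ k₁ j s₁) f) * (∑ a ∈ fin, mixedNorm 2 ∞
          (multX (cut a) (multTX (symA χ b₂ k₂ j s₂) g)) ^ 2) ^ (1 / 2 : ℝ) := by
  have := FiniteDimensional.complete ℂ E₁
  have := FiniteDimensional.complete ℂ E₂
  have := FiniteDimensional.complete ℂ E₀
  obtain ⟨C₀, hC₀⟩ := exists_eLpNorm_proj_bilinear_le d E₀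
  obtain ⟨C₁, hC₁⟩ := exists_eLpNorm_hatX_proj_le d E₁
  obtain ⟨C₂, hC₂⟩ := exists_eLpNorm_hatX_le d E₁
  set W : ℝ≥0∞ := (∫⁻ t, ENNReal.ofReal (wt χ 0 t)) + ∫⁻ t, ENNReal.ofReal (wt (lowBump χ) 0 t)
    with hW
  have hprof : ∀ {b : ℝ → ℝ}, (b = χ ∨ b = lowBump χ) → IsProfile b := by
    rintro b (rfl | rfl)
    · exact hχ.isProfile
    · exact hχ.isProfile_lowBump
  have hWb : ∀ {b : ℝ → ℝ}, (b = χ ∨ b = lowBump χ) → ∫⁻ t, ENNReal.ofReal (wt b 0 t) ≤ W := by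
    rintro b (rfl | rfl)
    · exact le_self_add
    · exact le_add_self
  have hWt : W ≠ ⊤ := by
    refine ENNReal.add_ne_top.2 ⟨?_, ?_⟩
    · exact (integrable_wt hχ.isProfile 0).lintegral_lt_top.ne
    · exact (integrable_wt hχ.isProfile_lowBump 0).lintegral_lt_top.ne
  refine ⟨W.toNNReal * C₀ * (C₁ * W.toNNReal + C₂), ?_⟩
  intro b₀ b₁ b₂ h₀ h₁ h₂ k₀ k₁ k₂ j s₀ s₁ s₂ f g ι N A m fin cut Ma hm hD
  obtain ⟨F, hF⟩ := exists_schwartz_proj hχ (hprof h₁) k₁ j s₁ f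
  obtain ⟨G, hG⟩ := exists_schwartz_proj hχ (hprof h₂) k₂ j s₂ g
  have hFl := freqLoc_multTX hχ (hprof h₁) k₁ j s₁ f
  have hGl := freqLoc_multTX hχ (hprof h₂) k₂ j s₂ g
  have hφt := hC₁ hχ (hprof h₁) k₁ j s₁ f
  rw [← hF] at hFl ⊢
  rw [← hG] at hGl ⊢
  simp_rw [← hF] at hφt
  set φ : ℝ → ℝ≥0∞ := fun t => eLpNorm (hatX F t) 2 volume with hφ
  set B : ℝ → ℝ≥0∞ := fun t => (∑ a ∈ fin, eLpNorm (fun x => multX (cut a) G (t, x)) ∞ volume ^ 2) ^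
    (1 / 2 : ℝ) with hB
  have mφ : Measurable φ := measurable_eLpNorm_two_slice
    (H := fun p : ℝ × Sp d => hatX F p.1 p.2) (continuous_hatX F)
  have mB' : ∀ a, Measurable (fun t => eLpNorm (fun x => multX (cut a) G (t, x)) ∞ volume ^ 2) :=
    fun a => (measurable_eLpNorm_top_slice
      (continuous_multX (hD.smooth a) (hD.compact a) G)).pow_const 2
  have mB : Measurable B := (Finset.measurable_fun_sum _ fun a _ => mB' a).pow_const _
  set Φ : ℝ → ℝ≥0∞ := fun t => C₀ * (N * A * (φ t * B t)) with hΦ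
  have mΦ : Measurable Φ := by fun_prop
  have hU : ∀ t, eLpNorm (fun x => multTX (symA χ b₀ k₀ j s₀) (atEachTime (symbolOp m) F G) (t, x))
      2 volume ≤ ∫⁻ t', ENNReal.ofReal (wt b₀ j (t - t')) * Φ t' := by
    intro t
    refine (hC₀ hχ (hprof h₀) F G hFl hGl hm hD.bddSymbol_assembled
      (fun ξ η hc h1 h2 => hD.eq_assembled hc h1 h2) t).trans ?_
    have hw := (continuous_wt (hprof h₀) j).measurable
    rw [← lintegral_const_mul' _ _ ENNReal.coe_ne_top]
    refine lintegral_mono fun t' => ?_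
    change _ ≤ ENNReal.ofReal _ * (C₀ * (N * A * (φ t' * B t')))
    rw [mul_left_comm]
    gcongr
    have hFc : Continuous (hatX F t') := (continuous_hatX F).comp
      (by fun_prop : Continuous fun ξ : Sp d => (t', ξ))
    have hi : Integrable (hatX F t') := by
      obtain ⟨C, gF, hg, -, -, hgF⟩ := exists_hat_majorant F hFl
      exact hg.mono' hFc.aestronglyMeasurable (Filter.Eventually.of_forall fun ξ => hgF t' ξ)
    exact hD.eLpNorm_bilF_le hFc.stronglyMeasurable hi (sliceS t' G)
  have hB2 : eLpNorm B 2 volume =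
      (∑ a ∈ fin, mixedNorm 2 ∞ (multX (cut a) G) ^ 2) ^ (1 / 2 : ℝ) := by
    have : eLpNorm B 2 volume ^ 2 = ∑ a ∈ fin, mixedNorm 2 ∞ (multX (cut a) G) ^ 2 := by
      rw [eLpNorm_two_sq]
      simp only [hB, enorm_eq_self, ENNReal_sq_rpow_half, mixedNorm]
      rw [lintegral_finsetSum _ fun a _ => mB' a]
      simp_rw [eLpNorm_two_sq, enorm_eq_self]
    rw [← this, ← ENNReal.rpow_natCast, ← ENNReal.rpow_mul]
    norm_num
  rw [← hB2]
  have hWn : (W.toNNReal : ℝ≥0∞) = W := ENNReal.coe_toNNReal hWt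
  obtain ⟨hY2, hY1⟩ := eLpNorm_conv_wt_le (hprof h₀) j mΦ
  constructor
  · calc _ ≤ eLpNorm (fun t => ∫⁻ t', ENNReal.ofReal (wt b₀ j (t - t')) * Φ t') 2 volume :=
          eLpNorm_mono_enorm (by simpa using hU)
      _ ≤ _ := hY2
      _ ≤ W * (C₀ * (N * A * (C₁ * W * mixedNorm ∞ 2 (projP χ k₁ f))) * eLpNorm B 2 volume) := by
          gcongr
          · exact hWb h₀
          rw [← ENNReal_pow_two_le_iff, mul_pow, eLpNorm_two_sq, eLpNorm_two_sq,
            ← lintegral_const_mul _ (by fun_prop)]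
          refine lintegral_mono fun t => ?_
          rw [← mul_pow, enorm_eq_self, enorm_eq_self]
          refine pow_le_pow_left' ?_ 2
          calc Φ t = C₀ * (N * A * (φ t * B t)) := rfl
            _ ≤ C₀ * (N * A * ((C₁ * W * mixedNorm ∞ 2 (projP χ k₁ f)) * B t)) := by
                gcongr
                refine (hφt t).trans ?_
                gcongr
                exact hWb h₁
            _ = _ := by ring
      _ ≤ _ := by
          push_cast
          rw [hWn]
          calc _ = W * C₀ * (C₁ * W) * (N * A) * mixedNorm ∞ 2 (projP χ k₁ f) *
                eLpNorm B 2 volume := by ring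
            _ ≤ _ := by
                gcongr
                exact le_self_add
  · calc _ ≤ eLpNorm (fun t => ∫⁻ t', ENNReal.ofReal (wt b₀ j (t - t')) * Φ t') 1 volume :=
          eLpNorm_mono_enorm (by simpa using hU)
      _ ≤ _ := hY1
      _ ≤ W * (C₀ * (N * A * (C₂ * mixedNorm 2 2 F * eLpNorm B 2 volume))) := by
          gcongr
          · exact hWb h₀
          rw [eLpNorm_one_eq_lintegral_enorm]
          simp only [enorm_eq_self, hΦ]
          rw [lintegral_const_mul _ (by fun_prop), lintegral_const_mul _ (by fun_prop)]
          gcongr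
          have hCS := ENNReal.lintegral_mul_le_Lp_mul_Lq volume (p := 2) (q := 2)
            (by constructor <;> norm_num) mφ.aemeasurable mB.aemeasurable
          have hφ2 : eLpNorm φ 2 volume ≤ C₂ * mixedNorm 2 2 F := by
            rw [mixedNorm, ← ENNReal_pow_two_le_iff, mul_pow, eLpNorm_two_sq, eLpNorm_two_sq,
              ← lintegral_const_mul _
                ((measurable_eLpNorm_two_slice F.continuous).enorm.pow_const 2)]
            refine lintegral_mono fun t => ?_
            rw [← mul_pow, enorm_eq_self, enorm_eq_self]
            gcongr
            exact hC₂ (sliceS t F)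
          refine le_trans ?_ (mul_le_mul_left hφ2 _)
          rw [eLpNorm_eq_lintegral_rpow_enorm_toReal (f := φ) (by norm_num) (by norm_num),
            eLpNorm_eq_lintegral_rpow_enorm_toReal (f := B) (by norm_num) (by norm_num)]
          simpa using hCS
      _ ≤ _ := by
          push_cast
          rw [hWn]
          calc _ = W * C₀ * C₂ * (N * A) * mixedNorm 2 2 F * eLpNorm B 2 volume := by ring
            _ ≤ _ := by
                gcongr
                exact le_add_self

end time

end MDNull

end

noncomputable section

namespace MDNull

/-! ### Geometry of resonant interactions -/

section geometry

variable {d : ℕ}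

/-- The unit vector in the direction of `x` (zero for `x = 0`). -/
def dir (x : Sp d) : Sp d := ‖x‖⁻¹ • x

lemma norm_dir {x : Sp d} (hx : x ≠ 0) : ‖dir x‖ = 1 := by
  rw [dir, norm_smul, norm_inv, norm_norm, inv_mul_cancel₀ (norm_ne_zero_iff.2 hx)]

lemma norm_smul_dir (x : Sp d) : ‖x‖ • dir x = x := by
  rcases eq_or_ne x 0 with rfl | hx
  · simp [dir]
  · rw [dir, smul_smul, mul_inv_cancel₀ (norm_ne_zero_iff.2 hx), one_smul]

lemma dir_neg (x : Sp d) : dir (-x) = -dir x := by simp [dir]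

/-- The distance of `x` to the line spanned by the unit vector `u`. -/
def offLine (u x : Sp d) : ℝ := ‖x - (inner ℝ u x : ℝ) • u‖

lemma offLine_nonneg (u x : Sp d) : 0 ≤ offLine u x := norm_nonneg _

lemma offLine_add_le (u x y : Sp d) : offLine u (x + y) ≤ offLine u x + offLine u y := by
  unfold offLine
  rw [inner_add_right, add_smul, add_sub_add_comm]
  exact norm_add_le _ _

lemma offLine_smul (u x : Sp d) (c : ℝ) : offLine u (c • x) = |c| * offLine u x := by
  unfold offLine
  rw [inner_smul_right, mul_smul, ← smul_sub, norm_smul, Real.norm_eq_abs]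

lemma offLine_neg (u x : Sp d) : offLine u (-x) = offLine u x := by
  have := offLine_smul u x (-1)
  simpa using this

lemma offLine_sub_le (u x y : Sp d) : offLine u (x - y) ≤ offLine u x + offLine u y := by
  rw [sub_eq_add_neg, ← offLine_neg u y]
  exact offLine_add_le _ _ _

lemma offLine_sq {u : Sp d} (hu : ‖u‖ = 1) (x : Sp d) :
    offLine u x ^ 2 = ‖x‖ ^ 2 - (inner ℝ u x : ℝ) ^ 2 := by
  unfold offLine
  rw [norm_sub_sq_real, inner_smul_right, norm_smul, hu, real_inner_comm, Real.norm_eq_abs, mul_one,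
    sq_abs]
  ring

lemma offLine_le_norm {u : Sp d} (hu : ‖u‖ = 1) (x : Sp d) : offLine u x ≤ ‖x‖ := by
  refine abs_le_of_sq_le_sq' ?_ (norm_nonneg _) |>.2
  rw [offLine_sq hu]
  nlinarith [sq_nonneg (inner ℝ u x : ℝ)]

lemma offLine_self {u : Sp d} (hu : ‖u‖ = 1) : offLine u u = 0 := by
  unfold offLine
  rw [real_inner_self_eq_norm_sq, hu]; simp

lemma offLine_le_norm_sub {u : Sp d} (hu : ‖u‖ = 1) (x : Sp d) (c : ℝ) :
    offLine u x ≤ ‖x - c • u‖ := by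
  calc offLine u x = offLine u ((x - c • u) + c • u) := by simp
    _ ≤ offLine u (x - c • u) + offLine u (c • u) := offLine_add_le _ _ _
    _ ≤ ‖x - c • u‖ := by
        rw [offLine_smul, offLine_self hu, mul_zero, add_zero]
        exact offLine_le_norm hu _

lemma offLine_comm {u v : Sp d} (hu : ‖u‖ = 1) (hv : ‖v‖ = 1) : offLine u v = offLine v u := by
  rw [← Real.sqrt_sq (offLine_nonneg u v), ← Real.sqrt_sq (offLine_nonneg v u), offLine_sq hu,
    offLine_sq hv, hu, hv, real_inner_comm]

/-- Changing the line changes the distance by at most the deviation of the directions. -/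
lemma offLine_le_add {u v : Sp d} (hu : ‖u‖ = 1) (hv : ‖v‖ = 1) (x : Sp d) :
    offLine u x ≤ offLine v x + ‖x‖ * offLine u v := by
  have h1 : x = (x - (inner ℝ v x : ℝ) • v) + (inner ℝ v x : ℝ) • v := by simp
  have h3 : offLine u ((inner ℝ v x : ℝ) • v) ≤ ‖x‖ * offLine u v := by
    rw [offLine_smul]
    refine mul_le_mul_of_nonneg_right ?_ (offLine_nonneg _ _)
    have := abs_real_inner_le_norm v x
    rwa [hv, one_mul] at this
  calc offLine u x = offLine u ((x - (inner ℝ v x : ℝ) • v) + (inner ℝ v x : ℝ) • v) := by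
        rw [← h1]
    _ ≤ _ := (offLine_add_le _ _ _).trans (add_le_add (offLine_le_norm hu _) h3)

lemma Compat.ne₁ {k₀ k₁ k₂ j : ℤ} {s₀ s₁ s₂ : ℤˣ} {ξ η : Sp d}
    (h : Compat k₀ k₁ k₂ j s₀ s₁ s₂ ξ η) : ξ ≠ 0 :=
  norm_ne_zero_iff.1 ((by positivity : (0 : ℝ) < 2 ^ (k₁ - 3)).trans h.lb₁).ne'

lemma Compat.ne₂ {k₀ k₁ k₂ j : ℤ} {s₀ s₁ s₂ : ℤˣ} {ξ η : Sp d}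
    (h : Compat k₀ k₁ k₂ j s₀ s₁ s₂ ξ η) : η ≠ 0 :=
  norm_ne_zero_iff.1 ((by positivity : (0 : ℝ) < 2 ^ (k₂ - 3)).trans h.lb₂).ne'

lemma Compat.ne₀ {k₀ k₁ k₂ j : ℤ} {s₀ s₁ s₂ : ℤˣ} {ξ η : Sp d}
    (h : Compat k₀ k₁ k₂ j s₀ s₁ s₂ ξ η) : ξ + η ≠ 0 :=
  norm_ne_zero_iff.1 ((by positivity : (0 : ℝ) < 2 ^ (k₀ - 3)).trans h.lb₀).ne'

/-- Exchanging the output with the first input. -/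
lemma Compat.rotate {k₀ k₁ k₂ j : ℤ} {s₀ s₁ s₂ : ℤˣ} {ξ η : Sp d}
    (h : Compat k₀ k₁ k₂ j s₀ s₁ s₂ ξ η) :
    Compat k₁ k₀ k₂ j s₁ s₀ (-s₂) (ξ + η) (-η) where
  lb₁ := h.lb₀
  ub₁ := h.ub₀
  lb₂ := by rw [norm_neg]; exact h.lb₂
  ub₂ := by rw [norm_neg]; exact h.ub₂
  lb₀ := by rw [add_neg_cancel_right]; exact h.lb₁
  ub₀ := by rw [add_neg_cancel_right]; exact h.ub₁
  modulation := by
    rw [add_neg_cancel_right, norm_neg, sgnR_neg, ← abs_neg]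
    convert h.modulation using 2
    ring

/-- Exchanging the two inputs. -/
lemma Compat.swap {k₀ k₁ k₂ j : ℤ} {s₀ s₁ s₂ : ℤˣ} {ξ η : Sp d}
    (h : Compat k₀ k₁ k₂ j s₀ s₁ s₂ ξ η) : Compat k₀ k₂ k₁ j s₀ s₂ s₁ η ξ where
  lb₁ := h.lb₂
  ub₁ := h.ub₂
  lb₂ := h.lb₁
  ub₂ := h.ub₁
  lb₀ := by rw [add_comm]; exact h.lb₀
  ub₀ := by rw [add_comm]; exact h.ub₀
  modulation := by
    rw [add_comm η ξ]
    convert h.modulation using 2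
    ring

/-- The angle between the input frequencies of a resonant interaction, from
`|ξ + η|² - (s₁|ξ| + s₂|η|)² = -s₁ s₂ |ξ| |η| |s₁ξ/|ξ| - s₂η/|η||²`. -/
lemma Compat.norm_dir_sub_le {κ k₀ k₁ k₂ j : ℤ} {s₀ s₁ s₂ : ℤˣ} {ξ η : Sp d} {C θ : ℝ}
    (h : Compat k₀ k₁ k₂ j s₀ s₁ s₂ ξ η) (hC : 0 ≤ C) (hθ : 0 ≤ θ) (hθ1 : θ ≤ 1)
    (hj : (2 : ℝ) ^ j ≤ C * 2 ^ κ * θ ^ 2) (hκ : κ ≤ k₀)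
    (hk : k₀ + 2 * min k₁ k₂ ≤ κ + k₁ + k₂ + 5) :
    ‖sgnR s₁ • dir ξ - sgnR s₂ • dir η‖ ≤ 1024 * (1 + C) * (θ * 2 ^ (κ - min k₁ k₂)) := by
  set δ := sgnR s₀ * ‖ξ + η‖ - sgnR s₁ * ‖ξ‖ - sgnR s₂ * ‖η‖ with hδ
  have hξ := norm_ne_zero_iff.2 h.ne₁
  have hη := norm_ne_zero_iff.2 h.ne₂
  have e0 := sgnR_sq s₀
  have e1 := sgnR_sq s₁
  have e2 := sgnR_sq s₂
  have hr : (0 : ℝ) < 2 ^ κ := by positivity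
  have hδ1 : |δ| ≤ 16 * (C * 2 ^ κ * θ ^ 2) := by
    have := h.modulation.le
    rw [zpow_add₀ (by norm_num)] at this
    norm_num at this
    linarith
  have hk0 : (2 : ℝ) ^ κ ≤ 2 ^ k₀ := zpow_le_zpow_right₀ (by norm_num) hκ
  have hS : |2 * (sgnR s₀ * ‖ξ + η‖) - δ| ≤ 16 * (1 + C) * 2 ^ k₀ := by
    have h1 := h.ub₀.le
    rw [zpow_add₀ (by norm_num)] at h1
    norm_num at h1
    have h2 : θ ^ 2 ≤ 1 := pow_le_one₀ hθ hθ1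
    have h3 : C * 2 ^ κ * θ ^ 2 ≤ C * 2 ^ k₀ := by
      calc C * 2 ^ κ * θ ^ 2 ≤ C * 2 ^ k₀ * 1 := by gcongr
        _ = _ := mul_one _
    calc |2 * (sgnR s₀ * ‖ξ + η‖) - δ| ≤ |2 * (sgnR s₀ * ‖ξ + η‖)| + |δ| := abs_sub _ _
      _ = 2 * ‖ξ + η‖ + |δ| := by
          rw [abs_mul, abs_mul, abs_sgnR, abs_norm]; norm_num
      _ ≤ _ := by linarith
  -- The right side is `|s₀|ξ + η| - σ| |s₀|ξ + η| + σ|` with `σ = s₁|ξ| + s₂|η|`.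
  have key : ‖ξ‖ * ‖η‖ * ‖sgnR s₁ • dir ξ - sgnR s₂ • dir η‖ ^ 2 =
      |δ| * |2 * (sgnR s₀ * ‖ξ + η‖) - δ| := by
    have h1 : ‖ξ + η‖ ^ 2 = ‖ξ‖ ^ 2 + 2 * inner ℝ ξ η + ‖η‖ ^ 2 := norm_add_sq_real ξ η
    have h2 : ‖sgnR s₁ • dir ξ - sgnR s₂ • dir η‖ ^ 2 =
        2 - 2 * (sgnR s₁ * sgnR s₂ * (‖ξ‖⁻¹ * ‖η‖⁻¹ * inner ℝ ξ η)) := by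
      rw [norm_sub_sq_real, norm_smul, norm_smul, norm_dir h.ne₁, norm_dir h.ne₂,
        inner_smul_left, inner_smul_right, dir, dir, inner_smul_left, inner_smul_right,
        Real.norm_eq_abs, Real.norm_eq_abs, abs_sgnR, abs_sgnR]
      simp only [conj_trivial]
      ring
    have h3 : ‖ξ‖ * ‖η‖ * ‖sgnR s₁ • dir ξ - sgnR s₂ • dir η‖ ^ 2 =
        -(sgnR s₁ * sgnR s₂) * (δ * (2 * (sgnR s₀ * ‖ξ + η‖) - δ)) := by
      have h4 : δ * (2 * (sgnR s₀ * ‖ξ + η‖) - δ) = 2 * inner ℝ ξ η -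
          2 * (sgnR s₁ * sgnR s₂) * (‖ξ‖ * ‖η‖) := by
        have : δ * (2 * (sgnR s₀ * ‖ξ + η‖) - δ) = (sgnR s₀ * sgnR s₀) * ‖ξ + η‖ ^ 2 -
          (sgnR s₁ * sgnR s₁) * ‖ξ‖ ^ 2 - (sgnR s₂ * sgnR s₂) * ‖η‖ ^ 2 -
          2 * (sgnR s₁ * sgnR s₂) * (‖ξ‖ * ‖η‖) := by rw [hδ]; ring
        rw [this, e0, e1, e2, h1]; ring
      rw [h4, h2]
      have h5 : ‖ξ‖ * ‖η‖ * (‖ξ‖⁻¹ * ‖η‖⁻¹) = 1 := by field_simp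
      linear_combination (-2 * sgnR s₁ * sgnR s₂ * inner ℝ ξ η) * h5 +
        (-2 * ‖ξ‖ * ‖η‖ * (sgnR s₂ * sgnR s₂)) * e1 + (-2 * ‖ξ‖ * ‖η‖) * e2
    have h6 : 0 ≤ ‖ξ‖ * ‖η‖ * ‖sgnR s₁ • dir ξ - sgnR s₂ • dir η‖ ^ 2 := by positivity
    rw [← abs_of_nonneg h6, h3, abs_mul, abs_neg, abs_mul, abs_sgnR, abs_sgnR, abs_mul]
    ring
  refine abs_le_of_sq_le_sq' ?_ (by positivity) |>.2
  have hlow : (2 : ℝ) ^ (k₁ - 3) * 2 ^ (k₂ - 3) ≤ ‖ξ‖ * ‖η‖ :=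
    mul_le_mul h.lb₁.le h.lb₂.le (by positivity) (norm_nonneg _)
  have hmain : (2 : ℝ) ^ (k₁ - 3) * 2 ^ (k₂ - 3) * ‖sgnR s₁ • dir ξ - sgnR s₂ • dir η‖ ^ 2 ≤
      16 * (C * 2 ^ κ * θ ^ 2) * (16 * (1 + C) * 2 ^ k₀) := by
    calc _ ≤ ‖ξ‖ * ‖η‖ * ‖sgnR s₁ • dir ξ - sgnR s₂ • dir η‖ ^ 2 := by gcongr
      _ = _ := key
      _ ≤ _ := mul_le_mul hδ1 hS (abs_nonneg _) (by positivity)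
  have hexp : (2 : ℝ) ^ κ * 2 ^ k₀ ≤
      2 ^ (k₁ - 3) * 2 ^ (k₂ - 3) * (2048 * (2 ^ (κ - min k₁ k₂)) ^ 2) := by
    have h1 : (2048 : ℝ) = 2 ^ (11 : ℤ) := by norm_num
    rw [h1, ← zpow_natCast, ← zpow_mul, ← zpow_add₀ (by norm_num), ← zpow_add₀ (by norm_num),
      ← zpow_add₀ (by norm_num), ← zpow_add₀ (by norm_num)]
    refine zpow_le_zpow_right₀ (by norm_num) ?_
    push_cast
    omega
  have hpos : (0 : ℝ) < 2 ^ (k₁ - 3) * 2 ^ (k₂ - 3) := by positivity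
  refine le_of_mul_le_mul_left (hmain.trans ?_) hpos
  calc 16 * (C * 2 ^ κ * θ ^ 2) * (16 * (1 + C) * 2 ^ k₀)
      = 256 * C * (1 + C) * θ ^ 2 * (2 ^ κ * 2 ^ k₀) := by ring
    _ ≤ 256 * C * (1 + C) * θ ^ 2 *
        (2 ^ (k₁ - 3) * 2 ^ (k₂ - 3) * (2048 * (2 ^ (κ - min k₁ k₂)) ^ 2)) := by gcongr
    _ ≤ 256 * (1 + C) * (1 + C) * θ ^ 2 *
        (2 ^ (k₁ - 3) * 2 ^ (k₂ - 3) * (4096 * (2 ^ (κ - min k₁ k₂)) ^ 2)) := by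
        gcongr <;> linarith
    _ = _ := by ring

end geometry

end MDNull

end

noncomputable section

namespace MDNull

/-! ### Counting boxes -/

open scoped Pointwise

section counting

variable {d : ℕ}

lemma boxSide_eq (k : ℤ) (l : ℝ) (i : Fin d) :
    boxSide k l i = if (i : ℕ) = 0 then (2 : ℝ) ^ k else 2 ^ k * 2 ^ l := by
  unfold boxSide
  split_ifs
  · exact Real.rpow_intCast 2 k
  · rw [Real.rpow_add (by norm_num), Real.rpow_intCast]

lemma boxSide_pos (k : ℤ) (l : ℝ) (i : Fin d) : 0 < boxSide k l i := by
  rw [boxSide_eq]; split_ifs <;> positivity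

/-- The dilation of the coordinate axes by the side lengths of `𝒞_k(l)`. -/
def boxDiag (d : ℕ) (k : ℤ) (l : ℝ) : Sp d →ₗ[ℝ] Sp d where
  toFun y := WithLp.toLp 2 fun i => boxSide k l i * y i
  map_add' y z := by ext i; simp [mul_add]
  map_smul' c y := by ext i; simp; ring

@[simp] lemma boxDiag_apply (k : ℤ) (l : ℝ) (y : Sp d) (i : Fin d) :
    boxDiag d k l y i = boxSide k l i * y i := rfl

lemma FreqBox.chart_eq (b : FreqBox d) (k : ℤ) (l : ℝ) (y : Sp d) :
    b.chart k l y = b.center + b.frame.repr.symm (boxDiag d k l y) := by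
  rw [FreqBox.chart, ← OrthonormalBasis.sum_repr_symm]
  rfl

lemma continuous_boxDiag (k : ℤ) (l : ℝ) : Continuous (boxDiag d k l) :=
  LinearMap.continuous_of_finiteDimensional _

lemma FreqBox.continuous_chart (b : FreqBox d) (k : ℤ) (l : ℝ) : Continuous (b.chart k l) := by
  rw [show b.chart k l = fun y => b.center + b.frame.repr.symm (boxDiag d k l y) from
    funext (b.chart_eq k l)]
  have := continuous_boxDiag (d := d) k l
  fun_prop

/-- The cube of side `lam` about the origin. -/
def cube (d : ℕ) (lam : ℝ) : Set (Sp d) := {y | ∀ i, |y i| ≤ lam / 2}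

lemma isCompact_cube (lam : ℝ) : IsCompact (cube d lam) := by
  have h : cube d lam = (EuclideanSpace.equiv (Fin d) ℝ).toHomeomorph ⁻¹'
      (Set.pi univ fun _ => Icc (-(lam / 2)) (lam / 2)) := by
    ext y
    simp only [cube, abs_le, mem_ofPred_eq, mem_preimage, Set.mem_pi, mem_univ, true_implies, mem_Icc]
    rfl
  rw [h, Homeomorph.isCompact_preimage]
  exact isCompact_univ_pi fun _ => isCompact_Icc

lemma norm_le_of_mem_cube {lam : ℝ} {y : Sp d} (hy : y ∈ cube d lam) : ‖y‖ ≤ d * (lam / 2) := by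
  calc ‖y‖ ≤ ∑ i, ‖y i‖ := by
        rw [EuclideanSpace.norm_eq]
        refine Real.sqrt_le_iff.2 ⟨Finset.sum_nonneg fun i _ => norm_nonneg _, ?_⟩
        exact Finset.sum_sq_le_sq_sum_of_nonneg fun i _ => norm_nonneg _
    _ ≤ ∑ _i : Fin d, lam / 2 := Finset.sum_le_sum fun i _ => hy i
    _ = _ := by simp

lemma FreqBox.dilate_eq (b : FreqBox d) (k : ℤ) (l lam : ℝ) :
    b.dilate k l lam = b.chart k l '' cube d lam := rfl

lemma FreqBox.isCompact_dilate (b : FreqBox d) (k : ℤ) (l lam : ℝ) :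
    IsCompact (b.dilate k l lam) := (isCompact_cube lam).image (b.continuous_chart k l)

/-- The common volume of the boxes `𝒞_k(l)`. -/
def boxVol (d : ℕ) (k : ℤ) (l : ℝ) : ℝ≥0∞ := volume (boxDiag d k l '' cube d 1)

lemma FreqBox.volume_dilate (b : FreqBox d) (k : ℤ) (l : ℝ) {lam : ℝ} (hlam : 0 < lam) :
    volume (b.dilate k l lam) = ENNReal.ofReal (lam ^ d) * boxVol d k l := by
  have h1 : b.dilate k l lam = (fun x => b.center + x) ''
      (b.frame.repr.symm '' (boxDiag d k l '' cube d lam)) := by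
    rw [FreqBox.dilate_eq, image_image, image_image]
    exact image_congr fun y _ => b.chart_eq k l y
  have h2 : cube d lam = lam • cube d 1 := by
    ext y
    rw [mem_smul_set_iff_inv_smul_mem₀ hlam.ne']
    simp only [cube, mem_ofPred_eq, PiLp.smul_apply, smul_eq_mul, abs_mul, abs_inv, abs_of_pos hlam]
    refine forall_congr' fun i => ?_
    rw [inv_mul_le_iff₀ hlam]
    ring_nf
  have h3 : boxDiag d k l '' (lam • cube d 1) = lam • (boxDiag d k l '' cube d 1) :=
    image_smul_set _ _ _
  have h4 : volume ((fun x => b.center + x) ''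
      (b.frame.repr.symm '' (boxDiag d k l '' cube d lam))) =
      volume (b.frame.repr.symm '' (boxDiag d k l '' cube d lam)) := by
    rw [image_add_left, measure_preimage_add]
  have h5 : volume (b.frame.repr.symm '' (boxDiag d k l '' cube d lam)) =
      volume (boxDiag d k l '' cube d lam) := by
    have h6 : b.frame.repr.symm '' (boxDiag d k l '' cube d lam) =
        b.frame.repr ⁻¹' (boxDiag d k l '' cube d lam) :=
      b.frame.repr.symm.toEquiv.image_eq_preimage_symm _
    rw [h6, b.frame.repr.measurePreserving.measure_preimage
      (((isCompact_cube lam).image (continuous_boxDiag k l)).measurableSet.nullMeasurableSet)]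
  rw [h1, h4, h5, h2, h3, Measure.addHaar_smul]
  simp [boxVol, abs_of_pos hlam]

lemma boxVol_ne_top (d : ℕ) (k : ℤ) (l : ℝ) : boxVol d k l ≠ ⊤ :=
  ((isCompact_cube 1).image (continuous_boxDiag k l)).measure_lt_top.ne

lemma boxVol_ne_zero (d : ℕ) (k : ℤ) (l : ℝ) : boxVol d k l ≠ 0 := by
  rw [boxVol, Measure.addHaar_image_linearMap]
  refine mul_ne_zero ?_ ?_
  · rw [Ne, ENNReal.ofReal_eq_zero, not_le, abs_pos]
    intro h
    refine (LinearMap.bot_lt_ker_of_det_eq_zero h).ne' ?_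
    rw [LinearMap.ker_eq_bot']
    intro y hy
    ext i
    have h1 : boxSide k l i * y i = 0 := by
      rw [← boxDiag_apply, hy]; rfl
    exact (mul_eq_zero.1 h1).resolve_left (boxSide_pos k l i).ne'
  · refine (Measure.measure_pos_of_mem_nhds (x := (0 : Sp d)) volume ?_).ne'
    refine Filter.mem_of_superset (Metric.ball_mem_nhds 0 (by norm_num : (0 : ℝ) < 1 / 2)) ?_
    intro y hy i
    rw [mem_ball_zero_iff] at hy
    exact (PiLp.norm_apply_le y i).trans hy.le

variable {ι : Type} {k : ℤ} {l lam : ℝ} {M : ℕ} {D : ℕ → ℝ} {box : ι → FreqBox d}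

/-- Volume counting: boxes inside `Ω` overlap at most `M` times. -/
lemma IsBoxFamily.card_mul_boxVol_le (h : IsBoxFamily k l lam M D box) (T : Finset ι)
    {Ω : Set (Sp d)} (hΩ : MeasurableSet Ω) (hT : ∀ a ∈ T, (box a).dilate k l 1 ⊆ Ω) :
    (T.card : ℝ≥0∞) * boxVol d k l ≤ M * volume Ω := by
  classical
  have hm : ∀ a, MeasurableSet ((box a).dilate k l 1) := fun a =>
    ((box a).isCompact_dilate k l 1).measurableSet
  have key : ∀ x, (∑ a ∈ T, ((box a).dilate k l 1).indicator (1 : Sp d → ℝ≥0∞) x : ℝ≥0∞) ≤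
      M * Ω.indicator (1 : Sp d → ℝ≥0∞) x := by
    intro x
    by_cases hx : x ∈ Ω
    · have h1 : (∑ a ∈ T, ((box a).dilate k l 1).indicator (1 : Sp d → ℝ≥0∞) x : ℝ≥0∞) =
          ((T.filter fun a => x ∈ (box a).dilate k l 1).card : ℝ≥0∞) := by
        simp [indicator_apply]
      rw [indicator_of_mem hx, h1, Pi.one_apply, mul_one]
      have h2 : (((T.filter fun a => x ∈ (box a).dilate k l 1) : Finset ι) : Set ι).encard ≤
          M := (encard_le_encard fun a ha => by simpa using (Finset.mem_filter.1 ha).2).trans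
            (h.overlap x)
      rw [encard_coe_eq_coe_finsetCard] at h2
      have h3 : (T.filter fun a => x ∈ (box a).dilate k l 1).card ≤ M := by exact_mod_cast h2
      exact_mod_cast h3
    · refine le_of_eq_of_le (Finset.sum_eq_zero fun a ha => ?_) bot_le
      exact indicator_of_notMem (fun hxa => hx (hT a ha hxa)) _
  calc (T.card : ℝ≥0∞) * boxVol d k l = ∑ a ∈ T, volume ((box a).dilate k l 1) := by
        simp [(box _).volume_dilate k l one_pos]
    _ = ∫⁻ x, ∑ a ∈ T, ((box a).dilate k l 1).indicator 1 x := by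
        rw [lintegral_finsetSum _ fun a _ => measurable_one.indicator (hm a)]
        refine Finset.sum_congr rfl fun a _ => (lintegral_indicator_one (hm a)).symm
    _ ≤ ∫⁻ x, M * Ω.indicator 1 x := lintegral_mono key
    _ = M * volume Ω := by
        rw [lintegral_const_mul _ (measurable_one.indicator hΩ), lintegral_indicator_one hΩ]

/-- The direction of the long side. -/
def FreqBox.axis (b : FreqBox d) (hd : 2 ≤ d) : Sp d := b.frame ⟨0, by omega⟩

lemma FreqBox.norm_axis (b : FreqBox d) (hd : 2 ≤ d) : ‖b.axis hd‖ = 1 :=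
  b.frame.orthonormal.1 _

lemma FreqBox.norm_frame_le (b : FreqBox d) (k : ℤ) {l : ℝ} (hl : l ≤ 0) (y : Sp d) :
    ‖b.frame.repr.symm (boxDiag d k l y)‖ ≤ 2 ^ k * ‖y‖ := by
  rw [LinearIsometryEquiv.norm_map, EuclideanSpace.norm_eq, EuclideanSpace.norm_eq,
    ← Real.sqrt_sq (by positivity : (0 : ℝ) ≤ 2 ^ k), ← Real.sqrt_mul (by positivity),
    Finset.mul_sum]
  refine Real.sqrt_le_sqrt (Finset.sum_le_sum fun i _ => ?_)
  rw [boxDiag_apply, norm_mul, mul_pow, Real.norm_of_nonneg (boxSide_pos k l i).le, boxSide_eq]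
  have : (2 : ℝ) ^ l ≤ 1 := Real.rpow_le_one_of_one_le_of_nonpos (by norm_num) hl
  gcongr
  split_ifs
  · rfl
  · exact mul_le_of_le_one_right (by positivity) this

lemma FreqBox.offLine_frame_le (b : FreqBox d) (hd : 2 ≤ d) (k : ℤ) (l : ℝ) (y : Sp d) :
    offLine (b.axis hd) (b.frame.repr.symm (boxDiag d k l y)) ≤ 2 ^ k * 2 ^ l * ‖y‖ := by
  set x := b.frame.repr.symm (boxDiag d k l y) with hx
  refine abs_le_of_sq_le_sq' ?_ (by positivity) |>.2
  have hin : inner ℝ (b.axis hd) x = (2 : ℝ) ^ k * y ⟨0, by omega⟩ := by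
    rw [FreqBox.axis, ← OrthonormalBasis.repr_apply_apply, hx, LinearIsometryEquiv.apply_symm_apply,
      boxDiag_apply, boxSide_eq]
    simp
  rw [offLine_sq (b.norm_axis hd), hin, hx, LinearIsometryEquiv.norm_map, EuclideanSpace.norm_sq_eq,
    mul_pow _ ‖y‖, EuclideanSpace.norm_sq_eq, Finset.mul_sum, sub_le_iff_le_add,
    ← Finset.add_sum_erase _ _ (Finset.mem_univ (⟨0, by omega⟩ : Fin d)),
    ← Finset.add_sum_erase (a := (⟨0, by omega⟩ : Fin d)) (f := fun i => (2 ^ k * 2 ^ l) ^ 2 * ‖y i‖ ^ 2)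
      _ (Finset.mem_univ _)]
  have h1 : ∑ i ∈ Finset.univ.erase (⟨0, by omega⟩ : Fin d), ‖boxDiag d k l y i‖ ^ 2 ≤
      ∑ i ∈ Finset.univ.erase (⟨0, by omega⟩ : Fin d), (2 ^ k * 2 ^ l) ^ 2 * ‖y i‖ ^ 2 := by
    refine Finset.sum_le_sum fun i hi => le_of_eq ?_
    have hi0 : (i : ℕ) ≠ 0 := fun h => Finset.ne_of_mem_erase hi (Fin.ext h)
    rw [boxDiag_apply, boxSide_eq, if_neg hi0, norm_mul, mul_pow, Real.norm_of_nonneg (by positivity)]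
  have h2 : ‖boxDiag d k l y ⟨0, by omega⟩‖ ^ 2 = (2 ^ k * y ⟨0, by omega⟩) ^ 2 := by
    rw [boxDiag_apply, boxSide_eq, if_pos rfl, Real.norm_eq_abs, sq_abs]
  rw [h2]
  have h3 : 0 ≤ ((2 : ℝ) ^ k * 2 ^ l) ^ 2 * ‖y ⟨0, by omega⟩‖ ^ 2 := by positivity
  linarith

/-- Points at distance at most `C 2^k` from the origin and `C 2^{k+l}` from the axis lie in the
box spanned by the frame. -/
lemma FreqBox.exists_frame_eq (b : FreqBox d) (hd : 2 ≤ d) {k : ℤ} {l : ℝ} {C : ℝ} {x : Sp d}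
    (h1 : ‖x‖ ≤ C * 2 ^ k) (h2 : offLine (b.axis hd) x ≤ C * (2 ^ k * 2 ^ l)) :
    ∃ z ∈ cube d (2 * C), x = b.frame.repr.symm (boxDiag d k l z) := by
  refine ⟨WithLp.toLp 2 fun i => (boxSide k l i)⁻¹ * b.frame.repr x i, fun i => ?_, ?_⟩
  · have hs := boxSide_pos k l i
    have e : 2 * C / 2 = C := by ring
    simp only [abs_mul, abs_inv, abs_of_pos hs, e]
    rw [inv_mul_le_iff₀ hs, OrthonormalBasis.repr_apply_apply, boxSide_eq]
    have hn : ‖b.frame i‖ = 1 := b.frame.orthonormal.1 i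
    split_ifs with hi
    · have := abs_real_inner_le_norm (b.frame i) x
      rw [hn, one_mul] at this
      linarith
    · have h0 : inner ℝ (b.frame i) (b.axis hd) = (0 : ℝ) :=
        b.frame.orthonormal.2 (fun h => hi (by rw [h]))
      have h3 : inner ℝ (b.frame i) x =
          inner ℝ (b.frame i) (x - (inner ℝ (b.axis hd) x : ℝ) • b.axis hd) := by
        rw [inner_sub_right, inner_smul_right, h0, mul_zero, sub_zero]
      have := abs_real_inner_le_norm (b.frame i) (x - (inner ℝ (b.axis hd) x : ℝ) • b.axis hd)
      rw [hn, one_mul, ← h3] at this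
      have h4 : offLine (b.axis hd) x = ‖x - (inner ℝ (b.axis hd) x : ℝ) • b.axis hd‖ := rfl
      linarith
  · rw [eq_comm, LinearIsometryEquiv.symm_apply_eq]
    ext i
    rw [boxDiag_apply]
    exact mul_inv_cancel_left₀ (boxSide_pos k l i).ne' _

lemma IsBoxFamily.exists_frame (b : FreqBox d) {p q : Sp d} {lam' : ℝ}
    (hp : p ∈ b.dilate k l lam) (hq : q ∈ b.dilate k l lam') :
    ∃ y : Sp d, ‖y‖ ≤ d * (|lam| + |lam'|) ∧ q - p = b.frame.repr.symm (boxDiag d k l y) := by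
  obtain ⟨y, hy, rfl⟩ := hp
  obtain ⟨z, hz, rfl⟩ := hq
  refine ⟨z - y, ?_, by rw [b.chart_eq, b.chart_eq, map_sub, map_sub]; abel⟩
  have h1 := norm_le_of_mem_cube hy
  have h2 := norm_le_of_mem_cube hz
  have hd : (0 : ℝ) ≤ d := by positivity
  have h3 := le_abs_self lam
  have h4 := le_abs_self lam'
  refine (norm_sub_le z y).trans ?_
  nlinarith [abs_nonneg lam, abs_nonneg lam', mul_nonneg hd (abs_nonneg lam),
    mul_nonneg hd (abs_nonneg lam'), mul_le_mul_of_nonneg_left h3 hd,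
    mul_le_mul_of_nonneg_left h4 hd]

/-- Only finitely many boxes meet a bounded set. -/
lemma IsBoxFamily.finite_meet (h : IsBoxFamily k l lam M D box) (hl : l ≤ 0) (R : ℝ) :
    {a | ∃ p ∈ (box a).dilate k l lam, ‖p‖ ≤ R}.Finite := by
  set r := R + 2 ^ k * (d * (|lam| + |1|)) with hr
  have hΩ := measure_closedBall_lt_top (μ := (volume : Measure (Sp d))) (x := 0) (r := r)
  have hcard : ∀ T : Finset ι, (↑T : Set ι) ⊆ {a | ∃ p ∈ (box a).dilate k l lam, ‖p‖ ≤ R} →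
      (T.card : ℝ≥0∞) ≤ M * volume (Metric.closedBall (0 : Sp d) r) / boxVol d k l := by
    intro T hT
    rw [ENNReal.le_div_iff_mul_le (Or.inl (boxVol_ne_zero d k l)) (Or.inl (boxVol_ne_top d k l))]
    refine h.card_mul_boxVol_le T measurableSet_closedBall fun a ha q hq => ?_
    obtain ⟨p, hp, hpR⟩ := hT ha
    obtain ⟨y, hy, e⟩ := IsBoxFamily.exists_frame (box a) hp hq
    rw [mem_closedBall_zero_iff]
    calc ‖q‖ = ‖p + (q - p)‖ := by simp
      _ ≤ ‖p‖ + ‖q - p‖ := norm_add_le _ _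
      _ ≤ R + 2 ^ k * ‖y‖ := by
          rw [e]; exact add_le_add hpR ((box a).norm_frame_le k hl y)
      _ ≤ _ := by rw [hr]; gcongr
  by_contra hinf
  have hfin : M * volume (Metric.closedBall (0 : Sp d) r) / boxVol d k l < ⊤ :=
    ENNReal.div_lt_top (ENNReal.mul_ne_top (by simp) hΩ.ne) (boxVol_ne_zero d k l)
  obtain ⟨n, hn⟩ := ENNReal.exists_nat_gt hfin.ne
  obtain ⟨T, hT, hTn⟩ := Set.Infinite.exists_subset_card_eq hinf n
  have := hcard T hT
  rw [hTn] at this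
  exact absurd hn (not_lt.2 this)

/-- The number of boxes that are close to a given line, at bounded distance from each other in the
scale of the boxes and almost parallel to the line, is bounded. -/
lemma exists_card_le (d : ℕ) (hd : 2 ≤ d) (lam : ℝ) (M : ℕ) (C : ℝ) (hC : 0 ≤ C) :
    ∃ N : ℕ, ∀ {ι : Type} {k : ℤ} {l : ℝ} {D : ℕ → ℝ} {box : ι → FreqBox d},
      IsBoxFamily k l lam M D box → l ≤ 0 → ∀ (T : Finset ι) (v : Sp d) (p : ι → Sp d),
      ‖v‖ = 1 → (∀ a ∈ T, p a ∈ (box a).dilate k l lam) →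
      (∀ a ∈ T, ∀ a' ∈ T, ‖p a - p a'‖ ≤ C * 2 ^ k) →
      (∀ a ∈ T, offLine v (p a) ≤ C * (2 ^ k * 2 ^ l)) →
      (∀ a ∈ T, offLine v ((box a).axis hd) ≤ C * 2 ^ l) → T.card ≤ N := by
  set L : ℝ := d * (|lam| + |1|) with hL
  have hL0 : 0 ≤ L := by positivity
  set C' : ℝ := 2 * C + L + L * C + (C + L) * C + 1 with hC'
  have hC'0 : 0 < C' := by positivity
  refine ⟨M * ⌈(2 * C') ^ d⌉₊, ?_⟩
  intro ι k l D box h hl T v p hv hp hpp hpv hpa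
  rcases T.eq_empty_or_nonempty with rfl | ⟨a₀, ha₀⟩
  · simp
  set b : FreqBox d := ⟨p a₀, (box a₀).frame, fun _ => 0⟩ with hb
  have hθ1 : (2 : ℝ) ^ l ≤ 1 := Real.rpow_le_one_of_one_le_of_nonpos (by norm_num) hl
  have hθ0 : (0 : ℝ) < 2 ^ l := by positivity
  have hr : (0 : ℝ) < 2 ^ k := by positivity
  have hsub : ∀ a ∈ T, (box a).dilate k l 1 ⊆ b.dilate k l (2 * C') := by
    intro a ha q hq
    obtain ⟨y, hy, e⟩ := IsBoxFamily.exists_frame (box a) (hp a ha) hq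
    have ex : q - p a₀ = (q - p a) + (p a - p a₀) := by abel
    have n1 : ‖q - p a‖ ≤ 2 ^ k * L := by
      rw [e]; exact ((box a).norm_frame_le k hl y).trans (by gcongr)
    have n2 : ‖q - p a₀‖ ≤ (C + L) * 2 ^ k := by
      rw [ex]
      refine (norm_add_le _ _).trans ?_
      linarith [hpp a ha a₀ ha₀]
    have o1 : offLine v (q - p a) ≤ (L + L * C) * (2 ^ k * 2 ^ l) := by
      have h1 := offLine_le_add hv ((box a).norm_axis hd) (q - p a)
      have h2 : offLine ((box a).axis hd) (q - p a) ≤ 2 ^ k * 2 ^ l * L := by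
        rw [e]; exact ((box a).offLine_frame_le hd k l y).trans (by gcongr)
      have h3 : ‖q - p a‖ * offLine v ((box a).axis hd) ≤ (2 ^ k * L) * (C * 2 ^ l) :=
        mul_le_mul n1 (hpa a ha) (offLine_nonneg _ _) (by positivity)
      linarith
    have o2 : offLine v (q - p a₀) ≤ (2 * C + L + L * C) * (2 ^ k * 2 ^ l) := by
      rw [ex]
      have h1 := offLine_add_le v (q - p a) (p a - p a₀)
      have h2 := offLine_sub_le v (p a) (p a₀)
      linarith [hpv a ha, hpv a₀ ha₀]
    have o3 : offLine ((box a₀).axis hd) (q - p a₀) ≤ C' * (2 ^ k * 2 ^ l) := by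
      have h1 := offLine_le_add ((box a₀).norm_axis hd) hv (q - p a₀)
      have h2 : ‖q - p a₀‖ * offLine ((box a₀).axis hd) v ≤ ((C + L) * 2 ^ k) * (C * 2 ^ l) := by
        rw [offLine_comm ((box a₀).norm_axis hd) hv]
        exact mul_le_mul n2 (hpa a₀ ha₀) (offLine_nonneg _ _) (by positivity)
      have h3 : 0 < (2 : ℝ) ^ k * 2 ^ l := by positivity
      rw [hC']
      linarith
    have n3 : ‖q - p a₀‖ ≤ C' * 2 ^ k := by
      refine n2.trans (mul_le_mul_of_nonneg_right ?_ hr.le)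
      rw [hC']
      nlinarith [mul_nonneg hL0 hC, mul_nonneg (add_nonneg hC hL0) hC]
    obtain ⟨z, hz, ez⟩ := b.exists_frame_eq hd n3 o3
    exact ⟨z, hz, by rw [b.chart_eq, ← ez]; simp [hb]⟩
  have hcount := h.card_mul_boxVol_le T (b.isCompact_dilate k l (2 * C')).measurableSet hsub
  rw [b.volume_dilate k l (by positivity), ← mul_assoc,
    ENNReal.mul_le_mul_iff_left (boxVol_ne_zero d k l) (boxVol_ne_top d k l)] at hcount
  have h5 : ENNReal.ofReal ((2 * C') ^ d) ≤ (⌈(2 * C') ^ d⌉₊ : ℝ≥0∞) := by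
    rw [← ENNReal.ofReal_natCast]
    exact ENNReal.ofReal_le_ofReal (Nat.le_ceil _)
  have h6 : (T.card : ℝ≥0∞) ≤ M * (⌈(2 * C') ^ d⌉₊ : ℝ≥0∞) := hcount.trans (by gcongr)
  exact_mod_cast h6

end counting

end MDNull

end

noncomputable section

namespace MDNull

/-! ### Resonant boxes -/

section resonant

variable {d : ℕ}

/-- `κ` is the minimum of `k₀, k₁, k₂`, and the two largest of them are comparable. -/
structure FreqTriple (κ k₀ k₁ k₂ : ℤ) : Prop where
  le₀ : κ ≤ k₀
  le₁ : κ ≤ k₁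
  le₂ : κ ≤ k₂
  eq : κ = k₀ ∨ κ = k₁ ∨ κ = k₂
  sep₀ : k₀ ≤ max k₁ k₂ + 5
  sep₁ : k₁ ≤ max k₀ k₂ + 5
  sep₂ : k₂ ≤ max k₀ k₁ + 5

lemma freqTriple_of_kMin {k₀ k₁ k₂ : ℤ} (h : |kMax k₀ k₁ k₂ - kMed k₀ k₁ k₂| ≤ 5) :
    FreqTriple (kMin k₀ k₁ k₂) k₀ k₁ k₂ := by
  rw [abs_le] at h
  unfold kMed kMax kMin at h
  unfold kMin
  constructor <;> omega

lemma FreqTriple.swap {κ k₀ k₁ k₂ : ℤ} (h : FreqTriple κ k₀ k₁ k₂) : FreqTriple κ k₀ k₂ k₁ := by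
  obtain ⟨h1, h2, h3, h4, h5, h6, h7⟩ := h
  constructor <;> omega

lemma FreqTriple.rotate {κ k₀ k₁ k₂ : ℤ} (h : FreqTriple κ k₀ k₁ k₂) :
    FreqTriple κ k₁ k₀ k₂ := by
  obtain ⟨h1, h2, h3, h4, h5, h6, h7⟩ := h
  constructor <;> omega

lemma FreqTriple.chord {κ k₀ k₁ k₂ : ℤ} (h : FreqTriple κ k₀ k₁ k₂) :
    k₀ + 2 * min k₁ k₂ ≤ κ + k₁ + k₂ + 5 := by
  obtain ⟨h1, h2, h3, h4, h5, h6, h7⟩ := h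
  omega

/-- The modulation parameter in the scale of the boxes: `2^j ≲ 2^κ 2^{2ℓ}`. -/
lemma two_zpow_le_of_ell {k₀ k₁ k₂ j : ℤ} {C₀ : ℝ} (hj : (j : ℝ) ≤ (kMin k₀ k₁ k₂ : ℝ) + C₀) :
    (2 : ℝ) ^ j ≤ max 1 ((2 : ℝ) ^ C₀) * 2 ^ kMin k₀ k₁ k₂ * ((2 : ℝ) ^ ell k₀ k₁ k₂ j) ^ 2 := by
  have e : ((2 : ℝ) ^ ell k₀ k₁ k₂ j) ^ 2 =
      (2 : ℝ) ^ min ((j : ℝ) - (kMin k₀ k₁ k₂ : ℝ)) 0 := by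
    rw [← Real.rpow_natCast, ← Real.rpow_mul (by norm_num), ell]
    congr 1; push_cast; ring
  rw [e, ← Real.rpow_intCast, ← Real.rpow_intCast]
  rcases le_total ((j : ℝ) - (kMin k₀ k₁ k₂ : ℝ)) 0 with h | h
  · rw [min_eq_left h, mul_assoc, ← Real.rpow_add (by norm_num)]
    simp only [add_sub_cancel]
    exact le_mul_of_one_le_left (by positivity) (le_max_left _ _)
  · rw [min_eq_right h, Real.rpow_zero, mul_one]
    calc (2 : ℝ) ^ (j : ℝ) ≤ 2 ^ ((kMin k₀ k₁ k₂ : ℝ) + C₀) :=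
          Real.rpow_le_rpow_of_exponent_le (by norm_num) hj
      _ = 2 ^ C₀ * 2 ^ (kMin k₀ k₁ k₂ : ℝ) := by rw [Real.rpow_add (by norm_num), mul_comm]
      _ ≤ _ := by gcongr; exact le_max_right _ _

lemma ell_nonpos (k₀ k₁ k₂ j : ℤ) : ell k₀ k₁ k₂ j ≤ 0 := by
  unfold ell
  have := min_le_right ((j : ℝ) - (kMin k₀ k₁ k₂ : ℝ)) 0
  linarith

section family

variable {ι : Type} {k : ℤ} {l lam : ℝ} {M : ℕ} {D : ℕ → ℝ} {box : ι → FreqBox d}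

/-- Since the long side is radial, the points of a box are close to the line of the axis. -/
lemma IsBoxFamily.offLine_axis_le (h : IsBoxFamily k l lam M D box) (hd : 2 ≤ d) {a : ι}
    {η : Sp d} {lam' : ℝ} (hη : η ∈ (box a).dilate k l lam') :
    offLine ((box a).axis hd) η ≤ 2 ^ k * 2 ^ l * (d * |lam'|) := by
  obtain ⟨y, hy, rfl⟩ := hη
  have h1 : offLine ((box a).axis hd) (box a).center = 0 := by
    have := h.radial a ⟨0, by omega⟩ rfl
    have h2 : (box a).center = ‖(box a).center‖ • (box a).axis hd := this
    rw [h2, offLine_smul, offLine_self ((box a).norm_axis hd), mul_zero]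
  rw [(box a).chart_eq]
  refine (offLine_add_le _ _ _).trans ?_
  rw [h1, zero_add]
  refine ((box a).offLine_frame_le hd k l y).trans ?_
  gcongr
  refine (norm_le_of_mem_cube hy).trans ?_
  gcongr
  linarith [le_abs_self lam', abs_nonneg lam']

lemma offLine_dir_le {s₁ s₂ : ℤˣ} {v p : Sp d} (hv : v ≠ 0) :
    offLine (dir v) p ≤ ‖p‖ * ‖sgnR s₁ • dir v - sgnR s₂ • dir p‖ := by
  refine (offLine_le_norm_sub (norm_dir hv) p (‖p‖ * (sgnR s₂ * sgnR s₁))).trans (le_of_eq ?_)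
  have e : p - (‖p‖ * (sgnR s₂ * sgnR s₁)) • dir v =
      (-(‖p‖ * sgnR s₂)) • (sgnR s₁ • dir v - sgnR s₂ • dir p) := by
    rw [smul_sub, smul_smul, smul_smul]
    have : -(‖p‖ * sgnR s₂) * sgnR s₂ = -‖p‖ := by
      rw [neg_mul, mul_assoc, sgnR_sq, mul_one]
    rw [this, neg_smul, norm_smul_dir, neg_mul, neg_smul, mul_assoc]
    abel
  rw [e, norm_smul, norm_neg, norm_mul, norm_norm, Real.norm_eq_abs (sgnR s₂), abs_sgnR, mul_one]

/-- For a fixed frequency of the largest size, the number of boxes that contain a frequency in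
resonance with it is bounded: the resonant frequencies lie within `O(2^{κ+l})` of the line through
`v`, in a region of diameter `O(2^κ)`. The factor `σ = ±1` allows for `v` being the output
frequency. -/
lemma exists_card_le_of_compat (d : ℕ) (hd : 2 ≤ d) (lam : ℝ) (M : ℕ) (C : ℝ) (hC : 0 ≤ C) :
    ∃ N : ℕ, ∀ {ι : Type} {κ k₀ k₁ k₂ j : ℤ} {l : ℝ} {D : ℕ → ℝ} {box : ι → FreqBox d}
      {s₀ s₁ s₂ : ℤˣ}, IsBoxFamily κ l lam M D box → l ≤ 0 →
      (2 : ℝ) ^ j ≤ C * 2 ^ κ * ((2 : ℝ) ^ l) ^ 2 → FreqTriple κ k₀ k₁ k₂ → k₀ ≤ k₁ →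
      ∀ (T : Finset ι) (v : Sp d) (η : ι → Sp d) (σ : ℝ), |σ| = 1 →
      (∀ a ∈ T, η a ∈ (box a).dilate κ l lam) →
      (∀ a ∈ T, Compat k₀ k₁ k₂ j s₀ s₁ s₂ v (σ • η a)) → T.card ≤ N := by
  set K : ℝ := 1024 * (1 + C) with hK
  set C' : ℝ := 16 + 256 * K + K + 8 * (d * |lam|) with hC'
  have hK0 : 0 ≤ K := by positivity
  obtain ⟨N, hN⟩ := exists_card_le d hd lam M C' (by positivity)
  refine ⟨N, ?_⟩
  intro ι κ k₀ k₁ k₂ j l D box s₀ s₁ s₂ h hl hj hk hk01 T v η σ hσ hη hc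
  rcases T.eq_empty_or_nonempty with rfl | ⟨a₀, ha₀⟩
  · simp
  have hv : v ≠ 0 := (hc a₀ ha₀).ne₁
  have hθ0 : (0 : ℝ) < 2 ^ l := by positivity
  have hθ1 : (2 : ℝ) ^ l ≤ 1 := Real.rpow_le_one_of_one_le_of_nonpos (by norm_num) hl
  have hr : (0 : ℝ) < 2 ^ κ := by positivity
  have hd0 : (0 : ℝ) ≤ d * |lam| := by positivity
  have hnσ : ∀ x : Sp d, ‖σ • x‖ = ‖x‖ := fun x => by
    rw [norm_smul, Real.norm_eq_abs, hσ, one_mul]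
  have hσ0 : σ ≠ 0 := by rintro rfl; simp at hσ
  have hchord : ∀ a ∈ T, offLine (dir v) (η a) ≤ ‖η a‖ * (K * (2 ^ l * 2 ^ (κ - min k₁ k₂))) := by
    intro a ha
    have h1 := (hc a ha).norm_dir_sub_le hC hθ0.le hθ1 hj hk.le₀ hk.chord
    have h2 := offLine_dir_le (s₁ := s₁) (s₂ := s₂) (v := v) (p := σ • η a) hv
    rw [offLine_smul, hσ, one_mul, hnσ] at h2
    exact h2.trans (by gcongr)
  have hub : ∀ a ∈ T, ‖η a‖ ≤ 8 * 2 ^ k₂ := by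
    intro a ha
    have := (hc a ha).ub₂.le
    rw [hnσ, zpow_add₀ (by norm_num)] at this
    norm_num at this
    linarith
  have hlb : ∀ a ∈ T, 2 ^ κ ≤ 8 * ‖η a‖ := by
    intro a ha
    have h1 := (hc a ha).lb₂.le
    have h2 : (2 : ℝ) ^ κ ≤ 2 ^ k₂ := zpow_le_zpow_right₀ (by norm_num) hk.le₂
    rw [hnσ, zpow_sub₀ (by norm_num)] at h1
    norm_num at h1
    linarith
  refine hN h hl T (dir v) η (norm_dir hv) hη ?_ ?_ ?_
  · intro a ha a' ha'
    have h16 : ‖η a - η a'‖ ≤ 16 * 2 ^ κ := by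
      -- If the smallest frequency is `η`, then `η` is bounded by `2^κ` itself; otherwise it is
      -- the sum `v + σ η`, and `η` stays within `2^κ` of `-σ v`.
      have hcase : κ = k₂ ∨ κ = k₀ := by
        rcases hk.eq with e | e | e
        · exact Or.inr e
        · exact Or.inr (le_antisymm hk.le₀ (e ▸ hk01))
        · exact Or.inl e
      rcases hcase with rfl | rfl
      · exact (norm_sub_le _ _).trans (by linarith [hub a ha, hub a' ha'])
      · have h1 : ∀ a ∈ T, ‖v + σ • η a‖ ≤ 8 * 2 ^ κ := by
          intro a ha
          have := (hc a ha).ub₀.le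
          rw [zpow_add₀ (by norm_num)] at this
          norm_num at this
          linarith
        have h2 : ‖η a - η a'‖ = ‖(v + σ • η a) - (v + σ • η a')‖ := by
          rw [add_sub_add_left_eq_sub, ← smul_sub, hnσ]
        rw [h2]
        exact (norm_sub_le _ _).trans (by linarith [h1 a ha, h1 a' ha'])
    refine h16.trans (mul_le_mul_of_nonneg_right ?_ hr.le)
    rw [hC']; linarith
  · intro a ha
    have h1 : (2 : ℝ) ^ k₂ * 2 ^ (κ - min k₁ k₂) ≤ 32 * 2 ^ κ := by
      have : (32 : ℝ) = 2 ^ (5 : ℤ) := by norm_num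
      rw [this, ← zpow_add₀ (by norm_num), ← zpow_add₀ (by norm_num)]
      refine zpow_le_zpow_right₀ (by norm_num) ?_
      have := hk.sep₂
      omega
    calc offLine (dir v) (η a) ≤ ‖η a‖ * (K * (2 ^ l * 2 ^ (κ - min k₁ k₂))) := hchord a ha
      _ ≤ 8 * 2 ^ k₂ * (K * (2 ^ l * 2 ^ (κ - min k₁ k₂))) := by gcongr; exact hub a ha
      _ = 8 * K * 2 ^ l * (2 ^ k₂ * 2 ^ (κ - min k₁ k₂)) := by ring
      _ ≤ 8 * K * 2 ^ l * (32 * 2 ^ κ) := by gcongr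
      _ = 256 * K * (2 ^ κ * 2 ^ l) := by ring
      _ ≤ C' * (2 ^ κ * 2 ^ l) := by
          refine mul_le_mul_of_nonneg_right ?_ (by positivity)
          rw [hC']; linarith
  · intro a ha
    have hη0 : η a ≠ 0 := fun h0 => (hc a ha).ne₂ (by rw [h0, smul_zero])
    have hηn : 0 < ‖η a‖ := norm_pos_iff.2 hη0
    have e1 : ∀ u : Sp d, offLine u (dir (η a)) = ‖η a‖⁻¹ * offLine u (η a) := fun u => by
      rw [dir, offLine_smul, abs_of_pos (by positivity)]
    have h1 := offLine_le_add (norm_dir hv) (norm_dir hη0) ((box a).axis hd)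
    rw [(box a).norm_axis hd, one_mul, offLine_comm (norm_dir hη0) ((box a).norm_axis hd), e1,
      e1] at h1
    have h2 : ‖η a‖⁻¹ * offLine ((box a).axis hd) (η a) ≤ 8 * (d * |lam|) * 2 ^ l := by
      rw [inv_mul_le_iff₀ hηn]
      calc _ ≤ 2 ^ κ * 2 ^ l * (d * |lam|) := h.offLine_axis_le hd (hη a ha)
        _ ≤ (8 * ‖η a‖) * 2 ^ l * (d * |lam|) := by gcongr; exact hlb a ha
        _ = _ := by ring
    have h3 : ‖η a‖⁻¹ * offLine (dir v) (η a) ≤ K * 2 ^ l := by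
      rw [inv_mul_le_iff₀ hηn]
      refine (hchord a ha).trans ?_
      have h4 : (2 : ℝ) ^ (κ - min k₁ k₂) ≤ 1 :=
        zpow_le_one_of_nonpos₀ (by norm_num) (by have := hk.le₁; have := hk.le₂; omega)
      gcongr
      exact mul_le_of_le_one_right hθ0.le h4
    calc _ ≤ _ := h1
      _ ≤ (8 * (d * |lam|) + K) * 2 ^ l := by linarith
      _ ≤ _ := by
          refine mul_le_mul_of_nonneg_right ?_ hθ0.le
          rw [hC']; linarith

end family

variable {E₁ E₂ E₀ : Type*}
  [NormedAddCommGroup E₁] [NormedSpace ℂ E₁] [NormedAddCommGroup E₂] [NormedSpace ℂ E₂]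
  [NormedAddCommGroup E₀] [NormedSpace ℂ E₀]

/-- The cutoffs of a box family decompose every symbol. -/
lemma exists_boxDecomp (d : ℕ) (hd : 2 ≤ d) (lam : ℝ) (M : ℕ) (C : ℝ) (hC : 0 ≤ C) :
    ∃ N : ℕ, ∀ {ι : Type} {κ k₀ k₁ k₂ j : ℤ} {l : ℝ} {D : ℕ → ℝ} {box : ι → FreqBox d}
      {s₀ s₁ s₂ : ℤˣ}, IsBoxFamily κ l lam M D box → l ≤ 0 →
      (2 : ℝ) ^ j ≤ C * 2 ^ κ * ((2 : ℝ) ^ l) ^ 2 → FreqTriple κ k₀ k₁ k₂ →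
      ∀ {A : ℝ≥0∞} {m : Sp d → Sp d → Bil E₁ E₂ E₀} {Ma : ι → Sp d → Sp d → Bil E₁ E₂ E₀},
      (∀ a, BddSymbol (Ma a)) → (∀ a, SliceBound (Ma a) A) →
      (∀ a, ∀ ξ η, (box a).cutoff η ≠ 0 → Compat k₀ k₁ k₂ j s₀ s₁ s₂ ξ η → m ξ η = Ma a ξ η) →
      ∃ fin : Finset ι, BoxDecomp N A k₀ k₁ k₂ j s₀ s₁ s₂ m fin (fun a => (box a).cutoff) Ma := by
  obtain ⟨N, hN⟩ := exists_card_le_of_compat d hd lam M C hC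
  refine ⟨N, ?_⟩
  intro ι κ k₀ k₁ k₂ j l D box s₀ s₁ s₂ h hl hj hk A m Ma hb hs ha
  classical
  have hfin := h.finite_meet hl (2 ^ (k₂ + 2))
  refine ⟨hfin.toFinset, h.smooth, fun a => ?_, fun η h1 h2 => ?_, hb, hs, ha, ?_⟩
  · exact HasCompactSupport.of_support_subset_isCompact ((box a).isCompact_dilate κ l lam) (h.supp a)
  · have h3 : (2 : ℝ) ^ (κ - 2) ≤ ‖η‖ :=
      (zpow_le_zpow_right₀ (by norm_num) (by have := hk.le₂; omega)).trans h1
    refine (hasSum_sum_of_ne_finset_zero (f := fun a => (box a).cutoff η) fun a ha => ?_).unique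
      (h.sum_one η h3)
    by_contra h4
    exact ha (hfin.mem_toFinset.2 ⟨η, h.supp a h4, h2⟩)
  · have e : ∀ P : ι → Prop, {a | a ∈ hfin.toFinset ∧ P a}.ncard =
        (hfin.toFinset.filter P).card := by
      intro P
      rw [← ncard_coe_finset]
      congr 1; ext a; simp
    -- The larger of `ξ` and `ξ + η` is held fixed. In the second case `ξ = ζ + (-η)`, so the roles
    -- of the output and of the first input are exchanged.
    rcases le_total k₀ k₁ with h01 | h10
    · left
      intro ξ
      rw [e]
      have : ∀ a : ι, ∃ η, ξ ∈ inSet k₀ k₁ k₂ j s₀ s₁ s₂ (box a).cutoff →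
          (box a).cutoff η ≠ 0 ∧ Compat k₀ k₁ k₂ j s₀ s₁ s₂ ξ η := by
        intro a
        by_cases hξ : ξ ∈ inSet k₀ k₁ k₂ j s₀ s₁ s₂ (box a).cutoff
        · obtain ⟨η, hη⟩ := hξ
          exact ⟨η, fun _ => hη⟩
        · exact ⟨0, fun h => absurd h hξ⟩
      choose η hη using this
      refine hN (s₀ := s₀) (s₁ := s₁) (s₂ := s₂) h hl hj hk h01 _ ξ η 1 (by norm_num) ?_ ?_
      · exact fun a ha => h.supp a (hη a (Finset.mem_filter.1 ha).2).1
      · intro a ha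
        rw [one_smul]
        exact (hη a (Finset.mem_filter.1 ha).2).2
    · right
      intro ζ
      rw [e]
      have : ∀ a : ι, ∃ η, ζ ∈ outSet k₀ k₁ k₂ j s₀ s₁ s₂ (box a).cutoff →
          (box a).cutoff η ≠ 0 ∧ Compat k₀ k₁ k₂ j s₀ s₁ s₂ (ζ - η) η := by
        intro a
        by_cases hξ : ζ ∈ outSet k₀ k₁ k₂ j s₀ s₁ s₂ (box a).cutoff
        · obtain ⟨η, hη⟩ := hξ
          exact ⟨η, fun _ => hη⟩
        · exact ⟨0, fun h => absurd h hξ⟩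
      choose η hη using this
      refine hN (s₀ := s₁) (s₁ := s₀) (s₂ := -s₂) h hl hj hk.rotate h10 _ ζ η (-1) (by norm_num)
        ?_ ?_
      · exact fun a ha => h.supp a (hη a (Finset.mem_filter.1 ha).2).1
      · intro a ha
        have := (hη a (Finset.mem_filter.1 ha).2).2.rotate
        rw [sub_add_cancel] at this
        rwa [neg_one_smul]

end resonant

end MDNull

end

noncomputable section

namespace MDNull

/-! ### Radial derivatives and angular slices -/

section radial

variable {d : ℕ} {F : Type*} [NormedAddCommGroup F] [NormedSpace ℝ F]

/-- The radial derivative `η · ∂_η`. -/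
def radialDeriv (f : Sp d → F) (η : Sp d) : F := fderiv ℝ f η η

lemma contDiffAt_of_punctured {f : Sp d → F} (hf : ContDiffOn ℝ ∞ f {0}ᶜ) {η : Sp d} (hη : η ≠ 0) :
    ContDiffAt ℝ ∞ f η :=
  hf.contDiffAt (isOpen_compl_singleton.mem_nhds hη)

lemma contDiffOn_radialDeriv {f : Sp d → F} (hf : ContDiffOn ℝ ∞ f {0}ᶜ) :
    ContDiffOn ℝ ∞ (radialDeriv f) {0}ᶜ := fun η hη =>
  (((contDiffAt_of_punctured hf hη).fderiv_right (m := ∞) (by simp)).clm_apply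
    contDiffAt_id).contDiffWithinAt

lemma contDiffOn_radialDeriv_iterate {f : Sp d → F} (hf : ContDiffOn ℝ ∞ f {0}ᶜ) (n : ℕ) :
    ContDiffOn ℝ ∞ (radialDeriv^[n] f) {0}ᶜ := by
  induction n with
  | zero => exact hf
  | succ n ih => rw [Function.iterate_succ_apply']; exact contDiffOn_radialDeriv ih

/-- With `T_n f(η) = D^n f(η)(η, …, η)`, one has `T_{n+1} = (η · ∂_η - n) T_n`: along the ray
`t ↦ (1 + t) η` the function `T_n f` is `(1 + t)^n D^n f((1 + t) η)(η, …, η)`. -/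
lemma iteratedFDeriv_succ_radial {f : Sp d → F} (hf : ContDiffOn ℝ ∞ f {0}ᶜ) (n : ℕ) {η : Sp d}
    (hη : η ≠ 0) :
    iteratedFDeriv ℝ (n + 1) f η (fun _ => η) =
      radialDeriv (fun y => iteratedFDeriv ℝ n f y (fun _ => y)) η -
        (n : ℝ) • iteratedFDeriv ℝ n f η (fun _ => η) := by
  have hf' := contDiffAt_of_punctured hf hη
  have hD : DifferentiableAt ℝ (iteratedFDeriv ℝ n f) η :=
    hf'.differentiableAt_iteratedFDeriv (by exact_mod_cast ENat.natCast_lt_top n)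
  have hT : DifferentiableAt ℝ (fun y => iteratedFDeriv ℝ n f y (fun _ => y)) η := by
    have h1 := hD.hasFDerivAt.continuousMultilinearMap_apply (g := fun (_ : Fin n) (y : Sp d) => y)
      (g' := fun _ => ContinuousLinearMap.id ℝ (Sp d)) (fun _ => hasFDerivAt_id η)
    exact h1.differentiableAt
  have hline : HasDerivAt (fun t : ℝ => η + t • η) η 0 := by
    simpa using ((hasDerivAt_id (0 : ℝ)).smul_const η).const_add η
  have hz : η + (0 : ℝ) • η = η := by simp
  have e1 : HasDerivAt (fun t : ℝ => iteratedFDeriv ℝ n f (η + t • η) (fun _ => η + t • η))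
      (radialDeriv (fun y => iteratedFDeriv ℝ n f y (fun _ => y)) η) 0 := by
    have := HasFDerivAt.comp_hasDerivAt_of_eq (0 : ℝ) (y := η) hT.hasFDerivAt hline hz.symm
    exact this
  have e2 : HasDerivAt (fun t : ℝ => iteratedFDeriv ℝ n f (η + t • η) (fun _ => η + t • η))
      (iteratedFDeriv ℝ (n + 1) f η (fun _ => η) +
        (n : ℝ) • iteratedFDeriv ℝ n f η (fun _ => η)) 0 := by
    have h1 : (fun t : ℝ => iteratedFDeriv ℝ n f (η + t • η) (fun _ => η + t • η)) =
        fun t : ℝ => (1 + t) ^ n • iteratedFDeriv ℝ n f (η + t • η) (fun _ => η) := by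
      funext t
      have : (fun _ : Fin n => η + t • η) = fun i : Fin n => (fun _ => (1 + t)) i • (fun _ => η) i := by
        funext i; simp [add_smul]
      rw [this, ContinuousMultilinearMap.map_smul_univ]
      simp
    rw [h1]
    have h2 : HasDerivAt (fun t : ℝ => iteratedFDeriv ℝ n f (η + t • η))
        (fderiv ℝ (iteratedFDeriv ℝ n f) η η) 0 :=
      HasFDerivAt.comp_hasDerivAt_of_eq (0 : ℝ) (y := η) hD.hasFDerivAt hline hz.symm
    have h3 : HasDerivAt (fun t : ℝ => iteratedFDeriv ℝ n f (η + t • η) (fun _ => η))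
        (fderiv ℝ (iteratedFDeriv ℝ n f) η η (fun _ => η)) 0 :=
      ((ContinuousMultilinearMap.apply ℝ (fun _ : Fin n => Sp d) F
        (fun _ => η)).hasFDerivAt).comp_hasDerivAt (0 : ℝ) h2
    have h4 : HasDerivAt (fun t : ℝ => (1 + t) ^ n) (n : ℝ) 0 := by
      have := ((hasDerivAt_id (0 : ℝ)).const_add 1).fun_pow n
      simpa using this
    have h5 := h4.smul h3
    simp only [zero_smul, add_zero, one_pow, one_smul] at h5
    rw [iteratedFDeriv_succ_apply_left]
    exact h5
  rw [e1.unique e2]; simp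

/-- `D^n f(η)(η, …, η)` is a universal linear combination of iterated radial derivatives. -/
lemma exists_iteratedFDeriv_radial_eq (d : ℕ) (F : Type*) [NormedAddCommGroup F] [NormedSpace ℝ F]
    (n : ℕ) : ∃ c : ℕ → ℝ, ∀ f : Sp d → F, ContDiffOn ℝ ∞ f {0}ᶜ →
      ∀ η : Sp d, η ≠ 0 → iteratedFDeriv ℝ n f η (fun _ => η) =
        ∑ k ∈ Finset.range (n + 1), c k • (radialDeriv^[k] f) η := by
  induction n with
  | zero => exact ⟨fun _ => 1, fun f _ η _ => by simp⟩
  | succ n ih =>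
    obtain ⟨c, hc⟩ := ih
    refine ⟨fun k => (if k = 0 then 0 else c (k - 1)) - (n : ℝ) * (if k ≤ n then c k else 0), ?_⟩
    intro f hf η hη
    have hev : (fun y => iteratedFDeriv ℝ n f y (fun _ => y)) =ᶠ[nhds η]
        fun y => ∑ k ∈ Finset.range (n + 1), c k • (radialDeriv^[k] f) y := by
      filter_upwards [isOpen_compl_singleton.mem_nhds hη] with y hy using hc f hf y hy
    have hs : radialDeriv (fun y => iteratedFDeriv ℝ n f y (fun _ => y)) η =
        ∑ k ∈ Finset.range (n + 1), c k • (radialDeriv^[k + 1] f) η := by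
      unfold radialDeriv
      rw [hev.fderiv_eq, fderiv_fun_sum]
      · rw [sum_apply]
        refine Finset.sum_congr rfl fun k _ => ?_
        have hk := (contDiffAt_of_punctured (contDiffOn_radialDeriv_iterate hf k) hη
          ).differentiableAt (by simp)
        rw [Function.iterate_succ_apply']
        erw [fderiv_const_smul hk]
        rfl
      · intro k _
        exact ((contDiffAt_of_punctured (contDiffOn_radialDeriv_iterate hf k) hη
          ).differentiableAt (by simp)).const_smul _
    rw [iteratedFDeriv_succ_radial hf n hη, hs, hc f hf η hη]
    simp only [sub_smul, Finset.sum_sub_distrib]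
    congr 1
    · rw [Finset.sum_range_succ' _ (n + 1)]
      simp
    · rw [Finset.sum_range_succ _ (n + 1), if_neg (by omega), mul_zero, zero_smul, add_zero,
        Finset.smul_sum]
      refine Finset.sum_congr rfl fun k hk => ?_
      rw [if_pos (by have := Finset.mem_range.1 hk; omega), mul_smul]

/-- The bounds on `η ↦ n(q, η)` that are contained in the definition of a null symbol. -/
structure IsAngular (A B : ℕ → ℝ) (n : Sp d → Sp d → F) : Prop where
  smooth : ContDiffOn ℝ ∞ (fun p : Sp d × Sp d => n p.1 p.2) {p | p.1 ≠ 0 ∧ p.2 ≠ 0}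
  angle_bound : ∀ i, ∀ q η : Sp d, q ≠ 0 → η ≠ 0 →
    ‖(radialDeriv^[i] (n q)) η‖ ≤ A i * InnerProductGeometry.angle q η
  deriv_bound : ∀ i, ∀ q η : Sp d, q ≠ 0 → η ≠ 0 →
    ‖iteratedFDeriv ℝ i (n q) η‖ ≤ B i * (‖η‖ ^ i)⁻¹

lemma IsAngular.contDiffOn {A B : ℕ → ℝ} {n : Sp d → Sp d → F} (h : IsAngular A B n) {q : Sp d}
    (hq : q ≠ 0) : ContDiffOn ℝ ∞ (n q) {0}ᶜ :=
  h.smooth.comp (f := fun η => (q, η)) (by fun_prop) fun _ hη => ⟨hq, hη⟩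

/-- The angle is at most twice the chord, from `cos α ≤ 1 - 2 α² / π²`. -/
lemma angle_le_norm_dir_sub {q x : Sp d} (hq : q ≠ 0) (hx : x ≠ 0) :
    InnerProductGeometry.angle q x ≤ 2 * ‖dir q - dir x‖ := by
  set α := InnerProductGeometry.angle q x with hα
  have h0 : 0 ≤ α := InnerProductGeometry.angle_nonneg _ _
  have h1 : α ≤ Real.pi := InnerProductGeometry.angle_le_pi _ _
  have h2 : Real.cos α ≤ 1 - 2 / Real.pi ^ 2 * α ^ 2 :=
    Real.cos_le_one_sub_mul_cos_sq (by rwa [abs_of_nonneg h0])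
  have h3 : ‖dir q - dir x‖ ^ 2 = 2 - 2 * Real.cos α := by
    rw [norm_sub_sq_real, norm_dir hq, norm_dir hx, hα, InnerProductGeometry.cos_angle, dir, dir,
      inner_smul_left, inner_smul_right]
    simp only [conj_trivial]
    have := norm_ne_zero_iff.2 hq
    have := norm_ne_zero_iff.2 hx
    field_simp
    ring
  refine abs_le_of_sq_le_sq' ?_ (by positivity) |>.2
  rw [mul_pow, h3]
  have hpi : Real.pi ^ 2 ≤ 16 := by nlinarith [Real.pi_le_four, Real.pi_pos]
  have h4 : α ^ 2 / 8 ≤ 2 / Real.pi ^ 2 * α ^ 2 := by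
    rw [div_eq_mul_one_div, mul_comm]
    refine mul_le_mul_of_nonneg_right ?_ (sq_nonneg _)
    rw [div_le_div_iff₀ (by norm_num) (by positivity)]
    linarith
  nlinarith

/-- A multilinear map that is small on the diagonal of `x` is small on vectors that are nearly
parallel to `x`. -/
lemma norm_apply_le_of_nearly_parallel {i : ℕ}
    (D : ContinuousMultilinearMap ℝ (fun _ : Fin i => Sp d) F) {x : Sp d} {R g b t : ℝ}
    (hR : 0 ≤ R) (hg : 0 ≤ g) (hx : x ≠ 0) (hb0 : 0 ≤ b) (hb : ‖D‖ ≤ b * (‖x‖ ^ i)⁻¹)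
    (ht : ‖D (fun _ => x)‖ ≤ t * g)
    (v : Fin i → Sp d) (hv : ∀ j, ‖v j‖ ≤ R * ‖x‖) (ho : ∀ j, offLine (dir x) (v j) ≤ R * g * ‖x‖) :
    ‖D v‖ ≤ (R ^ i * t + b * i * R ^ i) * g := by
  have hxn : 0 < ‖x‖ := norm_pos_iff.2 hx
  set α : Fin i → ℝ := fun j => ‖x‖⁻¹ * inner ℝ (dir x) (v j) with hα
  set w : Fin i → Sp d := fun j => α j • x with hw
  have hw' : ∀ j, w j = (inner ℝ (dir x) (v j) : ℝ) • dir x := fun j => by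
    simp only [hw, hα, dir, smul_smul]
    congr 1; ring
  have hα1 : ∀ j, |α j| ≤ R := fun j => by
    have := abs_real_inner_le_norm (dir x) (v j)
    rw [norm_dir hx, one_mul] at this
    rw [hα, abs_mul, abs_inv, abs_norm, inv_mul_le_iff₀ hxn, mul_comm]
    exact this.trans (hv j)
  have hwn : ∀ j, ‖w j‖ ≤ R * ‖x‖ := fun j => by
    simp only [hw]
    rw [norm_smul, Real.norm_eq_abs]
    exact mul_le_mul_of_nonneg_right (hα1 j) hxn.le
  have h1 : ‖D w‖ ≤ R ^ i * (t * g) := by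
    have : D w = (∏ j, α j) • D (fun _ => x) := D.map_smul_univ α (fun _ => x)
    rw [this, norm_smul, norm_prod]
    refine mul_le_mul ?_ ht (norm_nonneg _) (by positivity)
    calc ∏ j, ‖α j‖ ≤ ∏ _j : Fin i, R := Finset.prod_le_prod (fun _ _ => norm_nonneg _)
          fun j _ => hα1 j
      _ = R ^ i := by simp
  have h2 : ‖D v - D w‖ ≤ b * i * R ^ i * g := by
    have h3 := D.norm_image_sub_le v w
    rw [Fintype.card_fin] at h3
    have h4 : ‖v‖ ≤ R * ‖x‖ := (pi_norm_le_iff_of_nonneg (by positivity)).2 hv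
    have h5 : ‖w‖ ≤ R * ‖x‖ := (pi_norm_le_iff_of_nonneg (by positivity)).2 hwn
    have h6 : ‖v - w‖ ≤ R * g * ‖x‖ := by
      refine (pi_norm_le_iff_of_nonneg (by positivity)).2 fun j => ?_
      rw [Pi.sub_apply, hw']
      exact ho j
    rcases Nat.eq_zero_or_pos i with rfl | hi
    · simpa using h3
    calc ‖D v - D w‖ ≤ _ := h3
      _ ≤ (b * (‖x‖ ^ i)⁻¹) * i * (R * ‖x‖) ^ (i - 1) * (R * g * ‖x‖) := by
          gcongr
          exact max_le h4 h5
      _ = b * i * g * ((R * ‖x‖) ^ (i - 1) * (R * ‖x‖)) * (‖x‖ ^ i)⁻¹ := by ring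
      _ = b * i * R ^ i * g := by
          rw [← pow_succ, Nat.sub_add_cancel hi, mul_pow]
          field_simp
  calc ‖D v‖ = ‖D w + (D v - D w)‖ := by simp
    _ ≤ ‖D w‖ + ‖D v - D w‖ := norm_add_le _ _
    _ ≤ R ^ i * (t * g) + b * i * R ^ i * g := add_le_add h1 h2
    _ = _ := by ring

lemma ContinuousMultilinearMap.opNorm_le_of_unit {i : ℕ}
    (D : ContinuousMultilinearMap ℝ (fun _ : Fin i => Sp d) F) {C : ℝ} (hC : 0 ≤ C)
    (h : ∀ v : Fin i → Sp d, (∀ j, ‖v j‖ ≤ 1) → ‖D v‖ ≤ C) : ‖D‖ ≤ C := by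
  refine D.opNorm_le_bound hC fun v => ?_
  have e : v = fun j => ‖v j‖ • dir (v j) := by funext j; rw [norm_smul_dir]
  have h1 : D v = (∏ j, ‖v j‖) • D (fun j => dir (v j)) := by
    conv_lhs => rw [e]
    exact D.map_smul_univ _ _
  rw [h1, norm_smul, norm_prod, mul_comm]
  simp only [norm_norm]
  refine mul_le_mul_of_nonneg_right (h _ fun j => ?_) (by positivity)
  rcases eq_or_ne (v j) 0 with h0 | h0
  · simp [h0, dir]
  · exact (norm_dir h0).le

lemma iteratedFDeriv_comp_affine {f : Sp d → F} (hf : ContDiffOn ℝ ∞ f {0}ᶜ)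
    (Z : Sp d →L[ℝ] Sp d) (p z : Sp d) (h : p + Z z ≠ 0) (i : ℕ) (v : Fin i → Sp d) :
    iteratedFDeriv ℝ i (fun z => f (p + Z z)) z v =
      iteratedFDeriv ℝ i f (p + Z z) (fun j => Z (v j)) := by
  set s : Set (Sp d) := {y | p + y ≠ 0} with hs
  have hso : IsOpen s := isOpen_ne_fun (by fun_prop) continuous_const
  have hsz : IsOpen (Z ⁻¹' s) := hso.preimage Z.continuous
  have hg : ContDiffOn ℝ ∞ (fun y => f (p + y)) s :=
    hf.comp (f := fun y => p + y) (by fun_prop) fun y hy => hy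
  have h1 := Z.iteratedFDerivWithin_comp_right (i := i) hg hso.uniqueDiffOn hsz.uniqueDiffOn
    (x := z) h (by exact_mod_cast le_top)
  rw [iteratedFDerivWithin_of_isOpen i hsz h, iteratedFDerivWithin_of_isOpen i hso h,
    iteratedFDeriv_comp_add_left] at h1
  have h2 := congrArg (fun D => D v) h1
  exact h2

/-- In the scale of a box that is angularly close to `q`, all derivatives of `n(q, ·)` gain the
angle: those in radial direction by the radial bounds, the others because the box is thin. -/
lemma exists_iteratedFDeriv_angular_le (d : ℕ) (F : Type*) [NormedAddCommGroup F]
    [NormedSpace ℝ F] (A B : ℕ → ℝ) (R : ℝ) (hR : 0 ≤ R) (i : ℕ) :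
    ∃ C : ℝ, 0 ≤ C ∧ ∀ {n : Sp d → Sp d → F}, IsAngular A B n →
      ∀ {q p z : Sp d} {Z : Sp d →L[ℝ] Sp d} {g : ℝ}, 0 ≤ g → q ≠ 0 → p + Z z ≠ 0 →
      ‖dir q - dir (p + Z z)‖ ≤ R * g →
      (∀ v, ‖Z v‖ ≤ R * ‖p + Z z‖ * ‖v‖) →
      (∀ v, offLine (dir (p + Z z)) (Z v) ≤ R * g * ‖p + Z z‖ * ‖v‖) →
      ‖iteratedFDeriv ℝ i (fun z => n q (p + Z z)) z‖ ≤ C * g := by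
  obtain ⟨c, hc⟩ := exists_iteratedFDeriv_radial_eq d F i
  set t : ℝ := ∑ k ∈ Finset.range (i + 1), |c k| * (|A k| * (2 * R)) with ht
  have ht0 : 0 ≤ t := Finset.sum_nonneg fun k _ => by positivity
  refine ⟨R ^ i * t + |B i| * i * R ^ i, by positivity, ?_⟩
  intro n hn q p z Z g hg hq hx hdir h1 h2
  set x := p + Z z with hxdef
  have hxn : 0 < ‖x‖ := norm_pos_iff.2 hx
  refine ContinuousMultilinearMap.opNorm_le_of_unit _ (by positivity) fun v hv => ?_
  rw [iteratedFDeriv_comp_affine (hn.contDiffOn hq) Z p z hx]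
  refine norm_apply_le_of_nearly_parallel (b := |B i|) _ hR hg hx (abs_nonneg _) ?_ ?_ _ ?_ ?_
  · refine (hn.deriv_bound i q x hq hx).trans ?_
    gcongr
    exact le_abs_self _
  · rw [hc _ (hn.contDiffOn hq) x hx, ht, Finset.sum_mul]
    refine (norm_sum_le _ _).trans (Finset.sum_le_sum fun k _ => ?_)
    rw [norm_smul, Real.norm_eq_abs, mul_assoc]
    refine mul_le_mul_of_nonneg_left ?_ (abs_nonneg _)
    refine (hn.angle_bound k q x hq hx).trans ?_
    have h3 := angle_le_norm_dir_sub hq hx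
    have h4 := InnerProductGeometry.angle_nonneg q x
    calc A k * InnerProductGeometry.angle q x ≤ |A k| * InnerProductGeometry.angle q x :=
          mul_le_mul_of_nonneg_right (le_abs_self _) h4
      _ ≤ |A k| * (2 * (R * g)) := by
          refine mul_le_mul_of_nonneg_left (h3.trans ?_) (abs_nonneg _)
          linarith
      _ = _ := by ring
  · intro j
    refine (h1 _).trans ?_
    exact mul_le_of_le_one_right (by positivity) (hv j)
  · intro j
    refine (h2 _).trans ?_
    exact mul_le_of_le_one_right (by positivity) (hv j)

end radial

section complexified

variable {d : ℕ} {E₁ E₂ E₀ : Type*}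
  [NormedAddCommGroup E₁] [NormedSpace ℂ E₁] [NormedAddCommGroup E₂] [NormedSpace ℂ E₂]
  [NormedAddCommGroup E₀] [NormedSpace ℂ E₀]

lemma radialDerivSnd_iterate (m : Sp d → Sp d → Bil E₁ E₂ E₀) (i : ℕ) (ξ : Sp d) :
    (radialDerivSnd^[i] m) ξ = radialDeriv^[i] (m ξ) := by
  induction i with
  | zero => rfl
  | succ i ih =>
    rw [Function.iterate_succ_apply', Function.iterate_succ_apply', ← ih]
    rfl

lemma IsNullSymbol.isAngular {A B : ℕ → ℕ → ℝ} {m : Sp d → Sp d → Bil E₁ E₂ E₀}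
    (h : IsNullSymbol A B m) : IsAngular (A 0) (B 0) m where
  smooth := h.smooth
  angle_bound i q η hq hη := by
    have := h.angle_bound 0 i q η hq hη
    rwa [Function.iterate_zero, id, radialDerivSnd_iterate] at this
  deriv_bound i q η hq hη := by
    have := h.deriv_bound 0 i q η hq hη
    rwa [norm_iteratedFDeriv_zero, pow_zero, inv_one, mul_one] at this

end complexified

end MDNull

end

noncomputable section

namespace MDNull

/-! ### Alignment of frequencies in a thin box -/

section aligned

variable {d : ℕ}

lemma norm_dir_sub_dir_le {x y : Sp d} (hx : x ≠ 0) : ‖dir y - dir x‖ ≤ 2 * (‖y - x‖ / ‖x‖) := by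
  have hxn : 0 < ‖x‖ := norm_pos_iff.2 hx
  have e : dir y - dir x = ‖x‖⁻¹ • (y - x) + (‖x‖⁻¹ * (‖x‖ - ‖y‖)) • dir y := by
    rw [mul_sub, sub_smul, inv_mul_cancel₀ hxn.ne', one_smul, mul_smul, norm_smul_dir]
    simp only [dir, smul_sub]
    abel
  have h1 : ‖dir y‖ ≤ 1 := by
    rcases eq_or_ne y 0 with rfl | hy
    · simp [dir]
    · exact (norm_dir hy).le
  rw [e]
  refine (norm_add_le _ _).trans ?_
  rw [norm_smul, norm_smul, norm_mul, norm_inv, norm_norm, Real.norm_eq_abs]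
  have h2 : |‖x‖ - ‖y‖| ≤ ‖y - x‖ := by rw [norm_sub_rev]; exact abs_norm_sub_norm_le x y
  calc ‖x‖⁻¹ * ‖y - x‖ + ‖x‖⁻¹ * |‖x‖ - ‖y‖| * ‖dir y‖
      ≤ ‖x‖⁻¹ * ‖y - x‖ + ‖x‖⁻¹ * ‖y - x‖ * 1 := by gcongr
    _ = _ := by ring

lemma dir_smul_of_pos {c : ℝ} (hc : 0 < c) (x : Sp d) : dir (c • x) = dir x := by
  rw [dir, dir, norm_smul, Real.norm_eq_abs, abs_of_pos hc, smul_smul, mul_inv_rev, mul_assoc,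
    inv_mul_cancel₀ hc.ne', mul_one]

/-- A displacement along `x` does not change the direction of `x`. -/
lemma norm_dir_add_sub_le {x δ : Sp d} (hx : x ≠ 0) (hδ : ‖δ‖ ≤ ‖x‖ / 2) :
    ‖dir (x + δ) - dir x‖ ≤ 4 * (offLine (dir x) δ / ‖x‖) := by
  have hxn : 0 < ‖x‖ := norm_pos_iff.2 hx
  set a : ℝ := inner ℝ (dir x) δ with ha
  set w : Sp d := δ - a • dir x with hw
  set c : ℝ := 1 + ‖x‖⁻¹ * a with hc
  have ha1 : |a| ≤ ‖x‖ / 2 := by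
    have := abs_real_inner_le_norm (dir x) δ
    rw [norm_dir hx, one_mul] at this
    exact this.trans hδ
  have hc1 : 1 / 2 ≤ c := by
    have h1 : |‖x‖⁻¹ * a| ≤ 1 / 2 := by
      rw [abs_mul, abs_inv, abs_norm, inv_mul_le_iff₀ hxn]; linarith
    have := (abs_le.1 h1).1
    rw [hc]; linarith
  have hc0 : 0 < c := by linarith
  have e : x + δ = c • (x + c⁻¹ • w) := by
    rw [smul_add, smul_smul, mul_inv_cancel₀ hc0.ne', one_smul, hw, hc, add_smul, one_smul, dir,
      smul_smul, mul_comm a]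
    abel
  rw [e, dir_smul_of_pos hc0]
  refine (norm_dir_sub_dir_le hx).trans ?_
  rw [add_sub_cancel_left, norm_smul, norm_inv, Real.norm_eq_abs, abs_of_pos hc0]
  have h2 : c⁻¹ ≤ 2 := by rw [inv_le_comm₀ hc0 (by norm_num)]; linarith
  calc 2 * (c⁻¹ * ‖w‖ / ‖x‖) ≤ 2 * (2 * ‖w‖ / ‖x‖) := by gcongr
    _ = 4 * (‖w‖ / ‖x‖) := by ring

/-- The frequency `x`, which moves in a box with sides `r` along `e` and `r θ` across, makes an
angle `≲ g` with `q`, and so does the box as seen from the origin. -/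
structure Aligned (S R g r θ : ℝ) (e q x : Sp d) : Prop where
  ne_q : q ≠ 0
  ne_x : x ≠ 0
  size : r ≤ S * ‖x‖
  thin : r * θ ≤ R * g * ‖x‖
  axis : r * offLine e x ≤ R * g * ‖x‖ ^ 2
  near : ‖dir q - dir x‖ ≤ R * g

/-- The linear map `Z` takes the unit ball to a box with sides `r` along `e` and `r θ` across. -/
structure IsThin (r θ : ℝ) (e : Sp d) (Z : Sp d →L[ℝ] Sp d) : Prop where
  norm_le : ∀ v, ‖Z v‖ ≤ r * ‖v‖
  offLine_le : ∀ v, offLine e (Z v) ≤ r * θ * ‖v‖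

variable {S R g r θ : ℝ} {e q x : Sp d} {Z : Sp d →L[ℝ] Sp d}

lemma Aligned.offLine_dir_le (h : Aligned S R g r θ e q x) (hZ : IsThin r θ e Z) (he : ‖e‖ = 1)
    (v : Sp d) :
    offLine (dir x) (Z v) ≤ 2 * R * g * ‖x‖ * ‖v‖ := by
  have hxn : 0 < ‖x‖ := norm_pos_iff.2 h.ne_x
  have h1 := offLine_le_add (norm_dir h.ne_x) he (Z v)
  have h2 : offLine (dir x) e = ‖x‖⁻¹ * offLine e x := by
    rw [offLine_comm (norm_dir h.ne_x) he, dir, offLine_smul, abs_of_pos (by positivity)]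
  have h3 : r * (‖x‖⁻¹ * offLine e x) ≤ R * g * ‖x‖ := by
    rw [mul_left_comm, inv_mul_le_iff₀ hxn]
    calc _ ≤ _ := h.axis
      _ = _ := by ring
  calc offLine (dir x) (Z v) ≤ offLine e (Z v) + ‖Z v‖ * offLine (dir x) e := h1
    _ ≤ r * θ * ‖v‖ + r * ‖v‖ * (‖x‖⁻¹ * offLine e x) := by
        rw [h2]
        exact add_le_add (hZ.offLine_le v) (mul_le_mul_of_nonneg_right (hZ.norm_le v)
          (mul_nonneg (by positivity) (offLine_nonneg _ _)))
    _ = (r * θ + r * (‖x‖⁻¹ * offLine e x)) * ‖v‖ := by ring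
    _ ≤ (R * g * ‖x‖ + R * g * ‖x‖) * ‖v‖ := by
        refine mul_le_mul_of_nonneg_right (add_le_add h.thin h3) (norm_nonneg _)
    _ = _ := by ring

/-- Alignment persists under displacements that are small in the scale of the box. -/
lemma Aligned.perturb (h : Aligned S R g r θ e q x) (hZ : IsThin r θ e Z) (he : ‖e‖ = 1)
    (hS : 1 ≤ S) (hR : 0 ≤ R) (hg : 0 ≤ g) (hr : 0 ≤ r) {δ : Sp d} (hδ : ‖δ‖ ≤ 1 / (4 * S)) :
    Aligned (2 * S) (8 * R) g r θ e q (x + Z δ) := by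
  have hxn : 0 < ‖x‖ := norm_pos_iff.2 h.ne_x
  have hδS : S * ‖δ‖ ≤ 1 / 4 := by
    rw [le_div_iff₀ (by positivity)] at hδ; linarith
  have hδ1 : ‖δ‖ ≤ 1 / 4 := by nlinarith [norm_nonneg δ]
  have hZδ : ‖Z δ‖ ≤ ‖x‖ / 4 := by
    calc ‖Z δ‖ ≤ r * ‖δ‖ := hZ.norm_le δ
      _ ≤ S * ‖x‖ * ‖δ‖ := by gcongr; exact h.size
      _ = ‖x‖ * (S * ‖δ‖) := by ring
      _ ≤ ‖x‖ * (1 / 4) := by gcongr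
      _ = _ := by ring
  have hy : ‖x‖ ≤ 4 / 3 * ‖x + Z δ‖ := by
    have : ‖x‖ ≤ ‖x + Z δ‖ + ‖Z δ‖ := by
      simpa using norm_sub_le (x + Z δ) (Z δ)
    linarith
  have hRg : 0 ≤ R * g := by positivity
  have hy2 : ‖x‖ ^ 2 ≤ 16 / 9 * ‖x + Z δ‖ ^ 2 := by
    calc ‖x‖ ^ 2 ≤ (4 / 3 * ‖x + Z δ‖) ^ 2 := by gcongr
      _ = _ := by ring
  refine ⟨h.ne_q, ?_, ?_, ?_, ?_, ?_⟩
  · rw [← norm_pos_iff]; linarith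
  · refine h.size.trans ?_
    nlinarith [norm_nonneg (x + Z δ)]
  · refine h.thin.trans ?_
    nlinarith [norm_nonneg (x + Z δ), mul_le_mul_of_nonneg_left hy hRg]
  · calc r * offLine e (x + Z δ) ≤ r * (offLine e x + r * θ * ‖δ‖) := by
          gcongr
          exact (offLine_add_le _ _ _).trans (by gcongr; exact hZ.offLine_le δ)
      _ = r * offLine e x + r * ‖δ‖ * (r * θ) := by ring
      _ ≤ R * g * ‖x‖ ^ 2 + ‖x‖ / 4 * (R * g * ‖x‖) := by
          have h1 : r * ‖δ‖ ≤ ‖x‖ / 4 := by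
            calc r * ‖δ‖ ≤ S * ‖x‖ * ‖δ‖ := by gcongr; exact h.size
              _ = ‖x‖ * (S * ‖δ‖) := by ring
              _ ≤ ‖x‖ * (1 / 4) := by gcongr
              _ = _ := by ring
          have h2 : r * ‖δ‖ * (r * θ) ≤ ‖x‖ / 4 * (R * g * ‖x‖) :=
            (mul_le_mul_of_nonneg_left h.thin (by positivity)).trans
              (mul_le_mul_of_nonneg_right h1 (by positivity))
          exact add_le_add h.axis h2
      _ = 5 / 4 * (R * g * ‖x‖ ^ 2) := by ring
      _ ≤ 5 / 4 * (R * g * (16 / 9 * ‖x + Z δ‖ ^ 2)) := by gcongr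
      _ ≤ 8 * R * g * ‖x + Z δ‖ ^ 2 := by
          have : 0 ≤ R * g * ‖x + Z δ‖ ^ 2 := by positivity
          nlinarith
  · have h1 := norm_dir_add_sub_le h.ne_x (hZδ.trans (by linarith))
    have h2 : offLine (dir x) (Z δ) / ‖x‖ ≤ 2 * R * g * (1 / 4) := by
      rw [div_le_iff₀ hxn]
      calc _ ≤ 2 * R * g * ‖x‖ * ‖δ‖ := h.offLine_dir_le hZ he δ
        _ ≤ 2 * R * g * ‖x‖ * (1 / 4) := by gcongr
        _ = _ := by ring
    calc ‖dir q - dir (x + Z δ)‖ = ‖(dir q - dir x) - (dir (x + Z δ) - dir x)‖ := by congr 1; abel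
      _ ≤ ‖dir q - dir x‖ + ‖dir (x + Z δ) - dir x‖ := norm_sub_le _ _
      _ ≤ R * g + 4 * (2 * R * g * (1 / 4)) := add_le_add h.near (h1.trans (by gcongr))
      _ ≤ _ := by nlinarith

/-- In a box that is aligned with `q`, all derivatives of `n(q, ·)` in the scale of the box gain
the angle. -/
lemma exists_iteratedFDeriv_aligned_le (d : ℕ) (F : Type*) [NormedAddCommGroup F]
    [NormedSpace ℝ F] (A B : ℕ → ℝ) (S R : ℝ) (hS : 1 ≤ S) (hR : 0 ≤ R) (N : ℕ) :
    ∃ C : ℝ, 0 ≤ C ∧ ∀ {n : Sp d → Sp d → F}, IsAngular A B n →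
      ∀ {e q p z₀ z : Sp d} {Z : Sp d →L[ℝ] Sp d} {g r θ : ℝ}, 0 ≤ g → 0 ≤ r → ‖e‖ = 1 →
      IsThin r θ e Z → Aligned S R g r θ e q (p + Z z₀) → ‖z - z₀‖ ≤ 1 / (4 * S) →
      p + Z z ≠ 0 ∧ ∀ i ≤ N, ‖iteratedFDeriv ℝ i (fun z => n q (p + Z z)) z‖ ≤ C * g := by
  have hR' : 0 ≤ 2 * S + 16 * R := by linarith
  choose C hC0 hC using fun i =>
    exists_iteratedFDeriv_angular_le d F A B (2 * S + 16 * R) hR' i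
  refine ⟨∑ i ∈ Finset.range (N + 1), C i, Finset.sum_nonneg fun i _ => hC0 i, ?_⟩
  intro n hn e q p z₀ z Z g r θ hg hr he hZ hal hz
  have hal' := hal.perturb hZ he hS hR hg hr hz
  have e1 : p + Z z₀ + Z (z - z₀) = p + Z z := by rw [map_sub]; abel
  rw [e1] at hal'
  refine ⟨hal'.ne_x, fun i hi => ?_⟩
  refine (hC i hn hg hal'.ne_q hal'.ne_x ?_ ?_ ?_).trans ?_
  · refine hal'.near.trans ?_
    gcongr; linarith
  · intro v
    refine (hZ.norm_le v).trans ?_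
    refine mul_le_mul_of_nonneg_right (hal'.size.trans ?_) (norm_nonneg _)
    gcongr; linarith
  · intro v
    refine (hal'.offLine_dir_le hZ he v).trans ?_
    gcongr; linarith
  · refine mul_le_mul_of_nonneg_right ?_ hg
    exact Finset.single_le_sum (fun j _ => hC0 j) (Finset.mem_range.2 (by omega))

end aligned

/-! ### Localized symbols as superpositions of modulations -/

section kernel

variable {d : ℕ}

/-- A smooth partition of unity on a compact set with supports of small diameter. -/
lemma exists_partition {K : Set (Sp d)} (hK : IsCompact K) {ε : ℝ} (hε : 0 < ε) :
    ∃ (J : Finset (Sp d)) (ψ : J → Sp d → ℝ), (∀ c, ContDiff ℝ ∞ (ψ c)) ∧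
      (∀ c, HasCompactSupport (ψ c)) ∧
      (∀ c, ∀ z ∈ tsupport (ψ c), ∀ z' ∈ tsupport (ψ c), ‖z - z'‖ ≤ ε) ∧
      ∀ z ∈ K, ∑ c, ψ c z = 1 := by
  obtain ⟨J, -, hJ⟩ := hK.elim_nhds_subcover (fun x => Metric.ball x (ε / 2))
    fun x _ => Metric.ball_mem_nhds x (by positivity)
  obtain ⟨f, hf⟩ := SmoothPartitionOfUnity.exists_isSubordinate (modelWithCornersSelf ℝ (Sp d))
    hK.isClosed (fun c : J => Metric.ball (c : Sp d) (ε / 2)) (fun _ => Metric.isOpen_ball)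
    (by intro x hx; obtain ⟨c, hc, hx'⟩ := mem_iUnion₂.1 (hJ hx); exact mem_iUnion.2 ⟨⟨c, hc⟩, hx'⟩)
  refine ⟨J, fun c => f c, fun c => ?_, fun c => ?_, fun c z hz z' hz' => ?_, fun z hz => ?_⟩
  · exact contMDiff_iff_contDiff.1 (f c).contMDiff
  · exact (isCompact_closedBall (c : Sp d) (ε / 2)).of_isClosed_subset (isClosed_tsupport _)
      ((hf c).trans Metric.ball_subset_closedBall)
  · have h1 := hf c hz
    have h2 := hf c hz'
    rw [← dist_eq_norm]
    have := dist_triangle_right z z' (c : Sp d)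
    rw [Metric.mem_ball] at h1 h2
    linarith
  · rw [← finsum_eq_sum_of_fintype]
    exact f.sum_eq_one hz

lemma contDiff_cutoff_smul {F : Type*} [NormedAddCommGroup F] [NormedSpace ℝ F] {ψ : Sp d → ℝ}
    (hψ : ContDiff ℝ ∞ ψ) {f : Sp d → F} {U : Set (Sp d)} (hU : IsOpen U)
    (hf : ContDiffOn ℝ ∞ f U) (hs : tsupport ψ ⊆ U) : ContDiff ℝ ∞ (fun z => ψ z • f z) := by
  refine contDiff_iff_contDiffAt.2 fun z => ?_
  by_cases hz : z ∈ tsupport ψ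
  · exact hψ.contDiffAt.smul (hf.contDiffAt (hU.mem_nhds (hs hz)))
  · refine (contDiffAt_const (c := (0 : F))).congr_of_eventuallyEq ?_
    filter_upwards [notMem_tsupport_iff_eventuallyEq.1 hz] with y hy
    rw [hy]; simp

lemma norm_iteratedFDeriv_cutoff_smul_le {F : Type*} [NormedAddCommGroup F] [NormedSpace ℝ F]
    {ψ : Sp d → ℝ} (hψ : ContDiff ℝ ∞ ψ) {f : Sp d → F} {U : Set (Sp d)} (hU : IsOpen U)
    (hf : ContDiffOn ℝ ∞ f U) (hs : tsupport ψ ⊆ U) {P G : ℝ} {N : ℕ} (hP : 0 ≤ P) (hG : 0 ≤ G)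
    (hψb : ∀ i ≤ N, ∀ z, ‖iteratedFDeriv ℝ i ψ z‖ ≤ P)
    (hfb : ∀ z ∈ tsupport ψ, ∀ i ≤ N, ‖iteratedFDeriv ℝ i f z‖ ≤ G) :
    ∀ i ≤ N, ∀ z, ‖iteratedFDeriv ℝ i (fun z => ψ z • f z) z‖ ≤ 2 ^ N * P * G := by
  intro i hi z
  by_cases hz : z ∈ tsupport ψ
  · have h1 := norm_iteratedFDerivWithin_smul_le (n := i) hψ.contDiffOn hf hU.uniqueDiffOn (hs hz)
      (by exact_mod_cast le_top)
    rw [iteratedFDerivWithin_of_isOpen i hU (hs hz)] at h1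
    calc _ ≤ _ := h1
      _ ≤ ∑ k ∈ Finset.range (i + 1), (i.choose k : ℝ) * P * G := by
          refine Finset.sum_le_sum fun k hk => ?_
          have hk' := Finset.mem_range.1 hk
          rw [iteratedFDerivWithin_of_isOpen k hU (hs hz),
            iteratedFDerivWithin_of_isOpen (i - k) hU (hs hz)]
          gcongr
          · exact hψb k (by omega) z
          · exact hfb z hz (i - k) (by omega)
      _ = 2 ^ i * P * G := by
          rw [← Finset.sum_mul, ← Finset.sum_mul]
          congr 2
          exact_mod_cast Nat.sum_range_choose i
      _ ≤ _ := by gcongr; norm_num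
  · have h1 : Filter.EventuallyEq (nhds z) (fun z => ψ z • f z) fun _ => (0 : F) := by
      filter_upwards [notMem_tsupport_iff_eventuallyEq.1 hz] with y hy
      rw [hy]; simp
    have h2 : iteratedFDeriv ℝ i (fun z => ψ z • f z) z = 0 := by
      rw [(Filter.EventuallyEq.iteratedFDeriv ℝ h1 i).eq_of_nhds]
      simp
    rw [h2, norm_zero]
    positivity

lemma exists_iteratedFDeriv_le_of_compact {ψ : Sp d → ℝ} (hψ : ContDiff ℝ ∞ ψ)
    (hc : HasCompactSupport ψ) (N : ℕ) :
    ∃ P : ℝ, 0 ≤ P ∧ ∀ i ≤ N, ∀ z, ‖iteratedFDeriv ℝ i ψ z‖ ≤ P := by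
  have : ∀ i, ∃ P : ℝ, 0 ≤ P ∧ ∀ z, ‖iteratedFDeriv ℝ i ψ z‖ ≤ P := by
    intro i
    obtain ⟨P, hP⟩ := (hψ.continuous_iteratedFDeriv (m := i)
      (by exact_mod_cast le_top)).bounded_above_of_compact_support (hc.iteratedFDeriv i)
    exact ⟨P, (norm_nonneg _).trans (hP 0), hP⟩
  choose P hP0 hP using this
  refine ⟨∑ i ∈ Finset.range (N + 1), P i, Finset.sum_nonneg fun i _ => hP0 i, fun i hi z => ?_⟩
  exact (hP i z).trans
    (Finset.single_le_sum (fun j _ => hP0 j) (Finset.mem_range.2 (by omega)))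

/-- Decay of the Fourier transform of a function with compact support, in terms of bounds on its
derivatives. -/
lemma exists_norm_fourierX_le_decay (d : ℕ) (F : Type*) [NormedAddCommGroup F] [NormedSpace ℂ F]
    (ρ : ℝ) :
    ∃ C : ℝ, 0 ≤ C ∧ ∀ {f : Sp d → F} {G : ℝ}, ContDiff ℝ ∞ f → 0 ≤ G →
      Function.support f ⊆ Metric.closedBall 0 ρ →
      (∀ i ≤ d + 1, ∀ z, ‖iteratedFDeriv ℝ i f z‖ ≤ G) →
      ∀ w, ‖fourierX f w‖ ≤ C * G * (1 + ‖w‖) ^ (-((d : ℝ) + 1)) := by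
  set V : ℝ := (volume (Metric.closedBall (0 : Sp d) ρ)).toReal with hV
  have hV0 : 0 ≤ V := ENNReal.toReal_nonneg
  set c : ℝ := 2 ^ (d + 1) * (V * (1 + (4 * Real.pi) ^ (d + 1) * (d + 2))) with hc
  refine ⟨c, by positivity, ?_⟩
  intro f G hf hG hs hb w
  have hts : tsupport f ⊆ Metric.closedBall 0 ρ :=
    closure_minimal hs Metric.isClosed_closedBall
  have hcs : HasCompactSupport f :=
    (isCompact_closedBall (0 : Sp d) ρ).of_isClosed_subset (isClosed_tsupport _) hts
  have hint : ∀ i ≤ d + 1, ∫ v, ‖iteratedFDeriv ℝ i f v‖ ≤ V * G := by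
    intro i hi
    have hsi : Function.support (fun v => ‖iteratedFDeriv ℝ i f v‖) ⊆ Metric.closedBall 0 ρ := by
      intro v hv
      exact hts (support_iteratedFDeriv_subset i (by simpa using hv))
    rw [← setIntegral_eq_integral_of_forall_compl_eq_zero (s := Metric.closedBall (0 : Sp d) ρ)
      (fun v hv => by by_contra h; exact hv (hsi h))]
    have h1 := norm_setIntegral_le_of_norm_le_const (μ := volume)
      (s := Metric.closedBall (0 : Sp d) ρ) (f := fun v => ‖iteratedFDeriv ℝ i f v‖) (C := G)
      (isCompact_closedBall (0 : Sp d) ρ).measure_lt_top (fun v _ => by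
        rw [norm_norm]; exact hb i hi v)
    refine (le_abs_self _).trans (h1.trans (le_of_eq ?_))
    rw [mul_comm]; rfl
  have h0 : ‖fourierX f w‖ ≤ V * G := by
    refine (norm_fourierX_le f w).trans ?_
    have := hint 0 (by omega)
    simpa only [norm_iteratedFDeriv_zero] using this
  have h1 : ‖w‖ ^ (d + 1) * ‖fourierX f w‖ ≤ (4 * Real.pi) ^ (d + 1) * (d + 2) * (V * G) := by
    have hi : ∀ (k n : ℕ), (k : ℕ∞) ≤ ⊤ → (n : ℕ∞) ≤ ⊤ →
        Integrable (fun v => ‖v‖ ^ k * ‖iteratedFDeriv ℝ n f v‖) := by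
      intro k n _ _
      refine Continuous.integrable_of_hasCompactSupport ?_ ?_
      · have := hf.continuous_iteratedFDeriv (m := n) (by exact_mod_cast le_top)
        fun_prop
      · exact ((hcs.iteratedFDeriv n).norm).mul_left
    have h2 := Real.pow_mul_norm_iteratedFDeriv_fourier_le (K := ⊤) (N := ⊤) hf hi
      (k := 0) (n := d + 1) le_top le_top ((2 * Real.pi)⁻¹ • w)
    rw [norm_iteratedFDeriv_zero, ← fourierX_eq_fourier] at h2
    have h3 : ∑ p ∈ Finset.range (0 + 1) ×ˢ Finset.range (d + 1 + 1),
        ∫ v, ‖v‖ ^ p.1 * ‖iteratedFDeriv ℝ p.2 f v‖ ≤ (d + 2) * (V * G) := by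
      rw [Finset.sum_product]
      simp only [zero_add, Finset.range_one, Finset.sum_singleton, pow_zero, one_mul]
      calc _ ≤ ∑ i ∈ Finset.range (d + 1 + 1), V * G :=
            Finset.sum_le_sum fun i hi => hint i (by have := Finset.mem_range.1 hi; omega)
        _ = _ := by rw [Finset.sum_const, Finset.card_range, nsmul_eq_mul]; push_cast; ring
    have h4 : ‖w‖ = 2 * Real.pi * ‖(2 * Real.pi)⁻¹ • w‖ := by
      rw [norm_smul, Real.norm_eq_abs, abs_of_pos two_pi_inv_pos, ← mul_assoc,
        mul_inv_cancel₀ (by positivity), one_mul]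
    rw [h4, mul_pow, mul_assoc]
    calc _ ≤ (2 * Real.pi) ^ (d + 1) * ((2 * Real.pi) ^ 0 * (2 * (0 : ℕ) + 2) ^ (d + 1) *
          ((d + 2) * (V * G))) := by
          refine mul_le_mul_of_nonneg_left (h2.trans ?_) (by positivity)
          gcongr
      _ = _ := by
          rw [show (4 * Real.pi) = (2 * Real.pi) * 2 by ring, mul_pow (2 * Real.pi) 2]
          push_cast; ring
  have hw : 0 < 1 + ‖w‖ := by positivity
  rw [Real.rpow_neg hw.le, ← div_eq_mul_inv, le_div_iff₀ (by positivity)]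
  have e : (1 + ‖w‖) ^ ((d : ℝ) + 1) = (1 + ‖w‖) ^ (d + 1) := by
    rw [← Real.rpow_natCast]; push_cast; rfl
  rw [e]
  have h5 : (1 + ‖w‖) ^ (d + 1) ≤ 2 ^ (d + 1) * (1 + ‖w‖ ^ (d + 1)) := by
    calc (1 + ‖w‖) ^ (d + 1) ≤ 2 ^ (d + 1 - 1) * (1 ^ (d + 1) + ‖w‖ ^ (d + 1)) :=
          add_pow_le zero_le_one (norm_nonneg _) _
      _ ≤ _ := by
          rw [one_pow]
          gcongr
          · norm_num
          · omega
  calc ‖fourierX f w‖ * (1 + ‖w‖) ^ (d + 1)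
      ≤ ‖fourierX f w‖ * (2 ^ (d + 1) * (1 + ‖w‖ ^ (d + 1))) := by gcongr
    _ = 2 ^ (d + 1) * (‖fourierX f w‖ + ‖w‖ ^ (d + 1) * ‖fourierX f w‖) := by ring
    _ ≤ 2 ^ (d + 1) * (V * G + (4 * Real.pi) ^ (d + 1) * (d + 2) * (V * G)) := by gcongr
    _ = _ := by rw [hc]; ring

/-- A symbol that is smooth in the second frequency in the scale of a box is a superposition of
modulations in that frequency, with integrable weights: expand `z ↦ N(v, z)` by Fourier
inversion. -/
lemma exists_sliceBound_of_smooth (d : ℕ) (E₁ E₂ E₀ F : Type*)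
    [NormedAddCommGroup E₁] [NormedSpace ℂ E₁] [NormedAddCommGroup E₂] [NormedSpace ℂ E₂]
    [NormedAddCommGroup E₀] [NormedSpace ℂ E₀] [FiniteDimensional ℂ E₁] [FiniteDimensional ℂ E₂]
    [FiniteDimensional ℂ E₀] [NormedAddCommGroup F] [NormedSpace ℂ F] [FiniteDimensional ℂ F]
    (ρ : ℝ) (L : F →L[ℂ] Bil E₁ E₂ E₀) :
    ∃ C : ℝ≥0, ∀ {N : Sp d → Sp d → F} {G : ℝ≥0},
      StronglyMeasurable (fun p : Sp d × Sp d => N p.1 p.2) → (∀ v, ContDiff ℝ ∞ (N v)) →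
      (∀ v, Function.support (N v) ⊆ Metric.closedBall 0 ρ) →
      (∀ v, ∀ i ≤ d + 1, ∀ z, ‖iteratedFDeriv ℝ i (N v) z‖ ≤ G) →
      ∀ (W : Sp d →L[ℝ] Sp d) (c : Sp d),
        SliceBound (fun ξ η => L (N ξ (W (η - c)))) (C * G) ∧
        SliceBound (fun ξ η => L (N (ξ + η) (W (η - c)))) (C * G) := by
  have := FiniteDimensional.complete ℂ E₁
  have := FiniteDimensional.complete ℂ E₂
  have := FiniteDimensional.complete ℂ E₀
  have := FiniteDimensional.complete ℂ F
  obtain ⟨C₁, hC₁0, hC₁⟩ := exists_norm_fourierX_le_decay d F ρ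
  obtain ⟨C₂, hC₂⟩ := exists_sliceBound_one d E₁ E₂ E₀
  set J : ℝ := ∫ w : Sp d, (1 + ‖w‖) ^ (-((d : ℝ) + 1)) with hJ
  have hJi := integrable_japanese_space (d := d)
  set T : ℝ := ((2 * Real.pi) ^ d)⁻¹ with hT
  have hT0 : 0 < T := by positivity
  refine ⟨C₂ * (‖L‖₊ * (C₁ * (T * J)).toNNReal), ?_⟩
  intro N G hN hs hsupp hb W c
  set k : Sp d → Sp d → Bil E₁ E₂ E₀ := fun w v => (T : ℂ) • L (fourierX (N v) w) with hk
  have hkm : StronglyMeasurable (fun p : Sp d × Sp d => k p.1 p.2) := by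
    refine StronglyMeasurable.fun_const_smul (𝕜 := ℂ) ?_ _
    refine L.continuous.comp_stronglyMeasurable ?_
    have h1 : StronglyMeasurable (fun p : (Sp d × Sp d) × Sp d =>
        ph (-inner ℝ p.2 p.1.1) • N p.1.2 p.2) := by
      refine StronglyMeasurable.smul ?_ ?_
      · exact (continuous_ph.comp (by fun_prop)).stronglyMeasurable
      · exact hN.comp_measurable (g := fun p : (Sp d × Sp d) × Sp d => (p.1.2, p.2)) (by fun_prop)
    have h2 := h1.integral_prod_right' (ν := (volume : Measure (Sp d)))
    simpa only [fourierX_eq_ph] using h2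
  set κ : Sp d → ℝ := fun w => ‖L‖ * (C₁ * G * T * (1 + ‖w‖) ^ (-((d : ℝ) + 1))) with hκ
  have hκ0 : ∀ w, 0 ≤ κ w := fun w => by positivity
  have hκi : Integrable κ := (hJi.const_mul _).const_mul _
  have hkb : ∀ w v, ‖k w v‖ ≤ κ w := by
    intro w v
    simp only [hk, hκ]
    rw [norm_smul, Complex.norm_real, Real.norm_eq_abs, abs_of_pos hT0]
    have h1 := (L.le_opNorm (fourierX (N v) w)).trans
      (mul_le_mul_of_nonneg_left (hC₁ (hs v) G.2 (hsupp v) (hb v) w) (norm_nonneg L))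
    calc T * ‖L (fourierX (N v) w)‖ ≤ T * (‖L‖ * (C₁ * G * (1 + ‖w‖) ^ (-((d : ℝ) + 1)))) := by
          gcongr
          exact h1
      _ = _ := by ring
  have hinv : ∀ v z, L (N v z) = ∫ w, ph (inner ℝ z w) • k w v := by
    intro v z
    have hts : tsupport (N v) ⊆ Metric.closedBall 0 ρ :=
      closure_minimal (hsupp v) Metric.isClosed_closedBall
    have hcs : HasCompactSupport (N v) :=
      (isCompact_closedBall (0 : Sp d) ρ).of_isClosed_subset (isClosed_tsupport _) hts
    have hNi : Integrable (N v) := (hs v).continuous.integrable_of_hasCompactSupport hcs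
    have hfi : Integrable (fourierX (N v)) := by
      refine (hJi.const_mul (C₁ * G)).mono' (continuous_fourierX hNi).aestronglyMeasurable ?_
      exact Filter.Eventually.of_forall fun w => hC₁ (hs v) G.2 (hsupp v) (hb v) w
    have h1 := invX_fourierX (hs v).continuous hNi hfi z
    have h2 : N v z = (T : ℂ) • invX (fourierX (N v)) z := by
      rw [h1, hT]
      rw [← Complex.coe_smul, smul_smul, ← Complex.ofReal_mul,
        inv_mul_cancel₀ (by positivity), Complex.ofReal_one, one_smul]
    rw [h2, map_smul, invX, ← L.integral_comp_comm (integrable_ph_smul hfi (by fun_prop)),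
      ← integral_smul]
    congr 1; ext1 w
    simp only [hk, map_smul]
    rw [smul_comm]
  have hA : ∫⁻ w : Sp d, (C₂ : ℝ≥0∞) * (κ w).toNNReal =
      ((C₂ * (‖L‖₊ * (C₁ * (T * J)).toNNReal) : ℝ≥0) : ℝ≥0∞) * G := by
    rw [lintegral_const_mul' _ _ (by simp)]
    have h1 : ∫⁻ w : Sp d, ((κ w).toNNReal : ℝ≥0∞) = ENNReal.ofReal (∫ w, κ w) :=
      (ofReal_integral_eq_lintegral_ofReal hκi (Filter.Eventually.of_forall hκ0)).symm
    rw [h1]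
    simp only [hκ]
    rw [integral_const_mul, integral_const_mul, ← hJ]
    have hJ0 : 0 ≤ J := integral_nonneg fun w => by positivity
    have h2 : ‖L‖ * (C₁ * G * T * J) = ((‖L‖₊ * (C₁ * (T * J)).toNNReal * G : ℝ≥0) : ℝ) := by
      push_cast
      rw [Real.coe_toNNReal _ (by positivity)]
      ring
    rw [h2, ENNReal.ofReal_coe_nnreal]
    push_cast
    ring
  have hph : ∀ w η, ph (inner ℝ (W (η - c)) w) =
      ph (-inner ℝ (W c) w) * ph (-inner ℝ (-(ContinuousLinearMap.adjoint W w)) η) := by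
    intro w η
    rw [← ph_add]
    congr 1
    rw [inner_neg_left, neg_neg, ContinuousLinearMap.adjoint_inner_left, map_sub, inner_sub_left,
      real_inner_comm (W η) w]
    ring
  have hmeasA : AEMeasurable (fun w : Sp d => (C₂ : ℝ≥0∞) * (κ w).toNNReal) := by
    have : Measurable κ := by
      have : Continuous κ := by
        have h1 : Continuous fun w : Sp d => (1 + ‖w‖) ^ (-((d : ℝ) + 1)) :=
          Continuous.rpow_const (by fun_prop) fun w => Or.inl (by positivity)
        fun_prop
      exact this.measurable
    exact (this.real_toNNReal.coe_nnreal_ennreal.const_mul _).aemeasurable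
  have hkw : ∀ w, StronglyMeasurable (fun v => ph (-inner ℝ (W c) w) • k w v) := fun w =>
    (hkm.comp_measurable (g := fun v : Sp d => (w, v)) (by fun_prop)).fun_const_smul _
  have hkb' : ∀ w v, ‖ph (-inner ℝ (W c) w) • k w v‖₊ ≤ (κ w).toNNReal := by
    intro w v
    rw [← NNReal.coe_le_coe, coe_nnnorm, norm_smul, norm_ph, one_mul,
      Real.coe_toNNReal _ (hκ0 w)]
    exact hkb w v
  have hfm : ∀ V : Sp d × Sp d → Sp d, Continuous V →
      StronglyMeasurable fun p : Sp d × Sp d × Sp d =>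
        ph (inner ℝ (W (p.2.2 - c)) p.1) • k p.1 (V p.2) := by
    intro V hV
    refine StronglyMeasurable.fun_smul ?_ ?_
    · exact (continuous_ph.comp (by fun_prop)).stronglyMeasurable
    · exact hkm.comp_measurable (g := fun p : Sp d × Sp d × Sp d => (p.1, V p.2))
        (by have := hV.measurable; fun_prop)
  constructor
  · rw [← hA]
    simp only [hinv]
    refine SliceBound.integral (N := fun w ξ η => ph (inner ℝ (W (η - c)) w) • k w ξ)
      (hfm (fun p => p.1) continuous_fst) hκi ?_ hmeasA ?_
    · intro w ξ η
      rw [norm_smul, norm_ph, one_mul]; exact hkb w ξ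
    · intro w
      have h1 := (hC₂ _ _ (hkw w) (hkb' w)).1.modulate (-(ContinuousLinearMap.adjoint W w))
      refine (congrArg (fun M => SliceBound M _) ?_).mp h1
      funext ξ η
      rw [hph, smul_smul, mul_comm]
  · rw [← hA]
    simp only [hinv]
    refine SliceBound.integral (N := fun w ξ η => ph (inner ℝ (W (η - c)) w) • k w (ξ + η))
      (hfm (fun p => p.1 + p.2) (by fun_prop)) hκi ?_ hmeasA ?_
    · intro w ξ η
      rw [norm_smul, norm_ph, one_mul]; exact hkb w _
    · intro w
      have h1 := (hC₂ _ _ (hkw w) (hkb' w)).2.modulate (-(ContinuousLinearMap.adjoint W w))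
      refine (congrArg (fun M => SliceBound M _) ?_).mp h1
      funext ξ η
      rw [hph, smul_smul, mul_comm]

end kernel

end MDNull

end

noncomputable section

namespace MDNull

/-! ### Null symbols on aligned boxes -/

section alignedSet

variable {d : ℕ}

/-- The pairs of frequencies that are strictly aligned. -/
def alignedSet (S R g r θ : ℝ) (e : Sp d) : Set (Sp d × Sp d) :=
  {p | p.1 ≠ 0 ∧ p.2 ≠ 0 ∧ r < S * ‖p.2‖ ∧ r * θ < R * g * ‖p.2‖ ∧
    r * offLine e p.2 < R * g * ‖p.2‖ ^ 2 ∧ ‖dir p.1 - dir p.2‖ < R * g}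

lemma aligned_of_mem {S R g r θ : ℝ} {e q x : Sp d} (h : (q, x) ∈ alignedSet S R g r θ e) :
    Aligned S R g r θ e q x :=
  ⟨h.1, h.2.1, h.2.2.1.le, h.2.2.2.1.le, h.2.2.2.2.1.le, h.2.2.2.2.2.le⟩

lemma Aligned.mem_alignedSet {S R g r θ : ℝ} {e q x : Sp d} (h : Aligned S R g r θ e q x)
    (hg : 0 < g) : (q, x) ∈ alignedSet (S + 1) (R + 1) g r θ e := by
  have hxn : 0 < ‖x‖ := norm_pos_iff.2 h.ne_x
  have h1 : 0 < g * ‖x‖ := by positivity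
  have h2 : 0 < g * ‖x‖ ^ 2 := by positivity
  refine ⟨h.ne_q, h.ne_x, ?_, ?_, ?_, ?_⟩
  · linarith [h.size]
  · linarith [h.thin]
  · linarith [h.axis]
  · linarith [h.near]

lemma continuousAt_dir {x : Sp d} (hx : x ≠ 0) : ContinuousAt (dir (d := d)) x :=
  (continuousAt_id.norm.inv₀ (norm_ne_zero_iff.2 hx)).smul continuousAt_id

lemma continuous_offLine (e : Sp d) : Continuous (offLine e) := by
  unfold offLine; fun_prop

lemma isOpen_alignedSet (S R g r θ : ℝ) (e : Sp d) : IsOpen (alignedSet S R g r θ e) := by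
  refine isOpen_iff_mem_nhds.2 ?_
  rintro ⟨q, x⟩ ⟨h1, h2, h3, h4, h5, h6⟩
  have c1 : ContinuousAt (fun p : Sp d × Sp d => ‖p.2‖) (q, x) := by fun_prop
  have c2 : ContinuousAt (fun p : Sp d × Sp d => offLine e p.2) (q, x) :=
    ((continuous_offLine e).comp continuous_snd).continuousAt
  have c3 : ContinuousAt (fun p : Sp d × Sp d => ‖dir p.1 - dir p.2‖) (q, x) := by
    have a1 : ContinuousAt (fun p : Sp d × Sp d => dir p.1) (q, x) :=
      ContinuousAt.comp (g := dir (d := d)) (f := Prod.fst) (continuousAt_dir h1) continuousAt_fst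
    have a2 : ContinuousAt (fun p : Sp d × Sp d => dir p.2) (q, x) :=
      ContinuousAt.comp (g := dir (d := d)) (f := Prod.snd) (continuousAt_dir h2) continuousAt_snd
    exact (a1.sub a2).norm
  filter_upwards [continuousAt_fst.eventually_ne h1, continuousAt_snd.eventually_ne h2,
    continuousAt_const.eventually_lt (continuousAt_const.mul c1) h3,
    continuousAt_const.eventually_lt (continuousAt_const.mul c1) h4,
    (continuousAt_const.mul c2).eventually_lt (continuousAt_const.mul (c1.pow 2)) h5,
    c3.eventually_lt continuousAt_const h6] with p p1 p2 p3 p4 p5 p6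
  exact ⟨p1, p2, p3, p4, p5, p6⟩

end alignedSet

section nullbox

variable {d : ℕ}

/-- The linear part of the chart of a box. -/
def FreqBox.lin (b : FreqBox d) (k : ℤ) (l : ℝ) : Sp d →L[ℝ] Sp d :=
  (b.frame.repr.symm.toContinuousLinearEquiv : Sp d →L[ℝ] Sp d).comp
    (LinearMap.toContinuousLinearMap (boxDiag d k l))

lemma FreqBox.lin_apply (b : FreqBox d) (k : ℤ) (l : ℝ) (z : Sp d) :
    b.lin k l z = b.frame.repr.symm (boxDiag d k l z) := rfl

lemma FreqBox.exists_leftInverse_lin (b : FreqBox d) (k : ℤ) (l : ℝ) :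
    ∃ W : Sp d →L[ℝ] Sp d, ∀ z, W (b.lin k l z) = z := by
  have hinj : Function.Injective (b.lin k l).toLinearMap := by
    intro y z h
    have h1 : boxDiag d k l y = boxDiag d k l z := b.frame.repr.symm.injective h
    ext i
    have h2 := congrArg (fun x : Sp d => x i) h1
    simp only [boxDiag_apply] at h2
    exact mul_left_cancel₀ (boxSide_pos k l i).ne' h2
  refine ⟨LinearMap.toContinuousLinearMap
    ((LinearEquiv.ofInjectiveEndo _ hinj).symm : Sp d →ₗ[ℝ] Sp d), fun z => ?_⟩
  exact (LinearEquiv.ofInjectiveEndo _ hinj).symm_apply_apply z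

lemma FreqBox.isThin_lin (b : FreqBox d) (hd : 2 ≤ d) (k : ℤ) {l : ℝ} (hl : l ≤ 0) {τ : ℝ}
    (hτ : |τ| = 1) : IsThin (2 ^ k) (2 ^ l) (b.axis hd) (τ • b.lin k l) where
  norm_le v := by
    rw [smul_apply, norm_smul, Real.norm_eq_abs, hτ, one_mul]
    exact b.norm_frame_le k hl v
  offLine_le v := by
    rw [smul_apply, offLine_smul, hτ, one_mul]
    exact b.offLine_frame_le hd k l v

/-- The restriction of a symbol to nonzero frequencies. -/
def punctured {F : Type*} [Zero F] (n : Sp d → Sp d → F) (q x : Sp d) : F :=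
  {p : Sp d × Sp d | p.1 ≠ 0 ∧ p.2 ≠ 0}.indicator (fun p => n p.1 p.2) (q, x)

lemma punctured_of_ne {F : Type*} [Zero F] (n : Sp d → Sp d → F) {q x : Sp d} (hq : q ≠ 0)
    (hx : x ≠ 0) : punctured n q x = n q x :=
  indicator_of_mem (s := {p : Sp d × Sp d | p.1 ≠ 0 ∧ p.2 ≠ 0}) ⟨hq, hx⟩ _

lemma isOpen_punctured : IsOpen {p : Sp d × Sp d | p.1 ≠ 0 ∧ p.2 ≠ 0} :=
  (isOpen_ne_fun continuous_fst continuous_const).inter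
    (isOpen_ne_fun continuous_snd continuous_const)

lemma stronglyMeasurable_punctured {F : Type*} [NormedAddCommGroup F] [NormedSpace ℂ F]
    [FiniteDimensional ℂ F] {n : Sp d → Sp d → F}
    (hn : ContinuousOn (fun p : Sp d × Sp d => n p.1 p.2) {p | p.1 ≠ 0 ∧ p.2 ≠ 0}) :
    StronglyMeasurable (fun p : Sp d × Sp d => punctured n p.1 p.2) := by
  classical
  have := FiniteDimensional.proper ℂ F
  borelize F
  refine Measurable.stronglyMeasurable ?_
  have h := hn.measurable_piecewise (g := fun _ => (0 : F)) continuousOn_const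
    isOpen_punctured.measurableSet
  refine (congrArg Measurable ?_).mp h
  funext p
  unfold punctured
  rw [← piecewise_eq_indicator]
  rfl

/-- On the frequencies in a box that are aligned with the first argument, a null symbol agrees
with a symbol of size `g` that is bounded from `L² × L^∞` to `L²`. The argument `V` is the input
frequency `ξ` or the output frequency `ξ + η`. -/
lemma exists_sliceBound_aligned (d : ℕ) (hd : 2 ≤ d) (E₁ E₂ E₀ F : Type*)
    [NormedAddCommGroup E₁] [NormedSpace ℂ E₁] [NormedAddCommGroup E₂] [NormedSpace ℂ E₂]
    [NormedAddCommGroup E₀] [NormedSpace ℂ E₀] [FiniteDimensional ℂ E₁] [FiniteDimensional ℂ E₂]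
    [FiniteDimensional ℂ E₀] [NormedAddCommGroup F] [NormedSpace ℂ F] [FiniteDimensional ℂ F]
    (lam : ℝ) (A B : ℕ → ℝ) (S R : ℝ) (hS : 0 ≤ S) (hR : 0 ≤ R) (L : F →L[ℂ] Bil E₁ E₂ E₀) :
    ∃ C : ℝ≥0, ∀ {n : Sp d → Sp d → F}, IsAngular A B n →
      ∀ {V : Sp d → Sp d → Sp d}, ((V = fun ξ _ => ξ) ∨ (V = fun ξ η => ξ + η)) →
      ∀ (b : FreqBox d) (k : ℤ) {l : ℝ}, l ≤ 0 → ∀ {σ β τ : ℝ}, |τ| = 1 → ∀ {g : ℝ≥0}, 0 < g →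
      ∃ Ma : Sp d → Sp d → Bil E₁ E₂ E₀, BddSymbol Ma ∧ SliceBound Ma (C * g) ∧
        ∀ ξ η, η ∈ b.dilate k l lam →
          Aligned S R g (2 ^ k) (2 ^ l) (b.axis hd) (σ • V ξ η) (β • V ξ η + τ • η) →
          L (n (σ • V ξ η) (β • V ξ η + τ • η)) = Ma ξ η := by
  have := FiniteDimensional.complete ℂ E₀
  have hS1 : 1 ≤ S + 1 := by linarith
  have hR1 : 0 ≤ R + 1 := by linarith
  obtain ⟨C₁, hC₁0, hC₁⟩ := exists_iteratedFDeriv_aligned_le d F A B (S + 1) (R + 1) hS1 hR1 (d + 1)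
  obtain ⟨J, ψ, hψs, hψc, hψd, hψ1⟩ := exists_partition (isCompact_cube (d := d) lam)
    (ε := 1 / (4 * (S + 1))) (by positivity)
  choose P hP0 hP using fun c => exists_iteratedFDeriv_le_of_compact (hψs c) (hψc c) (d + 1)
  have : ∀ c, ∃ ρ, tsupport (ψ c) ⊆ Metric.closedBall 0 ρ := fun c =>
    (hψc c).isBounded.subset_closedBall 0
  choose ρ hρ using this
  choose K hK using fun c => exists_sliceBound_of_smooth d E₁ E₂ E₀ F (ρ c) L
  refine ⟨∑ c, K c * (2 ^ (d + 1) * P c * C₁).toNNReal, ?_⟩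
  intro n hn V hV b k l hl σ β τ hτ g hg
  obtain ⟨W, hW⟩ := b.exists_leftInverse_lin k l
  set e := b.axis hd with he
  have he1 : ‖e‖ = 1 := b.norm_axis hd
  set Z : Sp d →L[ℝ] Sp d := τ • b.lin k l with hZ
  have hZt : IsThin (2 ^ k) (2 ^ l) e Z := b.isThin_lin hd k hl hτ
  set p : Sp d → Sp d := fun v => β • v + τ • b.center with hp
  have hpc : Continuous p := by fun_prop
  -- If one point of the support of `ψ c` is strictly aligned with `σ • v`, then all are aligned, with
  -- larger constants, because the support is small in the scale of the box.
  set T : J → Set (Sp d) := fun c => {v | ∃ z, ψ c z ≠ 0 ∧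
    (σ • v, p v + Z z) ∈ alignedSet (S + 1) (R + 1) g (2 ^ k) (2 ^ l) e} with hT
  have hTo : ∀ c, IsOpen (T c) := by
    intro c
    have : T c = ⋃ z ∈ Function.support (ψ c), (fun v => (σ • v, p v + Z z)) ⁻¹'
        alignedSet (S + 1) (R + 1) g (2 ^ k) (2 ^ l) e := by
      ext v; simp [hT]
    rw [this]
    exact isOpen_biUnion fun z _ => (isOpen_alignedSet _ _ _ _ _ _).preimage (by fun_prop)
  set N : J → Sp d → Sp d → F := fun c v z =>
    (T c).indicator (fun v => ψ c z • punctured n (σ • v) (p v + Z z)) v with hN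
  have hnm := stronglyMeasurable_punctured hn.smooth.continuousOn
  have hNm : ∀ c, StronglyMeasurable (fun q : Sp d × Sp d => N c q.1 q.2) := by
    intro c
    have h1 : StronglyMeasurable (fun q : Sp d × Sp d =>
        ψ c q.2 • punctured n (σ • q.1) (p q.1 + Z q.2)) := by
      refine StronglyMeasurable.fun_smul ?_ ?_
      · exact ((hψs c).continuous.comp continuous_snd).stronglyMeasurable
      · exact hnm.comp_measurable
          (g := fun q : Sp d × Sp d => (σ • q.1, p q.1 + Z q.2)) (by fun_prop)
    have h2 := h1.indicator (s := Prod.fst ⁻¹' T c)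
      (measurable_fst (hTo c).measurableSet)
    exact h2
  have key : ∀ c, ∀ v ∈ T c, (σ • v ≠ 0) ∧ ∀ z ∈ tsupport (ψ c), p v + Z z ≠ 0 ∧
      ∀ i ≤ d + 1, ‖iteratedFDeriv ℝ i (fun z => n (σ • v) (p v + Z z)) z‖ ≤ C₁ * g := by
    rintro c v ⟨z', hz', hal⟩
    have hal' := aligned_of_mem hal
    refine ⟨hal'.ne_q, fun z hz => ?_⟩
    exact hC₁ hn g.2 (by positivity) he1 hZt hal'
      (hψd c z hz z' (subset_tsupport _ hz'))
  have hNeq : ∀ c, ∀ v ∈ T c, N c v = fun z => ψ c z • n (σ • v) (p v + Z z) := by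
    intro c v hv
    funext z
    simp only [hN]
    rw [indicator_of_mem hv]
    by_cases hz : ψ c z = 0
    · rw [hz, zero_smul, zero_smul]
    · have h1 := key c v hv
      rw [punctured_of_ne n h1.1 (h1.2 z (subset_tsupport _ hz)).1]
  have hN0 : ∀ c, ∀ v ∉ T c, N c v = fun _ => 0 := by
    intro c v hv
    funext z
    simp only [hN]
    rw [indicator_of_notMem hv]
  have hU : ∀ v, IsOpen {z : Sp d | p v + Z z ≠ 0} := fun v =>
    isOpen_ne_fun (by fun_prop) continuous_const
  have hUd : ∀ c, ∀ v ∈ T c,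
      ContDiffOn ℝ ∞ (fun z => n (σ • v) (p v + Z z)) {z : Sp d | p v + Z z ≠ 0} := by
    intro c v hv
    exact (hn.contDiffOn (key c v hv).1).comp (f := fun z => p v + Z z) (by fun_prop)
      fun z hz => hz
  have hNs : ∀ c v, ContDiff ℝ ∞ (N c v) := by
    intro c v
    by_cases hv : v ∈ T c
    · rw [hNeq c v hv]
      exact contDiff_cutoff_smul (hψs c) (hU v) (hUd c v hv) fun z hz => ((key c v hv).2 z hz).1
    · rw [hN0 c v hv]; exact contDiff_const
  have hNsupp : ∀ c v, Function.support (N c v) ⊆ Metric.closedBall 0 (ρ c) := by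
    intro c v z hz
    refine hρ c (subset_tsupport _ fun h0 => hz ?_)
    by_cases hv : v ∈ T c
    · rw [hNeq c v hv]; simp [h0]
    · rw [hN0 c v hv]
  set G : J → ℝ≥0 := fun c => (2 ^ (d + 1) * P c * C₁).toNNReal * g with hG
  have hGr : ∀ c, (G c : ℝ) = 2 ^ (d + 1) * P c * (C₁ * g) := by
    intro c
    have := hP0 c
    simp only [hG]
    rw [NNReal.coe_mul, Real.coe_toNNReal _ (by positivity)]
    ring
  have hNb : ∀ c v, ∀ i ≤ d + 1, ∀ z, ‖iteratedFDeriv ℝ i (N c v) z‖ ≤ G c := by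
    intro c v i hi z
    by_cases hv : v ∈ T c
    · rw [hNeq c v hv, hGr]
      exact norm_iteratedFDeriv_cutoff_smul_le (hψs c) (hU v) (hUd c v hv)
        (fun z hz => ((key c v hv).2 z hz).1) (hP0 c) (by positivity) (hP c)
        (fun z hz => ((key c v hv).2 z hz).2) i hi z
    · rw [hN0 c v hv]
      have : iteratedFDeriv ℝ i (fun _ : Sp d => (0 : F)) z = 0 := by simp
      rw [this, norm_zero]; exact (G c).2
  have hVm : Measurable (fun q : Sp d × Sp d => V q.1 q.2) := by
    rcases hV with rfl | rfl <;> fun_prop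
  have hMb : ∀ c, BddSymbol (fun ξ η => L (N c (V ξ η) (W (η - b.center)))) := by
    intro c
    constructor
    · refine L.continuous.comp_stronglyMeasurable ?_
      exact (hNm c).comp_measurable
        (g := fun q : Sp d × Sp d => (V q.1 q.2, W (q.2 - b.center))) (by fun_prop)
    · refine ⟨‖L‖ * G c, fun ξ η => (L.le_opNorm _).trans ?_⟩
      gcongr
      have := hNb c (V ξ η) 0 (by omega) (W (η - b.center))
      rwa [norm_iteratedFDeriv_zero] at this
  have hMs : ∀ c, SliceBound (fun ξ η => L (N c (V ξ η) (W (η - b.center)))) (K c * G c) := by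
    intro c
    have h1 := hK c (hNm c) (hNs c) (hNsupp c) (hNb c) W b.center
    rcases hV with rfl | rfl
    · exact h1.1
    · exact h1.2
  refine ⟨fun ξ η => ∑ c, L (N c (V ξ η) (W (η - b.center))), ?_, ?_, ?_⟩
  · constructor
    · exact Finset.stronglyMeasurable_fun_sum _ fun c _ => (hMb c).meas
    · choose Bc hBc using fun c => (hMb c).bdd
      exact ⟨∑ c, Bc c, fun ξ η => (norm_sum_le _ _).trans
        (Finset.sum_le_sum fun c _ => hBc c ξ η)⟩
  · refine (SliceBound.sum Finset.univ hMb hMs).mono (le_of_eq ?_)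
    push_cast
    rw [Finset.sum_mul]
    refine Finset.sum_congr rfl fun c _ => ?_
    simp only [hG]
    push_cast
    ring
  · rintro ξ η ⟨z, hz, rfl⟩ hal
    have e1 : b.chart k l z - b.center = b.lin k l z := by
      rw [b.chart_eq, b.lin_apply, add_sub_cancel_left]
    have e2 : β • V ξ (b.chart k l z) + τ • b.chart k l z = p (V ξ (b.chart k l z)) + Z z := by
      simp only [hp, hZ]
      rw [b.chart_eq, smul_add, smul_apply, b.lin_apply, add_assoc]
    beta_reduce
    rw [e1, hW]
    rw [e2] at hal ⊢
    set v := V ξ (b.chart k l z) with hv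
    have hterm : ∀ c, N c v z = ψ c z • n (σ • v) (p v + Z z) := by
      intro c
      by_cases hψ0 : ψ c z = 0
      · simp only [hN, hψ0, zero_smul]
        simp [indicator]
      · have : v ∈ T c := ⟨z, hψ0, hal.mem_alignedSet (by exact_mod_cast hg)⟩
        rw [hNeq c v this]
    simp only [hterm]
    rw [← map_sum, ← Finset.sum_smul, hψ1 z hz, one_smul]

end nullbox

end MDNull

end

noncomputable section

namespace MDNull

/-! ### Box decompositions of null symbols -/

section nulldecomp

variable {d : ℕ}

/-- The real number `2^ℓ 2^{κ - min(a, b)}`. -/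
def angGain (κ : ℤ) (l : ℝ) (a b : ℤ) : ℝ := (2 : ℝ) ^ l * (2 : ℝ) ^ (κ - min a b)

lemma angGain_pos (κ : ℤ) (l : ℝ) (a b : ℤ) : 0 < angGain κ l a b := by
  unfold angGain; positivity

lemma norm_sgnR_smul (s : ℤˣ) (x : Sp d) : ‖sgnR s • x‖ = ‖x‖ := by
  rw [norm_smul, Real.norm_eq_abs, abs_sgnR, one_mul]

lemma sgnR_smul_sgnR_smul (s : ℤˣ) (x : Sp d) : sgnR s • sgnR s • x = x := by
  rw [smul_smul, sgnR_sq, one_smul]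

lemma sgnR_ne_zero (s : ℤˣ) : sgnR s ≠ 0 := fun h => by
  have := sgnR_sq s
  rw [h] at this; simp at this

lemma dir_sgnR_smul (s : ℤˣ) (x : Sp d) : dir (sgnR s • x) = sgnR s • dir x := by
  rw [dir, dir, norm_sgnR_smul, smul_comm]

/-- The chord between the directions of two signed frequencies. -/
lemma norm_dir_sub_dir_sgnR_smul (s t : ℤˣ) (x y : Sp d) :
    ‖dir x - dir (sgnR (s * t) • y)‖ = ‖sgnR s • dir x - sgnR t • dir y‖ := by
  rw [← norm_sgnR_smul s (dir x - dir _), smul_sub, dir_sgnR_smul, smul_smul, sgnR_mul, ← mul_assoc,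
    sgnR_sq, one_mul]

variable {ι : Type} {κ k₀ k₁ k₂ j : ℤ} {l lam : ℝ} {M : ℕ} {D : ℕ → ℝ} {box : ι → FreqBox d}
  {s₀ s₁ s₂ : ℤˣ} {C : ℝ} {ξ η : Sp d}

lemma two_zpow_le_of_lb {k μ : ℤ} (hμ : μ ≤ k) {x : Sp d} (h : (2 : ℝ) ^ (k - 3) < ‖x‖) :
    (2 : ℝ) ^ μ ≤ 8 * ‖x‖ := by
  have h1 : (2 : ℝ) ^ μ ≤ 2 ^ k := zpow_le_zpow_right₀ (by norm_num) hμ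
  rw [zpow_sub₀ (by norm_num)] at h
  norm_num at h
  linarith

lemma angGain_mul (κ : ℤ) (l : ℝ) (a b : ℤ) :
    angGain κ l a b * 2 ^ min a b = 2 ^ κ * 2 ^ l := by
  rw [angGain, mul_assoc, ← zpow_add₀ (by norm_num), sub_add_cancel, mul_comm]

/-- The chord bounds for the three pairs of frequencies of a resonant interaction. -/
lemma Compat.chord₁₂ (h : Compat k₀ k₁ k₂ j s₀ s₁ s₂ ξ η) (hC : 0 ≤ C) (hl : l ≤ 0)
    (hj : (2 : ℝ) ^ j ≤ C * 2 ^ κ * ((2 : ℝ) ^ l) ^ 2) (hk : FreqTriple κ k₀ k₁ k₂) :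
    ‖sgnR s₁ • dir ξ - sgnR s₂ • dir η‖ ≤ 1024 * (1 + C) * angGain κ l k₁ k₂ :=
  h.norm_dir_sub_le hC (by positivity)
    (Real.rpow_le_one_of_one_le_of_nonpos (by norm_num) hl) hj hk.le₀ hk.chord

lemma Compat.chord₀₂ (h : Compat k₀ k₁ k₂ j s₀ s₁ s₂ ξ η) (hC : 0 ≤ C) (hl : l ≤ 0)
    (hj : (2 : ℝ) ^ j ≤ C * 2 ^ κ * ((2 : ℝ) ^ l) ^ 2) (hk : FreqTriple κ k₀ k₁ k₂) :
    ‖sgnR s₀ • dir (ξ + η) - sgnR s₂ • dir η‖ ≤ 1024 * (1 + C) * angGain κ l k₀ k₂ := by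
  have := h.rotate.chord₁₂ hC hl hj hk.rotate
  rwa [sgnR_neg, dir_neg, neg_smul, smul_neg, neg_neg] at this

lemma Compat.chord₀₁ (h : Compat k₀ k₁ k₂ j s₀ s₁ s₂ ξ η) (hC : 0 ≤ C) (hl : l ≤ 0)
    (hj : (2 : ℝ) ^ j ≤ C * 2 ^ κ * ((2 : ℝ) ^ l) ^ 2) (hk : FreqTriple κ k₀ k₁ k₂) :
    ‖sgnR s₀ • dir (ξ + η) - sgnR s₁ • dir ξ‖ ≤ 1024 * (1 + C) * angGain κ l k₀ k₁ := by
  have := h.swap.chord₀₂ hC hl hj hk.swap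
  rwa [add_comm η ξ] at this

/-- Alignment when the second frequency of the symbol is, up to sign, the box variable `η`. -/
lemma IsBoxFamily.aligned (h : IsBoxFamily κ l lam M D box) (hd : 2 ≤ d) {a : ι}
    (hη : η ∈ (box a).dilate κ l lam) {μ a₁ a₂ : ℤ} (hμ : min a₁ a₂ = μ) (hμ₂ : μ ≤ k₂)
    (hκ : κ ≤ k₂) (hlb : (2 : ℝ) ^ (k₂ - 3) < ‖η‖) {K R : ℝ} (hK : K ≤ R) (hR8 : 8 ≤ R)
    (hR : 64 * (d * |lam|) ≤ R) {q : Sp d} (hq : q ≠ 0) (s : ℤˣ)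
    (hnear : ‖dir q - dir (sgnR s • η)‖ ≤ K * angGain κ l a₁ a₂) :
    Aligned 8 R (angGain κ l a₁ a₂) (2 ^ κ) (2 ^ l) ((box a).axis hd) q (sgnR s • η) := by
  have hg := angGain_pos κ l a₁ a₂
  have hη0 : 0 < ‖η‖ := (by positivity : (0 : ℝ) < 2 ^ (k₂ - 3)).trans hlb
  have h1 : (2 : ℝ) ^ μ ≤ 8 * ‖η‖ := two_zpow_le_of_lb hμ₂ hlb
  have h2 : (2 : ℝ) ^ κ ≤ 8 * ‖η‖ := two_zpow_le_of_lb hκ hlb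
  have h3 : (2 : ℝ) ^ κ * 2 ^ l ≤ angGain κ l a₁ a₂ * (8 * ‖η‖) := by
    rw [← angGain_mul κ l a₁ a₂, hμ]
    gcongr
  refine ⟨hq, smul_ne_zero (sgnR_ne_zero s) (norm_pos_iff.1 hη0), ?_, ?_, ?_,
    hnear.trans (by gcongr)⟩
  · rwa [norm_sgnR_smul]
  · rw [norm_sgnR_smul]
    refine h3.trans ?_
    calc angGain κ l a₁ a₂ * (8 * ‖η‖) = 8 * angGain κ l a₁ a₂ * ‖η‖ := by ring
      _ ≤ _ := by gcongr
  · rw [norm_sgnR_smul, offLine_smul, abs_sgnR, one_mul]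
    calc (2 : ℝ) ^ κ * offLine ((box a).axis hd) η ≤ 2 ^ κ * (2 ^ κ * 2 ^ l * (d * |lam|)) := by
          gcongr
          exact h.offLine_axis_le hd hη
      _ ≤ (8 * ‖η‖) * (angGain κ l a₁ a₂ * (8 * ‖η‖) * (d * |lam|)) := by gcongr
      _ = 64 * (d * |lam|) * angGain κ l a₁ a₂ * ‖η‖ ^ 2 := by ring
      _ ≤ _ := by gcongr

/-- Alignment when the second frequency of the symbol is, up to sign, the frequency `ξ`, and the box
variable is `η`: the direction of `ξ` is compared with the axis through that of `η`. -/
lemma IsBoxFamily.aligned_fst (h : IsBoxFamily κ l lam M D box) (hd : 2 ≤ d) {a : ι}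
    (hη : η ∈ (box a).dilate κ l lam) (hc : Compat k₀ k₁ k₂ j s₀ s₁ s₂ ξ η) (hC : 0 ≤ C)
    (hl : l ≤ 0) (hj : (2 : ℝ) ^ j ≤ C * 2 ^ κ * ((2 : ℝ) ^ l) ^ 2)
    (hk : FreqTriple κ k₀ k₁ k₂) {R : ℝ}
    (hR : 8 * (1024 * (1 + C) + 8 * (d * |lam|)) ≤ R) {q : Sp d} (hq : q ≠ 0) (s : ℤˣ)
    (hnear : ‖dir q - dir (sgnR s • ξ)‖ ≤ 1024 * (1 + C) * angGain κ l k₀ k₁) :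
    Aligned 8 R (angGain κ l k₀ k₁) (2 ^ κ) (2 ^ l) ((box a).axis hd) q (sgnR s • ξ) := by
  have hg := angGain_pos κ l k₀ k₁
  have hθ0 : (0 : ℝ) < 2 ^ l := by positivity
  have hξ0 : 0 < ‖ξ‖ := norm_pos_iff.2 hc.ne₁
  have hη0 : 0 < ‖η‖ := norm_pos_iff.2 hc.ne₂
  have hdl : 0 ≤ d * |lam| := by positivity
  set K : ℝ := 1024 * (1 + C) with hK
  have hK0 : 8 ≤ K := by rw [hK]; linarith
  have h1 : (2 : ℝ) ^ min k₀ k₁ ≤ 8 * ‖ξ‖ := two_zpow_le_of_lb (min_le_right _ _) hc.lb₁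
  have h2 : (2 : ℝ) ^ κ ≤ 8 * ‖ξ‖ := two_zpow_le_of_lb hk.le₁ hc.lb₁
  have h2' : (2 : ℝ) ^ κ ≤ 8 * ‖η‖ := two_zpow_le_of_lb hk.le₂ hc.lb₂
  have h3 : (2 : ℝ) ^ κ * 2 ^ l ≤ angGain κ l k₀ k₁ * (8 * ‖ξ‖) := by
    rw [← angGain_mul κ l k₀ k₁]
    gcongr
  refine ⟨hq, smul_ne_zero (sgnR_ne_zero s) hc.ne₁, ?_, ?_, ?_,
    hnear.trans (by gcongr; linarith)⟩
  · rwa [norm_sgnR_smul]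
  · rw [norm_sgnR_smul]
    refine h3.trans ?_
    calc angGain κ l k₀ k₁ * (8 * ‖ξ‖) = 8 * angGain κ l k₀ k₁ * ‖ξ‖ := by ring
      _ ≤ _ := by gcongr; linarith
  · rw [norm_sgnR_smul, offLine_smul, abs_sgnR, one_mul]
    have h4 : offLine (dir η) ξ ≤ ‖ξ‖ * (K * 2 ^ l) := by
      have h5 := MDNull.offLine_dir_le (s₁ := s₂) (s₂ := s₁) (v := η) (p := ξ) hc.ne₂
      refine h5.trans ?_
      rw [norm_sub_rev]
      gcongr
      refine (hc.chord₁₂ hC hl hj hk).trans ?_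
      rw [angGain]
      have h6 : (2 : ℝ) ^ (κ - min k₁ k₂) ≤ 1 :=
        zpow_le_one_of_nonpos₀ (by norm_num) (by have := hk.le₁; have := hk.le₂; omega)
      gcongr
      exact mul_le_of_le_one_right hθ0.le h6
    have h5 : offLine ((box a).axis hd) (dir η) ≤ 8 * (d * |lam|) * 2 ^ l := by
      rw [dir, offLine_smul, abs_of_pos (by positivity), inv_mul_le_iff₀ hη0]
      calc _ ≤ 2 ^ κ * 2 ^ l * (d * |lam|) := h.offLine_axis_le hd hη
        _ ≤ (8 * ‖η‖) * 2 ^ l * (d * |lam|) := by gcongr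
        _ = _ := by ring
    have h6 := offLine_le_add ((box a).norm_axis hd) (norm_dir hc.ne₂) ξ
    calc (2 : ℝ) ^ κ * offLine ((box a).axis hd) ξ
        ≤ 2 ^ κ * (‖ξ‖ * (K * 2 ^ l) + ‖ξ‖ * (8 * (d * |lam|) * 2 ^ l)) := by
          gcongr
          refine h6.trans (add_le_add h4 ?_)
          gcongr
      _ = (K + 8 * (d * |lam|)) * (2 ^ κ * 2 ^ l) * ‖ξ‖ := by ring
      _ ≤ (K + 8 * (d * |lam|)) * (angGain κ l k₀ k₁ * (8 * ‖ξ‖)) * ‖ξ‖ := by gcongr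
      _ = 8 * (K + 8 * (d * |lam|)) * angGain κ l k₀ k₁ * ‖ξ‖ ^ 2 := by ring
      _ ≤ _ := by gcongr

section decomp

variable {E₁ E₂ E₀ F : Type*}
  [NormedAddCommGroup E₁] [NormedSpace ℂ E₁] [NormedAddCommGroup E₂] [NormedSpace ℂ E₂]
  [NormedAddCommGroup E₀] [NormedSpace ℂ E₀] [FiniteDimensional ℂ E₁] [FiniteDimensional ℂ E₂]
  [FiniteDimensional ℂ E₀] [NormedAddCommGroup F] [NormedSpace ℂ F] [FiniteDimensional ℂ F]

/-- A symbol `L n(σ v, β v + τ η)`, `v = ξ` or `v = ξ + η`, whose arguments are aligned on all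
resonant frequencies in the boxes, has a box decomposition of size `g`. -/
lemma exists_boxDecomp_aligned (hd : 2 ≤ d) (lam : ℝ) (M : ℕ) (C : ℝ) (hC : 0 ≤ C)
    (A B : ℕ → ℝ) (R : ℝ) (hR : 0 ≤ R) (L : F →L[ℂ] Bil E₁ E₂ E₀) :
    ∃ (N : ℕ) (K : ℝ≥0), ∀ {ι : Type} {κ k₀ k₁ k₂ j : ℤ} {l : ℝ} {D : ℕ → ℝ}
      {box : ι → FreqBox d} {s₀ s₁ s₂ : ℤˣ}, IsBoxFamily κ l lam M D box → l ≤ 0 →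
      (2 : ℝ) ^ j ≤ C * 2 ^ κ * ((2 : ℝ) ^ l) ^ 2 → FreqTriple κ k₀ k₁ k₂ →
      ∀ {n : Sp d → Sp d → F}, IsAngular A B n →
      ∀ {V : Sp d → Sp d → Sp d}, ((V = fun ξ _ => ξ) ∨ (V = fun ξ η => ξ + η)) →
      ∀ {σ β τ : ℝ}, |τ| = 1 → ∀ {g : ℝ}, 0 < g →
      (∀ a ξ η, η ∈ (box a).dilate κ l lam → Compat k₀ k₁ k₂ j s₀ s₁ s₂ ξ η →
        Aligned 8 R g (2 ^ κ) (2 ^ l) ((box a).axis hd) (σ • V ξ η) (β • V ξ η + τ • η)) →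
      ∀ {m : Sp d → Sp d → Bil E₁ E₂ E₀}, (∀ ξ η, Compat k₀ k₁ k₂ j s₀ s₁ s₂ ξ η →
        m ξ η = L (n (σ • V ξ η) (β • V ξ η + τ • η))) →
      ∃ (fin : Finset ι) (Ma : ι → Sp d → Sp d → Bil E₁ E₂ E₀),
        BoxDecomp N (K * ENNReal.ofReal g) k₀ k₁ k₂ j s₀ s₁ s₂ m fin
          (fun a => (box a).cutoff) Ma := by
  obtain ⟨N, hN⟩ := exists_boxDecomp (E₁ := E₁) (E₂ := E₂) (E₀ := E₀) d hd lam M C hC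
  obtain ⟨K, hK⟩ := exists_sliceBound_aligned d hd E₁ E₂ E₀ F lam A B 8 R (by norm_num) hR L
  refine ⟨N, K, ?_⟩
  intro ι κ k₀ k₁ k₂ j l D box s₀ s₁ s₂ h hl hj hk n hn V hV σ β τ hτ g hg hal m hm
  have hg' : 0 < g.toNNReal := Real.toNNReal_pos.2 hg
  choose Ma hMb hMs hMa using fun a => hK hn hV (box a) κ hl (σ := σ) (β := β) hτ hg'
  obtain ⟨fin, hfin⟩ := hN h hl hj hk (m := m) hMb hMs (fun a ξ η ha hc => by
    have h1 := h.supp a ha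
    rw [hm ξ η hc]
    refine hMa a ξ η h1 ?_
    rw [Real.coe_toNNReal _ hg.le]
    exact hal a ξ η h1 hc)
  exact ⟨fin, Ma, hfin⟩

/-- Null symbols: the angle between the two inputs. -/
lemma exists_boxDecomp_null (hd : 2 ≤ d) (lam : ℝ) (M : ℕ) (C : ℝ) (hC : 0 ≤ C)
    (A B : ℕ → ℝ) (L : F →L[ℂ] Bil E₁ E₂ E₀) :
    ∃ (N : ℕ) (K : ℝ≥0), ∀ {ι : Type} {κ k₀ k₁ k₂ j : ℤ} {l : ℝ} {D : ℕ → ℝ}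
      {box : ι → FreqBox d} {s₀ s₁ s₂ : ℤˣ}, IsBoxFamily κ l lam M D box → l ≤ 0 →
      (2 : ℝ) ^ j ≤ C * 2 ^ κ * ((2 : ℝ) ^ l) ^ 2 → FreqTriple κ k₀ k₁ k₂ →
      ∀ {n : Sp d → Sp d → F}, IsAngular A B n →
      ∀ {m : Sp d → Sp d → Bil E₁ E₂ E₀}, (∀ ξ η, ξ ≠ 0 → η ≠ 0 →
        m ξ η = L (n ξ (sgnR (s₁ * s₂) • η))) →
      ∃ (fin : Finset ι) (Ma : ι → Sp d → Sp d → Bil E₁ E₂ E₀),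
        BoxDecomp N (K * ENNReal.ofReal (angGain κ l k₁ k₂)) k₀ k₁ k₂ j s₀ s₁ s₂ m fin
          (fun a => (box a).cutoff) Ma := by
  set R : ℝ := max (1024 * (1 + C)) (64 * (d * |lam|)) with hR
  have hR1 : 1024 * (1 + C) ≤ R := le_max_left _ _
  obtain ⟨N, K, hNK⟩ := exists_boxDecomp_aligned (E₁ := E₁) (E₂ := E₂) (E₀ := E₀) hd lam M C hC
    A B R (by linarith) L
  refine ⟨N, K, ?_⟩
  intro ι κ k₀ k₁ k₂ j l D box s₀ s₁ s₂ h hl hj hk n hn m hm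
  refine hNK h hl hj hk hn (V := fun ξ _ => ξ) (Or.inl rfl) (σ := 1) (β := 0)
    (τ := sgnR (s₁ * s₂)) (abs_sgnR _) (angGain_pos κ l k₁ k₂) ?_ ?_
  · intro a ξ η hη hc
    simp only [one_smul, zero_smul, zero_add]
    refine h.aligned hd hη rfl (min_le_right _ _) hk.le₂ hc.lb₂ hR1 (by linarith)
      (le_max_right _ _) hc.ne₁ _ ?_
    rw [norm_dir_sub_dir_sgnR_smul]
    exact hc.chord₁₂ hC hl hj hk
  · intro ξ η hc
    simp only [one_smul, zero_smul, zero_add]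
    exact hm ξ η hc.ne₁ hc.ne₂

/-- Dual null symbols: the angle between the output and the second input, which is localized to
boxes. -/
lemma exists_boxDecomp_dual (hd : 2 ≤ d) (lam : ℝ) (M : ℕ) (C : ℝ) (hC : 0 ≤ C)
    (A B : ℕ → ℝ) (L : F →L[ℂ] Bil E₁ E₂ E₀) :
    ∃ (N : ℕ) (K : ℝ≥0), ∀ {ι : Type} {κ k₀ k₁ k₂ j : ℤ} {l : ℝ} {D : ℕ → ℝ}
      {box : ι → FreqBox d} {s₀ s₁ s₂ : ℤˣ}, IsBoxFamily κ l lam M D box → l ≤ 0 →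
      (2 : ℝ) ^ j ≤ C * 2 ^ κ * ((2 : ℝ) ^ l) ^ 2 → FreqTriple κ k₀ k₁ k₂ →
      ∀ {n : Sp d → Sp d → F}, IsAngular A B n →
      ∀ {m : Sp d → Sp d → Bil E₁ E₂ E₀}, (∀ ξ η, ξ + η ≠ 0 → η ≠ 0 →
        m ξ η = L (n (-(ξ + η)) (-(sgnR (s₀ * s₂) • η)))) →
      ∃ (fin : Finset ι) (Ma : ι → Sp d → Sp d → Bil E₁ E₂ E₀),
        BoxDecomp N (K * ENNReal.ofReal (angGain κ l k₀ k₂)) k₀ k₁ k₂ j s₀ s₁ s₂ m fin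
          (fun a => (box a).cutoff) Ma := by
  set R : ℝ := max (1024 * (1 + C)) (64 * (d * |lam|)) with hR
  have hR1 : 1024 * (1 + C) ≤ R := le_max_left _ _
  obtain ⟨N, K, hNK⟩ := exists_boxDecomp_aligned (E₁ := E₁) (E₂ := E₂) (E₀ := E₀) hd lam M C hC
    A B R (by linarith) L
  refine ⟨N, K, ?_⟩
  intro ι κ k₀ k₁ k₂ j l D box s₀ s₁ s₂ h hl hj hk n hn m hm
  have e : ∀ ξ η : Sp d, (-1 : ℝ) • (ξ + η) = -(ξ + η) ∧
      (0 : ℝ) • (ξ + η) + sgnR (-(s₀ * s₂)) • η = -(sgnR (s₀ * s₂) • η) := by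
    intro ξ η
    rw [neg_one_smul, zero_smul, zero_add, sgnR_neg, neg_smul]
    exact ⟨rfl, rfl⟩
  refine hNK h hl hj hk hn (V := fun ξ η => ξ + η) (Or.inr rfl) (σ := -1) (β := 0)
    (τ := sgnR (-(s₀ * s₂))) (abs_sgnR _) (angGain_pos κ l k₀ k₂) ?_ ?_
  · intro a ξ η hη hc
    simp only [neg_one_smul, zero_smul, zero_add]
    refine h.aligned hd hη rfl (min_le_right _ _) hk.le₂ hc.lb₂ hR1 (by linarith)
      (le_max_right _ _) (neg_ne_zero.2 hc.ne₀) _ ?_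
    rw [sgnR_neg, neg_smul, dir_neg, dir_neg, ← norm_neg, neg_sub, neg_sub_neg,
      norm_dir_sub_dir_sgnR_smul]
    exact hc.chord₀₂ hC hl hj hk
  · intro ξ η hc
    rw [(e ξ η).1, (e ξ η).2]
    exact hm ξ η hc.ne₀ hc.ne₂

/-- Dual null symbols: the angle between the output and the first input, when the second input is
localized to boxes. -/
lemma exists_boxDecomp_dual_fst (hd : 2 ≤ d) (lam : ℝ) (M : ℕ) (C : ℝ) (hC : 0 ≤ C)
    (A B : ℕ → ℝ) (L : F →L[ℂ] Bil E₁ E₂ E₀) :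
    ∃ (N : ℕ) (K : ℝ≥0), ∀ {ι : Type} {κ k₀ k₁ k₂ j : ℤ} {l : ℝ} {D : ℕ → ℝ}
      {box : ι → FreqBox d} {s₀ s₁ s₂ : ℤˣ}, IsBoxFamily κ l lam M D box → l ≤ 0 →
      (2 : ℝ) ^ j ≤ C * 2 ^ κ * ((2 : ℝ) ^ l) ^ 2 → FreqTriple κ k₀ k₁ k₂ →
      ∀ {n : Sp d → Sp d → F}, IsAngular A B n →
      ∀ {m : Sp d → Sp d → Bil E₁ E₂ E₀}, (∀ ξ η, ξ + η ≠ 0 → ξ ≠ 0 →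
        m ξ η = L (n (-(ξ + η)) (-(sgnR (s₀ * s₁) • ξ)))) →
      ∃ (fin : Finset ι) (Ma : ι → Sp d → Sp d → Bil E₁ E₂ E₀),
        BoxDecomp N (K * ENNReal.ofReal (angGain κ l k₀ k₁)) k₀ k₁ k₂ j s₀ s₁ s₂ m fin
          (fun a => (box a).cutoff) Ma := by
  set R : ℝ := 8 * (1024 * (1 + C) + 8 * (d * |lam|)) with hR
  obtain ⟨N, K, hNK⟩ := exists_boxDecomp_aligned (E₁ := E₁) (E₂ := E₂) (E₀ := E₀) hd lam M C hC
    A B R (by positivity) L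
  refine ⟨N, K, ?_⟩
  intro ι κ k₀ k₁ k₂ j l D box s₀ s₁ s₂ h hl hj hk n hn m hm
  have e : ∀ ξ η : Sp d, (-1 : ℝ) • (ξ + η) = -(ξ + η) ∧
      (-sgnR (s₀ * s₁)) • (ξ + η) + sgnR (s₀ * s₁) • η = sgnR (-(s₀ * s₁)) • ξ := by
    intro ξ η
    rw [neg_one_smul, sgnR_neg, smul_add]
    refine ⟨rfl, ?_⟩
    rw [neg_smul _ η, neg_add_cancel_right]
  -- The symbol depends on `ξ + η` and `ξ = (ξ + η) - η`, an affine function of `η` for fixed output.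
  refine hNK h hl hj hk hn (V := fun ξ η => ξ + η) (Or.inr rfl) (σ := -1)
    (β := -sgnR (s₀ * s₁)) (τ := sgnR (s₀ * s₁)) (abs_sgnR _) (angGain_pos κ l k₀ k₁) ?_ ?_
  · intro a ξ η hη hc
    beta_reduce
    rw [(e ξ η).1, (e ξ η).2]
    refine h.aligned_fst hd hη hc hC hl hj hk le_rfl (neg_ne_zero.2 hc.ne₀) _ ?_
    rw [sgnR_neg, neg_smul, dir_neg, dir_neg, ← norm_neg, neg_sub, neg_sub_neg,
      norm_dir_sub_dir_sgnR_smul]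
    exact hc.chord₀₁ hC hl hj hk
  · intro ξ η hc
    rw [(e ξ η).1, (e ξ η).2, sgnR_neg, neg_smul]
    exact hm ξ η hc.ne₀ hc.ne₁

end decomp

end nulldecomp

end MDNull

end

noncomputable section

namespace MDNull

/-! ### Operators with bounded mass and dual null forms as symbol operators -/

section identification

variable {d : ℕ} {E₁ E₂ E₀ U : Type*}
  [NormedAddCommGroup E₁] [NormedSpace ℂ E₁] [NormedAddCommGroup E₂] [NormedSpace ℂ E₂]
  [NormedAddCommGroup E₀] [NormedSpace ℂ E₀] [NormedAddCommGroup U] [NormedSpace ℂ U]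

open scoped FourierTransform in
lemma integrable_fourierX_schwartz (γ : 𝓢(Sp d, U)) : Integrable (fourierX γ) := by
  have e : fourierX γ = fun ξ => (𝓕 γ : 𝓢(Sp d, U)) ((2 * Real.pi)⁻¹ • ξ) := by
    funext ξ
    rw [fourierX_eq_fourier, SchwartzMap.fourier_coe]
  rw [e]
  exact (integrable_comp_smul_iff volume (⇑(𝓕 γ : 𝓢(Sp d, U))) two_pi_inv_pos.ne').2
    (𝓕 γ : 𝓢(Sp d, U)).integrable

/-- Fourier inversion. -/
lemma schwartz_eq_invX [CompleteSpace U] (u : 𝓢(Sp d, U)) (z : Sp d) :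
    u z = (((2 * Real.pi : ℝ) : ℂ)⁻¹ ^ d) • invX (fourierX u) z := by
  rw [invX_fourierX u.continuous u.integrable (integrable_fourierX_schwartz u),
    ← Complex.coe_smul, smul_smul]
  have : ((2 * Real.pi : ℝ) : ℂ)⁻¹ ^ d * (((2 * Real.pi : ℝ) ^ d : ℝ) : ℂ) = 1 := by
    rw [Complex.ofReal_pow, ← mul_pow, inv_mul_cancel₀, one_pow]
    exact_mod_cast (by positivity : (2 * Real.pi : ℝ) ≠ 0)
  rw [this, one_smul]

/-- The integrand of a symbol operator on the Fourier side. -/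
def interaction (m : Sp d → Sp d → Bil E₁ E₂ E₀) (f : Sp d → E₁) (g : Sp d → E₂)
    (ζ : Sp d × Sp d) : E₀ := m ζ.1 ζ.2 (fourierX f ζ.1) (fourierX g ζ.2)

lemma symbolOp_eq (m : Sp d → Sp d → Bil E₁ E₂ E₀) (f : Sp d → E₁) (g : Sp d → E₂) (x : Sp d) :
    symbolOp m f g x = (((2 * Real.pi : ℝ) : ℂ)⁻¹ ^ (2 * d)) •
      ∫ ζ : Sp d × Sp d, ph (inner ℝ x (ζ.1 + ζ.2)) • interaction m f g ζ := rfl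

lemma BddSymbol.integrable_interaction {m : Sp d → Sp d → Bil E₁ E₂ E₀} (hm : BddSymbol m)
    (f : 𝓢(Sp d, E₁)) (g : 𝓢(Sp d, E₂)) : Integrable (interaction m f g) := by
  obtain ⟨B, hB⟩ := hm.bdd
  have hf := integrable_fourierX_schwartz f
  have hg := integrable_fourierX_schwartz g
  refine ((hf.norm.mul_prod hg.norm).const_mul B).mono' ?_ ?_
  · refine (stronglyMeasurable_bil hm.meas ?_ ?_).aestronglyMeasurable
    · exact ((continuous_fourierX_schwartz f).comp continuous_fst).stronglyMeasurable
    · exact ((continuous_fourierX_schwartz g).comp continuous_snd).stronglyMeasurable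
  · filter_upwards with ζ
    refine ((m ζ.1 ζ.2).le_opNorm₂ _ _).trans ?_
    rw [mul_assoc]
    exact mul_le_mul_of_nonneg_right (hB _ _) (by positivity)

lemma BddSymbol.continuous_symbolOp {m : Sp d → Sp d → Bil E₁ E₂ E₀} (hm : BddSymbol m)
    (f : 𝓢(Sp d, E₁)) (g : 𝓢(Sp d, E₂)) : Continuous (symbolOp m f g) := by
  have hi := hm.integrable_interaction f g
  have : symbolOp m f g = fun x => (((2 * Real.pi : ℝ) : ℂ)⁻¹ ^ (2 * d)) •
      ∫ ζ : Sp d × Sp d, ph (inner ℝ x (ζ.1 + ζ.2)) • interaction m f g ζ := rfl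
  rw [this]
  refine Continuous.const_smul ?_ _
  refine continuous_of_dominated (bound := fun ζ => ‖interaction m f g ζ‖) ?_ ?_ hi.norm ?_
  · intro x
    exact (integrable_ph_smul hi (by fun_prop)).aestronglyMeasurable
  · intro x; filter_upwards with ζ; simp [norm_smul]
  · filter_upwards with ζ; fun_prop

/-- Pairing a symbol operator with a test function, on the Fourier side. -/
lemma BddSymbol.integral_pairing {m : Sp d → Sp d → Bil E₁ E₂ E₀} (hm : BddSymbol m)
    [CompleteSpace U] [CompleteSpace E₀]
    (Θ : U →L[ℂ] E₀ →L[ℂ] ℂ) (u : 𝓢(Sp d, U)) (f : 𝓢(Sp d, E₁)) (g : 𝓢(Sp d, E₂)) :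
    Integrable (fun ζ : Sp d × Sp d =>
      Θ (fourierX u (-(ζ.1 + ζ.2))) (interaction m f g ζ)) ∧
    ∫ x, Θ (u x) (symbolOp m f g x) = (((2 * Real.pi : ℝ) : ℂ)⁻¹ ^ (2 * d)) •
      ∫ ζ : Sp d × Sp d, Θ (fourierX u (-(ζ.1 + ζ.2))) (interaction m f g ζ) := by
  have hP := hm.integrable_interaction f g
  constructor
  · refine (hP.norm.const_mul (‖Θ‖ * ∫ x, ‖u x‖)).mono' ?_ ?_
    · refine Θ.aestronglyMeasurable_comp₂ ?_ hP.aestronglyMeasurable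
      exact ((continuous_fourierX_schwartz u).comp (by fun_prop)).aestronglyMeasurable
    · filter_upwards with ζ
      refine (Θ.le_opNorm₂ _ _).trans ?_
      gcongr
      exact norm_fourierX_le _ _
  · have h1 : ∀ x, Θ (u x) (symbolOp m f g x) = (((2 * Real.pi : ℝ) : ℂ)⁻¹ ^ (2 * d)) •
        ∫ ζ : Sp d × Sp d, ph (inner ℝ x (ζ.1 + ζ.2)) • Θ (u x) (interaction m f g ζ) := by
      intro x
      rw [symbolOp_eq, map_smul,
        ← (Θ (u x)).integral_comp_comm (integrable_ph_smul hP (by fun_prop))]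
      simp only [map_smul]
    simp only [h1]
    rw [integral_smul]
    congr 1
    have hswap : Integrable (Function.uncurry fun (x : Sp d) (ζ : Sp d × Sp d) =>
        ph (inner ℝ x (ζ.1 + ζ.2)) • Θ (u x) (interaction m f g ζ)) (volume.prod volume) := by
      have h2 := integrable_bil_prod Θ (u.integrable (μ := volume)) hP
      exact integrable_ph_smul h2 (p := fun z : Sp d × Sp d × Sp d => inner ℝ z.1 (z.2.1 + z.2.2))
        (by fun_prop)
    rw [integral_integral_swap hswap]
    congr 1; ext1 ζ
    rw [fourierX_eq_ph]
    have h3 := ((ContinuousLinearMap.flip Θ) (interaction m f g ζ)).integral_comp_comm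
      (integrable_ph_smul (p := fun x : Sp d => -inner ℝ x (-(ζ.1 + ζ.2)))
        (u.integrable (μ := volume))
        (by fun_prop))
    simp only [ContinuousLinearMap.flip_apply] at h3
    rw [← h3]
    congr 1; ext1 x
    rw [inner_neg_right, neg_neg, map_smul]
    rfl

lemma symbolOp_congr (hd : 0 < d) {m m' : Sp d → Sp d → Bil E₁ E₂ E₀}
    (h : ∀ ξ η, ξ ≠ 0 → η ≠ 0 → m ξ η = m' ξ η) : symbolOp m = symbolOp m' := by
  have : Nonempty (Fin d) := ⟨⟨0, hd⟩⟩
  funext f g x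
  rw [symbolOp_eq, symbolOp_eq]
  congr 1
  refine integral_congr_ae ?_
  have h1 : ∀ᵐ ζ : Sp d × Sp d, ζ.1 ≠ 0 :=
    Measure.quasiMeasurePreserving_fst.ae (p := fun ξ : Sp d => ξ ≠ 0) (by simp [ae_iff])
  have h2 : ∀ᵐ ζ : Sp d × Sp d, ζ.2 ≠ 0 :=
    Measure.quasiMeasurePreserving_snd.ae (p := fun ξ : Sp d => ξ ≠ 0) (by simp [ae_iff])
  filter_upwards [h1, h2] with ζ hζ1 hζ2
  unfold interaction
  rw [h _ _ hζ1 hζ2]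

lemma symbolOp_flip (m : Sp d → Sp d → Bil E₁ E₂ E₀) (f : Sp d → E₁) (g : Sp d → E₂) (x : Sp d) :
    symbolOp m f g x = symbolOp (fun η ξ => (m ξ η).flip) g f x := by
  rw [symbolOp_eq, symbolOp_eq]
  congr 1
  rw [Measure.volume_eq_prod, ← integral_prod_swap]
  congr 1; ext1 ζ
  simp only [interaction, Prod.fst_swap, Prod.snd_swap, ContinuousLinearMap.flip_apply]
  rw [add_comm]

lemma BddSymbol.flip {m : Sp d → Sp d → Bil E₁ E₂ E₀} (hm : BddSymbol m) :
    BddSymbol (fun η ξ => (m ξ η).flip) where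
  meas := by
    have h1 : StronglyMeasurable (fun p : Sp d × Sp d => m p.2 p.1) :=
      hm.meas.comp_measurable (g := fun p : Sp d × Sp d => (p.2, p.1)) (by fun_prop)
    exact (ContinuousLinearMap.flipₗᵢ ℂ E₁ E₂ E₀).continuous.comp_stronglyMeasurable h1
  bdd := by
    obtain ⟨B, hB⟩ := hm.bdd
    exact ⟨B, fun ξ η => by rw [ContinuousLinearMap.opNorm_flip]; exact hB _ _⟩

/-- Two continuous functions with the same integrals against test functions are equal. -/
lemma eq_of_forall_integral_pairing {u v : Sp d → E₀} (hu : Continuous u) (hv : Continuous v)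
    (h : ∀ φ : 𝓢(Sp d, StrongDual ℂ E₀), ∫ x, φ x (u x) = ∫ x, φ x (v x)) : u = v := by
  funext x
  rw [← sub_eq_zero]
  refine SeparatingDual.eq_zero_of_forall_dual_eq_zero (R := ℂ) fun φ => ?_
  set w : Sp d → ℂ := fun x => φ (u x - v x) with hw
  have hwc : Continuous w := by fun_prop
  have hae : ∀ᵐ x, w x = 0 := by
    refine ae_eq_zero_of_integral_contDiff_smul_eq_zero hwc.locallyIntegrable fun ψ hψ hψc => ?_
    have hs : ContDiff ℝ ∞ (fun x => (ψ x : ℂ) • φ) :=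
      (Complex.ofRealCLM.contDiff.comp hψ).smul contDiff_const
    have hc : HasCompactSupport (fun x => (ψ x : ℂ) • φ) :=
      hψc.mono fun x hx hx0 => hx (by simp [hx0])
    have h1 := h (hc.toSchwartzMap hs)
    have hi : ∀ {u : Sp d → E₀}, Continuous u → Integrable (fun x => ((ψ x : ℂ) • φ) (u x)) := by
      intro u hu
      refine Continuous.integrable_of_hasCompactSupport ?_ ?_
      · have := hψ.continuous
        simp only [smul_apply]
        fun_prop
      · exact hψc.mono fun x hx hx0 => hx (by simp [hx0])
    have h2 : ∫ x, ((ψ x : ℂ) • φ) (u x) = ∫ x, ((ψ x : ℂ) • φ) (v x) := h1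
    rw [← sub_eq_zero, ← integral_sub (hi hu) (hi hv)] at h2
    rw [← h2]
    congr 1; ext1 x
    simp only [hw, map_sub, smul_apply, Complex.real_smul, smul_eq_mul]
    ring
  have h3 : w = fun _ => 0 := (Continuous.ae_eq_iff_eq volume hwc continuous_const).1 hae
  exact congrFun h3 x

section dual

/-- The transpose of a bilinear map `E₀* × E₂ → E₁*`, a bilinear map `E₁ × E₂ → E₀`. -/
lemma exists_transpose (E₁ E₂ E₀ : Type*) [NormedAddCommGroup E₁] [NormedSpace ℂ E₁]
    [NormedAddCommGroup E₂] [NormedSpace ℂ E₂] [NormedAddCommGroup E₀] [NormedSpace ℂ E₀]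
    [FiniteDimensional ℂ E₁] [FiniteDimensional ℂ E₂] [FiniteDimensional ℂ E₀] :
    ∃ Ψ : Bil (StrongDual ℂ E₀) E₂ (StrongDual ℂ E₁) →L[ℂ] Bil E₁ E₂ E₀,
      ∀ (B : Bil (StrongDual ℂ E₀) E₂ (StrongDual ℂ E₁)) (φ : StrongDual ℂ E₀) (e₁ : E₁) (e₂ : E₂),
        φ (Ψ B e₁ e₂) = B φ e₂ e₁ := by
  set b := Module.finBasis ℂ E₀ with hb
  set bd : Fin (Module.finrank ℂ E₀) → StrongDual ℂ E₀ := fun i =>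
    LinearMap.toContinuousLinearMap (b.coord i) with hbd
  let S : Bil (StrongDual ℂ E₀) E₂ (StrongDual ℂ E₁) →ₗ[ℂ] Bil E₁ E₂ E₀ :=
    { toFun := fun B => ∑ i, (ContinuousLinearMap.compL ℂ E₂ ℂ E₀
        (ContinuousLinearMap.toSpanSingleton ℂ (b i))).comp (B (bd i)).flip
      map_add' := fun B B' => by
        rw [← Finset.sum_add_distrib]
        refine Finset.sum_congr rfl fun i _ => ?_
        ext e₁ e₂
        simp
      map_smul' := fun c B => by
        rw [RingHom.id_apply, Finset.smul_sum]
        refine Finset.sum_congr rfl fun i _ => ?_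
        ext e₁ e₂
        simp }
  refine ⟨LinearMap.toContinuousLinearMap S, fun B φ e₁ e₂ => ?_⟩
  have h1 : LinearMap.toContinuousLinearMap S B e₁ e₂ = ∑ i, (B (bd i) e₂ e₁) • b i := by
    change S B e₁ e₂ = _
    simp [S, sum_apply]
  have h2 : φ = ∑ i, φ (b i) • bd i := by
    ext x
    conv_lhs => rw [← b.sum_repr x, map_sum]
    simp [hbd, sum_apply, mul_comm]
  rw [h1, map_sum]
  conv_rhs => rw [h2]
  simp [sum_apply, mul_comm]

/-- A dual null form is the operator whose symbol is the transpose of `m(-ξ-η, η)`. -/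
lemma eq_symbolOp_of_dual [FiniteDimensional ℂ E₁] [FiniteDimensional ℂ E₀]
    {T : (Sp d → E₁) → (Sp d → E₂) → Sp d → E₀}
    {m : Sp d → Sp d → Bil (StrongDual ℂ E₀) E₂ (StrongDual ℂ E₁)} (hm : BddSymbol m)
    {m' : Sp d → Sp d → Bil E₁ E₂ E₀} (hm' : BddSymbol m')
    (hmm : ∀ ξ η φ e₁ e₂, φ (m' ξ η e₁ e₂) = m (-(ξ + η)) η φ e₂ e₁)
    (f : 𝓢(Sp d, E₁)) (g : 𝓢(Sp d, E₂)) (hT : Continuous (T f g))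
    (h : ∀ φ : 𝓢(Sp d, StrongDual ℂ E₀),
      ∫ x, φ x (T f g x) = ∫ x, symbolOp m φ g x (f x)) :
    T f g = symbolOp m' f g := by
  have := FiniteDimensional.complete ℂ E₁
  have := FiniteDimensional.complete ℂ E₀
  refine eq_of_forall_integral_pairing hT (hm'.continuous_symbolOp f g) fun φ => ?_
  rw [h]
  obtain ⟨i1, e1⟩ := hm'.integral_pairing (ContinuousLinearMap.id ℂ (StrongDual ℂ E₀)) φ f g
  obtain ⟨i2, e2⟩ := hm.integral_pairing
    ((ContinuousLinearMap.id ℂ (StrongDual ℂ E₁)).flip) f φ g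
  simp only [ContinuousLinearMap.flip_apply, ContinuousLinearMap.id_apply] at i1 e1 i2 e2
  rw [e1, e2]
  congr 1
  rw [Measure.volume_eq_prod] at i1 i2 ⊢
  rw [integral_prod_symm _ i1, integral_prod_symm _ i2]
  congr 1; ext1 η
  rw [← integral_sub_left_eq_self (fun ξ => fourierX φ (-(ξ + η)) (interaction m' f g (ξ, η)))
    volume (-η)]
  congr 1; ext1 ξ
  simp only [interaction]
  rw [hmm, show -(-η - ξ + η) = ξ by abel, show -η - ξ = -(ξ + η) by abel]

end dual

section mass

/-- The symbol of the operator with kernel measure `K μ`. -/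
def kernelSymbol (μ : Measure (Sp d × Sp d)) (K : Sp d × Sp d → Bil E₁ E₂ E₀) (ξ η : Sp d) :
    Bil E₁ E₂ E₀ :=
  ∫ y, ph (-inner ℝ y.2 η) • ph (-inner ℝ y.1 ξ) • K y ∂μ

variable {μ : Measure (Sp d × Sp d)} [SFinite μ] {K : Sp d × Sp d → Bil E₁ E₂ E₀}

lemma stronglyMeasurable_kernelSymbol_integrand (hKm : StronglyMeasurable K) :
    StronglyMeasurable fun p : (Sp d × Sp d) × Sp d × Sp d =>
      ph (-inner ℝ p.1.2 p.2.2) • ph (-inner ℝ p.1.1 p.2.1) • K p.1 := by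
  refine StronglyMeasurable.fun_smul ?_ (StronglyMeasurable.fun_smul ?_ ?_)
  · exact (continuous_ph.comp (by fun_prop)).stronglyMeasurable
  · exact (continuous_ph.comp (by fun_prop)).stronglyMeasurable
  · exact hKm.comp_measurable measurable_fst

lemma bddSymbol_kernelSymbol (hKm : StronglyMeasurable K) : BddSymbol (kernelSymbol μ K) where
  meas := by
    have h1 := (stronglyMeasurable_kernelSymbol_integrand hKm).comp_measurable
      (g := fun p : (Sp d × Sp d) × Sp d × Sp d => (p.2, p.1)) (by fun_prop)
    exact h1.integral_prod_right' (ν := μ)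
  bdd := by
    refine ⟨∫ y, ‖K y‖ ∂μ, fun ξ η => ?_⟩
    refine (norm_integral_le_integral_norm _).trans (le_of_eq ?_)
    simp [norm_smul]

lemma exists_sliceBound_kernelSymbol (d : ℕ) (E₁ E₂ E₀ : Type*)
    [NormedAddCommGroup E₁] [NormedSpace ℂ E₁] [NormedAddCommGroup E₂] [NormedSpace ℂ E₂]
    [NormedAddCommGroup E₀] [NormedSpace ℂ E₀] [FiniteDimensional ℂ E₁] [FiniteDimensional ℂ E₂]
    [FiniteDimensional ℂ E₀] :
    ∃ C : ℝ≥0, ∀ (μ : Measure (Sp d × Sp d)) [SFinite μ] (K : Sp d × Sp d → Bil E₁ E₂ E₀),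
      StronglyMeasurable K → Integrable K μ →
      SliceBound (kernelSymbol μ K) (C * ∫⁻ y, ‖K y‖ₑ ∂μ) := by
  have := FiniteDimensional.complete ℂ E₁
  have := FiniteDimensional.complete ℂ E₂
  have := FiniteDimensional.complete ℂ E₀
  obtain ⟨C, hC⟩ := exists_sliceBound_one d E₁ E₂ E₀
  refine ⟨C, ?_⟩
  intro μ _ K hKm hK
  rw [← lintegral_const_mul' _ _ (by simp)]
  refine SliceBound.integral (κ := fun y => ‖K y‖)
    (stronglyMeasurable_kernelSymbol_integrand hKm) hK.norm ?_ ?_ ?_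
  · intro y ξ η
    simp [norm_smul]
  · exact (hKm.enorm.const_mul _).aemeasurable
  · intro y
    refine ((hC (fun ξ => ph (-inner ℝ y.1 ξ) • K y) ‖K y‖₊ ?_ ?_).1.modulate y.2)
    · exact (continuous_ph.comp (by fun_prop)).stronglyMeasurable.smul_const _
    · intro ξ
      rw [← NNReal.coe_le_coe]
      simp [norm_smul]

/-- An operator with bounded mass is the symbol operator whose symbol is the Fourier transform of
its kernel. -/
lemma kernelOp_eq_symbolOp [CompleteSpace E₁] [CompleteSpace E₂] [CompleteSpace E₀]
    (hKm : StronglyMeasurable K) (hK : Integrable K μ) (f : 𝓢(Sp d, E₁)) (g : 𝓢(Sp d, E₂)) :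
    kernelOp μ K f g = symbolOp (kernelSymbol μ K) f g := by
  funext x
  have hf := integrable_fourierX_schwartz f
  have hg := integrable_fourierX_schwartz g
  set c : ℂ := ((2 * Real.pi : ℝ) : ℂ)⁻¹ ^ d with hc
  have h1 : ∀ y : Sp d × Sp d, K y (f (x - y.1)) (g (x - y.2)) =
      (((2 * Real.pi : ℝ) : ℂ)⁻¹ ^ (2 * d)) • ∫ ζ : Sp d × Sp d, ph (inner ℝ x (ζ.1 + ζ.2)) •
        (ph (-inner ℝ y.2 ζ.2) • ph (-inner ℝ y.1 ζ.1) • K y)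
          (fourierX f ζ.1) (fourierX g ζ.2) := by
    intro y
    have h2 : f (x - y.1) = c • _ := schwartz_eq_invX f _
    have h3 : g (x - y.2) = c • _ := schwartz_eq_invX g _
    rw [h2, h3]
    simp only [map_smul, smul_apply, invX]
    rw [bil_integral_integral (K y) (integrable_ph_smul hf (by fun_prop))
      (integrable_ph_smul hg (by fun_prop)), smul_smul]
    congr 1
    · rw [hc, two_mul d, pow_add]
    · rw [Measure.volume_eq_prod]
      congr 1; ext1 ζ
      simp only [map_smul, smul_apply, smul_smul, ← ph_add]
      congr 2
      rw [inner_sub_left, inner_sub_left, inner_add_right]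
      ring
  have h4 : ∀ ζ : Sp d × Sp d, interaction (kernelSymbol μ K) f g ζ =
      ∫ y, (ph (-inner ℝ y.2 ζ.2) • ph (-inner ℝ y.1 ζ.1) • K y)
        (fourierX f ζ.1) (fourierX g ζ.2) ∂μ := by
    intro ζ
    have hi : Integrable (fun y : Sp d × Sp d =>
        ph (-inner ℝ y.2 ζ.2) • ph (-inner ℝ y.1 ζ.1) • K y) μ :=
      integrable_ph_smul (integrable_ph_smul hK (by fun_prop)) (by fun_prop)
    have h5 := (ContinuousLinearMap.apply ℂ (E₂ →L[ℂ] E₀) (fourierX f ζ.1)).integral_comp_comm hi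
    have h6 := (ContinuousLinearMap.apply ℂ E₀ (fourierX g ζ.2)).integral_comp_comm
      ((ContinuousLinearMap.apply ℂ (E₂ →L[ℂ] E₀) (fourierX f ζ.1)).integrable_comp hi)
    rw [h5] at h6
    exact h6.symm
  unfold kernelOp
  simp only [h1]
  rw [integral_smul, symbolOp_eq]
  congr 1
  have hswap : Integrable (Function.uncurry fun (y ζ : Sp d × Sp d) =>
      ph (inner ℝ x (ζ.1 + ζ.2)) • (ph (-inner ℝ y.2 ζ.2) • ph (-inner ℝ y.1 ζ.1) • K y)
          (fourierX f ζ.1) (fourierX g ζ.2)) (μ.prod volume) := by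
    refine (hK.norm.mul_prod (hf.norm.mul_prod hg.norm)).mono' ?_ ?_
    · refine StronglyMeasurable.aestronglyMeasurable ?_
      refine StronglyMeasurable.fun_smul ?_ ?_
      · exact (continuous_ph.comp (by fun_prop)).stronglyMeasurable
      · refine stronglyMeasurable_bil (stronglyMeasurable_kernelSymbol_integrand hKm) ?_ ?_
        · exact ((continuous_fourierX_schwartz f).comp (by fun_prop)).stronglyMeasurable
        · exact ((continuous_fourierX_schwartz g).comp (by fun_prop)).stronglyMeasurable
    · filter_upwards with p
      simp only [Function.uncurry, smul_apply, norm_smul, norm_ph, one_mul]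
      rw [← mul_assoc]
      exact (K p.1).le_opNorm₂ _ _
  rw [integral_integral_swap hswap]
  congr 1; ext1 ζ
  rw [h4, integral_smul]

end mass

end identification

end MDNull

end

noncomputable section

namespace MDNull

/-! ### The estimates -/

section estimates

/-- The two estimates for an operator whose symbol has a box decomposition. -/
lemma exists_estimate_of_operator (d : ℕ) (E₁ E₂ E₀ : Type*)
    [NormedAddCommGroup E₁] [NormedSpace ℂ E₁] [NormedAddCommGroup E₂] [NormedSpace ℂ E₂]
    [NormedAddCommGroup E₀] [NormedSpace ℂ E₀] [FiniteDimensional ℂ E₁] [FiniteDimensional ℂ E₂]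
    [FiniteDimensional ℂ E₀] {χ : ℝ → ℝ} (hχ : IsDyadicBump χ) :
    ∃ C : ℝ≥0, ∀ {k₀ k₁ k₂ j : ℤ} {s₀ s₁ s₂ : ℤˣ} (f : 𝓢(ℝ × Sp d, E₁)) (g : 𝓢(ℝ × Sp d, E₂))
      {ι : Type} {box : ι → FreqBox d} {N : ℕ} {A : ℝ≥0∞} {m : Sp d → Sp d → Bil E₁ E₂ E₀}
      {fin : Finset ι} {Ma : ι → Sp d → Sp d → Bil E₁ E₂ E₀}
      {T : (Sp d → E₁) → (Sp d → E₂) → Sp d → E₀},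
      (∀ (u : 𝓢(Sp d, E₁)) (v : 𝓢(Sp d, E₂)), T u v = symbolOp m u v) → BddSymbol m →
      BoxDecomp N A k₀ k₁ k₂ j s₀ s₁ s₂ m fin (fun a => (box a).cutoff) Ma →
      mixedNorm 2 2 (projPQ χ k₀ j s₀ (atEachTime T
          (projPQlt χ k₁ j s₁ f) (projPQlt χ k₂ j s₂ g))) ≤
        C * (N * A) * mixedNorm ∞ 2 (projP χ k₁ f) * boxNorm box (projPQlt χ k₂ j s₂ g) ∧
      mixedNorm 1 2 (projPQlt χ k₀ j s₀ (atEachTime T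
          (projPQ χ k₁ j s₁ f) (projPQlt χ k₂ j s₂ g))) ≤
        C * (N * A) * mixedNorm 2 2 (projPQ χ k₁ j s₁ f) *
          boxNorm box (projPQlt χ k₂ j s₂ g) := by
  have := FiniteDimensional.complete ℂ E₁
  have := FiniteDimensional.complete ℂ E₂
  obtain ⟨C, hC⟩ := exists_estimate_of_boxDecomp d E₁ E₂ E₀ hχ
  refine ⟨C, ?_⟩
  intro k₀ k₁ k₂ j s₀ s₁ s₂ f g ι box N A m fin Ma T hT hm hdec
  have hprof : ∀ {b : ℝ → ℝ}, (b = χ ∨ b = lowBump χ) → IsProfile b := by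
    rintro b (rfl | rfl)
    · exact hχ.isProfile
    · exact hχ.isProfile_lowBump
  have hTt : ∀ {b₁ b₂ : ℝ → ℝ}, (b₁ = χ ∨ b₁ = lowBump χ) → (b₂ = χ ∨ b₂ = lowBump χ) →
      atEachTime T (multTX (symA χ b₁ k₁ j s₁) f) (multTX (symA χ b₂ k₂ j s₂) g) =
        atEachTime (symbolOp m) (multTX (symA χ b₁ k₁ j s₁) f)
          (multTX (symA χ b₂ k₂ j s₂) g) := by
    intro b₁ b₂ h₁ h₂
    obtain ⟨F, hF⟩ := exists_schwartz_proj hχ (hprof h₁) k₁ j s₁ f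
    obtain ⟨G, hG⟩ := exists_schwartz_proj hχ (hprof h₂) k₂ j s₂ g
    rw [← hF, ← hG]
    funext p
    exact congrFun (hT (sliceS p.1 F) (sliceS p.1 G)) p.2
  have hbox : (∑ a ∈ fin, mixedNorm 2 ∞ (multX (box a).cutoff
      (multTX (symA χ (lowBump χ) k₂ j s₂) g)) ^ 2) ^ (1 / 2 : ℝ) ≤
      boxNorm box (projPQlt χ k₂ j s₂ g) := by
    refine ENNReal.rpow_le_rpow ?_ (by norm_num)
    exact ENNReal.sum_le_tsum fin
  constructor
  · have h1 := (hC (b₀ := χ) (b₁ := lowBump χ) (b₂ := lowBump χ) (Or.inl rfl) (Or.inr rfl)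
      (Or.inr rfl) f g hm hdec).1
    rw [← hTt (Or.inr rfl) (Or.inr rfl)] at h1
    exact h1.trans (mul_le_mul_right hbox _)
  · have h1 := (hC (b₀ := lowBump χ) (b₁ := χ) (b₂ := lowBump χ) (Or.inr rfl) (Or.inl rfl)
      (Or.inr rfl) f g hm hdec).2
    rw [← hTt (Or.inl rfl) (Or.inr rfl)] at h1
    exact h1.trans (mul_le_mul_right hbox _)

variable {d : ℕ} {E₁ E₂ E₀ : Type*}
  [NormedAddCommGroup E₁] [NormedSpace ℂ E₁] [NormedAddCommGroup E₂] [NormedSpace ℂ E₂]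
  [NormedAddCommGroup E₀] [NormedSpace ℂ E₀]

lemma ofReal_angGain (k₀ k₁ k₂ j a b : ℤ) :
    ENNReal.ofReal (angGain (kMin k₀ k₁ k₂) (ell k₀ k₁ k₂ j) a b) = gain k₀ k₁ k₂ j a b := rfl

/-- A null symbol, set to zero where a frequency vanishes, is bounded and measurable. -/
lemma IsNullSymbol.bddSymbol_punctured [FiniteDimensional ℂ E₁] [FiniteDimensional ℂ E₂]
    [FiniteDimensional ℂ E₀] {A B : ℕ → ℕ → ℝ} {n : Sp d → Sp d → Bil E₁ E₂ E₀}
    (hn : IsNullSymbol A B n) (s : ℤˣ) :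
    BddSymbol (fun ξ η => punctured n ξ (sgnR s • η)) where
  meas := (stronglyMeasurable_punctured hn.smooth.continuousOn).comp_measurable
    (g := fun p : Sp d × Sp d => (p.1, sgnR s • p.2)) (by fun_prop)
  bdd := by
    refine ⟨|B 0 0|, fun ξ η => ?_⟩
    by_cases h : ξ ≠ 0 ∧ sgnR s • η ≠ 0
    · rw [punctured_of_ne n h.1 h.2]
      have := hn.isAngular.deriv_bound 0 ξ (sgnR s • η) h.1 h.2
      rw [norm_iteratedFDeriv_zero, pow_zero, inv_one, mul_one] at this
      exact this.trans (le_abs_self _)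
    · have : punctured n ξ (sgnR s • η) = 0 :=
        indicator_of_notMem (s := {p : Sp d × Sp d | p.1 ≠ 0 ∧ p.2 ≠ 0}) h _
      rw [this, norm_zero]
      exact abs_nonneg _

lemma symbolOp_eq_punctured (hd : 0 < d) (s : ℤˣ)
    (m : Sp d → Sp d → Bil E₁ E₂ E₀) :
    symbolOp m = symbolOp (fun ξ η =>
      punctured (fun ξ η => m ξ (sgnR s • η)) ξ (sgnR s • η)) := by
  refine symbolOp_congr hd fun ξ η hξ hη => ?_
  rw [punctured_of_ne _ hξ (smul_ne_zero (sgnR_ne_zero s) hη), sgnR_smul_sgnR_smul]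

variable {χ : ℝ → ℝ} [FiniteDimensional ℂ E₁] [FiniteDimensional ℂ E₂] [FiniteDimensional ℂ E₀]

/-- The symbol of a dual null form. -/
lemma IsDualNullForm.exists_symbol (hd : 0 < d) {s : ℤˣ} {A B : ℕ → ℕ → ℝ}
    {T : (Sp d → E₁) → (Sp d → E₂) → Sp d → E₀} (hT : IsDualNullForm s A B T)
    {Ψ : Bil (StrongDual ℂ E₀) E₂ (StrongDual ℂ E₁) →L[ℂ] Bil E₁ E₂ E₀}
    (hΨ : ∀ (B : Bil (StrongDual ℂ E₀) E₂ (StrongDual ℂ E₁)) (φ : StrongDual ℂ E₀) (e₁ : E₁)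
      (e₂ : E₂), φ (Ψ B e₁ e₂) = B φ e₂ e₁) :
    ∃ (n : Sp d → Sp d → Bil (StrongDual ℂ E₀) E₂ (StrongDual ℂ E₁))
      (m' : Sp d → Sp d → Bil E₁ E₂ E₀), IsAngular (A 0) (B 0) n ∧ BddSymbol m' ∧
      (∀ ξ η, ξ + η ≠ 0 → η ≠ 0 → m' ξ η = Ψ (n (-(ξ + η)) (-(sgnR s • η)))) ∧
      ∀ (f : 𝓢(Sp d, E₁)) (g : 𝓢(Sp d, E₂)), T f g = symbolOp m' f g := by
  obtain ⟨m, hm, hTm⟩ := hT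
  set n : Sp d → Sp d → Bil (StrongDual ℂ E₀) E₂ (StrongDual ℂ E₁) :=
    fun ξ η => m ξ (sgnR (-s) • η) with hn
  have hnull : IsNullSymbol A B n := hm
  have hb := hnull.bddSymbol_punctured (-s)
  set m' : Sp d → Sp d → Bil E₁ E₂ E₀ :=
    fun ξ η => Ψ (punctured n (-(ξ + η)) (sgnR (-s) • η)) with hm'
  have hb' : BddSymbol m' := by
    constructor
    · refine Ψ.continuous.comp_stronglyMeasurable ?_
      exact hb.meas.comp_measurable (g := fun p : Sp d × Sp d => (-(p.1 + p.2), p.2)) (by fun_prop)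
    · obtain ⟨K, hK⟩ := hb.bdd
      refine ⟨‖Ψ‖ * K, fun ξ η => (Ψ.le_opNorm _).trans ?_⟩
      gcongr
      exact hK _ _
  refine ⟨n, m', hnull.isAngular, hb', fun ξ η h1 h2 => ?_, fun f g => ?_⟩
  · simp only [hm']
    rw [punctured_of_ne n (neg_ne_zero.2 h1) (smul_ne_zero (sgnR_ne_zero _) h2), sgnR_neg, neg_smul]
  · obtain ⟨h1, -, h2⟩ := hTm f g
    refine eq_symbolOp_of_dual hb hb' (fun ξ η φ e₁ e₂ => hΨ _ _ _ _) f g h1 fun φ => ?_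
    rw [h2, symbolOp_eq_punctured hd (-s) m]

/-- Operators with bounded mass: the whole symbol serves on every box. -/
lemma exists_estimate_kernelOp (hd : 2 ≤ d) (hχ : IsDyadicBump χ) (C₀ lam : ℝ) (M : ℕ)
    (D : ℕ → ℝ) :
    ∃ C : ℝ≥0, ∀ k₀ k₁ k₂ j : ℤ, |kMax k₀ k₁ k₂ - kMed k₀ k₁ k₂| ≤ 5 →
      (j : ℝ) ≤ (kMin k₀ k₁ k₂ : ℝ) + C₀ →
      ∀ (ι : Type) (box : ι → FreqBox d),
      IsBoxFamily (kMin k₀ k₁ k₂) (ell k₀ k₁ k₂ j) lam M D box →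
      ∀ (μ : Measure (Sp d × Sp d)) [SFinite μ] (K : Sp d × Sp d → Bil E₁ E₂ E₀),
      Integrable K μ →
      ∀ (s₀ s₁ s₂ : ℤˣ) (f : 𝓢(ℝ × Sp d, E₁)) (g : 𝓢(ℝ × Sp d, E₂)),
        mixedNorm 2 2 (projPQ χ k₀ j s₀ (atEachTime (kernelOp μ K)
            (projPQlt χ k₁ j s₁ f) (projPQlt χ k₂ j s₂ g))) ≤
          C * (∫⁻ y, ‖K y‖ₑ ∂μ) * mixedNorm ∞ 2 (projP χ k₁ f) *
            boxNorm box (projPQlt χ k₂ j s₂ g) ∧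
        mixedNorm 1 2 (projPQlt χ k₀ j s₀ (atEachTime (kernelOp μ K)
            (projPQ χ k₁ j s₁ f) (projPQlt χ k₂ j s₂ g))) ≤
          C * (∫⁻ y, ‖K y‖ₑ ∂μ) * mixedNorm 2 2 (projPQ χ k₁ j s₁ f) *
            boxNorm box (projPQlt χ k₂ j s₂ g) := by
  have := FiniteDimensional.complete ℂ E₁
  have := FiniteDimensional.complete ℂ E₂
  have := FiniteDimensional.complete ℂ E₀
  obtain ⟨N, hN⟩ := exists_boxDecomp (E₁ := E₁) (E₂ := E₂) (E₀ := E₀) d hd lam M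
    (max 1 ((2 : ℝ) ^ C₀)) (by positivity)
  obtain ⟨C₁, hC₁⟩ := exists_sliceBound_kernelSymbol d E₁ E₂ E₀
  obtain ⟨C₂, hC₂⟩ := exists_estimate_of_operator d E₁ E₂ E₀ hχ
  refine ⟨C₂ * (N * C₁), ?_⟩
  intro k₀ k₁ k₂ j hk hj ι box hbox μ _ K hK s₀ s₁ s₂ f g
  -- A strongly measurable representative of the kernel gives the same operator.
  set K' := hK.aestronglyMeasurable.mk K with hK'
  have hae : K =ᵐ[μ] K' := hK.aestronglyMeasurable.ae_eq_mk
  have hKm : StronglyMeasurable K' := hK.aestronglyMeasurable.stronglyMeasurable_mk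
  have hKi : Integrable K' μ := hK.congr hae
  have e1 : ∫⁻ y, ‖K y‖ₑ ∂μ = ∫⁻ y, ‖K' y‖ₑ ∂μ :=
    lintegral_congr_ae (hae.mono fun y hy => by simp only [hy])
  have e2 : ∀ (u : Sp d → E₁) (v : Sp d → E₂), kernelOp μ K u v = kernelOp μ K' u v := by
    intro u v
    funext x
    exact integral_congr_ae (hae.mono fun y hy => by simp only [hy])
  have hb := bddSymbol_kernelSymbol (μ := μ) hKm
  obtain ⟨fin, hfin⟩ := hN (s₀ := s₀) (s₁ := s₁) (s₂ := s₂) hbox (ell_nonpos k₀ k₁ k₂ j)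
    (two_zpow_le_of_ell hj) (freqTriple_of_kMin hk) (m := kernelSymbol μ K')
    (Ma := fun _ => kernelSymbol μ K') (fun _ => hb) (fun _ => hC₁ μ K' hKm hKi)
    (fun _ _ _ _ _ => rfl)
  have h := hC₂ f g (T := kernelOp μ K) (fun u v => by
    rw [e2, kernelOp_eq_symbolOp hKm hKi]) hb hfin
  have e3 : (C₂ : ℝ≥0∞) * (N * (C₁ * ∫⁻ y, ‖K' y‖ₑ ∂μ)) =
      ((C₂ * (N * C₁) : ℝ≥0) : ℝ≥0∞) * ∫⁻ y, ‖K y‖ₑ ∂μ := by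
    rw [e1]; push_cast; ring
  rw [e3] at h
  exact h

/-- Null forms: the symbol is small because the angle between the two inputs is. -/
lemma exists_estimate_null (hd : 2 ≤ d) (hχ : IsDyadicBump χ) (C₀ lam : ℝ) (M : ℕ)
    (D : ℕ → ℝ) (A B : ℕ → ℕ → ℝ) :
    ∃ C : ℝ≥0, ∀ k₀ k₁ k₂ j : ℤ,
      |kMax k₀ k₁ k₂ - kMed k₀ k₁ k₂| ≤ 5 → (j : ℝ) ≤ (kMin k₀ k₁ k₂ : ℝ) + C₀ →
      ∀ (ι : Type) (box : ι → FreqBox d),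
      IsBoxFamily (kMin k₀ k₁ k₂) (ell k₀ k₁ k₂ j) lam M D box →
      ∀ (s₀ s₁ s₂ : ℤˣ) (m : Sp d → Sp d → Bil E₁ E₂ E₀),
      IsNullSymbolOfType (s₁ * s₂) A B m →
      ∀ (f : 𝓢(ℝ × Sp d, E₁)) (g : 𝓢(ℝ × Sp d, E₂)),
        mixedNorm 2 2 (projPQ χ k₀ j s₀ (atEachTime (symbolOp m)
            (projPQlt χ k₁ j s₁ f) (projPQlt χ k₂ j s₂ g))) ≤
          C * gain k₀ k₁ k₂ j k₁ k₂ * mixedNorm ∞ 2 (projP χ k₁ f) *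
            boxNorm box (projPQlt χ k₂ j s₂ g) ∧
        mixedNorm 1 2 (projPQlt χ k₀ j s₀ (atEachTime (symbolOp m)
            (projPQ χ k₁ j s₁ f) (projPQlt χ k₂ j s₂ g))) ≤
          C * gain k₀ k₁ k₂ j k₁ k₂ * mixedNorm 2 2 (projPQ χ k₁ j s₁ f) *
            boxNorm box (projPQlt χ k₂ j s₂ g) := by
  obtain ⟨N, C₁, hN⟩ := exists_boxDecomp_null (E₁ := E₁) (E₂ := E₂) (E₀ := E₀) hd lam M
    (max 1 ((2 : ℝ) ^ C₀)) (by positivity) (A 0) (B 0) (ContinuousLinearMap.id ℂ (Bil E₁ E₂ E₀))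
  obtain ⟨C₂, hC₂⟩ := exists_estimate_of_operator d E₁ E₂ E₀ hχ
  refine ⟨C₂ * (N * C₁), ?_⟩
  intro k₀ k₁ k₂ j hk hj ι box hbox s₀ s₁ s₂ m hm f g
  set n : Sp d → Sp d → Bil E₁ E₂ E₀ := fun ξ η => m ξ (sgnR (s₁ * s₂) • η) with hn
  have hnull : IsNullSymbol A B n := hm
  obtain ⟨fin, Ma, hfin⟩ := hN (s₀ := s₀) (s₁ := s₁) (s₂ := s₂) hbox (ell_nonpos k₀ k₁ k₂ j)
    (two_zpow_le_of_ell hj) (freqTriple_of_kMin hk) hnull.isAngular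
    (m := fun ξ η => punctured n ξ (sgnR (s₁ * s₂) • η)) (fun ξ η hξ hη => by
      rw [punctured_of_ne n hξ (smul_ne_zero (sgnR_ne_zero _) hη)]; rfl)
  have h := hC₂ f g (T := symbolOp m) (fun u v => by
    rw [symbolOp_eq_punctured (by omega) (s₁ * s₂) m])
    (hnull.bddSymbol_punctured (s₁ * s₂)) hfin
  have e : (C₂ : ℝ≥0∞) * (N * (C₁ * gain k₀ k₁ k₂ j k₁ k₂)) =
      ((C₂ * (N * C₁) : ℝ≥0) : ℝ≥0∞) * gain k₀ k₁ k₂ j k₁ k₂ := by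
    push_cast; ring
  rw [ofReal_angGain, e] at h
  exact h

/-- Dual null forms: the symbol is small because the angle between the output and an input is. In
the third estimate the boxes localize the first input, so the two inputs are exchanged. -/
lemma exists_estimate_dual (hd : 2 ≤ d) (hχ : IsDyadicBump χ) (C₀ lam : ℝ) (M : ℕ)
    (D : ℕ → ℝ) (A B : ℕ → ℕ → ℝ) :
    ∃ C : ℝ≥0, ∀ k₀ k₁ k₂ j : ℤ,
      |kMax k₀ k₁ k₂ - kMed k₀ k₁ k₂| ≤ 5 → (j : ℝ) ≤ (kMin k₀ k₁ k₂ : ℝ) + C₀ →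
      ∀ (ι : Type) (box : ι → FreqBox d),
      IsBoxFamily (kMin k₀ k₁ k₂) (ell k₀ k₁ k₂ j) lam M D box →
      ∀ (s₀ s₁ s₂ : ℤˣ) (T : (Sp d → E₁) → (Sp d → E₂) → Sp d → E₀),
      IsDualNullForm (s₀ * s₂) A B T →
      ∀ (f : 𝓢(ℝ × Sp d, E₁)) (g : 𝓢(ℝ × Sp d, E₂)),
        mixedNorm 2 2 (projPQ χ k₀ j s₀ (atEachTime T
            (projPQlt χ k₁ j s₁ f) (projPQlt χ k₂ j s₂ g))) ≤
          C * gain k₀ k₁ k₂ j k₀ k₂ * mixedNorm ∞ 2 (projP χ k₁ f) *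
            boxNorm box (projPQlt χ k₂ j s₂ g) ∧
        mixedNorm 1 2 (projPQlt χ k₀ j s₀ (atEachTime T
            (projPQ χ k₁ j s₁ f) (projPQlt χ k₂ j s₂ g))) ≤
          C * gain k₀ k₁ k₂ j k₀ k₂ * mixedNorm 2 2 (projPQ χ k₁ j s₁ f) *
            boxNorm box (projPQlt χ k₂ j s₂ g) ∧
        mixedNorm 1 2 (projPQlt χ k₀ j s₀ (atEachTime T
            (projPQlt χ k₁ j s₁ f) (projPQ χ k₂ j s₂ g))) ≤
          C * gain k₀ k₁ k₂ j k₀ k₂ * boxNorm box (projPQlt χ k₁ j s₁ f) *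
            mixedNorm 2 2 (projPQ χ k₂ j s₂ g) := by
  obtain ⟨Ψ, hΨ⟩ := exists_transpose E₁ E₂ E₀
  obtain ⟨N, C₁, hN⟩ := exists_boxDecomp_dual hd lam M
    (max 1 ((2 : ℝ) ^ C₀)) (by positivity) (A 0) (B 0) Ψ
  obtain ⟨N', C₁', hN'⟩ := exists_boxDecomp_dual_fst hd lam M
    (max 1 ((2 : ℝ) ^ C₀)) (by positivity) (A 0) (B 0)
    ((ContinuousLinearMap.flipₗᵢ ℂ E₁ E₂ E₀ : Bil E₁ E₂ E₀ →L[ℂ] Bil E₂ E₁ E₀).comp Ψ)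
  obtain ⟨C₂, hC₂⟩ := exists_estimate_of_operator d E₁ E₂ E₀ hχ
  obtain ⟨C₂', hC₂'⟩ := exists_estimate_of_operator d E₂ E₁ E₀ hχ
  refine ⟨C₂ * (N * C₁) + C₂' * (N' * C₁'), ?_⟩
  intro k₀ k₁ k₂ j hk hj ι box hbox s₀ s₁ s₂ T hT f g
  obtain ⟨n, m, hn, hb, hmn, hTm⟩ := hT.exists_symbol (by omega) hΨ
  have hl := ell_nonpos k₀ k₁ k₂ j
  have hj' := two_zpow_le_of_ell hj
  have hk' := freqTriple_of_kMin hk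
  obtain ⟨fin, Ma, hfin⟩ := hN (s₀ := s₀) (s₁ := s₁) (s₂ := s₂) hbox hl hj' hk' hn hmn
  obtain ⟨fin', Ma', hfin'⟩ := hN' (s₀ := s₀) (s₁ := s₂) (s₂ := s₁) hbox hl hj' hk'.swap hn
    (m := fun η ξ => (m ξ η).flip) (fun η ξ h1 h2 => by
      rw [add_comm] at h1 ⊢
      rw [hmn ξ η h1 h2]; rfl)
  have h := hC₂ f g hTm hb hfin
  have h' := (hC₂' g f (T := fun v u => T u v) (fun v u => by
    rw [hTm u v]
    funext x
    exact symbolOp_flip m u v x) hb.flip hfin').2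
  have e : (C₂ : ℝ≥0∞) * (N * (C₁ * gain k₀ k₁ k₂ j k₀ k₂)) =
      ((C₂ * (N * C₁) : ℝ≥0) : ℝ≥0∞) * gain k₀ k₁ k₂ j k₀ k₂ := by
    push_cast; ring
  have e' : (C₂' : ℝ≥0∞) * (N' * (C₁' * gain k₀ k₁ k₂ j k₀ k₂)) =
      ((C₂' * (N' * C₁') : ℝ≥0) : ℝ≥0∞) * gain k₀ k₁ k₂ j k₀ k₂ := by
    push_cast; ring
  rw [ofReal_angGain, e] at h
  rw [ofReal_angGain, e', mul_right_comm] at h'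
  have le1 : ((C₂ * (N * C₁) : ℝ≥0) : ℝ≥0∞) ≤
      ((C₂ * (N * C₁) + C₂' * (N' * C₁') : ℝ≥0) : ℝ≥0∞) := by
    exact_mod_cast le_self_add
  have le2 : ((C₂' * (N' * C₁') : ℝ≥0) : ℝ≥0∞) ≤
      ((C₂ * (N * C₁) + C₂' * (N' * C₁') : ℝ≥0) : ℝ≥0∞) := by
    exact_mod_cast le_add_self
  refine ⟨h.1.trans (by gcongr), h.2.trans (by gcongr), ?_⟩
  exact h'.trans (by gcongr)

end estimates

end MDNull

end

theorem mainTheorem11 (d : ℕ) (hd : 2 ≤ d) (χ : ℝ → ℝ) (hχ : IsDyadicBump χ) (C₀ : ℝ)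
    (lam : ℝ) (M : ℕ) (D : ℕ → ℝ)
    (E₀ E₁ E₂ : Type*) [NormedAddCommGroup E₀] [NormedSpace ℂ E₀] [FiniteDimensional ℂ E₀]
    [NormedAddCommGroup E₁] [NormedSpace ℂ E₁] [FiniteDimensional ℂ E₁]
    [NormedAddCommGroup E₂] [NormedSpace ℂ E₂] [FiniteDimensional ℂ E₂] :
    -- operators with kernel of bounded mass
    (∃ C : ℝ≥0, ∀ k₀ k₁ k₂ j : ℤ, |kMax k₀ k₁ k₂ - kMed k₀ k₁ k₂| ≤ 5 →
      (j : ℝ) ≤ (kMin k₀ k₁ k₂ : ℝ) + C₀ →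
      ∀ (ι : Type) (box : ι → FreqBox d),
      IsBoxFamily (kMin k₀ k₁ k₂) (ell k₀ k₁ k₂ j) lam M D box →
      ∀ (μ : Measure (Sp d × Sp d)) [SFinite μ] (K : Sp d × Sp d → Bil E₁ E₂ E₀),
      Integrable K μ →
      ∀ (s₀ s₁ s₂ : ℤˣ) (f : 𝓢(ℝ × Sp d, E₁)) (g : 𝓢(ℝ × Sp d, E₂)),
        mixedNorm 2 2 (projPQ χ k₀ j s₀ (atEachTime (kernelOp μ K)
            (projPQlt χ k₁ j s₁ f) (projPQlt χ k₂ j s₂ g))) ≤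
          C * (∫⁻ y, ‖K y‖ₑ ∂μ) * mixedNorm ∞ 2 (projP χ k₁ f) *
            boxNorm box (projPQlt χ k₂ j s₂ g) ∧
        mixedNorm 1 2 (projPQlt χ k₀ j s₀ (atEachTime (kernelOp μ K)
            (projPQ χ k₁ j s₁ f) (projPQlt χ k₂ j s₂ g))) ≤
          C * (∫⁻ y, ‖K y‖ₑ ∂μ) * mixedNorm 2 2 (projPQ χ k₁ j s₁ f) *
            boxNorm box (projPQlt χ k₂ j s₂ g)) ∧
    -- abstract null forms
    (∀ A B : ℕ → ℕ → ℝ, ∃ C : ℝ≥0, ∀ k₀ k₁ k₂ j : ℤ,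
      |kMax k₀ k₁ k₂ - kMed k₀ k₁ k₂| ≤ 5 → (j : ℝ) ≤ (kMin k₀ k₁ k₂ : ℝ) + C₀ →
      ∀ (ι : Type) (box : ι → FreqBox d),
      IsBoxFamily (kMin k₀ k₁ k₂) (ell k₀ k₁ k₂ j) lam M D box →
      ∀ (s₀ s₁ s₂ : ℤˣ) (m : Sp d → Sp d → Bil E₁ E₂ E₀),
      IsNullSymbolOfType (s₁ * s₂) A B m →
      ∀ (f : 𝓢(ℝ × Sp d, E₁)) (g : 𝓢(ℝ × Sp d, E₂)),
        mixedNorm 2 2 (projPQ χ k₀ j s₀ (atEachTime (symbolOp m)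
            (projPQlt χ k₁ j s₁ f) (projPQlt χ k₂ j s₂ g))) ≤
          C * gain k₀ k₁ k₂ j k₁ k₂ * mixedNorm ∞ 2 (projP χ k₁ f) *
            boxNorm box (projPQlt χ k₂ j s₂ g) ∧
        mixedNorm 1 2 (projPQlt χ k₀ j s₀ (atEachTime (symbolOp m)
            (projPQ χ k₁ j s₁ f) (projPQlt χ k₂ j s₂ g))) ≤
          C * gain k₀ k₁ k₂ j k₁ k₂ * mixedNorm 2 2 (projPQ χ k₁ j s₁ f) *
            boxNorm box (projPQlt χ k₂ j s₂ g)) ∧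
    -- dual abstract null forms
    (∀ A B : ℕ → ℕ → ℝ, ∃ C : ℝ≥0, ∀ k₀ k₁ k₂ j : ℤ,
      |kMax k₀ k₁ k₂ - kMed k₀ k₁ k₂| ≤ 5 → (j : ℝ) ≤ (kMin k₀ k₁ k₂ : ℝ) + C₀ →
      ∀ (ι : Type) (box : ι → FreqBox d),
      IsBoxFamily (kMin k₀ k₁ k₂) (ell k₀ k₁ k₂ j) lam M D box →
      ∀ (s₀ s₁ s₂ : ℤˣ) (T : (Sp d → E₁) → (Sp d → E₂) → Sp d → E₀),
      IsDualNullForm (s₀ * s₂) A B T →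
      ∀ (f : 𝓢(ℝ × Sp d, E₁)) (g : 𝓢(ℝ × Sp d, E₂)),
        mixedNorm 2 2 (projPQ χ k₀ j s₀ (atEachTime T
            (projPQlt χ k₁ j s₁ f) (projPQlt χ k₂ j s₂ g))) ≤
          C * gain k₀ k₁ k₂ j k₀ k₂ * mixedNorm ∞ 2 (projP χ k₁ f) *
            boxNorm box (projPQlt χ k₂ j s₂ g) ∧
        mixedNorm 1 2 (projPQlt χ k₀ j s₀ (atEachTime T
            (projPQ χ k₁ j s₁ f) (projPQlt χ k₂ j s₂ g))) ≤
          C * gain k₀ k₁ k₂ j k₀ k₂ * mixedNorm 2 2 (projPQ χ k₁ j s₁ f) *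
            boxNorm box (projPQlt χ k₂ j s₂ g) ∧
        mixedNorm 1 2 (projPQlt χ k₀ j s₀ (atEachTime T
            (projPQlt χ k₁ j s₁ f) (projPQ χ k₂ j s₂ g))) ≤
          C * gain k₀ k₁ k₂ j k₀ k₂ * boxNorm box (projPQlt χ k₁ j s₁ f) *
            mixedNorm 2 2 (projPQ χ k₂ j s₂ g)) :=
  ⟨exists_estimate_kernelOp hd hχ C₀ lam M D, exists_estimate_null hd hχ C₀ lam M D,
    exists_estimate_dual hd hχ C₀ lam M D⟩
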